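/- **Setting.** Let $K$ be a compact connected simply-connected Lie group of rank $r$, $\mathfrak t$ the Lie algebra of a maximal torus, with the normalised invariant inner product and an orthonormal basis $T_1,\dots,T_r$. Let $t=k+is$ with $k\in\mathbb Z_{>0}$, $s\in\mathbb R$. Let $\mathcal A_0\subset\mathcal A_0^{\mathbb C}$ be the spaces of translation-invariant $1$-forms on $\Sigma=\mathbb R^2/\mathbb Z^2$ with values in $\mathfrak t$, $\mathfrak t^{\mathbb C}$; write $A=\sum_j T_j(w_j\,dx+w_{j+r}\,dy)$. Put $\omega^{\mathbb C}=\sum_j dw_j\wedge dw_{j+r}$, $\omega=\omega^{\mathbb C}|_{\mathcal A_0}$, $\omega_t=\operatorname{Re}(t\omega^{\mathbb C})$ (so $\omega_t|_{\mathcal A_0}=k\omega$). The prequantum line bundles are trivial, with connections $\nabla_X=X-\frac i2\omega_t(A,X)$ on $\mathcal A_0^{\mathbb C}$ and $\nabla_X=X-\frac i2k\omega(A,X)$ on $\mathcal A_0$. Teichmüller space $\mathcal T$ is the upper half-plane; $\tau=\tau_1+i\tau_2\in\mathcal T$ gives the holomorphic coordinate $\zeta_\tau=x+\tau y$, with Hodge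 operator $*_\tau$. Let $I_\tau=*_\tau$ on $\mathcal A_0$; on $\mathcal A_0^{\mathbb C}$ let $J$ be multiplication by $i$, $I_\tau^{\mathbb C}A=*_\tau\overline A$, $K_\tau=I^{\mathbb C}_\tau J$, $I_{\tau,t}=\frac{k}{|t|}I^{\mathbb C}_\tau+\frac{s}{|t|}K_\tau$. The real polarisation $P_\tau$ is the space of $(1,0)$-forms in $\mathcal A_0^{\mathbb C}$, and $Q_\tau=I_{\tau,t}P_\tau$. Let $X_j=T_j\,d\zeta_\tau/\sqrt{2\tau_2}$, $X_{j+r}=JX_j$ $(1\le j\le r)$ and $Y_a=I_{\tau,t}X_a$ $(1\le a\le 2r)$; let $(p,q)$ be the linear coordinates in the real basis $(X_a,Y_a)$, $z=p+iq$, and $$\sigma_\tau=\Big(\frac{|t|}{2\pi}\Big)^{2r}e^{-\frac{|t|}4|z|^2},\qquad \rho_\tau=e^{-\frac{i|t|}2p\cdot q}.$$ For $V=\partial/\partial\tau$ or $\partial/\partial\overline\tau$ let $\delta_V=V-\sum_a\big(V[p_a]\,\partial_{p_a}+V[q_a]\,\partial_{q_a}\big)$, acting on functions on $\mathcal T\times\mathcal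 A_0^{\mathbb C}$, where $V$ differentiates at fixed $A\in\mathcal A_0^{\mathbb C}$; thus $\delta_V=\frac{\delta}{\delta\tau}$, $\frac{\delta}{\delta\overline\tau}$ respectively. **Connections.** Let $\widetilde G(V)$ be the bivector on $\mathcal A_0$ with $\widetilde G(V)\cdot\omega=V[I_\tau]$, and $G(V)$, $\overline G(V)$ its components of type $(2,0)$ and $(0,2)$ for $I_\tau$; let $G^{\mathbb C}(V)$ be the component in $T_{1,0}\otimes T_{1,0}$, for $I_{\tau,t}$, of the bivector $\widetilde G^{\mathbb C}(V)$ on $\mathcal A_0^{\mathbb C}$ with $\widetilde G^{\mathbb C}(V)\cdot\omega_t=|t|\,V[I_{\tau,t}]$. With $\Delta_G=\operatorname{Tr}(\nabla G\nabla)$, the lifted Hitchin–Witten and complexified Hitchin connections are $$\nabla^{HW}_V=V-\tfrac12\Big(\tfrac1{\overline t}\Delta_{\overline G(V)}-\tfrac1t\Delta_{G(V)}\Big),\qquad \nabla^{\mathbb C}_V=V+\tfrac1{4|t|}\Delta_{G^{\mathbb C}(V)},$$ acting on families of sections over $\mathcal A_0$ and over $\mathcal A_0^{\mathbb C}$ respectively.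 For a family $\psi$ of $P_\tau$-polarised functions on $\mathcal A_0^{\mathbb C}$ (i.e. annihilated by the derivatives along $P_\tau$), $\nabla^{HW}_V(\psi\rho)$ denotes the section over $\mathcal A_0^{\mathbb C}$ obtained by restricting $\psi\rho_\tau$ to $\mathcal A_0$, applying $\nabla^{HW}_V$, and extending the result from $\mathcal A_0$ to $\mathcal A_0^{\mathbb C}$ as a section parallel along $P_\tau$. Let $\widetilde{\mathcal H}_\tau$ be the space of square-integrable $I_{\tau,t}$-holomorphic sections over $\mathcal A_0^{\mathbb C}$ (Liouville measure), $\pi_\tau$ the orthogonal projection of $L^2$ onto it; the $L^2$-connection is $\nabla^{L^2}_V\varphi=\pi_\tau(V[\varphi])$. For $\eta\in L^2(Q_\tau)$, as a function of $q\in\mathbb R^{2r}$, the Bargmann transform is $$\mathcal B_\tau(\eta)=\Big(\frac{|t|}\pi\Big)^{r/2}\int_{\mathbb R^{2r}}\eta(q)\,e^{-\frac{|t|}4\left(4iq\cdot z+2|q|^2-z\cdot z\right)}\,dq .$$ The ladder operators on $L^2(Q_\tau)$ are $-i(q_a+\frac1{|t|}\partial_{q_a})$ and $i(q_a-\frac1{|t|}\partial_{q_a})$,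 $1\le a\le 2r$. For a function $\eta$ on $\mathcal A_0^{\mathbb C}$ write $\mathcal B_\tau(\eta)=\mathcal B_\tau(\eta|_{Q_\tau})$; note that $\rho_\tau|_{Q_\tau}=1$. **Theorem.** Let $U\subseteq\mathcal T$ be open and $\psi\colon U\times\mathcal A_0^{\mathbb C}\to\mathbb C$ a smooth family of functions such that for every $\tau\in U$: $\psi_\tau$ is $P_\tau$-polarised; $\psi_\tau|_{Q_\tau}$ lies in the $L^2$-domain of all ladder operators and of all their two-fold compositions; the restrictions of $\frac{\delta\psi}{\delta\tau}$ and $\frac{\delta\psi}{\delta\overline\tau}$ to $Q_\tau$ are square-integrable; and $\mathcal B_\tau(\psi_\tau)$ is differentiable in $\tau$ at each fixed point of $\mathcal A_0^{\mathbb C}$, with $$\mathcal B_\tau\Big(\frac{\delta\psi}{\delta\tau}\Big)=\frac{\delta\mathcal B_\tau(\psi)}{\delta\tau},\qquad \mathcal B_\tau\Big(\frac{\delta\psi}{\delta\overline\tau}\Big)=\frac{\delta\mathcal B_\tau(\psi)}{\delta\overline\tau}.$$ Then $\varphi_\tau:=\mathcal B_\tau(\psi_\tau)\,\sigma_\tau$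 lies in $\widetilde{\mathcal H}_\tau$ for $\tau\in U$, and for $V=\frac{\partial}{\partial\tau}$ and for $V=\frac{\partial}{\partial\overline\tau}$ (hence for all their complex combinations) $\nabla^{HW}_V(\psi\rho)|_{Q_\tau}$ and $V[\varphi]$ are square-integrable and $$\mathcal B_\tau\Big(\nabla^{HW}_V(\psi\rho)\big|_{Q_\tau}\Big)\,\sigma_\tau=\nabla^{L^2}_V\varphi=\nabla^{\mathbb C}_V\varphi .$$ Moreover this is equivariant for the mapping class group $\mathrm{SL}(2,\mathbb Z)$, which acts on $\mathcal T$ by Möbius transformations, on $\mathcal A_0^{\mathbb C}$ by $\left(\begin{smallmatrix}a&b\\c&d\end{smallmatrix}\right)\cdot(w_j,w_{j+r})=(dw_j+cw_{j+r},\,bw_j+aw_{j+r})$, and on families by $(\gamma F)_\tau(A)=F_{\gamma^{-1}\tau}(\gamma^{-1}A)$: for $\gamma\in\mathrm{SL}(2,\mathbb Z)$, $\tau\in U$ and any $V\in T_\tau\mathcal T\otimes\mathbb C$, at the point $\gamma\tau$, the family $\gamma\psi$ has Bargmann transform $\mathcal B(\gamma\psi)\sigma=\gamma\varphi$ and $$\nabla^{HW}_{\gamma_*V}\big((\gamma\psi)\rho\big)=\gamma\,\nabla^{HW}_V(\psi\rho),\qquad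 \nabla^{\mathbb C}_{\gamma_*V}\big(\mathcal B(\gamma\psi)\sigma\big)=\gamma\,\nabla^{\mathbb C}_V\varphi,\qquad \nabla^{L^2}_{\gamma_*V}\big(\mathcal B(\gamma\psi)\sigma\big)=\gamma\,\nabla^{L^2}_V\varphi .$$ -/

import Mathlib

open MeasureTheory
open scoped ContDiff

noncomputable section

namespace TorusCS

/-! ### Spaces and complexified tangent vectors of Teichmueller space -/

/-- Indices of linear coordinates. The pair `(0, j)` is the index `j`, and `(1, j)` is the
index `j + r`, of a family of `2r` coordinates. -/
abbrev Idx (r : ℕ) := Fin 2 × Fin r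

/-- Translation-invariant one-forms `∑ j, T j ⊗ (u (0, j) dx + u (1, j) dy)` on the torus `ℝ² / ℤ²`
with values in the Lie algebra of the maximal torus; `T` is an orthonormal basis of the latter. -/
abbrev A0 (r : ℕ) := Idx r → ℝ

/-- Translation-invariant one-forms with values in the complexified Lie algebra of the maximal
torus, in the coordinates `w = u + i v`. -/
abbrev A0C (r : ℕ) := Idx r → ℂ

/-- The inclusion of `A0` into `A0C`. -/
def incl {r : ℕ} (u : A0 r) : A0C r := fun a => (u a : ℂ)

/-- Multiplication of coefficients by `i`: the complex structure `J` on `A0C`. -/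
def cxJ (r : ℕ) : A0C r →ₗ[ℝ] A0C r where
  toFun A := fun a => Complex.I * A a
  map_add' A B := by funext a; simp [mul_add]
  map_smul' c A := by funext a; simp; ring

/-- A complexified tangent vector of the upper half-plane is a pair `V`, standing for
`V.1 ∂/∂τ + V.2 ∂/∂τ̄`. This is `∂/∂τ`. -/
def ddTau : ℂ × ℂ := (1, 0)

/-- The vector `∂/∂τ̄`. -/
def ddTauBar : ℂ × ℂ := (0, 1)

/-- The derivative of `F` at `τ` along `V.1 ∂/∂τ + V.2 ∂/∂τ̄`, with the usual
`∂/∂τ = (∂₁ - i ∂₂) / 2` and `∂/∂τ̄ = (∂₁ + i ∂₂) / 2`. -/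
def tderiv (V : ℂ × ℂ) (F : ℂ → ℂ) (τ : ℂ) : ℂ :=
  V.1 * ((fderiv ℝ F τ 1 - Complex.I * fderiv ℝ F τ Complex.I) / 2) +
  V.2 * ((fderiv ℝ F τ 1 + Complex.I * fderiv ℝ F τ Complex.I) / 2)

/-- The level `t = k + i s`. -/
def level (k : ℕ) (s : ℝ) : ℂ := (k : ℂ) + (s : ℂ) * Complex.I

/-! ### Linear complex structures, prequantum connections, second-order operators -/

section Linear

variable {E ι : Type*} [NormedAddCommGroup E] [NormedSpace ℝ E] [Fintype ι] [DecidableEq ι]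

/-- The prequantum connection `∇_X = X - (i/2) Ω(A, X)` at the point `A`, in the trivialisation
with the invariant symplectic potential; its curvature is `-i Ω`. -/
def covD (Ω : E → E → ℝ) (X : E) (χ : E → ℂ) (A : E) : ℂ :=
  fderiv ℝ χ A X - Complex.I / 2 * (Ω A X : ℂ) * χ A

/-- The (complexified) matrix of a bilinear form in a basis. -/
def formMatrix (b : Module.Basis ι ℝ E) (Ω : E → E → ℝ) : Matrix ι ι ℂ :=
  Matrix.of fun i j => (Ω (b i) (b j) : ℂ)

/-- The (complexified) matrix of a linear endomorphism in a basis. -/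
def endMatrix (b : Module.Basis ι ℝ E) (S : E →ₗ[ℝ] E) : Matrix ι ι ℂ :=
  Matrix.of fun i j => (LinearMap.toMatrix b b S i j : ℂ)

/-- The derivative `V[S]` of a family of endomorphisms parametrised by `τ`. -/
def varMatrix (b : Module.Basis ι ℝ E) (S : ℂ → (E →ₗ[ℝ] E)) (V : ℂ × ℂ) (τ : ℂ) :
    Matrix ι ι ℂ :=
  Matrix.of fun i j => tderiv V (fun τ' => endMatrix b (S τ') i j) τ

/-- The bivector `G̃(V)` with `G̃(V) · Ω = c V[S]`, for a nondegenerate form `Ω`. -/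
def bivector (b : Module.Basis ι ℝ E) (Ω : E → E → ℝ) (c : ℝ) (S : ℂ → (E →ₗ[ℝ] E))
    (V : ℂ × ℂ) (τ : ℂ) : Matrix ι ι ℂ :=
  (c : ℂ) • (varMatrix b S V τ * (formMatrix b Ω)⁻¹)

/-- The component `G(V)` of `G̃(V)` of type `(1,0)` for the complex structure `S τ`: the bivector
with `G(V) · Ω = c V[S]'`, where `V[S]'` is the `(1,0)`-valued part of `V[S]`. -/
def bivector10 (b : Module.Basis ι ℝ E) (Ω : E → E → ℝ) (c : ℝ) (S : ℂ → (E →ₗ[ℝ] E))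
    (V : ℂ × ℂ) (τ : ℂ) : Matrix ι ι ℂ :=
  ((1 / 2 : ℂ) • (1 - Complex.I • endMatrix b (S τ))) * bivector b Ω c S V τ

/-- The component `Ḡ(V)` of `G̃(V)` of type `(0,1)` for the complex structure `S τ`. -/
def bivector01 (b : Module.Basis ι ℝ E) (Ω : E → E → ℝ) (c : ℝ) (S : ℂ → (E →ₗ[ℝ] E))
    (V : ℂ × ℂ) (τ : ℂ) : Matrix ι ι ℂ :=
  ((1 / 2 : ℂ) • (1 + Complex.I • endMatrix b (S τ))) * bivector b Ω c S V τ

/-- The Laplace operator `Tr (∇ G ∇)` of a constant bivector `G` (the Levi-Civita connection is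
trivial). If `G` is of type `(1,0)` in both slots, then only `∇^{1,0}` contributes. -/
def laplacian (b : Module.Basis ι ℝ E) (Ω : E → E → ℝ) (G : Matrix ι ι ℂ) (χ : E → ℂ) (A : E) :
    ℂ :=
  ∑ i, ∑ j, G i j * covD Ω (b i) (covD Ω (b j) χ) A

end Linear

/-! ### The Kaehler structures on the two spaces -/

/-- The Hodge operator of the complex structure with holomorphic coordinate `x + τ y`, as a matrix
in the basis `dx`, `dy`. -/
def hodgeMatrix (τ : ℂ) : Matrix (Fin 2) (Fin 2) ℝ :=
  (1 / τ.im) • !![τ.re, -1; Complex.normSq τ, -τ.re]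

/-- The Hodge operator on translation-invariant forms with real or complex coefficients. -/
def hodge {𝕜 : Type*} [RCLike 𝕜] {r : ℕ} (τ : ℂ) : (Idx r → 𝕜) →ₗ[ℝ] (Idx r → 𝕜) where
  toFun A := fun a => ∑ l, hodgeMatrix τ a.1 l • A (l, a.2)
  map_add' A B := by funext a; simp [smul_add]; ring
  map_smul' c A := by funext a; simp [smul_add, smul_comm c]

/-- The real symplectic form `ω` on `A0`. -/
def omega {r : ℕ} (A B : A0 r) : ℝ := ∑ j, (A (0, j) * B (1, j) - A (1, j) * B (0, j))

/-- The complex symplectic form `∑ j, dw (0, j) ∧ dw (1, j)` on `A0C`. -/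
def omegaC {r : ℕ} (A B : A0C r) : ℂ := ∑ j, (A (0, j) * B (1, j) - A (1, j) * B (0, j))

/-- The real symplectic form `ω_t = Re (t ω^ℂ)` on `A0C`. -/
def omegaT (k : ℕ) (s : ℝ) {r : ℕ} (A B : A0C r) : ℝ := (level k s * omegaC A B).re

/-- The complex structure `I_τ^ℂ` on `A0C`: Hodge operator composed with the conjugation of
coefficients (the Cartan involution); it is the one compatible with `Re ω^ℂ`, it extends the Hodge
operator on `A0`, and it anticommutes with `J`. -/
def cxI {r : ℕ} (τ : ℂ) : A0C r →ₗ[ℝ] A0C r where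
  toFun A := hodge τ (fun a => (starRingEnd ℂ) (A a))
  map_add' A B := by
    rw [← map_add]; congr 1; funext a; simp
  map_smul' c A := by
    rw [RingHom.id_apply, ← map_smul]; congr 1; funext a; simp

/-- The complex structure `I_{τ,t} = k' I_τ^ℂ + s' K_τ` with `K_τ = I_τ^ℂ ∘ J`, `k' = k / |t|` and
`s' = s / |t|`. -/
def cxIt (k : ℕ) (s : ℝ) {r : ℕ} (τ : ℂ) : A0C r →ₗ[ℝ] A0C r :=
  ((k : ℝ) / ‖level k s‖) • cxI τ + (s / ‖level k s‖) • (cxI τ ∘ₗ cxJ r)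

/-- The coordinate basis of `A0`. -/
def basisA0 (r : ℕ) : Module.Basis (Idx r) ℝ (A0 r) := Pi.basisFun ℝ (Idx r)

/-- The real coordinate basis of `A0C`. -/
def basisA0C (r : ℕ) : Module.Basis (Σ _ : Idx r, Fin 2) ℝ (A0C r) :=
  Pi.basis fun _ => Complex.basisOneI

/-! ### The two connections -/

/-- The lifted Hitchin-Witten covariant derivative
`∇_V χ = V[χ] - (1/2) ((1/t̄) Δ_{Ḡ(V)} - (1/t) Δ_{G(V)}) χ` of a family `χ` of sections of the
prequantum line bundle (with curvature `-i k ω`) over `A0`. -/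
def hitchinWitten (k : ℕ) (s : ℝ) {r : ℕ} (V : ℂ × ℂ) (χ : ℂ → A0 r → ℂ) (τ : ℂ) (u : A0 r) : ℂ :=
  tderiv V (fun τ' => χ τ' u) τ - 1 / 2 *
    (1 / (starRingEnd ℂ) (level k s) *
        laplacian (basisA0 r) (fun A B => (k : ℝ) * omega A B)
          (bivector01 (basisA0 r) omega 1 hodge V τ) (χ τ) u
      - 1 / level k s *
        laplacian (basisA0 r) (fun A B => (k : ℝ) * omega A B)
          (bivector10 (basisA0 r) omega 1 hodge V τ) (χ τ) u)

/-- The lifted complexified Hitchin covariant derivative `∇_V φ = V[φ] - (1 / (4 |t|)) u(V) φ`,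
`u(V) = -Δ_{G^ℂ(V)}`, of a family `φ` of sections of the prequantum line bundle over `A0C`. -/
def complexHitchin (k : ℕ) (s : ℝ) {r : ℕ} (V : ℂ × ℂ) (φ : ℂ → A0C r → ℂ) (τ : ℂ) (A : A0C r) :
    ℂ :=
  tderiv V (fun τ' => φ τ' A) τ - 1 / (4 * (‖level k s‖ : ℂ)) *
    (-laplacian (basisA0C r) (omegaT k s)
      (bivector10 (basisA0C r) (omegaT k s) ‖level k s‖ (cxIt k s) V τ) (φ τ) A)

/-! ### Frames, coordinates, polarised functions -/

/-- The frame `X_j = T_j dζ_τ / √(2 τ₂)` (index `(0, j)`), with `dζ_τ = dx + τ dy`, and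
`X_{j+r} = J X_j` (index `(1, j)`), of the real polarisation. -/
def frameX {r : ℕ} (τ : ℂ) (a : Idx r) : A0C r := fun b =>
  if b.2 = a.2 then
    (if a.1 = 0 then 1 else Complex.I) * (if b.1 = 0 then 1 else τ) / (√(2 * τ.im) : ℂ)
  else 0

/-- The frame `Y_j = I_{τ,t} X_j` of `Q_τ`. -/
def frameY (k : ℕ) (s : ℝ) {r : ℕ} (τ : ℂ) (a : Idx r) : A0C r := cxIt k s τ (frameX τ a)

/-- The metric `ω_t(·, I_{τ,t} ·) / |t|`; the vectors `X_a`, `Y_a` are orthonormal for it. -/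
def metric (k : ℕ) (s : ℝ) {r : ℕ} (τ : ℂ) (A B : A0C r) : ℝ :=
  omegaT k s A (cxIt k s τ B) / ‖level k s‖

/-- The coordinates `p` in the basis `(X, Y)`. -/
def coordP (k : ℕ) (s : ℝ) {r : ℕ} (τ : ℂ) (A : A0C r) (a : Idx r) : ℝ :=
  metric k s τ (frameX τ a) A

/-- The coordinates `q` in the basis `(X, Y)`. -/
def coordQ (k : ℕ) (s : ℝ) {r : ℕ} (τ : ℂ) (A : A0C r) (a : Idx r) : ℝ :=
  metric k s τ (frameY k s τ a) A

/-- The `I_{τ,t}`-holomorphic coordinates `z = p + i q`. -/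
def coordZ (k : ℕ) (s : ℝ) {r : ℕ} (τ : ℂ) (A : A0C r) (a : Idx r) : ℂ :=
  (coordP k s τ A a : ℂ) + Complex.I * (coordQ k s τ A a : ℂ)

/-- The Kaehler-polarised frame `σ_τ = (|t| / 2π)^{2r} exp (-|t| |z|² / 4)`. -/
def frameSigma (k : ℕ) (s : ℝ) {r : ℕ} (τ : ℂ) (A : A0C r) : ℂ :=
  ((‖level k s‖ / (2 * Real.pi)) ^ (2 * r) *
    Real.exp (-(‖level k s‖ / 4) * ∑ a, ‖coordZ k s τ A a‖ ^ 2) : ℝ)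

/-- The frame `ρ_τ = exp (-i |t| p·q / 2)` polarised for the real polarisation. -/
def frameRho (k : ℕ) (s : ℝ) {r : ℕ} (τ : ℂ) (A : A0C r) : ℂ :=
  Complex.exp (-(Complex.I * (‖level k s‖ : ℂ) / 2) *
    ∑ a, (coordP k s τ A a : ℂ) * (coordQ k s τ A a : ℂ))

/-- The real polarisation `P_τ`: the forms of type `(1,0)`, on which the Hodge operator is `-i`. -/
def polP {r : ℕ} (τ : ℂ) : Set (A0C r) := {X | hodge τ X = -(Complex.I • X)}

/-- `P_τ`-polarised functions. -/
def IsPolarised {r : ℕ} (τ : ℂ) (η : A0C r → ℂ) : Prop :=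
  ∀ A : A0C r, ∀ X ∈ polP (r := r) τ, fderiv ℝ η A X = 0

/-- The point of `Q_τ` with coordinates `q`. -/
def pointQ (k : ℕ) (s : ℝ) {r : ℕ} (τ : ℂ) (q : Idx r → ℝ) : A0C r :=
  ∑ a, q a • frameY k s τ a

/-- Restriction to `Q_τ`, as a function of the coordinates `q`. -/
def restrictQ (k : ℕ) (s : ℝ) {r : ℕ} (τ : ℂ) (η : A0C r → ℂ) (q : Idx r → ℝ) : ℂ :=
  η (pointQ k s τ q)

/-- The projection of `A0C = A0 ⊕ P_τ` onto `A0` along `P_τ`. -/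
def projA0 {r : ℕ} (τ : ℂ) (A : A0C r) : A0 r := fun a =>
  if a.1 = 0 then -(A (1, a.2) - τ * A (0, a.2)).im / τ.im
  else (A (1, a.2) - τ * A (0, a.2)).re - τ.re * (A (1, a.2) - τ * A (0, a.2)).im / τ.im

/-- The polarised extension to `A0C` of a section `χ` over `A0`: the section that restricts to `χ`
on `A0` and that is `∇_t`-parallel along `P_τ`, i.e. whose quotient by the frame `ρ_τ` is constant
along `P_τ`. -/
def polExt (k : ℕ) (s : ℝ) {r : ℕ} (τ : ℂ) (χ : A0 r → ℂ) (A : A0C r) : ℂ :=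
  χ (projA0 τ A) / frameRho k s τ (incl (projA0 τ A)) * frameRho k s τ A

/-- The Hitchin-Witten covariant derivative of the family of sections `ψ ρ_τ`: the section is
restricted to `A0`, differentiated there, and extended back to a polarised section on `A0C`. -/
def hitchinWittenPol (k : ℕ) (s : ℝ) {r : ℕ} (V : ℂ × ℂ) (ψ : ℂ → A0C r → ℂ) (τ : ℂ) :
    A0C r → ℂ :=
  polExt k s τ
    (hitchinWitten k s V (fun τ' u => ψ τ' (incl u) * frameRho k s τ' (incl u)) τ)

/-- The derivative `δ_V = V - ∑ a, (V[p_a] ∂/∂p_a + V[q_a] ∂/∂q_a)`; for `V = ∂/∂τ` and `∂/∂τ̄`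
these are the vector fields `δ/δτ` and `δ/δτ̄`, which kill the coordinates `p` and `q`. -/
def deltaDeriv (k : ℕ) (s : ℝ) {r : ℕ} (V : ℂ × ℂ) (F : ℂ → A0C r → ℂ) (τ : ℂ) (A : A0C r) : ℂ :=
  tderiv V (fun τ' => F τ' A) τ -
    ∑ a, (tderiv V (fun τ' => (coordP k s τ' A a : ℂ)) τ * fderiv ℝ (F τ) A (frameX τ a) +
      tderiv V (fun τ' => (coordQ k s τ' A a : ℂ)) τ * fderiv ℝ (F τ) A (frameY k s τ a))

/-! ### Bargmann transform and ladder operators -/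

/-- The Bargmann transform `B_τ` (for `ħ = 1 / |t|` in dimension `m = 2r`) of the restriction of
`η` to `Q_τ`, as a function on `A0C`. -/
def bargmann (k : ℕ) (s : ℝ) {r : ℕ} (τ : ℂ) (η : A0C r → ℂ) (A : A0C r) : ℂ :=
  (((1 / (Real.pi * (1 / ‖level k s‖)) ^ ((2 * r : ℝ) / 4) : ℝ)) : ℂ) *
    ∫ q : Idx r → ℝ, restrictQ k s τ η q *
      Complex.exp (-((‖level k s‖ : ℂ) / 4) *
        (4 * Complex.I * ∑ a, (q a : ℂ) * coordZ k s τ A a + 2 * ∑ a, (q a : ℂ) ^ 2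
          - ∑ a, coordZ k s τ A a ^ 2))

/-- The Bargmann transforms of a family of polarised functions, as a family of sections. -/
def bargmannSection (k : ℕ) (s : ℝ) {r : ℕ} (ψ : ℂ → A0C r → ℂ) (τ : ℂ) (A : A0C r) : ℂ :=
  bargmann k s τ (ψ τ) A * frameSigma k s τ A

/-- The ladder operators on functions of `q`, with `ħ = 1 / |t|`: annihilation
`-i (q_a + ħ ∂/∂q_a)` for `false`, creation `i (q_a - ħ ∂/∂q_a)` for `true`. -/
def ladder (k : ℕ) (s : ℝ) {r : ℕ} (ε : Bool) (a : Idx r) (η : (Idx r → ℝ) → ℂ) (q : Idx r → ℝ) :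
    ℂ :=
  if ε then Complex.I * ((q a : ℂ) * η q - 1 / (‖level k s‖ : ℂ) * fderiv ℝ η q (Pi.single a 1))
  else -Complex.I * ((q a : ℂ) * η q + 1 / (‖level k s‖ : ℂ) * fderiv ℝ η q (Pi.single a 1))

/-- A smooth function lies in the domain (in `L²`) of the ladder operators and of all their
two-fold compositions. -/
def InTwofoldLadderDomain (k : ℕ) (s : ℝ) {r : ℕ} (η : (Idx r → ℝ) → ℂ) : Prop :=
  MemLp η 2 volume ∧ (∀ ε a, MemLp (ladder k s ε a η) 2 volume) ∧
    ∀ ε a ε' a', MemLp (ladder k s ε a (ladder k s ε' a' η)) 2 volume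

/-! ### Holomorphic sections and the `L²`-connection -/

/-- `I_{τ,t}`-holomorphic sections of the prequantum line bundle over `A0C`: those with
`∇^{0,1} φ = 0`. -/
def IsHolomorphicSection (k : ℕ) (s : ℝ) {r : ℕ} (τ : ℂ) (φ : A0C r → ℂ) : Prop :=
  Differentiable ℝ φ ∧ ∀ X A : A0C r,
    covD (omegaT k s) X φ A + Complex.I * covD (omegaT k s) (cxIt k s τ X) φ A = 0

/-- The subspace of holomorphic sections in the Hilbert space of square-integrable sections. The
Lebesgue measure in the coordinates `w` is the Liouville measure of `ω_t / |t|`. -/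
def holoSpace (k : ℕ) (s : ℝ) (r : ℕ) (τ : ℂ) : Submodule ℂ (Lp ℂ 2 (volume : Measure (A0C r))) where
  carrier := {φ | ∃ φ₀ : A0C r → ℂ, IsHolomorphicSection k s τ φ₀ ∧ φ =ᵐ[volume] φ₀}
  add_mem' := by
    rintro φ χ ⟨φ₀, ⟨hd, hh⟩, he⟩ ⟨χ₀, ⟨hd', hh'⟩, he'⟩
    refine ⟨φ₀ + χ₀, ⟨hd.add hd', fun X A => ?_⟩, (Lp.coeFn_add φ χ).trans (he.add he')⟩
    have h1 := hh X A
    have h2 := hh' X A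
    simp only [covD, Pi.add_apply, fderiv_add (hd A) (hd' A), _root_.add_apply]
      at h1 h2 ⊢
    linear_combination h1 + h2
  zero_mem' := by
    refine ⟨0, ⟨differentiable_const 0, fun X A => ?_⟩, Lp.coeFn_zero _ _ _⟩
    simp [covD]
  smul_mem' := by
    rintro c φ ⟨φ₀, ⟨hd, hh⟩, he⟩
    refine ⟨c • φ₀, ⟨hd.const_smul c, fun X A => ?_⟩, (Lp.coeFn_smul c φ).trans (he.const_smul c)⟩
    have h1 := hh X A
    simp only [covD, Pi.smul_apply, fderiv_const_smul (hd A), _root_.smul_apply,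
      smul_eq_mul] at h1 ⊢
    linear_combination c * h1

/-- The orthogonal projection onto the Hilbert space of holomorphic `L²`-sections. (That space is
closed; taking the closure only spares a proof of this.) -/
def holoProj (k : ℕ) (s : ℝ) (r : ℕ) (τ : ℂ) :
    Lp ℂ 2 (volume : Measure (A0C r)) →L[ℂ] Lp ℂ 2 (volume : Measure (A0C r)) :=
  (holoSpace k s r τ).topologicalClosure.starProjection

open Classical in
/-- The `L²`-connection: the orthogonal projection of `V[φ]`, for families of sections `φ` such that
`V[φ]` is square-integrable. -/
def l2Connection (k : ℕ) (s : ℝ) {r : ℕ} (V : ℂ × ℂ) (φ : ℂ → A0C r → ℂ) (τ : ℂ) :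
    Lp ℂ 2 (volume : Measure (A0C r)) :=
  if h : MemLp (fun A => tderiv V (fun τ' => φ τ' A) τ) 2 volume then
    holoProj k s r τ (h.toLp _)
  else 0

/-! ### The mapping class group -/

/-- The action of `SL(2, ℤ)` on the upper half-plane. -/
def mobius (γ : Matrix.SpecialLinearGroup (Fin 2) ℤ) (τ : ℂ) : ℂ :=
  ((γ.1 0 0 : ℂ) * τ + (γ.1 0 1 : ℂ)) / ((γ.1 1 0 : ℂ) * τ + (γ.1 1 1 : ℂ))

/-- The differential of the action at `τ`, on complexified tangent vectors. -/
def mobiusPush (γ : Matrix.SpecialLinearGroup (Fin 2) ℤ) (τ : ℂ) (V : ℂ × ℂ) : ℂ × ℂ :=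
  (V.1 / ((γ.1 1 0 : ℂ) * τ + (γ.1 1 1 : ℂ)) ^ 2,
    V.2 / (starRingEnd ℂ) (((γ.1 1 0 : ℂ) * τ + (γ.1 1 1 : ℂ)) ^ 2))

/-- The action of `SL(2, ℤ)` on translation-invariant one-forms on `ℝ² / ℤ²` by linear
diffeomorphisms of the torus; it takes `dx + τ dy` to a multiple of `dx + (γ τ) dy`. -/
def mcgForm (γ : Matrix.SpecialLinearGroup (Fin 2) ℤ) {r : ℕ} (A : A0C r) : A0C r := fun a =>
  if a.1 = 0 then (γ.1 1 1 : ℂ) * A (0, a.2) + (γ.1 1 0 : ℂ) * A (1, a.2)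
  else (γ.1 0 1 : ℂ) * A (0, a.2) + (γ.1 0 0 : ℂ) * A (1, a.2)

/-- The action on families, `(γ F)(τ, A) = F(γ⁻¹ τ, γ⁻¹ A)`. -/
def mcgFamily (γ : Matrix.SpecialLinearGroup (Fin 2) ℤ) {r : ℕ} (F : ℂ → A0C r → ℂ) (τ : ℂ)
    (A : A0C r) : ℂ :=
  F (mobius γ⁻¹ τ) (mcgForm γ⁻¹ A)

end TorusCS

end

/-! Write T = |t| and e = t/|t|. For fixed τ everything is linear algebra in the coordinates p, q,
so the theorem reduces to an identity of differential operators of order two, together with the L²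
estimates that give it a meaning. It is convenient to pair the coordinates as P_j = p_(0,j) + i
p_(1,j) and Q_j = q_(0,j) - i q_(1,j): up to scale and phase these are the coefficients of A along
dx + τ dy and dx + τ̄ dy, so their τ-derivatives are short, and I_{τ,t} acts by P ↦ -Q̄, Q ↦ P̄.

The side of the real polarisation. A polarised function is a function f of q alone, and δ_V
differentiates f at fixed q (`deltaDeriv_eq`). The bivectors G and Ḡ are block diagonal, with blocks
multiples of the squares of dx + τ̄ dy and dx + τ dy. Writing the Laplacians in the frame ρ and
adding the motion of q and ρ with τ, one finds ∇^{HW}_V = δ_V + D_V, where D_V consists of the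
infinitesimal rotation of the pairs (q_(0,j), q_(1,j)) and of a combination of the operators ∂_a ∂_b
+ T² q_a q_b (`restrictQ_hitchinWittenPol`).

The Bargmann transform. Differentiating the Gaussian kernel and integrating by parts, multiplication
by q_a becomes (i/T)(∂_a - (T/2) z_a) and ∂/∂q_a becomes i(∂_a + (T/2) z_a). Hence D_V becomes an
explicit operator D̂_V in z (`segal_hwOperator`), while δ_V passes through the transform by
hypothesis.

The holomorphic side. Let F be the Bargmann transform of ψ as a function of z, so that φ = F(z) σ.
Then V[φ] differs from (δ_V B(ψ)) σ by the motion of z and σ with τ, and `transport_identity` says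
that this motion contributes D̂_V F σ - (1/4T) Δ_{G^ℂ(V)} φ; the second derivatives of F cancel in
this difference. Therefore V[φ] = B(∇^{HW}_V(ψρ)) σ - (1/4T) Δ_{G^ℂ(V)} φ
(`tderiv_bargmannSection`).

Both equalities of the theorem are read off from this line. Moving the Laplacian to the left gives
∇^ℂ_V φ. For the L²-connection, G^ℂ is of type (1,0) in both slots, so the Laplacian of φ is a sum
of (1,0) covariant derivatives of square-integrable sections, and integration by parts makes it
orthogonal to all holomorphic sections in L² (`integral_nabla2_mul_conj_eq_zero`); the other term is
holomorphic and square-integrable, hence it is the projection of V[φ].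

The analysis rests on three facts. By Plancherel in Re z, the transform of an L² function times σ is
in L² (`memLp_segal`). Since z_a F and ∂_a F are again transforms of combinations of q_a f and
∂f/∂q_a, the two-fold ladder domain yields all integrability needed for second covariant derivatives
(`secondOrderRegular_segal`). Finally, an integrable divergence of an integrable field has integral
zero, by cutoffs (`integral_fderiv_combination_eq_zero`), so that no pointwise decay is required.

Equivariance. The element γ rotates every coordinate pair by the unitary part of cτ + d. Hence ρ, σ
and the Bargmann transform are invariant. The two differential connections are natural under linear
symplectic maps that intertwine the families of complex structures, and the L²-connection follows
from the same orthogonal decomposition, transported by γ. -/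

noncomputable section

namespace TorusCS

/-! ### Plancherel for Fourier integrals of functions in L¹ ∩ L² -/

section Plancherel

open FourierTransform SchwartzMap

variable {V : Type*} [NormedAddCommGroup V] [InnerProductSpace ℝ V] [FiniteDimensional ℝ V]
  [MeasurableSpace V] [BorelSpace V]

/-- The `L²` Fourier transform is given by the Fourier integral for integrable functions. -/
theorem fourier_toLp_ae_eq {g : V → ℂ} (h1 : Integrable g) (h2 : MemLp g 2) :
    (𝓕 (h2.toLp g) : Lp ℂ 2 (volume : Measure V)) =ᵐ[volume] 𝓕 g := by
  have hcont : Continuous (𝓕 g) := VectorFourier.fourierIntegral_continuous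
    Real.continuous_fourierChar (by exact continuous_inner) h1
  -- Against a test function both sides move the transform to the test function: the L² transform
  -- because it agrees with the transform of tempered distributions, the integral by Fubini.
  apply ae_eq_of_integral_contDiff_smul_eq
  · exact (Lp.memLp _).locallyIntegrable (by norm_num)
  · exact hcont.locallyIntegrable
  intro φ hφ hc
  have hc' : HasCompactSupport (fun x => (φ x : ℂ)) := hc.comp_left (g := ((↑) : ℝ → ℂ)) rfl
  set Φ : 𝓢(V, ℂ) := hc'.toSchwartzMap (Complex.ofRealCLM.contDiff.comp hφ) with hΦ
  have hΦx : ∀ x, Φ x = (φ x : ℂ) := fun x => rfl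
  have e1 := DFunLike.congr_fun (Lp.fourier_toTemperedDistribution_eq (h2.toLp g)) Φ
  rw [TemperedDistribution.fourier_apply, Lp.toTemperedDistribution_apply,
    Lp.toTemperedDistribution_apply] at e1
  have e2 : ∫ x, (𝓕 Φ) x • (h2.toLp g) x = ∫ x, (𝓕 Φ) x • g x := by
    apply integral_congr_ae
    filter_upwards [h2.coeFn_toLp] with x hx
    rw [hx]
  have e3 : ∫ x, (𝓕 Φ) x • g x = ∫ x, Φ x • (𝓕 g) x := by
    have := VectorFourier.integral_fourierIntegral_smul_eq_flip (L := innerₗ V)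
      (μ := (volume : Measure V)) (ν := (volume : Measure V)) Real.continuous_fourierChar
      (by exact continuous_inner) Φ.integrable h1
    rw [flip_innerₗ] at this
    rw [SchwartzMap.fourier_coe]
    exact this
  calc _ = ∫ x, Φ x • (𝓕 (h2.toLp g) : Lp ℂ 2 (volume : Measure V)) x := by
        simp [hΦx]
    _ = _ := by rw [← e1, e2, e3]; simp [hΦx]

theorem eLpNorm_fourier_eq {g : V → ℂ} (h1 : Integrable g) (h2 : MemLp g 2) :
    eLpNorm (𝓕 g) 2 = eLpNorm g 2 := by
  rw [← eLpNorm_congr_ae (fourier_toLp_ae_eq h1 h2), ← eLpNorm_congr_ae h2.coeFn_toLp]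
  have := Lp.norm_fourier_eq (h2.toLp g)
  rw [Lp.norm_def, Lp.norm_def, ENNReal.toReal_eq_toReal_iff' (Lp.eLpNorm_ne_top _)
    (Lp.eLpNorm_ne_top _)] at this
  exact this

end Plancherel

/-! ### The Gaussian kernel: bounds, holomorphy in z, integration by parts in q -/

section Segal

variable {ι : Type*} [Fintype ι]

/-- The kernel of the Segal-Bargmann transform with `ħ = 1 / T`. -/
def segalKernel (T : ℝ) (z : ι → ℂ) (q : ι → ℝ) : ℂ :=
  Complex.exp (-((T : ℂ) / 4) *
    (4 * Complex.I * ∑ a, (q a : ℂ) * z a + 2 * ∑ a, (q a : ℂ) ^ 2 - ∑ a, z a ^ 2))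

/-- The (unnormalised) Segal-Bargmann transform. -/
def segal (T : ℝ) (η : (ι → ℝ) → ℂ) (z : ι → ℂ) : ℂ := ∫ q, η q * segalKernel T z q

/-- A real Gaussian. -/
def gauss (c : ℝ) (q : ι → ℝ) : ℝ := Real.exp (-c * ∑ a, q a ^ 2)

theorem integrable_gauss {c : ℝ} (hc : 0 < c) : Integrable (gauss c : (ι → ℝ) → ℝ) := by
  have := (GaussianFourier.integrable_cexp_neg_mul_sum_add (ι := ι) (b := (c : ℂ))
    (by simpa using hc) 0).norm
  refine this.congr (Filter.Eventually.of_forall fun q => ?_)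
  simp only [Complex.norm_exp, gauss]
  congr 1
  simp [← Complex.ofReal_pow, ← Complex.ofReal_sum]

theorem memLp_gauss {c : ℝ} (hc : 0 < c) : MemLp (gauss c : (ι → ℝ) → ℝ) 2 := by
  have hm : Continuous (gauss c : (ι → ℝ) → ℝ) := by unfold gauss; fun_prop
  rw [memLp_two_iff_integrable_sq hm.aestronglyMeasurable]
  refine (integrable_gauss (ι := ι) (c := 2 * c) (by positivity)).congr
    (Filter.Eventually.of_forall fun q => ?_)
  simp only [gauss]
  rw [← Real.exp_nat_mul]; congr 1; push_cast; ring

theorem norm_segalKernel (T : ℝ) (z : ι → ℂ) (q : ι → ℝ) :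
    ‖segalKernel T z q‖ =
      Real.exp (∑ a, (T * (q a * (z a).im) - T / 2 * q a ^ 2
        + T / 4 * ((z a).re ^ 2 - (z a).im ^ 2))) := by
  rw [segalKernel, Complex.norm_exp]
  congr 1
  have h : -((T : ℂ) / 4) * (4 * Complex.I * ∑ a, (q a : ℂ) * z a + 2 * ∑ a, (q a : ℂ) ^ 2
      - ∑ a, z a ^ 2) = ∑ a, -((T : ℂ) / 4) * (4 * Complex.I * ((q a : ℂ) * z a)
        + 2 * (q a : ℂ) ^ 2 - z a ^ 2) := by
    rw [← Finset.mul_sum, Finset.sum_sub_distrib, Finset.sum_add_distrib, ← Finset.mul_sum,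
      ← Finset.mul_sum]
  rw [h, Complex.re_sum]
  refine Finset.sum_congr rfl fun a _ => ?_
  have h4 : -((T : ℂ) / 4) = ((-(T / 4) : ℝ) : ℂ) := by push_cast; ring
  rw [h4, Complex.re_ofReal_mul]
  simp [pow_two, Complex.mul_re, Complex.mul_im]
  ring

/-- The term T q·Im z is absorbed by half of the Gaussian exp(-(T/2)|q|²), since q y ≤ q²/4 + y².
The bound is uniform for z in a ball, which is what differentiation under the integral needs; the
constant 2TR² is deliberately crude. -/
theorem norm_segalKernel_le {T : ℝ} (hT : 0 < T) {R : ℝ} {z : ι → ℂ} (hz : ‖z‖ ≤ R)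
    (q : ι → ℝ) :
    ‖segalKernel T z q‖ ≤ Real.exp (Fintype.card ι * (2 * T * R ^ 2)) * gauss (T / 4) q := by
  rw [norm_segalKernel, gauss, ← Real.exp_add, Real.exp_le_exp]
  have h : (Fintype.card ι * (2 * T * R ^ 2) : ℝ) + -(T / 4) * ∑ a, q a ^ 2
      = ∑ a, (2 * T * R ^ 2 - T / 4 * q a ^ 2) := by
    rw [Finset.mul_sum, Finset.sum_sub_distrib, Finset.sum_const, nsmul_eq_mul,
      Finset.card_univ, sub_eq_add_neg, ← Finset.sum_neg_distrib]
    simp only [neg_mul]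
  rw [h]
  refine Finset.sum_le_sum fun a _ => ?_
  have ha : ‖z a‖ ≤ R := (norm_le_pi_norm z a).trans hz
  have h1 : (z a).re ^ 2 + (z a).im ^ 2 ≤ R ^ 2 := by
    have : (z a).re ^ 2 + (z a).im ^ 2 = ‖z a‖ ^ 2 := by
      rw [← Complex.normSq_eq_norm_sq, Complex.normSq_apply]; ring
    rw [this]; gcongr
  have h2 : q a * (z a).im ≤ q a ^ 2 / 4 + (z a).im ^ 2 := by
    nlinarith [sq_nonneg (q a / 2 - (z a).im)]
  nlinarith [mul_le_mul_of_nonneg_left h2 hT.le, mul_le_mul_of_nonneg_left h1 hT.le,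
    mul_nonneg hT.le (sq_nonneg (z a).re), mul_nonneg hT.le (sq_nonneg (z a).im)]

/-- Giving up half of the Gaussian pays for the linear weight: the remaining factor exp((T/8)|q|²)
dominates 1 + (T/8)|q|². The weight occurs in the logarithmic derivative of the kernel. -/
theorem exists_weight_bound {T : ℝ} (hT : 0 < T) : ∃ C : ℝ, 0 ≤ C ∧ ∀ q : ι → ℝ,
    (1 + ∑ a, |q a|) * gauss (T / 4) q ≤ C * gauss (T / 8) q := by
  refine ⟨1 + Fintype.card ι + 8 / T, by positivity, fun q => ?_⟩
  have hg : gauss (T / 4) q = gauss (T / 8) q * gauss (T / 8) q := by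
    simp only [gauss]; rw [← Real.exp_add]; congr 1; ring
  have hpos : 0 < gauss (T / 8) q := Real.exp_pos _
  rw [hg, ← mul_assoc]
  refine mul_le_mul_of_nonneg_right ?_ hpos.le
  have hs : 0 ≤ ∑ a, q a ^ 2 := Finset.sum_nonneg fun a _ => sq_nonneg _
  have h1 : (1 + ∑ a, |q a|) ≤ (1 + Fintype.card ι) + ∑ a, q a ^ 2 := by
    have : ∑ a, |q a| ≤ ∑ a, (1 + q a ^ 2) := Finset.sum_le_sum fun a _ => by
      nlinarith [sq_nonneg (|q a| - 1), sq_abs (q a)]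
    rw [Finset.sum_add_distrib] at this
    simp at this
    linarith
  have h2 : 1 + T / 8 * ∑ a, q a ^ 2 ≤ Real.exp (T / 8 * ∑ a, q a ^ 2) := by
    linarith [Real.add_one_le_exp (T / 8 * ∑ a, q a ^ 2)]
  have h3 : (1 + Fintype.card ι) + ∑ a, q a ^ 2 ≤
      (1 + Fintype.card ι + 8 / T) * Real.exp (T / 8 * ∑ a, q a ^ 2) := by
    refine le_trans ?_ (mul_le_mul_of_nonneg_left h2 (by positivity))
    have : (8 / T) * (T / 8 * ∑ a, q a ^ 2) = ∑ a, q a ^ 2 := by field_simp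
    have h5 : (0 : ℝ) ≤ (1 + Fintype.card ι) * (T / 8 * ∑ a, q a ^ 2) := by positivity
    have h6 : 0 ≤ 8 / T := by positivity
    nlinarith
  have h7 : gauss (T / 8) q * Real.exp (T / 8 * ∑ a, q a ^ 2) = 1 := by
    simp only [gauss]; rw [← Real.exp_add]; simp
  calc (1 + ∑ a, |q a|) * gauss (T / 8) q
      ≤ ((1 + Fintype.card ι + 8 / T) * Real.exp (T / 8 * ∑ a, q a ^ 2)) * gauss (T / 8) q :=
        mul_le_mul_of_nonneg_right (h1.trans h3) hpos.le
    _ = (1 + Fintype.card ι + 8 / T) * (gauss (T / 8) q * Real.exp (T / 8 * ∑ a, q a ^ 2)) := by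
        ring
    _ = _ := by rw [h7, mul_one]

/-- Square-integrable functions are integrable against functions with Gaussian bounds. -/
theorem integrable_mul_of_gauss_bound {η g : (ι → ℝ) → ℂ} (hη : MemLp η 2) {c C : ℝ} (hc : 0 < c)
    (hg : AEStronglyMeasurable g) (hb : ∀ q, ‖g q‖ ≤ C * gauss c q) :
    Integrable fun q => η q * g q := by
  have h : MemLp g 2 :=
    ((memLp_gauss hc).const_mul C).mono' hg (Filter.Eventually.of_forall hb)
  exact hη.integrable_mul h

theorem continuous_segalKernel_right (T : ℝ) (z : ι → ℂ) : Continuous (segalKernel T z) := by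
  unfold segalKernel; fun_prop

theorem integrable_mul_segalKernel {T : ℝ} (hT : 0 < T) {η : (ι → ℝ) → ℂ} (hη : MemLp η 2)
    (z : ι → ℂ) : Integrable fun q => η q * segalKernel T z q :=
  integrable_mul_of_gauss_bound hη (c := T / 4) (by positivity)
    (continuous_segalKernel_right T z).aestronglyMeasurable
    (norm_segalKernel_le hT le_rfl)

theorem integrable_mul_coord_segalKernel {T : ℝ} (hT : 0 < T) {η : (ι → ℝ) → ℂ} (hη : MemLp η 2)
    (z : ι → ℂ) (a : ι) : Integrable fun q => η q * ((q a : ℂ) * segalKernel T z q) := by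
  obtain ⟨C, hC, h⟩ := exists_weight_bound (ι := ι) hT
  refine integrable_mul_of_gauss_bound hη (c := T / 8)
    (C := Real.exp (Fintype.card ι * (2 * T * ‖z‖ ^ 2)) * C) (by positivity)
    (Continuous.aestronglyMeasurable (by
      have := continuous_segalKernel_right T z; fun_prop)) fun q => ?_
  rw [norm_mul, Complex.norm_real, Real.norm_eq_abs]
  have h1 := norm_segalKernel_le hT (le_refl ‖z‖) q
  have h2 : |q a| ≤ 1 + ∑ a, |q a| := by
    have := Finset.single_le_sum (f := fun a => |q a|) (fun i _ => abs_nonneg _)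
      (Finset.mem_univ a)
    linarith
  have h3 : 0 ≤ gauss (T / 4) q := (Real.exp_pos _).le
  calc |q a| * ‖segalKernel T z q‖ ≤ |q a| * (Real.exp (Fintype.card ι * (2 * T * ‖z‖ ^ 2))
        * gauss (T / 4) q) := by gcongr
    _ ≤ (1 + ∑ a, |q a|) * (Real.exp (Fintype.card ι * (2 * T * ‖z‖ ^ 2))
        * gauss (T / 4) q) := by gcongr
    _ = Real.exp (Fintype.card ι * (2 * T * ‖z‖ ^ 2)) *
        ((1 + ∑ a, |q a|) * gauss (T / 4) q) := by ring
    _ ≤ Real.exp (Fintype.card ι * (2 * T * ‖z‖ ^ 2)) * (C * gauss (T / 8) q) := by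
        exact mul_le_mul_of_nonneg_left (h q) (Real.exp_pos _).le
    _ = _ := by ring

/-- The logarithmic derivative of the kernel in `z`. -/
def segalLogDeriv (T : ℝ) (z : ι → ℂ) (q : ι → ℝ) : (ι → ℂ) →L[ℂ] ℂ :=
  ∑ a, ((T : ℂ) * (-Complex.I * q a + z a / 2)) •
    ContinuousLinearMap.proj (R := ℂ) (φ := fun _ : ι => ℂ) a

theorem hasFDerivAt_segalKernel (T : ℝ) (z : ι → ℂ) (q : ι → ℝ) :
    HasFDerivAt (fun z => segalKernel T z q) (segalKernel T z q • segalLogDeriv T z q) z := by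
  unfold segalKernel
  apply HasFDerivAt.cexp
  have hp : ∀ a, HasFDerivAt (fun z : ι → ℂ => z a) (ContinuousLinearMap.proj (R := ℂ) a) z :=
    fun a => (ContinuousLinearMap.proj (R := ℂ) (φ := fun _ : ι => ℂ) a).hasFDerivAt
  have h1 : HasFDerivAt (fun z : ι → ℂ => ∑ a, (q a : ℂ) * z a)
      (∑ a, (q a : ℂ) • ContinuousLinearMap.proj (R := ℂ) (φ := fun _ : ι => ℂ) a) z :=
    HasFDerivAt.fun_sum fun a _ => (hp a).const_mul (q a : ℂ)
  have h2 : HasFDerivAt (fun z : ι → ℂ => ∑ a, z a ^ 2)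
      (∑ a, (2 * z a) • ContinuousLinearMap.proj (R := ℂ) (φ := fun _ : ι => ℂ) a) z := by
    refine HasFDerivAt.fun_sum fun a _ => ?_
    have := (hp a).pow 2
    refine this.congr_fderiv ?_
    ext; simp
  have h := (((h1.const_mul (4 * Complex.I)).add_const (2 * ∑ a, (q a : ℂ) ^ 2)).sub h2).const_mul
    (-((T : ℂ) / 4))
  refine h.congr_fderiv ?_
  ext v
  simp only [segalLogDeriv, _root_.smul_apply, _root_.sub_apply,
    _root_.sum_apply, ContinuousLinearMap.proj_apply, smul_eq_mul, Finset.mul_sum,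
    ← Finset.sum_sub_distrib]
  refine Finset.sum_congr rfl fun a _ => ?_
  ring

theorem norm_segalLogDeriv_le {T : ℝ} (hT : 0 < T) {R : ℝ} (hR : 0 ≤ R) {z : ι → ℂ} (hz : ‖z‖ ≤ R)
    (q : ι → ℝ) :
    ‖segalLogDeriv T z q‖ ≤ T * (1 + Fintype.card ι * R) * (1 + ∑ a, |q a|) := by
  refine ContinuousLinearMap.opNorm_le_bound _ (by positivity) fun v => ?_
  rw [segalLogDeriv, _root_.sum_apply]
  refine (norm_sum_le _ _).trans ?_
  have h1 : ∀ a, ‖(((T : ℂ) * (-Complex.I * q a + z a / 2)) •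
      ContinuousLinearMap.proj (R := ℂ) (φ := fun _ : ι => ℂ) a) v‖ ≤ T * (|q a| + R) * ‖v‖ := by
    intro a
    rw [_root_.smul_apply, norm_smul, ContinuousLinearMap.proj_apply, norm_mul,
      Complex.norm_real, Real.norm_of_nonneg hT.le]
    gcongr
    · refine (norm_add_le _ _).trans ?_
      have : ‖z a‖ ≤ R := (norm_le_pi_norm z a).trans hz
      simp
      linarith [norm_nonneg (z a)]
    · exact norm_le_pi_norm v a
  refine (Finset.sum_le_sum fun a _ => h1 a).trans ?_
  rw [← Finset.sum_mul, ← Finset.mul_sum, Finset.sum_add_distrib]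
  simp only [Finset.sum_const, Finset.card_univ, nsmul_eq_mul]
  have h2 : 0 ≤ ∑ a, |q a| := Finset.sum_nonneg fun a _ => abs_nonneg _
  have h3 : 0 ≤ (Fintype.card ι * R) * ∑ a, |q a| := by positivity
  have h4 : (0 : ℝ) ≤ Fintype.card ι * R := by positivity
  have h5 : ∑ a, |q a| + Fintype.card ι * R ≤ (1 + Fintype.card ι * R) * (1 + ∑ a, |q a|) := by
    nlinarith
  exact (mul_le_mul_of_nonneg_right (mul_le_mul_of_nonneg_left h5 hT.le)
    (norm_nonneg v)).trans_eq (by ring)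

/-- Differentiation under the integral sign: near z the z-derivative of the kernel is bounded by a
fixed Gaussian, which is in L² and so pairs integrably with η. -/
theorem hasFDerivAt_segal {T : ℝ} (hT : 0 < T) {η : (ι → ℝ) → ℂ} (hη : MemLp η 2) (z : ι → ℂ) :
    Integrable (fun q => (η q * segalKernel T z q) • segalLogDeriv T z q) ∧
    HasFDerivAt (segal T η) (∫ q, (η q * segalKernel T z q) • segalLogDeriv T z q) z := by
  classical
  obtain ⟨C, hC, hw⟩ := exists_weight_bound (ι := ι) hT
  -- The domination is carried out on the unit ball around z, where norms are at most ‖z‖ + 1.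
  set R := ‖z‖ + 1 with hR
  set D := Real.exp (Fintype.card ι * (2 * T * R ^ 2)) * (T * (1 + Fintype.card ι * R)) * C with hD
  have hR0 : 0 ≤ R := by positivity
  have hbd : ∀ q : ι → ℝ, ∀ x ∈ Metric.ball z 1,
      ‖(η q * segalKernel T x q) • segalLogDeriv T x q‖ ≤ ‖η q‖ * (D * gauss (T / 8) q) := by
    intro q x hx
    have hxR : ‖x‖ ≤ R := by
      have := norm_le_norm_add_norm_sub' x z
      rw [Metric.mem_ball, dist_eq_norm] at hx
      linarith
    rw [norm_smul, norm_mul, mul_assoc]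
    refine mul_le_mul_of_nonneg_left ?_ (norm_nonneg _)
    have hg : 0 ≤ gauss (T / 4) q := (Real.exp_pos _).le
    calc _ ≤ (Real.exp (Fintype.card ι * (2 * T * R ^ 2)) * gauss (T / 4) q) *
          (T * (1 + Fintype.card ι * R) * (1 + ∑ a, |q a|)) := by
          gcongr
          · exact norm_segalKernel_le hT hxR q
          · exact norm_segalLogDeriv_le hT hR0 hxR q
      _ = Real.exp (Fintype.card ι * (2 * T * R ^ 2)) * (T * (1 + Fintype.card ι * R)) *
          ((1 + ∑ a, |q a|) * gauss (T / 4) q) := by ring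
      _ ≤ _ := by rw [hD, mul_assoc _ C]; exact mul_le_mul_of_nonneg_left (hw q) (by positivity)
  have hmeas : AEStronglyMeasurable (fun q => (η q * segalKernel T z q) • segalLogDeriv T z q) := by
    have h1 : Continuous (fun q : ι → ℝ => segalLogDeriv T z q) := by
      unfold segalLogDeriv; fun_prop
    exact (hη.1.mul (continuous_segalKernel_right T z).aestronglyMeasurable).smul
      h1.aestronglyMeasurable
  have hbi : Integrable fun q : ι → ℝ => ‖η q‖ * (D * gauss (T / 8) q) :=
    hη.norm.integrable_mul ((memLp_gauss (by positivity)).const_mul D)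
  have hint : Integrable (fun q => (η q * segalKernel T z q) • segalLogDeriv T z q) :=
    hbi.mono' hmeas (Filter.Eventually.of_forall fun q => hbd q z (Metric.mem_ball_self one_pos))
  refine ⟨hint, hasFDerivAt_integral_of_dominated_of_fderiv_le (Metric.ball_mem_nhds z one_pos)
    (Filter.Eventually.of_forall fun x => (integrable_mul_segalKernel hT hη x).1)
    (integrable_mul_segalKernel hT hη z) hmeas
    (Filter.Eventually.of_forall hbd) hbi
    (Filter.Eventually.of_forall fun q x _ => ?_)⟩
  have := (hasFDerivAt_segalKernel T x q).const_mul (η q)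
  rwa [smul_smul] at this

theorem differentiable_segal {T : ℝ} (hT : 0 < T) {η : (ι → ℝ) → ℂ} (hη : MemLp η 2) :
    Differentiable ℂ (segal T η) := fun z => (hasFDerivAt_segal hT hη z).2.differentiableAt

/-- The logarithmic derivative of the kernel in z_a is T(-i q_a + z_a/2). Only η itself is taken in
L²: the factor q_a is controlled by the kernel. -/
theorem fderiv_segal_single [DecidableEq ι] {T : ℝ} (hT : 0 < T) {η : (ι → ℝ) → ℂ}
    (hη : MemLp η 2) (z : ι → ℂ) (a : ι) :
    fderiv ℂ (segal T η) z (Pi.single a 1) =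
      T * (-Complex.I * segal T (fun q => (q a : ℂ) * η q) z + z a / 2 * segal T η z) := by
  obtain ⟨hi, hd⟩ := hasFDerivAt_segal hT hη z
  rw [hd.fderiv, ContinuousLinearMap.integral_apply hi]
  have h : ∀ q : ι → ℝ, ((η q * segalKernel T z q) • segalLogDeriv T z q) (Pi.single a 1) =
      (-Complex.I * T) * (((q a : ℂ) * η q) * segalKernel T z q) +
        (T * (z a / 2)) * (η q * segalKernel T z q) := by
    intro q
    simp only [segalLogDeriv, _root_.smul_apply, _root_.sum_apply,
      ContinuousLinearMap.proj_apply, smul_eq_mul, Pi.single_apply, mul_ite, mul_one, mul_zero,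
      Finset.sum_ite_eq', Finset.mem_univ, if_true]
    ring
  simp_rw [h]
  have i1 : Integrable fun q : ι → ℝ => ((q a : ℂ) * η q) * segalKernel T z q := by
    refine (integrable_mul_coord_segalKernel hT hη z a).congr
      (Filter.Eventually.of_forall fun q => ?_)
    simp only; ring
  rw [integral_add (i1.const_mul _) ((integrable_mul_segalKernel hT hη z).const_mul _),
    integral_const_mul, integral_const_mul]
  simp only [segal]
  ring

/-- Integration by parts moves the derivative to the kernel, whose logarithmic derivative in q_a is
-T(i z_a + q_a). With `fderiv_segal_single` this determines how q_a and ∂/∂q_a act on transforms. -/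
theorem segal_fderiv [DecidableEq ι] {T : ℝ} (hT : 0 < T) {η : (ι → ℝ) → ℂ}
    (hd : Differentiable ℝ η) (hη : MemLp η 2) (a : ι)
    (h' : MemLp (fun q => fderiv ℝ η q (Pi.single a 1)) 2) (z : ι → ℂ) :
    segal T (fun q => fderiv ℝ η q (Pi.single a 1)) z =
      T * (segal T (fun q => (q a : ℂ) * η q) z + Complex.I * z a * segal T η z) := by
  have hK : ∀ q : ι → ℝ, HasFDerivAt (segalKernel T z) (segalKernel T z q •
      ∑ b, (-(T : ℂ) * (Complex.I * z b + q b)) •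
        (Complex.ofRealCLM.comp (ContinuousLinearMap.proj (R := ℝ) (φ := fun _ : ι => ℝ) b))) q := by
    intro q
    unfold segalKernel
    apply HasFDerivAt.cexp
    have hp : ∀ b, HasFDerivAt (fun q : ι → ℝ => (q b : ℂ))
        (Complex.ofRealCLM.comp (ContinuousLinearMap.proj (R := ℝ) (φ := fun _ : ι => ℝ) b)) q :=
      fun b => (Complex.ofRealCLM.comp
        (ContinuousLinearMap.proj (R := ℝ) (φ := fun _ : ι => ℝ) b)).hasFDerivAt
    have h1 : HasFDerivAt (fun q : ι → ℝ => ∑ b, (q b : ℂ) * z b) _ q :=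
      HasFDerivAt.fun_sum fun b _ => (hp b).mul_const (z b)
    have h2 : HasFDerivAt (fun q : ι → ℝ => ∑ b, (q b : ℂ) ^ 2) _ q :=
      HasFDerivAt.fun_sum fun b _ => (hp b).pow 2
    refine ((((h1.const_mul (4 * Complex.I)).add (h2.const_mul 2)).sub_const
      (∑ b, z b ^ 2)).const_mul (-((T : ℂ) / 4))).congr_fderiv ?_
    ext v
    simp only [_root_.smul_apply, _root_.add_apply,
      _root_.sum_apply, ContinuousLinearMap.comp_apply,
      ContinuousLinearMap.proj_apply, smul_eq_mul, Finset.mul_sum,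
      ← Finset.sum_add_distrib]
    refine Finset.sum_congr rfl fun b _ => ?_
    simp
    ring
  have hKd : ∀ q : ι → ℝ, fderiv ℝ (segalKernel T z) q (Pi.single a 1) =
      -(T : ℂ) * (Complex.I * z a + q a) * segalKernel T z q := by
    intro q
    rw [(hK q).fderiv]
    simp only [_root_.smul_apply, _root_.sum_apply, ContinuousLinearMap.comp_apply,
      ContinuousLinearMap.proj_apply, smul_eq_mul, Complex.ofRealCLM_apply]
    rw [Finset.sum_eq_single a]
    · simp; ring
    · intro b _ hb; simp [hb]
    · simp
  have i1 : Integrable fun q : ι → ℝ => ((q a : ℂ) * η q) * segalKernel T z q := by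
    refine (integrable_mul_coord_segalKernel hT hη z a).congr
      (Filter.Eventually.of_forall fun q => ?_)
    simp only; ring
  have i0 := integrable_mul_segalKernel hT hη z
  have i2 : Integrable fun q : ι → ℝ => η q * fderiv ℝ (segalKernel T z) q (Pi.single a 1) := by
    refine ((i0.const_mul (-(T : ℂ) * (Complex.I * z a))).add (i1.const_mul (-(T : ℂ)))).congr
      (Filter.Eventually.of_forall fun q => ?_)
    simp only [hKd, Pi.add_apply]; ring
  -- No boundary term appears because the product and both of its partial derivatives are integrable
  -- on the whole space.
  have key := integral_mul_fderiv_eq_neg_fderiv_mul_of_integrable (μ := (volume : Measure (ι → ℝ)))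
    (f := η) (g := segalKernel T z) (v := Pi.single a 1)
    (integrable_mul_segalKernel hT h' z) i2 i0 (fun x _ => hd x)
    (fun x _ => (hK x).differentiableAt)
  have : segal T (fun q => fderiv ℝ η q (Pi.single a 1)) z =
      -∫ q, η q * fderiv ℝ (segalKernel T z) q (Pi.single a 1) := by
    rw [key, neg_neg]; rfl
  rw [this]
  have e : ∀ q : ι → ℝ, η q * fderiv ℝ (segalKernel T z) q (Pi.single a 1) =
      (-(T : ℂ) * (Complex.I * z a)) * (η q * segalKernel T z q) +
        (-(T : ℂ)) * (((q a : ℂ) * η q) * segalKernel T z q) := by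
    intro q; rw [hKd]; ring
  simp_rw [e]
  rw [integral_add (i0.const_mul _) (i1.const_mul _), integral_const_mul, integral_const_mul]
  simp only [segal]
  ring

end Segal

/-! ### Square-integrability of the Bargmann transform -/

section SegalL2

open FourierTransform

/-- Composition with a linear isomorphism preserves `L^p`. -/
theorem MemLp.comp_continuousLinearEquiv {E F G : Type*} [NormedAddCommGroup E] [NormedSpace ℝ E]
    [MeasurableSpace E] [BorelSpace E] [FiniteDimensional ℝ E] [NormedAddCommGroup F]
    [NormedSpace ℝ F] [MeasurableSpace F] [BorelSpace F] [FiniteDimensional ℝ F]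
    [NormedAddCommGroup G] {μ : Measure E} [μ.IsAddHaarMeasure] {ν : Measure F}
    [ν.IsAddHaarMeasure] (L : E ≃L[ℝ] F) {p : ENNReal} {f : F → G} (hf : MemLp f p ν) :
    MemLp (fun x => f (L x)) p μ := by
  have : (μ.map L).IsAddHaarMeasure := L.isAddHaarMeasure_map μ
  -- Two Haar measures are proportional, so membership in L^p needs no determinant.
  have h := Measure.isAddLeftInvariant_eq_smul (μ.map L) ν
  have h1 : MemLp f p (μ.map L) := by
    rw [h]; exact hf.smul_measure (by simp)
  exact h1.comp_of_map L.continuous.measurable.aemeasurable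

variable {ι : Type*} [Fintype ι]

/-- Plancherel for the kernel exp(-iT q·p) in place of exp(-2πi q·p): the substitution p ↦ (T/2π) p
produces the power of 2π/T. Here the coordinate space is also identified with its Euclidean version,
where the Fourier transform is available. -/
theorem lintegral_sq_fourier_eq (g : (ι → ℝ) → ℂ) (h1 : Integrable g) (h2 : MemLp g 2) {T : ℝ}
    (hT : 0 < T) :
    ∫⁻ p : ι → ℝ, ‖∫ q : ι → ℝ, g q * Complex.exp (-Complex.I * T * ∑ a, (q a : ℂ) * p a)‖ₑ ^ 2 =
      ENNReal.ofReal (((2 * Real.pi / T) ^ Fintype.card ι)) * ∫⁻ q, ‖g q‖ₑ ^ 2 := by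
  classical
  set g' : EuclideanSpace ℝ ι → ℂ := fun x => g (WithLp.ofLp x) with hg'
  have hpres := PiLp.volume_preserving_ofLp ι
  have hemb : MeasurableEmbedding (WithLp.ofLp : EuclideanSpace ℝ ι → ι → ℝ) :=
    (MeasurableEquiv.toLp 2 (ι → ℝ)).symm.measurableEmbedding
  have h1' : Integrable g' := (hpres.integrable_comp_emb hemb).2 h1
  have h2' : MemLp g' 2 := h2.comp_measurePreserving hpres
  have hp := eLpNorm_fourier_eq h1' h2'
  have hsq : ∀ f : EuclideanSpace ℝ ι → ℂ, ∫⁻ x, ‖f x‖ₑ ^ 2 = eLpNorm f 2 ^ 2 := by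
    intro f
    rw [eLpNorm_eq_lintegral_rpow_enorm_toReal (by norm_num) (by norm_num)]
    simp only [ENNReal.toReal_ofNat, one_div]
    rw [← ENNReal.rpow_natCast, ← ENNReal.rpow_mul]
    simp
  have hF : ∀ p : ι → ℝ, ∫ q : ι → ℝ, g q * Complex.exp (-Complex.I * T * ∑ a, (q a : ℂ) * p a) =
      𝓕 g' (WithLp.toLp 2 ((T / (2 * Real.pi)) • p)) := by
    intro p
    rw [Real.fourier_eq', ← hpres.integral_comp hemb]
    refine integral_congr_ae (Filter.Eventually.of_forall fun x => ?_)
    simp only [hg', smul_eq_mul]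
    rw [mul_comm]
    congr 2
    rw [PiLp.inner_apply]
    simp only [RCLike.inner_apply, conj_trivial, Pi.smul_apply, smul_eq_mul]
    push_cast
    rw [Finset.mul_sum, Finset.mul_sum, Finset.sum_mul]
    refine Finset.sum_congr rfl fun a _ => ?_
    have : (Real.pi : ℂ) ≠ 0 := by exact_mod_cast Real.pi_ne_zero
    field_simp
  simp_rw [hF]
  have hc : T / (2 * Real.pi) ≠ 0 := by positivity
  have hcont : Continuous (𝓕 g') := VectorFourier.fourierIntegral_continuous
    Real.continuous_fourierChar (by exact continuous_inner) h1'
  have hm : Measurable fun p : ι → ℝ => ‖𝓕 g' (WithLp.toLp 2 p)‖ₑ ^ 2 := by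
    have := hcont.comp (PiLp.continuous_toLp 2 (fun _ : ι => ℝ))
    exact this.enorm.measurable.pow_const 2
  have e1 := lintegral_map (μ := (volume : Measure (ι → ℝ))) hm
    (measurable_const_smul (T / (2 * Real.pi)))
  have e2 : ∫⁻ p : ι → ℝ, ‖𝓕 g' (WithLp.toLp 2 p)‖ₑ ^ 2 = ∫⁻ x, ‖𝓕 g' x‖ₑ ^ 2 :=
    (PiLp.volume_preserving_toLp ι).lintegral_comp_emb
      (MeasurableEquiv.toLp 2 (ι → ℝ)).measurableEmbedding (f := fun x => ‖𝓕 g' x‖ₑ ^ 2)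
  have e3 : ∫⁻ x, ‖g' x‖ₑ ^ 2 = ∫⁻ q, ‖g q‖ₑ ^ 2 :=
    hpres.lintegral_comp_emb hemb (f := fun x => ‖g x‖ₑ ^ 2)
  rw [← e1, Measure.map_addHaar_smul _ hc, lintegral_smul_measure, e2, hsq, hp, ← hsq, e3,
    smul_eq_mul, Module.finrank_fintype_fun_eq_card, ← inv_pow, inv_div, abs_of_nonneg (by positivity)]

/-- Write z = x + iy. After multiplication by the weight, the transform at fixed y is a phase times
the Fourier transform in x of η(q) exp(-(T/2)|q - y|²). Plancherel in x and Tonelli then leave the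
product of the squared norms of η and of a Gaussian. -/
theorem memLp_segal {T : ℝ} (hT : 0 < T) {η : (ι → ℝ) → ℂ} (hη : MemLp η 2) :
    MemLp (fun z : ι → ℂ => segal T η z * (Real.exp (-(T / 4) * ∑ a, ‖z a‖ ^ 2) : ℝ)) 2 := by
  classical
  set G : (ι → ℂ) → ℂ := fun z => segal T η z * (Real.exp (-(T / 4) * ∑ a, ‖z a‖ ^ 2) : ℝ) with hG
  let L : (ι → ℂ) ≃ₗ[ℝ] (ι → ℝ) × (ι → ℝ) :=
    { toFun := fun z => (fun a => (z a).re, fun a => (z a).im)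
      map_add' := fun x y => by ext <;> simp
      map_smul' := fun c x => by ext <;> simp
      invFun := fun x a => ⟨x.1 a, x.2 a⟩
      left_inv := fun z => by ext a; simp
      right_inv := fun x => by ext <;> simp }
  let f : (ι → ℝ) × (ι → ℝ) → ℂ := fun x => G (L.symm x)
  suffices hf : MemLp f 2 (volume.prod volume) by
    have hH : ((volume : Measure (ι → ℝ)).prod (volume : Measure (ι → ℝ))).IsAddHaarMeasure :=
      Measure.prod.instIsAddHaarMeasure _ _
    have := MemLp.comp_continuousLinearEquiv (μ := (volume : Measure (ι → ℂ)))
      L.toContinuousLinearEquiv hf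
    simpa [f] using this
  have hGc : Continuous G := by
    have := (differentiable_segal hT hη).continuous
    simp only [hG]; fun_prop
  have hLc : Continuous L.symm := L.symm.toContinuousLinearEquiv.continuous
  have hfm : AEStronglyMeasurable f (volume.prod volume) := (hGc.comp hLc).aestronglyMeasurable
  refine ⟨hfm, ?_⟩
  rw [eLpNorm_lt_top_iff_lintegral_rpow_enorm_lt_top (by norm_num) (by norm_num)]
  simp only [ENNReal.toReal_ofNat]
  rw [lintegral_prod_symm _ (hfm.enorm.pow_const _)]
  -- This is what remains of kernel times weight, apart from oscillating factors, once the square in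
  -- the exponent is completed.
  set h : (ι → ℝ) → (ι → ℝ) → ℂ := fun y q => η q * (gauss (T / 2) (q - y) : ℝ) with hh
  have hgs : ∀ c > 0, ∀ y : ι → ℝ, MemLp (fun q : ι → ℝ => (gauss c (q - y) : ℂ)) 2 := by
    intro c hc y
    exact ((memLp_gauss hc).ofReal).comp_measurePreserving
      (measurePreserving_sub_right volume y)
  have hh1 : ∀ y, Integrable (h y) := fun y => hη.integrable_mul (hgs (T / 2) (by positivity) y)
  have hh2 : ∀ y, MemLp (h y) 2 := fun y =>
    -- The Gaussian factor is at most 1; so η times it lies in L² as well as in L¹, as Plancherel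
    -- requires.
    hη.of_le (hh1 y).1 (Filter.Eventually.of_forall fun q => by
      rw [hh]
      simp only [norm_mul, Complex.norm_real]
      refine mul_le_of_le_one_right (norm_nonneg _) ?_
      rw [gauss, Real.norm_of_nonneg (Real.exp_pos _).le, Real.exp_le_one_iff]
      have : 0 ≤ ∑ a, (q - y) a ^ 2 := Finset.sum_nonneg fun a _ => sq_nonneg _
      nlinarith)
  have hfh : ∀ x y, ‖f (x, y)‖ₑ =
      ‖∫ q : ι → ℝ, h y q * Complex.exp (-Complex.I * T * ∑ a, (q a : ℂ) * x a)‖ₑ := by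
    intro x y
    set z : ι → ℂ := L.symm (x, y) with hz
    have hza : ∀ a, z a = x a + Complex.I * y a := fun a => by
      apply Complex.ext <;> simp [hz, L]
    have e1 : ∀ q : ι → ℝ, η q * segalKernel T z q * (Real.exp (-(T / 4) * ∑ a, ‖z a‖ ^ 2) : ℝ) =
        Complex.exp (Complex.I * (T / 2) * ∑ a, (x a : ℂ) * y a) *
        (h y q * Complex.exp (-Complex.I * T * ∑ a, (q a : ℂ) * x a)) := by
      intro q
      simp only [hh, segalKernel, gauss]
      push_cast
      have hexp : ∀ A B C : ℂ, Complex.exp A * (η q * Complex.exp B * Complex.exp C) =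
          η q * Complex.exp (A + B + C) := fun A B C => by
        rw [Complex.exp_add, Complex.exp_add]; ring
      rw [mul_assoc (η q), ← Complex.exp_add, hexp]
      congr 2
      have hn : ∀ a, (‖z a‖ : ℂ) ^ 2 = (x a : ℂ) ^ 2 + (y a : ℂ) ^ 2 := fun a => by
        rw [← Complex.ofReal_pow, ← Complex.normSq_eq_norm_sq, Complex.normSq_apply]
        simp [hz, L, pow_two]
      simp_rw [hn]
      simp only [Finset.mul_sum, ← Finset.sum_add_distrib, ← Finset.sum_sub_distrib]
      refine Finset.sum_congr rfl fun a _ => ?_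
      rw [hza, Pi.sub_apply]
      push_cast
      linear_combination (-(T:ℂ) * q a * y a + (T : ℂ)/4 * y a ^ 2) * Complex.I_sq
    have e2 : f (x, y) = Complex.exp (Complex.I * (T / 2) * ∑ a, (x a : ℂ) * y a) *
        ∫ q : ι → ℝ, h y q * Complex.exp (-Complex.I * T * ∑ a, (q a : ℂ) * x a) := by
      rw [← integral_const_mul, ← integral_congr_ae (Filter.Eventually.of_forall e1),
        integral_mul_const]
      rfl
    rw [e2, enorm_mul]
    have : ‖Complex.exp (Complex.I * (T / 2) * ∑ a, (x a : ℂ) * y a)‖ₑ = 1 := by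
      rw [← ofReal_norm, Complex.norm_exp]
      have : (Complex.I * (T / 2) * ∑ a, (x a : ℂ) * y a) =
        ((T / 2 * ∑ a, x a * y a : ℝ) : ℂ) * Complex.I := by push_cast; ring
      rw [this]; simp
    rw [this, one_mul]
  simp_rw [hfh]
  have e3 : ∀ y, ∫⁻ x : ι → ℝ, ‖∫ q : ι → ℝ, h y q *
      Complex.exp (-Complex.I * T * ∑ a, (q a : ℂ) * x a)‖ₑ ^ (2 : ℝ) =
      ENNReal.ofReal (((2 * Real.pi / T) ^ Fintype.card ι)) * ∫⁻ q, ‖h y q‖ₑ ^ 2 := by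
    intro y
    rw [← lintegral_sq_fourier_eq (h y) (hh1 y) (hh2 y) hT]
    simp
  simp_rw [e3]
  have hmeas : AEMeasurable (fun x : (ι → ℝ) × (ι → ℝ) => ‖h x.1 x.2‖ₑ ^ 2)
      (volume.prod volume) := by
    have h1 : AEStronglyMeasurable (fun x : (ι → ℝ) × (ι → ℝ) => η x.2)
      (volume.prod volume) := hη.1.comp_snd
    have h2 : Continuous (fun x : (ι → ℝ) × (ι → ℝ) => ((gauss (T / 2) (x.2 - x.1) : ℝ) : ℂ)) := by
      unfold gauss; simp only [Pi.sub_apply]; fun_prop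
    exact (h1.mul h2.aestronglyMeasurable).enorm.pow_const 2
  rw [lintegral_const_mul'' _ hmeas.lintegral_prod_right', lintegral_lintegral_swap hmeas]
  refine ENNReal.mul_lt_top ENNReal.ofReal_lt_top ?_
  -- With the order of integration exchanged, translation invariance makes the inner integral of the
  -- Gaussian over y independent of q.
  have e4 : ∀ q : ι → ℝ, ∫⁻ y, ‖h y q‖ₑ ^ 2 =
      ‖η q‖ₑ ^ 2 * ∫⁻ y : ι → ℝ, ‖gauss (T / 2) y‖ₑ ^ 2 := by
    intro q
    rw [← lintegral_const_mul' _ _ (by simp),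
      ← lintegral_sub_left_eq_self (μ := (volume : Measure (ι → ℝ))) _ q]
    refine lintegral_congr fun y => ?_
    simp only [hh, enorm_mul, mul_pow]
    congr 2
    rw [← ofReal_norm, ← ofReal_norm, Complex.norm_real, sub_sub_cancel]
  simp_rw [e4]
  have hfin : ∀ {X : Type _} [NormedAddCommGroup X] (g : (ι → ℝ) → X), MemLp g 2 →
      ∫⁻ q, ‖g q‖ₑ ^ 2 < ⊤ := by
    intro X _ g hg
    have := (eLpNorm_lt_top_iff_lintegral_rpow_enorm_lt_top (by norm_num) (by norm_num)).1 hg.2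
    simpa using this
  have hgf := hfin _ (memLp_gauss (ι := ι) (c := T / 2) (by positivity))
  rw [lintegral_mul_const' _ _ hgf.ne]
  exact ENNReal.mul_lt_top (hfin _ hη) hgf

end SegalL2

/-! ### The complex coordinates P, Q and the action of the complex structure -/

section Coordinates

open Complex
open scoped ComplexConjugate

variable {r : ℕ} {k : ℕ} {s : ℝ} {τ : ℂ}

theorem norm_level_pos (hk : 0 < k) (s : ℝ) : 0 < ‖level k s‖ := by
  rw [norm_pos_iff]
  intro h
  have := congrArg Complex.re h
  simp [level] at this
  omega

/-- The phase `t / |t|` of the level. -/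
def phase (k : ℕ) (s : ℝ) : ℂ := level k s / ‖level k s‖

theorem level_eq (hk : 0 < k) (s : ℝ) : level k s = ‖level k s‖ * phase k s := by
  have := norm_level_pos hk s
  have h : (‖level k s‖ : ℂ) ≠ 0 := by exact_mod_cast this.ne'
  rw [phase]; field_simp

theorem phase_mul_conj (hk : 0 < k) (s : ℝ) : phase k s * conj (phase k s) = 1 := by
  have := norm_level_pos hk s
  have h : (‖level k s‖ : ℂ) ≠ 0 := by exact_mod_cast this.ne'
  rw [phase, map_div₀, conj_ofReal, div_mul_div_comm, mul_conj, normSq_eq_norm_sq]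
  push_cast; field_simp

theorem conj_phase_eq (k : ℕ) (s : ℝ) :
    conj (phase k s) = (k : ℂ) / ‖level k s‖ - I * (s / ‖level k s‖) := by
  rw [phase, map_div₀, conj_ofReal]
  simp [level]; ring

/-- The coordinate `p (0, j) + i p (1, j)`. -/
def coordPp (τ : ℂ) (A : A0C r) (j : Fin r) : ℂ :=
  -I * (A (1, j) - conj τ * A (0, j)) * (√(2 * τ.im) : ℂ)⁻¹

/-- The coordinate `q (0, j) - i q (1, j)`. -/
def coordQm (k : ℕ) (s : ℝ) (τ : ℂ) (A : A0C r) (j : Fin r) : ℂ :=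
  phase k s * (A (1, j) - τ * A (0, j)) * (√(2 * τ.im) : ℂ)⁻¹

theorem hodge_zero {𝕜 : Type*} [RCLike 𝕜] (τ : ℂ) (A : Idx r → 𝕜) (j : Fin r) :
    hodge τ A (0, j) = ((τ.re / τ.im : ℝ) : 𝕜) * A (0, j) - ((1 / τ.im : ℝ) : 𝕜) * A (1, j) := by
  simp [hodge, hodgeMatrix, RCLike.real_smul_eq_coe_mul]
  ring

theorem hodge_one {𝕜 : Type*} [RCLike 𝕜] (τ : ℂ) (A : Idx r → 𝕜) (j : Fin r) :
    hodge τ A (1, j) = ((normSq τ / τ.im : ℝ) : 𝕜) * A (0, j)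
      - ((τ.re / τ.im : ℝ) : 𝕜) * A (1, j) := by
  simp [hodge, hodgeMatrix, RCLike.real_smul_eq_coe_mul]
  ring

theorem cxIt_zero (k : ℕ) (s : ℝ) (τ : ℂ) (A : A0C r) (j : Fin r) :
    cxIt k s τ A (0, j) = conj (phase k s) *
      ((τ.re : ℂ) * conj (A (0, j)) - conj (A (1, j))) / τ.im := by
  rw [conj_phase_eq]
  simp only [cxIt, cxI, cxJ, LinearMap.add_apply, LinearMap.smul_apply, LinearMap.comp_apply,
    LinearMap.coe_mk, AddHom.coe_mk, Pi.add_apply, Pi.smul_apply, hodge_zero, real_smul, map_mul,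
    conj_I]
  push_cast [coe_algebraMap]
  ring

theorem cxIt_one (k : ℕ) (s : ℝ) (τ : ℂ) (A : A0C r) (j : Fin r) :
    cxIt k s τ A (1, j) = conj (phase k s) *
      ((normSq τ : ℂ) * conj (A (0, j)) - τ.re * conj (A (1, j))) / τ.im := by
  rw [conj_phase_eq]
  simp only [cxIt, cxI, cxJ, LinearMap.add_apply, LinearMap.smul_apply, LinearMap.comp_apply,
    LinearMap.coe_mk, AddHom.coe_mk, Pi.add_apply, Pi.smul_apply, hodge_one, real_smul, map_mul,
    conj_I]
  push_cast [coe_algebraMap]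
  ring

/-- Relations between `τ`, its real and imaginary parts. -/
theorem tau_eq (τ : ℂ) : τ = τ.re + τ.im * I := (re_add_im τ).symm

theorem conj_tau_eq (τ : ℂ) : conj τ = τ.re - τ.im * I := by
  apply Complex.ext <;> simp

theorem normSq_tau_eq (τ : ℂ) : (normSq τ : ℂ) = (τ.re : ℂ) ^ 2 + (τ.im : ℂ) ^ 2 := by
  rw [normSq_apply]; push_cast; ring

/-- With `coordQm_cxIt` this describes I_{τ,t} completely: P ↦ -Q̄ and Q ↦ P̄. All dependence on the
phase of t is absorbed in the definition of Q. -/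
theorem coordPp_cxIt (hτ : 0 < τ.im) (A : A0C r) (j : Fin r) :
    coordPp τ (cxIt k s τ A) j = -conj (coordQm k s τ A j) := by
  have h : (τ.im : ℂ) ≠ 0 := by exact_mod_cast hτ.ne'
  simp only [coordPp, coordQm, cxIt_zero, cxIt_one, map_mul, map_sub, map_inv₀, conj_ofReal,
    normSq_tau_eq, conj_tau_eq τ]
  generalize (√(2 * τ.im) : ℂ)⁻¹ = ν
  generalize conj (A (0, j)) = a
  generalize conj (A (1, j)) = b
  field_simp
  linear_combination (-conj (phase k s) * τ.im * ν * (τ.re * a - b)) * I_sq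

theorem coordQm_cxIt (hk : 0 < k) (hτ : 0 < τ.im) (A : A0C r) (j : Fin r) :
    coordQm k s τ (cxIt k s τ A) j = conj (coordPp τ A j) := by
  have h : (τ.im : ℂ) ≠ 0 := by exact_mod_cast hτ.ne'
  have hp := phase_mul_conj hk s
  have e : τ = τ.re + τ.im * I := tau_eq τ
  have e' : coordQm k s τ (cxIt k s τ A) j = phase k s *
    (cxIt k s τ A (1, j) - (τ.re + τ.im * I) * cxIt k s τ A (0, j)) * (√(2 * τ.im) : ℂ)⁻¹ := by
    rw [coordQm, ← e]
  simp only [e', coordPp, cxIt_zero, cxIt_one, map_mul, map_sub, map_inv₀, conj_ofReal,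
    normSq_tau_eq, map_neg, conj_I, conj_conj]
  generalize (√(2 * τ.im) : ℂ)⁻¹ = ν
  generalize conj (A (0, j)) = a
  generalize conj (A (1, j)) = b
  have e'' : (I * (b - τ * a) * ν) = (I * (b - (τ.re + τ.im * I) * a) * ν) := by rw [← e]
  rw [neg_neg, e'']
  field_simp
  linear_combination (τ.im * ν * (τ.im * a + I * b - I * τ.re * a)) * hp
    + ν * a * τ.im ^ 2 * I_sq

theorem omegaC_frameX_zero (τ : ℂ) (B : A0C r) (j : Fin r) :
    omegaC (frameX τ (0, j)) B = (B (1, j) - τ * B (0, j)) * (√(2 * τ.im) : ℂ)⁻¹ := by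
  unfold omegaC
  rw [Finset.sum_eq_single j]
  · simp [frameX]; ring
  · intro b _ hb; simp [frameX, hb]
  · simp

theorem omegaC_frameX_one (τ : ℂ) (B : A0C r) (j : Fin r) :
    omegaC (frameX τ (1, j)) B = I * (B (1, j) - τ * B (0, j)) * (√(2 * τ.im) : ℂ)⁻¹ := by
  unfold omegaC
  rw [Finset.sum_eq_single j]
  · simp [frameX]; ring
  · intro b _ hb; simp [frameX, hb]
  · simp

/-- The complex structure `I_{τ,t}` is symplectic. -/
theorem omegaT_cxIt (hk : 0 < k) (hτ : 0 < τ.im) (A B : A0C r) :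
    omegaT k s (cxIt k s τ A) (cxIt k s τ B) = omegaT k s A B := by
  have h : (τ.im : ℂ) ≠ 0 := by exact_mod_cast hτ.ne'
  have : level k s * omegaC (cxIt k s τ A) (cxIt k s τ B) = conj (level k s * omegaC A B) := by
    unfold omegaC
    rw [Finset.mul_sum, Finset.mul_sum, map_sum]
    refine Finset.sum_congr rfl fun j _ => ?_
    simp only [cxIt_zero, cxIt_one, map_mul, map_sub, normSq_tau_eq]
    rw [level_eq hk, map_mul, conj_ofReal]
    have := phase_mul_conj hk s
    field_simp
    linear_combination (conj (phase k s) * ‖level k s‖ * τ.im ^ 2 * (conj (A (0, j)) * conj (B (1, j)) - conj (A (1, j)) * conj (B (0, j)))) * this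
  rw [omegaT, this, omegaT, conj_re]

/-- The frame vector is I X_a and the metric contains I once more; as I preserves ω_t, both copies
cancel and q_a is a contraction of ω_t with X_a. -/
theorem metric_frameY (hk : 0 < k) (hτ : 0 < τ.im) (A : A0C r) (a : Idx r) :
    coordQ k s τ A a = omegaT k s (frameX τ a) A / ‖level k s‖ := by
  rw [coordQ, metric, frameY, omegaT_cxIt hk hτ]

theorem coordQ_zero (hk : 0 < k) (hτ : 0 < τ.im) (A : A0C r) (j : Fin r) :
    coordQ k s τ A (0, j) = (coordQm k s τ A j).re := by
  have h : ‖level k s‖ ≠ 0 := (norm_level_pos hk s).ne'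
  have e : level k s * ((A (1, j) - τ * A (0, j)) * (√(2 * τ.im) : ℂ)⁻¹) =
      (‖level k s‖ : ℝ) * coordQm k s τ A j := by
    rw [coordQm]; linear_combination ((A (1, j) - τ * A (0, j)) * (√(2 * τ.im) : ℂ)⁻¹) * level_eq hk s
  rw [metric_frameY hk hτ, omegaT, omegaC_frameX_zero, e, re_ofReal_mul,
    mul_div_cancel_left₀ _ h]

theorem coordQ_one (hk : 0 < k) (hτ : 0 < τ.im) (A : A0C r) (j : Fin r) :
    coordQ k s τ A (1, j) = -(coordQm k s τ A j).im := by
  have h : ‖level k s‖ ≠ 0 := (norm_level_pos hk s).ne'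
  have e : level k s * (I * (A (1, j) - τ * A (0, j)) * (√(2 * τ.im) : ℂ)⁻¹) =
      (‖level k s‖ : ℝ) * (I * coordQm k s τ A j) := by
    rw [coordQm]
    linear_combination (I * (A (1, j) - τ * A (0, j)) * (√(2 * τ.im) : ℂ)⁻¹) * level_eq hk s
  rw [metric_frameY hk hτ, omegaT, omegaC_frameX_one, e, re_ofReal_mul,
    mul_div_cancel_left₀ _ h, I_mul_re]

/-- Pulling q back by I yields p, so the formulas for p need no separate computation. -/
theorem coordP_eq_coordQ (hk : 0 < k) (hτ : 0 < τ.im) (A : A0C r) (a : Idx r) :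
    coordP k s τ A a = coordQ k s τ (cxIt k s τ A) a := by
  rw [metric_frameY hk hτ, coordP, metric]

theorem coordP_zero (hk : 0 < k) (hτ : 0 < τ.im) (A : A0C r) (j : Fin r) :
    coordP k s τ A (0, j) = (coordPp τ A j).re := by
  rw [coordP_eq_coordQ hk hτ, coordQ_zero hk hτ, coordQm_cxIt hk hτ, conj_re]

theorem coordP_one (hk : 0 < k) (hτ : 0 < τ.im) (A : A0C r) (j : Fin r) :
    coordP k s τ A (1, j) = (coordPp τ A j).im := by
  rw [coordP_eq_coordQ hk hτ, coordQ_one hk hτ, coordQm_cxIt hk hτ, conj_im, neg_neg]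

end Coordinates

/-! ### The holomorphic coordinates z, the real polarisation and the frame ρ -/

section Coordinates

open Complex
open scoped ComplexConjugate

variable {r : ℕ} {k : ℕ} {s : ℝ} {τ : ℂ}

theorem sqrt_inv_sq (hτ : 0 < τ.im) :
    (√(2 * τ.im) : ℂ)⁻¹ * (√(2 * τ.im) : ℂ)⁻¹ * (2 * τ.im) = 1 := by
  have h : (τ.im : ℂ) ≠ 0 := by exact_mod_cast hτ.ne'
  rw [← mul_inv, ← ofReal_mul, Real.mul_self_sqrt (by positivity)]
  push_cast; field_simp

theorem tau_sub_conj (τ : ℂ) : τ - conj τ = 2 * τ.im * I := by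
  rw [sub_conj]; push_cast; ring

theorem coordPp_add (A B : A0C r) (j : Fin r) :
    coordPp τ (A + B) j = coordPp τ A j + coordPp τ B j := by
  simp only [coordPp, Pi.add_apply]; ring

theorem coordQm_add (A B : A0C r) (j : Fin r) :
    coordQm k s τ (A + B) j = coordQm k s τ A j + coordQm k s τ B j := by
  simp only [coordQm, Pi.add_apply]; ring

theorem coordPp_smul (c : ℝ) (A : A0C r) (j : Fin r) :
    coordPp τ (c • A) j = c * coordPp τ A j := by
  simp only [coordPp, Pi.smul_apply, real_smul]; ring

theorem coordQm_smul (c : ℝ) (A : A0C r) (j : Fin r) :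
    coordQm k s τ (c • A) j = c * coordQm k s τ A j := by
  simp only [coordQm, Pi.smul_apply, real_smul]; ring

theorem coordZ_zero (hk : 0 < k) (hτ : 0 < τ.im) (A : A0C r) (j : Fin r) :
    coordZ k s τ A (0, j) = (coordPp τ A j).re + I * (coordQm k s τ A j).re := by
  rw [coordZ, coordP_zero hk hτ, coordQ_zero hk hτ]

theorem coordZ_one (hk : 0 < k) (hτ : 0 < τ.im) (A : A0C r) (j : Fin r) :
    coordZ k s τ A (1, j) = (coordPp τ A j).im - I * (coordQm k s τ A j).im := by
  rw [coordZ, coordP_one hk hτ, coordQ_one hk hτ]; push_cast; ring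

/-- Unlike the single coordinates z_a, this combination and the one in `coordZm_eq` are simple in P
and Q. Identities between values of z are checked on these two combinations by `coordZ_ext`. -/
theorem coordZp_eq (hk : 0 < k) (hτ : 0 < τ.im) (A : A0C r) (j : Fin r) :
    coordZ k s τ A (0, j) + I * coordZ k s τ A (1, j) =
      coordPp τ A j + I * conj (coordQm k s τ A j) := by
  rw [coordZ_zero hk hτ, coordZ_one hk hτ]
  apply Complex.ext <;> simp <;> ring

theorem coordZm_eq (hk : 0 < k) (hτ : 0 < τ.im) (A : A0C r) (j : Fin r) :
    coordZ k s τ A (0, j) - I * coordZ k s τ A (1, j) =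
      conj (coordPp τ A j) + I * coordQm k s τ A j := by
  rw [coordZ_zero hk hτ, coordZ_one hk hτ]
  apply Complex.ext <;> (simp; ring)

theorem coordZ_ext {z z' : Idx r → ℂ} (hp : ∀ j, z (0, j) + I * z (1, j) = z' (0, j) + I * z' (1, j))
    (hm : ∀ j, z (0, j) - I * z (1, j) = z' (0, j) - I * z' (1, j)) : z = z' := by
  funext ⟨i, j⟩
  have h0 : z (0, j) = z' (0, j) := by linear_combination (hp j + hm j) / 2
  have h1 : z (1, j) = z' (1, j) := by
    linear_combination (hp j - hm j) * (-I / 2) + (z (1, j) - z' (1, j)) * I_sq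
  fin_cases i
  · exact h0
  · exact h1

/-- The point with given coordinates `p (0, j) + i p (1, j)` and `q (0, j) - i q (1, j)`. -/
def pointPQ (k : ℕ) (s : ℝ) (τ : ℂ) (P Q : Fin r → ℂ) : A0C r := fun a =>
  if a.1 = 0 then (√(2 * τ.im) : ℂ)⁻¹ * (P a.2 + I * conj (phase k s) * Q a.2)
  else (√(2 * τ.im) : ℂ)⁻¹ * (τ * P a.2 + I * conj (phase k s) * conj τ * Q a.2)

theorem coordPp_pointPQ (hτ : 0 < τ.im) (P Q : Fin r → ℂ) (j : Fin r) :
    coordPp τ (pointPQ k s τ P Q) j = P j := by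
  simp only [coordPp, pointPQ, if_true, one_ne_zero, if_false]
  linear_combination P j * sqrt_inv_sq hτ
    - I * P j * (√(2 * τ.im) : ℂ)⁻¹ * (√(2 * τ.im) : ℂ)⁻¹ * tau_sub_conj τ
    - 2 * τ.im * P j * (√(2 * τ.im) : ℂ)⁻¹ * (√(2 * τ.im) : ℂ)⁻¹ * I_sq

theorem coordQm_pointPQ (hk : 0 < k) (hτ : 0 < τ.im) (P Q : Fin r → ℂ) (j : Fin r) :
    coordQm k s τ (pointPQ k s τ P Q) j = Q j := by
  simp only [coordQm, pointPQ, if_true, one_ne_zero, if_false]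
  linear_combination Q j * sqrt_inv_sq hτ
    - I * phase k s * conj (phase k s) *
      Q j * (√(2 * τ.im) : ℂ)⁻¹ * (√(2 * τ.im) : ℂ)⁻¹ * tau_sub_conj τ
    - 2 * τ.im * phase k s * conj (phase k s) *
      Q j * (√(2 * τ.im) : ℂ)⁻¹ * (√(2 * τ.im) : ℂ)⁻¹ * I_sq
    + 2 * τ.im * Q j * (√(2 * τ.im) : ℂ)⁻¹ * (√(2 * τ.im) : ℂ)⁻¹ * phase_mul_conj hk s

theorem pointPQ_coord (hk : 0 < k) (hτ : 0 < τ.im) (A : A0C r) :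
    pointPQ k s τ (coordPp τ A) (coordQm k s τ A) = A := by
  have h := sqrt_inv_sq hτ
  funext ⟨i, j⟩
  fin_cases i
  · simp only [coordPp, coordQm, pointPQ, Fin.zero_eta, if_true]
    linear_combination A (0, j) * h
      + I * A (0, j) * (√(2 * τ.im) : ℂ)⁻¹ * (√(2 * τ.im) : ℂ)⁻¹ * (- tau_sub_conj τ)
      - 2 * τ.im * A (0, j) * (√(2 * τ.im) : ℂ)⁻¹ * (√(2 * τ.im) : ℂ)⁻¹ * I_sq
      + I * (A (1, j) - τ * A (0, j)) * (√(2 * τ.im) : ℂ)⁻¹ * (√(2 * τ.im) : ℂ)⁻¹ *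
        phase_mul_conj hk s
  · simp only [coordPp, coordQm, pointPQ, Fin.mk_one, one_ne_zero, if_false]
    linear_combination A (1, j) * h
      + I * A (1, j) * (√(2 * τ.im) : ℂ)⁻¹ * (√(2 * τ.im) : ℂ)⁻¹ * (- tau_sub_conj τ)
      - 2 * τ.im * A (1, j) * (√(2 * τ.im) : ℂ)⁻¹ * (√(2 * τ.im) : ℂ)⁻¹ * I_sq
      + I * conj τ * (A (1, j) - τ * A (0, j)) * (√(2 * τ.im) : ℂ)⁻¹ * (√(2 * τ.im) : ℂ)⁻¹ *
        phase_mul_conj hk s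

/-- The holomorphic coordinates as a linear isomorphism. -/
def zEquiv (hk : 0 < k) (s : ℝ) (hτ : 0 < τ.im) : A0C r ≃L[ℝ] (Idx r → ℂ) :=
  LinearEquiv.toContinuousLinearEquiv
    { toFun := fun A => coordZ k s τ A
      map_add' := fun A B => by
        funext ⟨i, j⟩
        fin_cases i
        · simp only [Fin.zero_eta, Pi.add_apply, coordZ_zero hk hτ, coordPp_add, coordQm_add,
            add_re]
          push_cast; ring
        · simp only [Fin.mk_one, Pi.add_apply, coordZ_one hk hτ, coordPp_add, coordQm_add,
            add_im]
          push_cast; ring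
      map_smul' := fun c A => by
        funext ⟨i, j⟩
        fin_cases i
        · simp only [Fin.zero_eta, Pi.smul_apply, coordZ_zero hk hτ, coordPp_smul, coordQm_smul,
            re_ofReal_mul, RingHom.id_apply, real_smul]
          push_cast; ring
        · simp only [Fin.mk_one, Pi.smul_apply, coordZ_one hk hτ, coordPp_smul, coordQm_smul,
            im_ofReal_mul, RingHom.id_apply, real_smul]
          push_cast; ring
      invFun := fun z => pointPQ k s τ (fun j => (z (0, j)).re + I * (z (1, j)).re)
        (fun j => (z (0, j)).im - I * (z (1, j)).im)
      left_inv := fun A => by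
        refine Eq.trans ?_ (pointPQ_coord (s := s) hk hτ A)
        refine congrArg₂ (pointPQ k s τ) ?_ ?_
        · funext j
          beta_reduce
          rw [coordZ_zero hk hτ, coordZ_one hk hτ]
          apply Complex.ext <;> simp
        · funext j
          beta_reduce
          rw [coordZ_zero hk hτ, coordZ_one hk hτ]
          apply Complex.ext <;> simp
      right_inv := fun z => by
        funext ⟨i, j⟩
        fin_cases i
        · simp only [Fin.zero_eta, coordZ_zero hk hτ, coordPp_pointPQ hτ,
            coordQm_pointPQ hk hτ]
          apply Complex.ext <;> simp
        · simp only [Fin.mk_one, coordZ_one hk hτ, coordPp_pointPQ hτ,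
            coordQm_pointPQ hk hτ]
          apply Complex.ext <;> simp }

@[simp]
theorem zEquiv_apply (hk : 0 < k) (hτ : 0 < τ.im) (A : A0C r) :
    zEquiv hk s hτ A = coordZ k s τ A := rfl

/-- Under P ↦ -Q̄ and Q ↦ P̄ both P + iQ̄ and P̄ + iQ are multiplied by i. -/
theorem coordZ_cxIt (hk : 0 < k) (hτ : 0 < τ.im) (A : A0C r) :
    coordZ k s τ (cxIt k s τ A) = I • coordZ k s τ A := by
  refine coordZ_ext (fun j => ?_) (fun j => ?_)
  · rw [coordZp_eq hk hτ, coordPp_cxIt hτ, coordQm_cxIt hk hτ, conj_conj]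
    simp only [Pi.smul_apply, smul_eq_mul]
    linear_combination -I * coordZp_eq hk hτ A j - conj (coordQm k s τ A j) * I_sq
  · rw [coordZm_eq hk hτ, coordPp_cxIt hτ, coordQm_cxIt hk hτ, map_neg, conj_conj]
    simp only [Pi.smul_apply, smul_eq_mul]
    linear_combination -I * coordZm_eq hk hτ A j - coordQm k s τ A j * I_sq

/-- In the coordinates P, Q the form t ω^ℂ is T ∑ (P Q' - Q P'), because the determinant τ - τ̄ of
the frame dx + τ dy, dx + τ̄ dy cancels the normalising factor 2τ₂. Its real part is the standard
Hermitian expression in z. -/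
theorem omegaT_eq (hk : 0 < k) (hτ : 0 < τ.im) (A B : A0C r) :
    omegaT k s A B =
      ‖level k s‖ * (∑ a, conj (coordZ k s τ A a) * coordZ k s τ B a).im := by
  have h1 : level k s * omegaC A B = (‖level k s‖ : ℝ) * ∑ j, (coordPp τ A j * coordQm k s τ B j -
      coordQm k s τ A j * coordPp τ B j) := by
    have e : level k s * omegaC A B = (‖level k s‖ : ℝ) * (phase k s * omegaC A B) := by
      linear_combination omegaC A B * level_eq hk s
    rw [e, omegaC, Finset.mul_sum]
    congr 1
    refine Finset.sum_congr rfl fun j _ => ?_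
    simp only [coordPp, coordQm]
    linear_combination (-(phase k s) * (A (0, j) * B (1, j) - A (1, j) * B (0, j))) *
        sqrt_inv_sq hτ
      + (I * phase k s * (A (0, j) * B (1, j) - A (1, j) * B (0, j))
        * (√(2 * τ.im) : ℂ)⁻¹ * (√(2 * τ.im) : ℂ)⁻¹) * tau_sub_conj τ
      + (2 * τ.im * phase k s * (A (0, j) * B (1, j) - A (1, j) * B (0, j))
        * (√(2 * τ.im) : ℂ)⁻¹ * (√(2 * τ.im) : ℂ)⁻¹) * I_sq
  rw [omegaT, h1, re_ofReal_mul, Fintype.sum_prod_type_right, re_sum, im_sum]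
  congr 1
  refine Finset.sum_congr rfl fun j _ => ?_
  rw [Fin.sum_univ_two, coordZ_zero hk hτ, coordZ_one hk hτ, coordZ_zero hk hτ, coordZ_one hk hτ]
  simp
  ring

theorem coordPp_frameX (hτ : 0 < τ.im) (i : Fin 2) (j j' : Fin r) :
    coordPp τ (frameX τ (i, j)) j' = if j' = j then (if i = 0 then 1 else I) else 0 := by
  simp only [coordPp, frameX, one_ne_zero, if_false, if_true]
  split_ifs with h1
  · linear_combination sqrt_inv_sq hτ
      - I * (√(2 * τ.im) : ℂ)⁻¹ * (√(2 * τ.im) : ℂ)⁻¹ * tau_sub_conj τ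
      - 2 * τ.im * (√(2 * τ.im) : ℂ)⁻¹ * (√(2 * τ.im) : ℂ)⁻¹ * I_sq
  · linear_combination I * sqrt_inv_sq hτ
      - I * I * (√(2 * τ.im) : ℂ)⁻¹ * (√(2 * τ.im) : ℂ)⁻¹ * tau_sub_conj τ
      - I * 2 * τ.im * (√(2 * τ.im) : ℂ)⁻¹ * (√(2 * τ.im) : ℂ)⁻¹ * I_sq
  · simp

theorem coordQm_frameX (τ : ℂ) (a : Idx r) (j' : Fin r) :
    coordQm k s τ (frameX τ a) j' = 0 := by
  simp only [coordQm, frameX, one_ne_zero, if_false, if_true]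
  split_ifs <;> ring

theorem coordZ_frameX (hk : 0 < k) (hτ : 0 < τ.im) (a : Idx r) :
    coordZ k s τ (frameX τ a) = Pi.single a 1 := by
  obtain ⟨i, j⟩ := a
  funext ⟨i', j'⟩
  have h1 := coordPp_frameX hτ i j j'
  have h2 := coordQm_frameX (k := k) (s := s) τ (i, j) j'
  by_cases hj : j' = j
  · subst hj
    fin_cases i <;> fin_cases i' <;>
      simp [coordZ_zero hk hτ, coordZ_one hk hτ, h2] at h1 h2 ⊢ <;>
      simp [h1]
  · fin_cases i' <;>
      simp [coordZ_zero hk hτ, coordZ_one hk hτ, h1, h2, hj]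

theorem coordZ_frameY (hk : 0 < k) (hτ : 0 < τ.im) (a : Idx r) :
    coordZ k s τ (frameY k s τ a) = I • Pi.single a 1 := by
  rw [frameY, coordZ_cxIt hk hτ, coordZ_frameX hk hτ]

theorem coordZ_pointQ (hk : 0 < k) (hτ : 0 < τ.im) (q : Idx r → ℝ) (a : Idx r) :
    coordZ k s τ (pointQ k s τ q) a = I * q a := by
  rw [← zEquiv_apply hk hτ, pointQ, map_sum, Finset.sum_apply, Finset.sum_eq_single a]
  · simp [coordZ_frameY hk hτ, mul_comm]
  · intro b _ hb
    simp [coordZ_frameY hk hτ, Ne.symm hb]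
  · simp

theorem coordP_eq_re (A : A0C r) (a : Idx r) : coordP k s τ A a = (coordZ k s τ A a).re := by
  simp [coordZ]

theorem coordQ_eq_im (A : A0C r) (a : Idx r) : coordQ k s τ A a = (coordZ k s τ A a).im := by
  simp [coordZ]

theorem coordQ_pointQ (hk : 0 < k) (hτ : 0 < τ.im) (q : Idx r → ℝ) :
    coordQ k s τ (pointQ k s τ q) = q := by
  funext a; rw [coordQ_eq_im, coordZ_pointQ hk hτ]; simp

theorem coordP_pointQ (hk : 0 < k) (hτ : 0 < τ.im) (q : Idx r → ℝ) (a : Idx r) :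
    coordP k s τ (pointQ k s τ q) a = 0 := by
  rw [coordP_eq_re, coordZ_pointQ hk hτ]; simp

theorem frameRho_pointQ (hk : 0 < k) (hτ : 0 < τ.im) (q : Idx r → ℝ) :
    frameRho k s τ (pointQ k s τ q) = 1 := by
  simp [frameRho, coordP_pointQ hk hτ]

/-! ### The real polarisation -/

theorem mem_polP_iff (hτ : 0 < τ.im) (X : A0C r) :
    X ∈ polP τ ↔ ∀ j, X (1, j) = τ * X (0, j) := by
  have h : (τ.im : ℂ) ≠ 0 := by exact_mod_cast hτ.ne'
  simp only [polP, Set.mem_ofPred_eq]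
  constructor
  · intro hX j
    have := congrFun hX (0, j)
    rw [hodge_zero] at this
    simp only [Pi.neg_apply, Pi.smul_apply, smul_eq_mul, coe_algebraMap] at this
    push_cast at this
    field_simp at this
    linear_combination -this - X (0, j) * tau_eq τ
  · intro hX
    funext ⟨i, j⟩
    fin_cases i
    · simp only [Fin.zero_eta, hodge_zero, Pi.neg_apply, Pi.smul_apply, smul_eq_mul,
        coe_algebraMap, hX]
      push_cast
      field_simp
      linear_combination - X (0, j) * tau_eq τ
    · simp only [Fin.mk_one, hodge_one, Pi.neg_apply, Pi.smul_apply, smul_eq_mul,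
        coe_algebraMap, hX]
      push_cast
      field_simp
      rw [normSq_tau_eq]
      linear_combination -(τ.re - I * τ.im) * X (0, j) * tau_eq τ + τ.im ^ 2 * X (0, j) * I_sq

/-- The polarisation is the common kernel of the functionals Q_j, which are nonzero multiples of
A(1,j) - τ A(0,j). -/
theorem sub_mem_polP_of_coordQm_eq (hk : 0 < k) (hτ : 0 < τ.im) {A B : A0C r}
    (h : coordQm k s τ A = coordQm k s τ B) : A - B ∈ polP τ := by
  rw [mem_polP_iff hτ]
  intro j
  have h0 := congrFun h j
  simp only [coordQm] at h0
  have h1 := phase_mul_conj hk s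
  have hp : phase k s ≠ 0 := left_ne_zero_of_mul_eq_one h1
  have hn : (√(2 * τ.im) : ℂ)⁻¹ ≠ 0 := left_ne_zero_of_mul (left_ne_zero_of_mul_eq_one (sqrt_inv_sq hτ))
  have h2 := mul_left_cancel₀ hp (by
    have := mul_right_cancel₀ hn h0
    exact this)
  simp only [Pi.sub_apply]
  linear_combination h2

theorem frameX_mem_polP (hτ : 0 < τ.im) (a : Idx r) : frameX τ a ∈ polP τ := by
  rw [mem_polP_iff hτ]
  intro j
  simp only [frameX, one_ne_zero, if_false, if_true]
  split_ifs <;> ring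

/-- Projecting along P_τ cannot change Q. Thus a polarised function can be evaluated on `A0` or on
Q_τ at will. -/
theorem coordQm_projA0 (hτ : 0 < τ.im) (A : A0C r) :
    coordQm k s τ (incl (projA0 τ A)) = coordQm k s τ A := by
  have h : (τ.im : ℂ) ≠ 0 := by exact_mod_cast hτ.ne'
  funext j
  simp only [coordQm, incl, projA0, one_ne_zero, if_false, if_true]
  congr 2
  set W := A (1, j) - τ * A (0, j) with hW
  have := re_add_im W
  push_cast
  field_simp
  linear_combination τ.im * this + W.im * tau_eq τ

/-- Polarised functions only depend on the coordinates `q`. -/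
theorem IsPolarised.eq_of_sub_mem {η : A0C r → ℂ} (hd : Differentiable ℝ η)
    (h : IsPolarised τ η) {A B : A0C r} (hAB : A - B ∈ polP τ) : η A = η B := by
  have hc : ∀ x y : ℝ, (fun x : ℝ => η (B + x • (A - B))) x = (fun x : ℝ => η (B + x • (A - B))) y := by
    have hdx : ∀ x : ℝ, HasDerivAt (fun x : ℝ => η (B + x • (A - B))) 0 x := by
      intro x
      have h1 : HasDerivAt (fun x : ℝ => B + x • (A - B)) (A - B) x := by
        simpa using ((hasDerivAt_id x).smul_const (A - B)).const_add B
      have h2 := (hd (B + x • (A - B))).hasFDerivAt.comp_hasDerivAt x h1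
      rwa [h _ _ hAB] at h2
    exact is_const_of_deriv_eq_zero (fun x => (hdx x).differentiableAt) fun x => (hdx x).deriv
  have := hc 1 0
  simpa using this

/-- For a real form, A(1,j) - τ̄ A(0,j) is the conjugate of A(1,j) - τ A(0,j). This exhibits `A0` as
a graph over the q-space. -/
theorem coordPp_incl (hk : 0 < k) (u : A0 r) (j : Fin r) :
    coordPp τ (incl u) j = -I * phase k s * conj (coordQm k s τ (incl u) j) := by
  simp only [coordPp, coordQm, incl, map_mul, map_sub, map_inv₀, conj_ofReal]
  linear_combination (I * ((u (1, j) : ℂ) - conj τ * u (0, j)) * (√(2 * τ.im) : ℂ)⁻¹) *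
    phase_mul_conj hk s

theorem sum_coordP_mul_coordQ (hk : 0 < k) (hτ : 0 < τ.im) (A : A0C r) :
    ∑ a, coordP k s τ A a * coordQ k s τ A a =
      ∑ j, (coordPp τ A j * coordQm k s τ A j).re := by
  rw [Fintype.sum_prod_type_right]
  refine Finset.sum_congr rfl fun j _ => ?_
  rw [Fin.sum_univ_two, coordP_zero hk hτ, coordQ_zero hk hτ, coordP_one hk hτ, coordQ_one hk hτ,
    mul_re]
  ring

/-- On `A0` one has P Q = -i e |Q|², whose real part is (s/T)|Q|². The factor T cancels, so the
frame ρ restricted to `A0` depends on t only through s. -/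
theorem frameRho_incl (hk : 0 < k) (hτ : 0 < τ.im) (u : A0 r) :
    frameRho k s τ (incl u) = Complex.exp (-(I * s / 2) *
      ∑ j, coordQm k s τ (incl u) j * conj (coordQm k s τ (incl u) j)) := by
  have hT : (‖level k s‖ : ℂ) ≠ 0 := by exact_mod_cast (norm_level_pos hk s).ne'
  have hT' := (norm_level_pos hk s).ne'
  have h := sum_coordP_mul_coordQ (s := s) hk hτ (incl u)
  have h' : ∑ a, (coordP k s τ (incl u) a : ℂ) * (coordQ k s τ (incl u) a : ℂ) =
      (s / ‖level k s‖ : ℝ) * ∑ j, coordQm k s τ (incl u) j * conj (coordQm k s τ (incl u) j) := by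
    simp_rw [← ofReal_mul, ← ofReal_sum, h]
    push_cast
    rw [Finset.mul_sum]
    refine Finset.sum_congr rfl fun j _ => ?_
    rw [coordPp_incl (k := k) (s := s) hk, mul_conj]
    have : -I * phase k s * conj (coordQm k s τ (incl u) j) * coordQm k s τ (incl u) j =
      ((normSq (coordQm k s τ (incl u) j) : ℝ) : ℂ) * (-I * phase k s) := by
      rw [← mul_conj]; ring
    rw [this, re_ofReal_mul]
    have : (-I * phase k s).re = s / ‖level k s‖ := by
      rw [phase, level]
      simp
    rw [this]
    push_cast; ring
  rw [frameRho, h']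
  congr 1
  push_cast
  field_simp

end Coordinates

/-! ### Wirtinger derivatives in τ, and the derivatives of P and Q at a fixed form -/

section Wirtinger

open Complex
open scoped ComplexConjugate

/-- The real-linear map `v ↦ a v + b v̄`. -/
def wirtMap (a b : ℂ) : ℂ →L[ℝ] ℂ :=
  a • (ContinuousLinearMap.id ℝ ℂ) + b • (conjCLE : ℂ →L[ℝ] ℂ)

theorem wirtMap_apply (a b v : ℂ) : wirtMap a b v = a * v + b * conj v := by
  simp [wirtMap]

/-- `F` is differentiable at `τ` with `∂F/∂τ = a` and `∂F/∂τ̄ = b`. -/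
def HasWirt (F : ℂ → ℂ) (a b τ : ℂ) : Prop := HasFDerivAt F (wirtMap a b) τ

variable {F G : ℂ → ℂ} {a b c d τ : ℂ}

theorem HasWirt.tderiv (h : HasWirt F a b τ) (V : ℂ × ℂ) :
    tderiv V F τ = V.1 * a + V.2 * b := by
  rw [TorusCS.tderiv, HasFDerivAt.fderiv h, wirtMap_apply, wirtMap_apply]
  simp
  linear_combination (-(V.1 * a) / 2 + V.1 * b / 2 + V.2 * a / 2 - V.2 * b / 2) * I_sq

theorem HasWirt.differentiableAt (h : HasWirt F a b τ) : DifferentiableAt ℝ F τ :=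
  HasFDerivAt.differentiableAt h

theorem hasWirt_tderiv (h : DifferentiableAt ℝ F τ) :
    HasWirt F (TorusCS.tderiv ddTau F τ) (TorusCS.tderiv ddTauBar F τ) τ := by
  have := h.hasFDerivAt
  refine this.congr_fderiv ?_
  ext v
  rw [wirtMap_apply]
  simp only [TorusCS.tderiv, ddTau, ddTauBar]
  have e : fderiv ℝ F τ v = v.re * fderiv ℝ F τ 1 + v.im * fderiv ℝ F τ I := by
    conv_lhs => rw [show v = v.re • (1 : ℂ) + v.im • I by simp]
    rw [map_add, map_smul, map_smul, real_smul, real_smul]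
  have e' : conj v = v.re - v.im * I := by apply Complex.ext <;> simp
  rw [e, e']
  have hv := re_add_im v
  linear_combination ((fderiv ℝ F τ 1 - I * fderiv ℝ F τ I) / 2) * hv
    + ((fderiv ℝ F τ I) * v.im) * I_sq

theorem tderiv_eq (V : ℂ × ℂ) (F : ℂ → ℂ) (τ : ℂ) :
    TorusCS.tderiv V F τ = V.1 * TorusCS.tderiv ddTau F τ + V.2 * TorusCS.tderiv ddTauBar F τ := by
  simp [TorusCS.tderiv, ddTau, ddTauBar]

theorem HasWirt.congr (h : HasWirt F a b τ) (ha : a = c) (hb : b = d) : HasWirt F c d τ := by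
  subst ha hb; exact h

theorem HasWirt.add (hF : HasWirt F a b τ) (hG : HasWirt G c d τ) :
    HasWirt (fun x => F x + G x) (a + c) (b + d) τ :=
  (HasFDerivAt.add hF hG).congr_fderiv (by ext v; simp [wirtMap_apply]; ring)

theorem HasWirt.sub (hF : HasWirt F a b τ) (hG : HasWirt G c d τ) :
    HasWirt (fun x => F x - G x) (a - c) (b - d) τ :=
  (HasFDerivAt.sub hF hG).congr_fderiv (by ext v; simp [wirtMap_apply]; ring)

theorem HasWirt.mul (hF : HasWirt F a b τ) (hG : HasWirt G c d τ) :
    HasWirt (fun x => F x * G x) (a * G τ + F τ * c) (b * G τ + F τ * d) τ :=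
  (HasFDerivAt.mul hF hG).congr_fderiv (by ext v; simp [wirtMap_apply]; ring)

theorem hasWirt_const (c τ : ℂ) : HasWirt (fun _ => c) 0 0 τ :=
  (hasFDerivAt_const c τ).congr_fderiv (by ext v; simp [wirtMap_apply])

theorem HasWirt.const_mul (c : ℂ) (hF : HasWirt F a b τ) :
    HasWirt (fun x => c * F x) (c * a) (c * b) τ :=
  ((hasWirt_const c τ).mul hF).congr (by simp) (by simp)

theorem HasWirt.sum {ι : Type*} {u : Finset ι} {F : ι → ℂ → ℂ} {a b : ι → ℂ}
    (h : ∀ i ∈ u, HasWirt (F i) (a i) (b i) τ) :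
    HasWirt (fun x => ∑ i ∈ u, F i x) (∑ i ∈ u, a i) (∑ i ∈ u, b i) τ := by
  refine (HasFDerivAt.fun_sum h).congr_fderiv ?_
  ext v
  simp only [_root_.sum_apply, wirtMap_apply, Finset.sum_add_distrib, Finset.sum_mul]

theorem hasWirt_id (τ : ℂ) : HasWirt (fun x => x) 1 0 τ :=
  (hasFDerivAt_id τ).congr_fderiv (by ext v; simp [wirtMap_apply])

theorem HasWirt.conj (hF : HasWirt F a b τ) :
    HasWirt (fun x => conj (F x)) (conj b) (conj a) τ :=
  ((conjCLE.hasFDerivAt (x := F τ)).comp τ hF).congr_fderiv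
    (by ext v; simp [wirtMap_apply]; ring)

theorem hasWirt_conj (τ : ℂ) : HasWirt (fun x => conj x) 0 1 τ :=
  (hasWirt_id τ).conj.congr (by simp) (by simp)

theorem HasWirt.cexp (hF : HasWirt F a b τ) :
    HasWirt (fun x => Complex.exp (F x)) (Complex.exp (F τ) * a) (Complex.exp (F τ) * b) τ :=
  (HasFDerivAt.cexp hF).congr_fderiv (by ext v; simp [wirtMap_apply]; ring)

theorem hasWirt_im (τ : ℂ) : HasWirt (fun x => (x.im : ℂ)) (-I / 2) (I / 2) τ := by
  have h := ((hasWirt_id τ).sub (hasWirt_conj τ)).const_mul (-I / 2)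
  have e : (fun x : ℂ => (x.im : ℂ)) = fun x => -I / 2 * (x - conj x) := by
    funext x; rw [tau_sub_conj]; linear_combination x.im * I_sq
  rw [e]
  exact h.congr (by ring) (by ring)

theorem hasWirt_re (τ : ℂ) : HasWirt (fun x => (x.re : ℂ)) (1 / 2) (1 / 2) τ := by
  have h := ((hasWirt_id τ).add (hasWirt_conj τ)).const_mul (1 / 2)
  have e : (fun x : ℂ => (x.re : ℂ)) = fun x => 1 / 2 * (x + conj x) := by
    funext x; rw [re_eq_add_conj]; ring
  rw [e]
  exact h.congr (by ring) (by ring)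

/-- Composition with a real function of the imaginary part. -/
theorem hasWirt_comp_im {f : ℝ → ℝ} {f' : ℝ} (h : HasDerivAt f f' τ.im) :
    HasWirt (fun x => (f x.im : ℂ)) (-I / 2 * f') (I / 2 * f') τ := by
  have h1 : HasFDerivAt (fun x : ℂ => x.im) imCLM τ := imCLM.hasFDerivAt
  have h2 := (ofRealCLM.hasFDerivAt (x := f τ.im)).comp τ (h.hasFDerivAt.comp τ h1)
  refine h2.congr_fderiv ?_
  ext v
  rw [wirtMap_apply]
  simp
  have : conj v = v.re - v.im * I := by apply Complex.ext <;> simp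
  rw [this]
  have hv := re_add_im v
  linear_combination (f' * v.im : ℂ) * I_sq - I / 2 * f' * hv

theorem hasWirt_im_inv (hτ : 0 < τ.im) :
    HasWirt (fun x => ((x.im : ℂ))⁻¹) (I / 2 * ((τ.im : ℂ)⁻¹) ^ 2) (-I / 2 * ((τ.im : ℂ)⁻¹) ^ 2) τ := by
  have h := hasWirt_comp_im (hasDerivAt_inv hτ.ne')
  have e : (fun x : ℂ => ((x.im : ℂ))⁻¹) = fun x => ((x.im⁻¹ : ℝ) : ℂ) := by
    funext x; push_cast; rfl
  rw [e]
  refine h.congr ?_ ?_ <;> push_cast <;> field_simp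

theorem hasWirt_sqrt_inv (hτ : 0 < τ.im) :
    HasWirt (fun x => ((√(2 * x.im) : ℝ) : ℂ)⁻¹)
      (I / (4 * τ.im) * (√(2 * τ.im) : ℂ)⁻¹) (-(I / (4 * τ.im)) * (√(2 * τ.im) : ℂ)⁻¹) τ := by
  have h2 : 0 < 2 * τ.im := by positivity
  have h1 : HasDerivAt (fun x : ℝ => (√(2 * x))⁻¹) _ τ.im :=
    (((hasDerivAt_id τ.im).const_mul 2).sqrt h2.ne').inv (Real.sqrt_pos.2 h2).ne'
  have h := hasWirt_comp_im h1
  have e : (fun x : ℂ => ((√(2 * x.im) : ℝ) : ℂ)⁻¹) =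
      fun x => (((√(2 * x.im))⁻¹ : ℝ) : ℂ) := by
    funext x; push_cast; rfl
  rw [e]
  have hs : (√(2 * τ.im) : ℂ) ≠ 0 := by exact_mod_cast (Real.sqrt_pos.2 h2).ne'
  have hi : (τ.im : ℂ) ≠ 0 := by exact_mod_cast hτ.ne'
  have hq : (√(2 * τ.im) : ℂ) ^ 2 = 2 * τ.im := by
    rw [← ofReal_pow, Real.sq_sqrt h2.le]; push_cast; ring
  simp only [id_eq] at h
  refine h.congr ?_ ?_
  · push_cast
    field_simp
    rw [hq]; ring
  · push_cast
    field_simp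
    rw [hq]; ring

variable {r : ℕ} {k : ℕ} {s : ℝ}

theorem coord_zero_eq (hk : 0 < k) (hτ : 0 < τ.im) (A : A0C r) (j : Fin r) :
    A (0, j) = (√(2 * τ.im) : ℂ)⁻¹ * (coordPp τ A j + I * conj (phase k s) * coordQm k s τ A j) := by
  have := congrFun (pointPQ_coord (s := s) hk hτ A) (0, j)
  simp only [pointPQ, if_true] at this
  exact this.symm

/-- Apart from the factor (2τ₂)^(-1/2), P depends on τ̄ only; hence its τ-derivative is a multiple
of P. In the τ̄-derivative the coefficient A(0,j) is eliminated by `coord_zero_eq`, which brings in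
Q. The roles are reversed in `hasWirt_coordQm`. -/
theorem hasWirt_coordPp (hk : 0 < k) (hτ : 0 < τ.im) (A : A0C r) (j : Fin r) :
    HasWirt (fun x => coordPp x A j) (I / (4 * τ.im) * coordPp τ A j)
      (I / (4 * τ.im) * coordPp τ A j - conj (phase k s) / (2 * τ.im) * coordQm k s τ A j) τ := by
  have hi : (τ.im : ℂ) ≠ 0 := by exact_mod_cast hτ.ne'
  have h1 := (((hasWirt_const (A (1, j)) τ).sub
    ((hasWirt_conj τ).mul (hasWirt_const (A (0, j)) τ))).const_mul (-I)).mul (hasWirt_sqrt_inv hτ)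
  refine HasWirt.congr h1 ?_ ?_
  · simp only [coordPp]; ring
  · have h0 := coord_zero_eq (s := s) hk hτ A j
    have e : ((√(2 * τ.im) : ℂ)⁻¹ * (√(2 * τ.im) : ℂ)⁻¹) = 1 / (2 * τ.im) := by
      rw [eq_div_iff (by simpa using hi)]; exact sqrt_inv_sq hτ
    have e' : I * A (0, j) * (√(2 * τ.im) : ℂ)⁻¹ =
        I * (coordPp τ A j + I * conj (phase k s) * coordQm k s τ A j) * (1 / (2 * τ.im)) := by
      conv_lhs => rw [h0]
      rw [← e]; ring
    have e3 : coordPp τ A j = -I * (A (1, j) - conj τ * A (0, j)) * (√(2 * τ.im) : ℂ)⁻¹ := rfl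
    linear_combination e' + (I / (4 * τ.im)) * e3 +
      conj (phase k s) * coordQm k s τ A j / (2 * τ.im) * I_sq

theorem hasWirt_coordQm (hk : 0 < k) (hτ : 0 < τ.im) (A : A0C r) (j : Fin r) :
    HasWirt (fun x => coordQm k s x A j)
      (-(I / (4 * τ.im)) * coordQm k s τ A j - phase k s / (2 * τ.im) * coordPp τ A j)
      (-(I / (4 * τ.im)) * coordQm k s τ A j) τ := by
  have hi : (τ.im : ℂ) ≠ 0 := by exact_mod_cast hτ.ne'
  have h1 := (((hasWirt_const (A (1, j)) τ).sub
    ((hasWirt_id τ).mul (hasWirt_const (A (0, j)) τ))).const_mul (phase k s)).mul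
      (hasWirt_sqrt_inv hτ)
  refine HasWirt.congr h1 ?_ ?_
  · have h0 := coord_zero_eq (s := s) hk hτ A j
    have e : ((√(2 * τ.im) : ℂ)⁻¹ * (√(2 * τ.im) : ℂ)⁻¹) = 1 / (2 * τ.im) := by
      rw [eq_div_iff (by simpa using hi)]; exact sqrt_inv_sq hτ
    have e' : phase k s * A (0, j) * (√(2 * τ.im) : ℂ)⁻¹ =
        phase k s * (coordPp τ A j + I * conj (phase k s) * coordQm k s τ A j)
          * (1 / (2 * τ.im)) := by
      conv_lhs => rw [h0]
      rw [← e]; ring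
    have e3 : coordQm k s τ A j =
      phase k s * (A (1, j) - τ * A (0, j)) * (√(2 * τ.im) : ℂ)⁻¹ := rfl
    linear_combination -e' - (I / (4 * τ.im)) * e3 
      - I * coordQm k s τ A j / (2 * τ.im) * phase_mul_conj hk s
  · simp only [coordQm]; ring

end Wirtinger

/-! ### The bivectors of the two connections -/

section Bivectors

open Complex
open scoped ComplexConjugate

variable {r : ℕ} {k : ℕ} {s : ℝ} {τ : ℂ}

/-- The coefficients of the form `dx + τ̄ dy`. -/
def formBar (τ : ℂ) (l : Fin 2) : ℂ := if l = 0 then 1 else conj τ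

/-- The coefficients of the form `dx + τ dy`. -/
def formHol (τ : ℂ) (l : Fin 2) : ℂ := if l = 0 then 1 else τ

/-- The bivector of the variation of the Hodge operator on `ℝ²`. -/
def planeBivector (V : ℂ × ℂ) (τ : ℂ) (l l' : Fin 2) : ℂ :=
  V.1 / (2 * I * τ.im ^ 2) * formBar τ l * formBar τ l'
    - V.2 / (2 * I * τ.im ^ 2) * formHol τ l * formHol τ l'

/-- Together the two columns say that V[*] is the bivector `planeBivector` contracted with dx ∧ dy,
in one plane of the torus. -/
theorem tderiv_hodgeMatrix (hτ : 0 < τ.im) (V : ℂ × ℂ) (l : Fin 2) :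
    tderiv V (fun x => (hodgeMatrix x l 0 : ℂ)) τ = -planeBivector V τ l 1 ∧
    tderiv V (fun x => (hodgeMatrix x l 1 : ℂ)) τ = planeBivector V τ l 0 := by
  have hi : (τ.im : ℂ) ≠ 0 := by exact_mod_cast hτ.ne'
  have hinv := hasWirt_im_inv hτ
  have hre := (hasWirt_re τ).mul hinv
  have hnsq := (((hasWirt_re τ).mul (hasWirt_re τ)).add ((hasWirt_im τ).mul (hasWirt_im τ))).mul hinv
  have e00 : (fun x => (hodgeMatrix x 0 0 : ℂ)) = fun x : ℂ => (x.re : ℂ) * (x.im : ℂ)⁻¹ := by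
    funext x; simp [hodgeMatrix]; ring
  have e01 : (fun x => (hodgeMatrix x 0 1 : ℂ)) = fun x : ℂ => (-1 : ℂ) * (x.im : ℂ)⁻¹ := by
    funext x; simp [hodgeMatrix]
  have e10 : (fun x => (hodgeMatrix x 1 0 : ℂ)) =
      fun x : ℂ => ((x.re : ℂ) * x.re + x.im * x.im) * (x.im : ℂ)⁻¹ := by
    funext x; simp [hodgeMatrix, normSq_apply]; ring
  have e11 : (fun x => (hodgeMatrix x 1 1 : ℂ)) =
      fun x : ℂ => (-1 : ℂ) * ((x.re : ℂ) * (x.im : ℂ)⁻¹) := by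
    funext x; simp [hodgeMatrix]; ring
  have b0 : formBar τ 0 = 1 := rfl
  have b1 : formBar τ 1 = τ.re - τ.im * I := conj_tau_eq τ
  have f0 : formHol τ 0 = 1 := rfl
  have f1 : formHol τ 1 = τ.re + τ.im * I := tau_eq τ
  have hI : ∀ v y : ℂ, v / (2 * I * y ^ 2) = -(v * I) / (2 * y ^ 2) := fun v y => by
    rw [mul_comm 2 I, mul_assoc, div_mul_eq_div_div, div_I]
  have hI3 : I ^ 3 = -I := by rw [pow_succ, I_sq]; ring
  fin_cases l
  · constructor
    · simp only [Fin.zero_eta, e00, hre.tderiv V, planeBivector, b0, b1, f0, f1, hI]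
      generalize (τ.re : ℂ) = x
      generalize (τ.im : ℂ) = y at *
      field_simp
      ring_nf
      simp only [I_sq]
      ring
    · simp only [Fin.zero_eta, e01, (hinv.const_mul (-1)).tderiv V, planeBivector, b0, f0, hI]
      generalize (τ.im : ℂ) = y at *
      field_simp
      ring
  · constructor
    · simp only [Fin.mk_one, e10, hnsq.tderiv V, planeBivector, b1, f1, hI]
      generalize (τ.re : ℂ) = x at *
      generalize (τ.im : ℂ) = y at *
      field_simp
      ring_nf
      simp only [I_sq, hI3]
      ring
    · simp only [Fin.mk_one, e11, (hre.const_mul (-1)).tderiv V, planeBivector, b0, b1, f0, f1, hI]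
      generalize (τ.re : ℂ) = x at *
      generalize (τ.im : ℂ) = y at *
      field_simp
      ring_nf
      simp only [I_sq]
      ring

/-- The Hodge operator acts by `i` on `dx + τ̄ dy`. -/
theorem hodgeMatrix_formBar (hτ : 0 < τ.im) (l : Fin 2) :
    (hodgeMatrix τ l 0 : ℂ) * formBar τ 0 + hodgeMatrix τ l 1 * formBar τ 1 = I * formBar τ l := by
  have hi : (τ.im : ℂ) ≠ 0 := by exact_mod_cast hτ.ne'
  fin_cases l
  · simp [hodgeMatrix, formBar, conj_tau_eq]
    field_simp
    ring
  · simp [hodgeMatrix, formBar, conj_tau_eq, normSq_tau_eq]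
    field_simp
    linear_combination (τ.im : ℂ) ^ 2 * I_sq

/-- The Hodge operator acts by `-i` on `dx + τ dy`. -/
theorem hodgeMatrix_formHol (hτ : 0 < τ.im) (l : Fin 2) :
    (hodgeMatrix τ l 0 : ℂ) * formHol τ 0 + hodgeMatrix τ l 1 * formHol τ 1 = -I * formHol τ l := by
  have hi : (τ.im : ℂ) ≠ 0 := by exact_mod_cast hτ.ne'
  have ht := tau_eq τ
  fin_cases l
  · simp [hodgeMatrix, formHol]
    field_simp
    linear_combination -ht
  · simp [hodgeMatrix, formHol, normSq_tau_eq]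
    field_simp
    linear_combination (-(τ.re : ℂ) + I * τ.im) * ht + (τ.im : ℂ) ^ 2 * I_sq

/-! ### The real space -/

theorem basisA0_apply (a : Idx r) : basisA0 r a = Pi.single a (1 : ℝ) := by
  simp [basisA0]

theorem endMatrix_hodge (τ : ℂ) (a b : Idx r) :
    endMatrix (basisA0 r) (hodge τ) a b =
      if a.2 = b.2 then (hodgeMatrix τ a.1 b.1 : ℂ) else 0 := by
  obtain ⟨l, j⟩ := a
  obtain ⟨l', j'⟩ := b
  simp only [endMatrix, Matrix.of_apply, LinearMap.toMatrix_apply, basisA0, Pi.basisFun_apply,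
    Pi.basisFun_repr]
  have : (hodge τ : A0 r →ₗ[ℝ] A0 r) (Pi.single (l', j') 1) (l, j) =
      if j = j' then hodgeMatrix τ l l' else 0 := by
    simp only [hodge, LinearMap.coe_mk, AddHom.coe_mk, Pi.single_apply, Prod.mk.injEq, smul_eq_mul]
    by_cases h : j = j'
    · simp [h]
    · simp [h]
  rw [this]
  split_ifs <;> simp

theorem formMatrix_omega (a b : Idx r) :
    formMatrix (basisA0 r) omega a b =
      if a.2 = b.2 then (if a.1 = 0 then (if b.1 = 0 then 0 else 1) else (if b.1 = 0 then -1 else 0))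
      else 0 := by
  obtain ⟨l, j⟩ := a
  obtain ⟨l', j'⟩ := b
  simp only [formMatrix, Matrix.of_apply, basisA0, Pi.basisFun_apply, omega]
  rw [Finset.sum_eq_single j]
  · by_cases h : j = j'
    · subst h
      fin_cases l <;> fin_cases l' <;> simp
    · fin_cases l <;> fin_cases l' <;> simp [h]
  · intro i _ hi
    simp [hi]
  · simp

/-- The block-diagonal candidate satisfies G̃ · ω = V[*], by the computation in a single plane. The
matrix of ω has square -1, so it is invertible and the candidate is the only solution. -/
theorem bivector_A0 (hτ : 0 < τ.im) (V : ℂ × ℂ) :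
    bivector (basisA0 r) omega 1 hodge V τ =
      Matrix.of fun a b : Idx r => if a.2 = b.2 then planeBivector V τ a.1 b.1 else 0 := by
  have hunit : formMatrix (basisA0 r) omega * -formMatrix (basisA0 r) omega = 1 := by
    ext ⟨l, j⟩ ⟨l', j'⟩
    rw [Matrix.mul_apply, Fintype.sum_prod_type_right, Finset.sum_eq_single j]
    · simp only [Fin.sum_univ_two, Matrix.neg_apply, formMatrix_omega, Matrix.one_apply,
        Prod.mk.injEq, if_true]
      by_cases h : j = j'
      · fin_cases l <;> fin_cases l' <;> simp [h]
      · simp [h]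
    · intro i _ hi
      simp [formMatrix_omega, Ne.symm hi]
    · simp
  have hdet : IsUnit (formMatrix (basisA0 r) omega).det :=
    Matrix.isUnit_det_of_right_inverse hunit
  have hv : varMatrix (basisA0 r) hodge V τ =
      (Matrix.of fun a b : Idx r => if a.2 = b.2 then planeBivector V τ a.1 b.1 else 0) *
        formMatrix (basisA0 r) omega := by
    ext ⟨l, j⟩ ⟨l', j'⟩
    rw [Matrix.mul_apply, Fintype.sum_prod_type_right, Finset.sum_eq_single j]
    · simp only [varMatrix, Fin.sum_univ_two, Matrix.of_apply, formMatrix_omega, endMatrix_hodge,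
        if_true]
      by_cases h : j = j'
      · have := tderiv_hodgeMatrix hτ V l
        fin_cases l' <;> simp [h, this.1, this.2]
      · simp [h, (hasWirt_const 0 τ).tderiv]
    · intro i _ hi
      simp [Ne.symm hi]
    · simp
  rw [bivector, hv, Matrix.mul_assoc, Matrix.mul_nonsing_inv _ hdet]
  simp

/-- The Hodge operator is i on dx + τ̄ dy and -i on dx + τ dy. The projection (1 - i*)/2 therefore
keeps the first square and kills the second. -/
theorem bivector10_A0 (hτ : 0 < τ.im) (V : ℂ × ℂ) (a b : Idx r) :
    bivector10 (basisA0 r) omega 1 hodge V τ a b =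
      if a.2 = b.2 then V.1 / (2 * I * τ.im ^ 2) * formBar τ a.1 * formBar τ b.1 else 0 := by
  obtain ⟨l, j⟩ := a
  obtain ⟨l', j'⟩ := b
  rw [bivector10, bivector_A0 hτ, Matrix.mul_apply, Fintype.sum_prod_type_right,
    Finset.sum_eq_single j]
  · have h1 := hodgeMatrix_formBar hτ l
    have h2 := hodgeMatrix_formHol hτ l
    simp only [Fin.sum_univ_two, Matrix.of_apply, Matrix.smul_apply, Matrix.sub_apply,
      Matrix.one_apply, endMatrix_hodge, Prod.mk.injEq, if_true, smul_eq_mul]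
    by_cases h : j = j'
    · simp only [h, if_true, and_true, planeBivector]
      have e : ∀ f : Fin 2 → ℂ, (if l = 0 then (1 : ℂ) else 0) * f 0 +
          (if l = 1 then (1 : ℂ) else 0) * f 1 = f l := by
        intro f; fin_cases l <;> simp
      linear_combination (1 / 2) * (V.1 / (2 * I * τ.im ^ 2) * formBar τ l') * e (formBar τ) -
        (1 / 2) * (V.2 / (2 * I * τ.im ^ 2) * formHol τ l') * e (formHol τ) -
        I / 2 * (V.1 / (2 * I * τ.im ^ 2) * formBar τ l') * h1 +
        I / 2 * (V.2 / (2 * I * τ.im ^ 2) * formHol τ l') * h2 -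
        (1 / 2) * (V.1 / (2 * I * τ.im ^ 2) * formBar τ l' * formBar τ l +
          V.2 / (2 * I * τ.im ^ 2) * formHol τ l' * formHol τ l) * I_sq
    · simp [h]
  · intro i _ hi
    simp [endMatrix_hodge, Ne.symm hi]
  · simp

/-- The two type projections add up to the identity, so this component is the rest of the bivector.
-/
theorem bivector01_A0 (hτ : 0 < τ.im) (V : ℂ × ℂ) (a b : Idx r) :
    bivector01 (basisA0 r) omega 1 hodge V τ a b =
      if a.2 = b.2 then -(V.2 / (2 * I * τ.im ^ 2) * formHol τ a.1 * formHol τ b.1) else 0 := by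
  have hsum : bivector01 (basisA0 r) omega 1 hodge V τ =
      bivector (basisA0 r) omega 1 hodge V τ - bivector10 (basisA0 r) omega 1 hodge V τ := by
    rw [bivector01, bivector10, eq_sub_iff_add_eq, ← Matrix.add_mul, ← smul_add]
    have : (1 + I • endMatrix (basisA0 r) (hodge τ)) + (1 - I • endMatrix (basisA0 r) (hodge τ)) =
      (2 : ℂ) • (1 : Matrix (Idx r) (Idx r) ℂ) := by rw [two_smul]; abel
    rw [this, smul_smul]
    norm_num
  rw [hsum, Matrix.sub_apply, bivector10_A0 hτ, bivector_A0 hτ, Matrix.of_apply]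
  split_ifs
  · rw [planeBivector]; ring
  · simp

/-! ### The complex space -/

/-- The matrix of `w ↦ (t̄ / |t|) w̄` in the basis `1, i`. -/
def phaseMatrix (k : ℕ) (s : ℝ) (ε ε' : Fin 2) : ℝ :=
  if ε = 0 then (if ε' = 0 then k / ‖level k s‖ else -(s / ‖level k s‖))
  else (if ε' = 0 then -(s / ‖level k s‖) else -(k / ‖level k s‖))

theorem basisA0C_apply (a : Idx r) (ε : Fin 2) :
    basisA0C r ⟨a, ε⟩ = Pi.single a (if ε = 0 then 1 else I) := by
  simp only [basisA0C, Pi.basis_apply]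
  congr 1
  fin_cases ε <;> simp

/-- In each j-block the complex structure is a tensor product: the Hodge matrix on the indices dx,
dy and the antilinear involution w ↦ (t̄/|t|) w̄ on the indices 1, i. By `formMatrix_omegaT` the
matrix of ω_t has the same second factor. -/
theorem endMatrix_cxIt (τ : ℂ) (x y : Σ _ : Idx r, Fin 2) :
    endMatrix (basisA0C r) (cxIt k s τ) x y =
      if x.1.2 = y.1.2 then (hodgeMatrix τ x.1.1 y.1.1 : ℂ) * phaseMatrix k s x.2 y.2 else 0 := by
  obtain ⟨⟨l, j⟩, ε⟩ := x
  obtain ⟨⟨l', j'⟩, ε'⟩ := y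
  simp only [endMatrix, Matrix.of_apply, LinearMap.toMatrix_apply]
  rw [basisA0C_apply, basisA0C, Pi.basis_repr, Complex.coe_basisOneI_repr]
  by_cases h : j = j'
  · subst h
    simp only [if_true]
    rw [← ofReal_mul]
    congr 1
    fin_cases l <;> fin_cases l' <;> fin_cases ε <;> fin_cases ε' <;>
      simp [cxIt, cxI, cxJ, hodge, phaseMatrix] <;> ring
  · simp only [h, if_false]
    fin_cases ε <;> fin_cases ε' <;>
      simp [cxIt, cxI, cxJ, hodge, h]

theorem formMatrix_omegaT (hk : 0 < k) (x y : Σ _ : Idx r, Fin 2) :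
    formMatrix (basisA0C r) (omegaT k s) x y =
      if x.1.2 = y.1.2 then
        (if x.1.1 = 0 then (if y.1.1 = 0 then 0 else 1) else (if y.1.1 = 0 then -1 else 0)) *
          (‖level k s‖ * phaseMatrix k s x.2 y.2 : ℂ)
      else 0 := by
  obtain ⟨⟨l, j⟩, ε⟩ := x
  obtain ⟨⟨l', j'⟩, ε'⟩ := y
  have hT := (norm_level_pos hk s).ne'
  have hT' : (‖level k s‖ : ℂ) ≠ 0 := by exact_mod_cast hT
  simp only [formMatrix, Matrix.of_apply, omegaT, omegaC, basisA0C_apply]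
  rw [Finset.sum_eq_single j]
  · by_cases h : j = j'
    · subst h
      have e1 : (level k s).re = k := by simp [level]
      have e2 : (level k s).im = s := by simp [level]
      fin_cases l <;> fin_cases l' <;> fin_cases ε <;> fin_cases ε' <;>
        simp [phaseMatrix, e1, e2] <;> field_simp
    · fin_cases l <;> fin_cases l' <;> simp [h]
  · intro i _ hi
    simp [hi]
  · simp

theorem phaseMatrix_sq (hk : 0 < k) (s : ℝ) (ε ε' : Fin 2) :
    phaseMatrix k s ε 0 * phaseMatrix k s 0 ε' + phaseMatrix k s ε 1 * phaseMatrix k s 1 ε' =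
      if ε = ε' then 1 else 0 := by
  have hT := norm_level_pos hk s
  have h2 : (k : ℝ) ^ 2 + s ^ 2 = ‖level k s‖ ^ 2 := by
    rw [← normSq_eq_norm_sq, normSq_apply]; simp [level]; ring
  fin_cases ε <;> fin_cases ε' <;> simp [phaseMatrix] <;> field_simp <;> linarith

theorem sum_sigma_eq_of_block {M : Type*} [AddCommMonoid M] (f : (Σ _ : Idx r, Fin 2) → M)
    (j : Fin r) (h : ∀ l i ε, i ≠ j → f ⟨(l, i), ε⟩ = 0) :
    ∑ x, f x = ∑ l, ∑ ε, f ⟨(l, j), ε⟩ := by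
  rw [Fintype.sum_sigma, Fintype.sum_prod_type_right, Finset.sum_eq_single j]
  · intro i _ hi
    exact Finset.sum_eq_zero fun l _ => Finset.sum_eq_zero fun ε _ => h l i ε hi
  · simp

theorem formMatrix_omegaT_inverse (hk : 0 < k) (s : ℝ) :
    IsUnit (formMatrix (basisA0C r) (omegaT k s)).det := by
  have hT' : (‖level k s‖ : ℂ) ≠ 0 := by exact_mod_cast (norm_level_pos hk s).ne'
  refine Matrix.isUnit_det_of_right_inverse
    (B := (-(1 / ‖level k s‖ ^ 2) : ℂ) • formMatrix (basisA0C r) (omegaT k s)) ?_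
  rw [Matrix.mul_smul]
  ext ⟨⟨l, j⟩, ε⟩ ⟨⟨l', j'⟩, ε'⟩
  rw [Matrix.smul_apply, Matrix.mul_apply, sum_sigma_eq_of_block _ j]
  · have hp := phaseMatrix_sq hk s ε ε'
    have hp' : (phaseMatrix k s ε 0 : ℂ) * phaseMatrix k s 0 ε' +
        phaseMatrix k s ε 1 * phaseMatrix k s 1 ε' = if ε = ε' then 1 else 0 := by
      rw [← ofReal_mul, ← ofReal_mul, ← ofReal_add, hp]
      split_ifs <;> simp
    simp only [Fin.sum_univ_two, formMatrix_omegaT hk, Matrix.one_apply, Sigma.mk.injEq,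
      Prod.mk.injEq, if_true, smul_eq_mul, heq_eq_eq]
    by_cases h : j = j'
    · subst h
      fin_cases l <;> fin_cases l' <;> simp <;> field_simp
      · linear_combination hp'
      · linear_combination hp'
    · simp [h]
  · intro l'' i ε'' hi
    simp [formMatrix_omegaT hk, Ne.symm hi]

/-- Variation of the complex structure and symplectic form share the tensor factor `phaseMatrix`.
Since the variation acts on the Hodge factor alone, the phases cancel and the bivector is that of
the plane tensored with the identity on 1, i. The factor |t| in the definition cancels the |t| of
ω_t. -/
theorem bivector_A0C (hk : 0 < k) (hτ : 0 < τ.im) (V : ℂ × ℂ) :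
    bivector (basisA0C r) (omegaT k s) ‖level k s‖ (cxIt k s) V τ =
      Matrix.of fun x y : Σ _ : Idx r, Fin 2 =>
        if x.1.2 = y.1.2 then (if x.2 = y.2 then planeBivector V τ x.1.1 y.1.1 else 0) else 0 := by
  have hT' : (‖level k s‖ : ℂ) ≠ 0 := by exact_mod_cast (norm_level_pos hk s).ne'
  set G : Matrix (Σ _ : Idx r, Fin 2) (Σ _ : Idx r, Fin 2) ℂ :=
      Matrix.of fun x y : Σ _ : Idx r, Fin 2 =>
        if x.1.2 = y.1.2 then (if x.2 = y.2 then planeBivector V τ x.1.1 y.1.1 else 0) else 0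
    with hG
  have hv : (‖level k s‖ : ℂ) • varMatrix (basisA0C r) (cxIt k s) V τ =
      G * formMatrix (basisA0C r) (omegaT k s) := by
    ext ⟨⟨l, j⟩, ε⟩ ⟨⟨l', j'⟩, ε'⟩
    rw [Matrix.smul_apply, Matrix.mul_apply, sum_sigma_eq_of_block _ j]
    · simp only [hG, varMatrix, Fin.sum_univ_two, Matrix.of_apply, formMatrix_omegaT hk,
        endMatrix_cxIt, if_true, smul_eq_mul]
      by_cases h : j = j'
      · subst h
        have hd := tderiv_hodgeMatrix hτ V l
        have hc : ∀ (F : ℂ → ℂ) (c : ℂ), DifferentiableAt ℝ F τ →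
            tderiv V (fun x => F x * c) τ = tderiv V F τ * c := by
          intro F c hF
          have h1 := hasWirt_tderiv hF
          rw [(h1.mul (hasWirt_const c τ)).tderiv V, tderiv_eq V F τ]; ring
        have hdiff : ∀ l l', DifferentiableAt ℝ (fun x => (hodgeMatrix x l l' : ℂ)) τ := by
          intro l l'
          have h0 : τ.im ≠ 0 := hτ.ne'
          have h1 : DifferentiableAt ℝ (fun x : ℂ => x.im) τ := imCLM.differentiableAt
          have h2 : DifferentiableAt ℝ (fun x : ℂ => x.re) τ := reCLM.differentiableAt
          have h3 : DifferentiableAt ℝ (fun x => hodgeMatrix x l l') τ := by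
            fin_cases l <;> fin_cases l' <;> simp [hodgeMatrix, normSq_apply] <;>
              fun_prop (disch := assumption)
          exact ofRealCLM.differentiableAt.comp τ h3
        simp only [if_true]
        rw [hc _ _ (hdiff l l')]
        fin_cases l' <;> fin_cases ε <;> simp [hd.1, hd.2] <;> ring
      · simp [h, (hasWirt_const 0 τ).tderiv]
    · intro l'' i ε'' hi
      simp [hG, Ne.symm hi]
  rw [bivector, ← Matrix.smul_mul, hv, Matrix.mul_assoc,
    Matrix.mul_nonsing_inv _ (formMatrix_omegaT_inverse hk s), Matrix.mul_one]

end Bivectors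

/-! ### Covariant derivatives and Laplacians over the complex space in the frame σ -/

section ComplexSpace

open Complex
open scoped ComplexConjugate

variable {r : ℕ} {k : ℕ} {s : ℝ} {τ : ℂ}

/-- The frame `σ` as a function of the holomorphic coordinates. -/
def sigmaZ (T : ℝ) (z : Idx r → ℂ) : ℂ :=
  ((T / (2 * Real.pi)) ^ (2 * r) * Real.exp (-(T / 4) * ∑ a, ‖z a‖ ^ 2) : ℝ)

theorem frameSigma_eq (A : A0C r) :
    frameSigma k s τ A = sigmaZ ‖level k s‖ (coordZ k s τ A) := rfl

theorem hasFDerivAt_sigmaZ (T : ℝ) (z : Idx r → ℂ) :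
    ∃ L : (Idx r → ℂ) →L[ℝ] ℂ, HasFDerivAt (sigmaZ T) L z ∧
      ∀ v, L v = -((T : ℂ) / 4) * (∑ a, (conj (z a) * v a + z a * conj (v a))) * sigmaZ T z := by
  have hp : ∀ a, HasFDerivAt (fun z : Idx r → ℂ => z a)
      (ContinuousLinearMap.proj (R := ℝ) (φ := fun _ : Idx r => ℂ) a) z :=
    fun a => (ContinuousLinearMap.proj (R := ℝ) (φ := fun _ : Idx r => ℂ) a).hasFDerivAt
  have h1 : ∀ a, HasFDerivAt (fun z : Idx r → ℂ => conj (z a) * z a) _ z := fun a =>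
    ((conjCLE.hasFDerivAt (x := z a)).comp z (hp a)).mul (hp a)
  have h2 := ((HasFDerivAt.fun_sum (u := Finset.univ) fun a _ => h1 a).const_mul
    (-((T : ℂ) / 4))).cexp.const_mul (((T : ℂ) / (2 * Real.pi)) ^ (2 * r))
  have e : (sigmaZ T : (Idx r → ℂ) → ℂ) = fun z => ((T : ℂ) / (2 * Real.pi)) ^ (2 * r) *
      Complex.exp (-((T : ℂ) / 4) * ∑ a, conj (z a) * z a) := by
    funext z
    simp only [sigmaZ]
    push_cast
    simp only [conj_mul']
  refine ⟨_, by rw [e]; exact h2, fun v => ?_⟩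
  rw [e]
  simp only [_root_.smul_apply, _root_.sum_apply, _root_.add_apply,
    ContinuousLinearMap.comp_apply, ContinuousLinearMap.proj_apply, smul_eq_mul,
    ContinuousLinearEquiv.coe_coe, conjCLE_apply]
  ring

theorem sigmaZ_ne_zero (hk : 0 < k) (s : ℝ) (z : Idx r → ℂ) : sigmaZ ‖level k s‖ z ≠ 0 := by
  have := norm_level_pos hk s
  rw [sigmaZ]
  exact_mod_cast (by positivity)

/-- The covariant derivative of a section in the frame `σ`. -/
theorem covD_mul_frameSigma (hk : 0 < k) (hτ : 0 < τ.im) {h : (Idx r → ℂ) → ℂ}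
    {h' : (Idx r → ℂ) →L[ℝ] ℂ} {A : A0C r} (hh : HasFDerivAt h h' (coordZ k s τ A)) (X : A0C r) :
    covD (omegaT k s) X (fun A => h (coordZ k s τ A) * frameSigma k s τ A) A =
      (h' (coordZ k s τ X) - (‖level k s‖ : ℂ) / 2 *
        (∑ a, conj (coordZ k s τ A a) * coordZ k s τ X a) * h (coordZ k s τ A)) *
          frameSigma k s τ A := by
  obtain ⟨L, hL, hLv⟩ := hasFDerivAt_sigmaZ ‖level k s‖ (coordZ k s τ A)
  have hz : HasFDerivAt (fun A => coordZ k s τ A) (zEquiv hk s hτ).toContinuousLinearMap A :=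
    (zEquiv hk s hτ).hasFDerivAt
  have h1 := (HasFDerivAt.mul hh hL).comp A hz
  have e : (fun A => h (coordZ k s τ A) * frameSigma k s τ A) =
    (h * sigmaZ ‖level k s‖) ∘ fun A => coordZ k s τ A := rfl
  rw [covD, e, h1.fderiv, omegaT_eq hk hτ]
  simp only [ContinuousLinearMap.comp_apply, _root_.add_apply, _root_.smul_apply, hLv,
    ContinuousLinearEquiv.coe_coe, zEquiv_apply, smul_eq_mul]
  rw [frameSigma_eq]
  set S := ∑ a, conj (coordZ k s τ A a) * coordZ k s τ X a with hS
  have hS' : ∑ a, (conj (coordZ k s τ A a) * coordZ k s τ X a +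
      coordZ k s τ A a * conj (coordZ k s τ X a)) = S + conj S := by
    rw [Finset.sum_add_distrib, hS, map_sum]
    simp only [map_mul, conj_conj]
  -- With S = ∑ z̄_a(A) z_a(X), the frame contributes -(T/4)(S + S̄) and the symplectic potential
  -- -(T/4)(S - S̄). The sum -(T/2)S has no part conjugate-linear in X, which expresses that σ is
  -- holomorphic.
  have him : ((S.im : ℝ) : ℂ) = (S - conj S) * (-I / 2) := by
    rw [tau_sub_conj]; linear_combination S.im * I_sq
  rw [hS']
  push_cast
  rw [him]
  linear_combination (‖level k s‖ / 4 * (S - conj S) * h (coordZ k s τ A) *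
    sigmaZ ‖level k s‖ (coordZ k s τ A)) * I_sq

/-- The partial derivatives of a holomorphic function. -/
def pd (F : (Idx r → ℂ) → ℂ) (a : Idx r) (z : Idx r → ℂ) : ℂ := fderiv ℂ F z (Pi.single a 1)

theorem fderiv_eq_sum_pd (F : (Idx r → ℂ) → ℂ) (z v : Idx r → ℂ) :
    fderiv ℂ F z v = ∑ a, v a * pd F a z := by
  conv_lhs => rw [← Finset.univ_sum_single v]
  rw [map_sum]
  refine Finset.sum_congr rfl fun a _ => ?_
  have : (Pi.single a (v a) : Idx r → ℂ) = v a • Pi.single a (1 : ℂ) := by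
    rw [← Pi.single_smul]; simp
  rw [this, map_smul, smul_eq_mul, pd]

/-- The `(1,0)` covariant derivative in the frame `σ`. -/
def nabla (T : ℝ) (F : (Idx r → ℂ) → ℂ) (a : Idx r) (z : Idx r → ℂ) : ℂ :=
  pd F a z - T / 2 * conj (z a) * F z

/-- The second `(1,0)` covariant derivative of a holomorphic function in the frame `σ`. -/
def nabla2 (T : ℝ) (F : (Idx r → ℂ) → ℂ) (c a : Idx r) (z : Idx r → ℂ) : ℂ :=
  pd (pd F a) c z - T / 2 * conj (z a) * pd F c z - T / 2 * conj (z c) * nabla T F a z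

theorem covD_holomorphic (hk : 0 < k) (hτ : 0 < τ.im) {F : (Idx r → ℂ) → ℂ}
    (hF : Differentiable ℂ F) (X A : A0C r) :
    covD (omegaT k s) X (fun A => F (coordZ k s τ A) * frameSigma k s τ A) A =
      (∑ a, coordZ k s τ X a * nabla ‖level k s‖ F a (coordZ k s τ A)) * frameSigma k s τ A := by
  rw [covD_mul_frameSigma hk hτ ((hF _).hasFDerivAt.restrictScalars ℝ)]
  congr 1
  rw [ContinuousLinearMap.coe_restrictScalars', fderiv_eq_sum_pd, Finset.mul_sum, Finset.sum_mul,
    ← Finset.sum_sub_distrib]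
  refine Finset.sum_congr rfl fun a _ => ?_
  rw [nabla]; ring

theorem hasFDerivAt_nabla (T : ℝ) {F : (Idx r → ℂ) → ℂ} (hF : Differentiable ℂ F)
    (hF' : ∀ a, Differentiable ℂ (pd F a)) (a : Idx r) (z : Idx r → ℂ) :
    ∃ L : (Idx r → ℂ) →L[ℝ] ℂ, HasFDerivAt (nabla T F a) L z ∧
      ∀ v, L v = ∑ c, v c * (pd (pd F a) c z - T / 2 * conj (z a) * pd F c z)
        - T / 2 * conj (v a) * F z := by
  have h1 := ((hF' a) z).hasFDerivAt.restrictScalars ℝ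
  have h2 := (hF z).hasFDerivAt.restrictScalars ℝ
  have hp : HasFDerivAt (fun z : Idx r → ℂ => z a)
      (ContinuousLinearMap.proj (R := ℝ) (φ := fun _ : Idx r => ℂ) a) z :=
    (ContinuousLinearMap.proj (R := ℝ) (φ := fun _ : Idx r => ℂ) a).hasFDerivAt
  have h3 : HasFDerivAt (fun z : Idx r → ℂ => conj (z a)) _ z :=
    (conjCLE.hasFDerivAt (x := z a)).comp z hp
  refine ⟨_, h1.sub ((h3.const_mul ((T : ℂ) / 2)).mul h2), fun v => ?_⟩
  simp only [_root_.sub_apply, _root_.add_apply, _root_.smul_apply,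
    ContinuousLinearMap.coe_restrictScalars', fderiv_eq_sum_pd, ContinuousLinearMap.comp_apply,
    ContinuousLinearMap.proj_apply, ContinuousLinearEquiv.coe_coe, conjCLE_apply, smul_eq_mul,
    mul_sub, Finset.sum_sub_distrib]
  rw [← sub_sub]
  congr 1
  · congr 1
    rw [Finset.mul_sum]
    exact Finset.sum_congr rfl fun c _ => by ring
  · ring

/-- The functions ∇_a F contain z̄_a and are no longer holomorphic. A second covariant derivative
along a general X therefore has a curvature term with the conjugate coordinates of X, besides the
second (1,0) derivatives. -/
theorem covD_nabla (hk : 0 < k) (hτ : 0 < τ.im) {F : (Idx r → ℂ) → ℂ} (hF : Differentiable ℂ F)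
    (hF' : ∀ a, Differentiable ℂ (pd F a)) (y : Idx r → ℂ) (X A : A0C r) :
    covD (omegaT k s) X (fun A => (∑ a, y a * nabla ‖level k s‖ F a (coordZ k s τ A)) *
        frameSigma k s τ A) A =
      (∑ a, ∑ c, y a * coordZ k s τ X c * nabla2 ‖level k s‖ F c a (coordZ k s τ A)
        - (‖level k s‖ : ℂ) / 2 * (∑ a, y a * conj (coordZ k s τ X a)) * F (coordZ k s τ A)) *
      frameSigma k s τ A := by
  choose L hL hLv using fun a => hasFDerivAt_nabla ‖level k s‖ hF hF' a (coordZ k s τ A)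
  have h := HasFDerivAt.fun_sum (u := Finset.univ) fun a _ => (hL a).const_mul (y a)
  rw [covD_mul_frameSigma hk hτ h]
  congr 1
  simp only [_root_.sum_apply, _root_.smul_apply, hLv, smul_eq_mul, nabla2]
  have e1 : ∀ S : ℂ, S * (∑ a, y a * nabla ‖level k s‖ F a (coordZ k s τ A)) =
    ∑ a, y a * nabla ‖level k s‖ F a (coordZ k s τ A) * S := fun S => by
      rw [mul_comm, Finset.sum_mul]
  rw [e1 _, Finset.mul_sum (s := Finset.univ) (a := (‖level k s‖ : ℂ) / 2)
    (f := fun a => y a * conj (coordZ k s τ X a)), Finset.sum_mul, ← Finset.sum_sub_distrib,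
    ← Finset.sum_sub_distrib]
  refine Finset.sum_congr rfl fun a _ => ?_
  have e2 : ∑ c, y a * coordZ k s τ X c * (pd (pd F a) c (coordZ k s τ A) -
      ↑‖level k s‖ / 2 * conj (coordZ k s τ A a) * pd F c (coordZ k s τ A) -
        ↑‖level k s‖ / 2 * conj (coordZ k s τ A c) * nabla ‖level k s‖ F a (coordZ k s τ A)) =
      y a * (∑ c, coordZ k s τ X c * (pd (pd F a) c (coordZ k s τ A) -
      ↑‖level k s‖ / 2 * conj (coordZ k s τ A a) * pd F c (coordZ k s τ A))) -
      y a * nabla ‖level k s‖ F a (coordZ k s τ A) *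
        (‖level k s‖ / 2 * ∑ c, conj (coordZ k s τ A c) * coordZ k s τ X c) := by
    rw [Finset.mul_sum, Finset.mul_sum, Finset.mul_sum, ← Finset.sum_sub_distrib]
    exact Finset.sum_congr rfl fun c _ => by ring
  rw [e2]
  ring

theorem sum_comm_four {α β γ δ M : Type*} [Fintype α] [Fintype β] [Fintype γ] [Fintype δ]
    [AddCommMonoid M] (f : α → β → γ → δ → M) :
    ∑ x, ∑ y, ∑ a, ∑ c, f x y a c = ∑ a, ∑ c, ∑ x, ∑ y, f x y a c := by
  calc _ = ∑ x, ∑ a, ∑ y, ∑ c, f x y a c := Finset.sum_congr rfl fun x _ => Finset.sum_comm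
    _ = ∑ a, ∑ x, ∑ y, ∑ c, f x y a c := Finset.sum_comm
    _ = ∑ a, ∑ x, ∑ c, ∑ y, f x y a c := Finset.sum_congr rfl fun a _ =>
        Finset.sum_congr rfl fun x _ => Finset.sum_comm
    _ = _ := Finset.sum_congr rfl fun a _ => Finset.sum_comm

theorem sum_comm_three {α β γ M : Type*} [Fintype α] [Fintype β] [Fintype γ]
    [AddCommMonoid M] (f : α → β → γ → M) :
    ∑ x, ∑ y, ∑ a, f x y a = ∑ a, ∑ x, ∑ y, f x y a := by
  calc _ = ∑ x, ∑ a, ∑ y, f x y a := Finset.sum_congr rfl fun x _ => Finset.sum_comm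
    _ = _ := Finset.sum_comm

/-- The coordinates `z` of the vectors of the coordinate basis. -/
def basisZ (k : ℕ) (s : ℝ) (τ : ℂ) (c : Idx r) (x : Σ _ : Idx r, Fin 2) : ℂ :=
  coordZ k s τ (basisA0C r x) c

/-- Only two contractions of G occur: with z ⊗ z in front of the second derivatives, and with z̄ ⊗ z
in the curvature term. The latter disappears for bivectors of type (1,0) in the first slot. -/
theorem laplacian_holomorphic (hk : 0 < k) (hτ : 0 < τ.im) {F : (Idx r → ℂ) → ℂ}
    (hF : Differentiable ℂ F) (hF' : ∀ a, Differentiable ℂ (pd F a))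
    (G : Matrix (Σ _ : Idx r, Fin 2) (Σ _ : Idx r, Fin 2) ℂ) (A : A0C r) :
    laplacian (basisA0C r) (omegaT k s) G
      (fun A => F (coordZ k s τ A) * frameSigma k s τ A) A =
    (∑ a, ∑ c, (∑ x, ∑ y, G x y * basisZ k s τ c x * basisZ k s τ a y) *
        nabla2 ‖level k s‖ F c a (coordZ k s τ A)
      - (‖level k s‖ : ℂ) / 2 * (∑ a, ∑ x, ∑ y, G x y * conj (basisZ k s τ a x) * basisZ k s τ a y)
        * F (coordZ k s τ A)) * frameSigma k s τ A := by
  have e : ∀ y, covD (omegaT k s) (basisA0C r y)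
      (fun A => F (coordZ k s τ A) * frameSigma k s τ A) =
      fun A => (∑ a, basisZ k s τ a y * nabla ‖level k s‖ F a (coordZ k s τ A)) *
        frameSigma k s τ A := fun y => funext fun A => covD_holomorphic hk hτ hF _ A
  simp only [laplacian, e, covD_nabla hk hτ hF hF']
  simp only [mul_sub, sub_mul, Finset.sum_sub_distrib, Finset.mul_sum, Finset.sum_mul]
  congr 1
  · rw [sum_comm_four]
    refine Finset.sum_congr rfl fun a _ => Finset.sum_congr rfl fun c _ =>
      Finset.sum_congr rfl fun x _ => Finset.sum_congr rfl fun y _ => ?_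
    simp only [basisZ]; ring
  · rw [sum_comm_three]
    refine Finset.sum_congr rfl fun a _ =>
      Finset.sum_congr rfl fun x _ => Finset.sum_congr rfl fun y _ => ?_
    simp only [basisZ]; ring

/-- The coefficients of `∂ (0, j) + i ∂ (1, j)`. -/
def wPlus (i : Fin 2) : ℂ := if i = 0 then 1 else I

/-- The coefficients of `∂ (0, j) - i ∂ (1, j)`. -/
def wMinus (i : Fin 2) : ℂ := if i = 0 then 1 else -I

/-- The complex-linear extension of z_(0,j) + i z_(1,j) = P_j + iQ̄_j annihilates dx + τ̄ dy, and
that of z_(0,j) - i z_(1,j) annihilates dx + τ dy. Hence contraction of these forms with z has the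
direction (1, i) or (1, -i); only the scalar depends on the index ε for 1 or i. -/
theorem basisZ_combination (hk : 0 < k) (hτ : 0 < τ.im) (c : Idx r) (j : Fin r) (ε : Fin 2) :
    (∑ l, formBar τ l * basisZ k s τ c ⟨(l, j), ε⟩ = if c.2 = j then wPlus c.1 *
      (τ.im * (√(2 * τ.im) : ℂ)⁻¹ * (if ε = 0 then 1 + phase k s else I * (phase k s - 1))) else 0) ∧
    (∑ l, formHol τ l * basisZ k s τ c ⟨(l, j), ε⟩ = if c.2 = j then wMinus c.1 *
      (τ.im * (√(2 * τ.im) : ℂ)⁻¹ * (if ε = 0 then 1 - conj (phase k s)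
        else I * (1 + conj (phase k s)))) else 0) := by
  obtain ⟨i, j'⟩ := c
  set ν := (√(2 * τ.im) : ℂ)⁻¹ with hν
  have hνc : conj ν = ν := by rw [hν, map_inv₀, conj_ofReal]
  have h0 : ∀ B : A0C r, coordZ k s τ B (0, j') = ((coordPp τ B j' + I * conj (coordQm k s τ B j'))
      + (conj (coordPp τ B j') + I * coordQm k s τ B j')) / 2 := fun B => by
    rw [← coordZp_eq hk hτ, ← coordZm_eq hk hτ]; ring
  have h1 : ∀ B : A0C r, coordZ k s τ B (1, j') = I * ((conj (coordPp τ B j') +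
      I * coordQm k s τ B j') - (coordPp τ B j' + I * conj (coordQm k s τ B j'))) / 2 := fun B => by
    rw [← coordZp_eq hk hτ, ← coordZm_eq hk hτ]
    linear_combination (-(coordZ k s τ B (1, j'))) * (-I_sq)
  have hP : ∀ l, coordPp τ (basisA0C r ⟨(l, j), ε⟩) j' = if j' = j then
      (if l = 0 then I * conj τ else -I) * (if ε = 0 then 1 else I) * ν else 0 := by
    intro l
    rw [coordPp, basisA0C_apply, hν]
    by_cases hj : j' = j
    · fin_cases l <;> fin_cases ε <;> simp [hj] <;> first | ring1 | (left; ring1)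
    · simp [hj]
  have hQ : ∀ l, coordQm k s τ (basisA0C r ⟨(l, j), ε⟩) j' = if j' = j then
      phase k s * (if l = 0 then -τ else 1) * (if ε = 0 then 1 else I) * ν else 0 := by
    intro l
    rw [coordQm, basisA0C_apply, hν]
    by_cases hj : j' = j
    · fin_cases l <;> fin_cases ε <;> simp [hj] <;> first | ring1 | (left; ring1)
    · simp [hj]
  have hd := tau_sub_conj τ
  by_cases hj : j' = j
  · subst hj
    simp only [if_true] at hP hQ ⊢
    have hb : conj τ = τ - 2 * τ.im * I := by linear_combination -hd
    clear_value ν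
    constructor <;> rw [Fin.sum_univ_two] <;> fin_cases i <;>
      simp only [Fin.zero_eta, Fin.mk_one, basisZ, h0, h1, hP, hQ] <;> clear hP hQ h0 h1 <;>
      fin_cases ε <;>
      simp [hνc, formBar, formHol, wPlus, wMinus, hb, Complex.conj_ofNat] <;> ring_nf <;>
      simp only [I_sq, I_pow_three, I_pow_four] <;> ring
  · simp only [hj, if_false] at hP hQ ⊢
    constructor <;> fin_cases i <;>
      simp [basisZ, h0, h1, hP, hQ]

end ComplexSpace

/-! ### The Laplacian of the complexified Hitchin connection -/

section Contraction

open Complex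
open scoped ComplexConjugate

variable {r : ℕ} {k : ℕ} {s : ℝ} {τ : ℂ}

/-- The coordinates `z` are of type `(1,0)`. -/
theorem sum_basisZ_endMatrix (hk : 0 < k) (hτ : 0 < τ.im) (c : Idx r) (u : Σ _ : Idx r, Fin 2) :
    ∑ x, basisZ k s τ c x * endMatrix (basisA0C r) (cxIt k s τ) x u = I * basisZ k s τ c u := by
  have h := congrFun (coordZ_cxIt (s := s) hk hτ (basisA0C r u)) c
  rw [Pi.smul_apply, smul_eq_mul] at h
  rw [basisZ, ← h, ← (basisA0C r).sum_repr (cxIt k s τ (basisA0C r u)),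
    ← zEquiv_apply hk hτ, map_sum, Finset.sum_apply]
  refine Finset.sum_congr rfl fun x _ => ?_
  rw [map_smul, Pi.smul_apply, zEquiv_apply, endMatrix, Matrix.of_apply, LinearMap.toMatrix_apply,
    basisZ, real_smul, mul_comm]

/-- A left eigenvector of the complex structure is also one of the type projection, with eigenvalue
(1 - ic)/2. This is 1 for the functionals z, where c = i, and 0 for their conjugates, where c = -i.
-/
theorem sum_typeProjection_mul {ι : Type*} [Fintype ι] [DecidableEq ι] (M N : Matrix ι ι ℂ)
    (v w : ι → ℂ) (c : ℂ) (h : ∀ u, ∑ x, v x * M x u = c * v u) :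
    ∑ x, ∑ y, (((1 / 2 : ℂ) • (1 - I • M)) * N) x y * v x * w y =
      (1 - I * c) / 2 * ∑ x, ∑ y, N x y * v x * w y := by
  have h1 : ∀ u, ∑ x, v x * ((1 / 2 : ℂ) • (1 - I • M)) x u = (1 - I * c) / 2 * v u := by
    intro u
    have : ∀ x, v x * ((1 / 2 : ℂ) • (1 - I • M)) x u =
        1 / 2 * (v x * (1 : Matrix ι ι ℂ) x u) - 1 / 2 * I * (v x * M x u) := by
      intro x
      simp only [Matrix.smul_apply, Matrix.sub_apply, smul_eq_mul]; ring
    simp only [this, Finset.sum_sub_distrib, ← Finset.mul_sum, h, Matrix.one_apply, mul_ite,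
      mul_one, mul_zero, Finset.sum_ite_eq', Finset.mem_univ, if_true]
    ring
  calc _ = ∑ y, ∑ u, (∑ x, v x * ((1 / 2 : ℂ) • (1 - I • M)) x u) * N u y * w y := by
        rw [Finset.sum_comm]
        refine Finset.sum_congr rfl fun y _ => ?_
        simp only [Matrix.mul_apply, Finset.sum_mul]
        rw [Finset.sum_comm]
        exact Finset.sum_congr rfl fun u _ => Finset.sum_congr rfl fun x _ => by ring
    _ = _ := by
        simp only [h1, Finset.mul_sum]
        rw [Finset.sum_comm]
        exact Finset.sum_congr rfl fun u _ => Finset.sum_congr rfl fun x _ => by ring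

/-- The bivector is a sum of squares of dx + τ̄ dy and dx + τ dy tensored with the identity on 1, i.
Summing the squared scalars of `basisZ_combination` over these two directions leaves (1 + e)² - (e -
1)² = 4e and (1 - ē)² - (1 + ē)² = -4ē: this is how the phase of t enters. -/
theorem sum_bivector_A0C (hk : 0 < k) (hτ : 0 < τ.im) (V : ℂ × ℂ) (c a : Idx r) :
    ∑ x, ∑ y, bivector (basisA0C r) (omegaT k s) ‖level k s‖ (cxIt k s) V τ x y *
      basisZ k s τ c x * basisZ k s τ a y =
    if c.2 = a.2 then -I / τ.im * (V.1 * phase k s * wPlus c.1 * wPlus a.1 +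
      V.2 * conj (phase k s) * wMinus c.1 * wMinus a.1) else 0 := by
  have hi : (τ.im : ℂ) ≠ 0 := by exact_mod_cast hτ.ne'
  have hν : ((√(2 * τ.im) : ℂ)⁻¹) ^ 2 = (2 * τ.im : ℂ)⁻¹ := by
    rw [inv_pow, ← ofReal_pow, Real.sq_sqrt (by positivity)]; push_cast; ring
  rw [bivector_A0C hk hτ]
  have h1 : ∀ x : Σ _ : Idx r, Fin 2, ∑ y, (Matrix.of fun x y : Σ _ : Idx r, Fin 2 =>
        if x.1.2 = y.1.2 then (if x.2 = y.2 then planeBivector V τ x.1.1 y.1.1 else 0) else 0) x y *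
      basisZ k s τ c x * basisZ k s τ a y =
      V.1 / (2 * I * τ.im ^ 2) * (formBar τ x.1.1 * basisZ k s τ c x) *
        (∑ l, formBar τ l * basisZ k s τ a ⟨(l, x.1.2), x.2⟩) -
      V.2 / (2 * I * τ.im ^ 2) * (formHol τ x.1.1 * basisZ k s τ c x) *
        (∑ l, formHol τ l * basisZ k s τ a ⟨(l, x.1.2), x.2⟩) := by
    rintro ⟨⟨l, j⟩, ε⟩
    rw [sum_sigma_eq_of_block _ j]
    · simp only [Matrix.of_apply, if_true, Finset.mul_sum, ← Finset.sum_sub_distrib]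
      refine Finset.sum_congr rfl fun l' _ => ?_
      rw [Finset.sum_eq_single ε]
      · simp only [if_true, planeBivector]; ring
      · intro ε' _ h; simp [Ne.symm h]
      · simp
    · intro l' i ε' h; simp [Ne.symm h]
  simp only [h1, (basisZ_combination (s := s) hk hτ a _ _).1,
    (basisZ_combination (s := s) hk hτ a _ _).2]
  rw [sum_sigma_eq_of_block _ a.2]
  · simp only [if_true]
    rw [Finset.sum_comm]
    have h2 : ∀ (ε : Fin 2) (α β u v : ℂ), ∑ l, (α * (formBar τ l * basisZ k s τ c ⟨(l, a.2), ε⟩) *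
        u - β * (formHol τ l * basisZ k s τ c ⟨(l, a.2), ε⟩) * v) =
        α * (∑ l, formBar τ l * basisZ k s τ c ⟨(l, a.2), ε⟩) * u -
        β * (∑ l, formHol τ l * basisZ k s τ c ⟨(l, a.2), ε⟩) * v := by
      intro ε α β u v
      simp only [Fin.sum_univ_two]; ring
    refine (Finset.sum_congr rfl fun ε _ => h2 ε _ _ _ _).trans ?_
    simp only [(basisZ_combination (s := s) hk hτ c _ _).1,
      (basisZ_combination (s := s) hk hτ c _ _).2]
    by_cases h : c.2 = a.2
    · simp only [h, if_true, Fin.sum_univ_two, one_ne_zero, if_false]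
      generalize (√(2 * τ.im) : ℂ)⁻¹ = ν at hν
      generalize conj (phase k s) = e'
      have key : ((τ.im : ℂ)⁻¹) ^ 2 * τ.im ^ 2 * ν ^ 2 = (τ.im : ℂ)⁻¹ / 2 := by
        rw [hν]; field_simp
      simp only [div_eq_mul_inv, mul_inv, inv_I, ← inv_pow] at key ⊢
      generalize (τ.im : ℂ)⁻¹ = y at key
      linear_combination (-I / 2 * (V.1 * wPlus c.1 * wPlus a.1 * ((1 + phase k s) ^ 2 +
        I ^ 2 * (phase k s - 1) ^ 2) - V.2 * wMinus c.1 * wMinus a.1 * ((1 - e') ^ 2 +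
        I ^ 2 * (1 + e') ^ 2))) * key + y / 2 * (-I / 2) * (V.1 * wPlus c.1 * wPlus a.1 *
        (phase k s - 1) ^ 2 - V.2 * wMinus c.1 * wMinus a.1 * (1 + e') ^ 2) * I_sq
    · simp [h]
  · intro l i ε h
    simp [Ne.symm h]

/-- The Laplace operator of the complexified Hitchin connection on a holomorphic section. -/
theorem laplacian_bivector10 (hk : 0 < k) (hτ : 0 < τ.im) {F : (Idx r → ℂ) → ℂ}
    (hF : Differentiable ℂ F) (hF' : ∀ a, Differentiable ℂ (pd F a)) (V : ℂ × ℂ) (A : A0C r) :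
    laplacian (basisA0C r) (omegaT k s)
      (bivector10 (basisA0C r) (omegaT k s) ‖level k s‖ (cxIt k s) V τ)
      (fun A => F (coordZ k s τ A) * frameSigma k s τ A) A =
    (-I / τ.im * ∑ j, ∑ i, ∑ i', (V.1 * phase k s * wPlus i' * wPlus i +
      V.2 * conj (phase k s) * wMinus i' * wMinus i) *
        nabla2 ‖level k s‖ F (i', j) (i, j) (coordZ k s τ A)) * frameSigma k s τ A := by
  have hc : ∀ (a : Idx r) u, ∑ x, conj (basisZ k s τ a x) *
      endMatrix (basisA0C r) (cxIt k s τ) x u = -I * conj (basisZ k s τ a u) := by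
    intro a u
    have h := congrArg conj (sum_basisZ_endMatrix (s := s) hk hτ a u)
    simp only [map_sum, map_mul, conj_I] at h
    rw [← h]
    refine Finset.sum_congr rfl fun x _ => ?_
    simp [endMatrix]
  rw [laplacian_holomorphic hk hτ hF hF']
  congr 1
  simp only [bivector10]
  have e1 : ∀ a c : Idx r, _ := fun a c => sum_typeProjection_mul
    (endMatrix (basisA0C r) (cxIt k s τ)) (bivector (basisA0C r) (omegaT k s) ‖level k s‖
      (cxIt k s) V τ) (basisZ k s τ c) (basisZ k s τ a) I (sum_basisZ_endMatrix hk hτ c)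
  -- The curvature term is contracted with z̄ in the first slot, where the projection has eigenvalue
  -- 0; so it vanishes.
  have e2 : ∀ a : Idx r, _ := fun a => sum_typeProjection_mul
    (endMatrix (basisA0C r) (cxIt k s τ)) (bivector (basisA0C r) (omegaT k s) ‖level k s‖
      (cxIt k s) V τ) (fun x => conj (basisZ k s τ a x)) (basisZ k s τ a) (-I) (hc a)
  simp only [e1, e2, sum_bivector_A0C hk hτ]
  have e3 : (1 - I * I) / 2 = (1 : ℂ) := by rw [I_mul_I]; norm_num
  have e4 : (1 - I * -I) / 2 = (0 : ℂ) := by rw [mul_neg, I_mul_I]; norm_num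
  simp only [e3, e4, one_mul, zero_mul, Finset.sum_const_zero, mul_zero, sub_zero]
  rw [Fintype.sum_prod_type_right, Finset.mul_sum]
  refine Finset.sum_congr rfl fun j _ => ?_
  rw [Finset.mul_sum]
  refine Finset.sum_congr rfl fun i _ => ?_
  rw [Fintype.sum_prod_type_right, Finset.sum_eq_single j, Finset.mul_sum]
  · refine Finset.sum_congr rfl fun i' _ => ?_
    simp only [if_true]; ring
  · intro j' _ h
    exact Finset.sum_eq_zero fun i' _ => by simp [h]
  · simp

end Contraction

/-! ### Position and derivative operators, and their Bargmann transforms -/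

section Ladder

open Complex
open scoped ComplexConjugate

variable {r : ℕ} {k : ℕ} {s : ℝ} {τ : ℂ}

/-- Multiplication by a coordinate. -/
def mulQ (a : Idx r) (η : (Idx r → ℝ) → ℂ) (q : Idx r → ℝ) : ℂ := (q a : ℂ) * η q

/-- A partial derivative. -/
def derivQ (a : Idx r) (η : (Idx r → ℝ) → ℂ) (q : Idx r → ℝ) : ℂ := fderiv ℝ η q (Pi.single a 1)

theorem contDiff_coord (a : Idx r) : ContDiff ℝ ∞ fun q : Idx r → ℝ => (q a : ℂ) :=
  ofRealCLM.contDiff.comp (contDiff_apply ℝ ℝ a)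

theorem contDiff_mulQ {η : (Idx r → ℝ) → ℂ} (h : ContDiff ℝ ∞ η) (a : Idx r) :
    ContDiff ℝ ∞ (mulQ a η) := (contDiff_coord a).mul h

theorem contDiff_derivQ {η : (Idx r → ℝ) → ℂ} (h : ContDiff ℝ ∞ η) (a : Idx r) :
    ContDiff ℝ ∞ (derivQ a η) :=
  (h.fderiv_right (m := ∞) (by simp)).clm_apply contDiff_const

theorem ladder_true (a : Idx r) (η : (Idx r → ℝ) → ℂ) : ladder k s true a η =
    fun q => I * (mulQ a η q - 1 / (‖level k s‖ : ℂ) * derivQ a η q) := rfl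

theorem ladder_false (a : Idx r) (η : (Idx r → ℝ) → ℂ) : ladder k s false a η =
    fun q => -I * (mulQ a η q + 1 / (‖level k s‖ : ℂ) * derivQ a η q) := rfl

theorem contDiff_ladder {η : (Idx r → ℝ) → ℂ} (h : ContDiff ℝ ∞ η) (ε : Bool) (a : Idx r) :
    ContDiff ℝ ∞ (ladder k s ε a η) := by
  have h1 := contDiff_mulQ h a
  have h2 := contDiff_derivQ h a
  cases ε
  · rw [ladder_false]; fun_prop
  · rw [ladder_true]; fun_prop

theorem mulQ_eq_ladder (a : Idx r) (η : (Idx r → ℝ) → ℂ) : mulQ a η = fun q =>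
    I / 2 * ladder k s false a η q - I / 2 * ladder k s true a η q := by
  funext q
  rw [ladder_true, ladder_false]
  linear_combination (mulQ a η q) * I_sq

theorem derivQ_eq_ladder (hk : 0 < k) (s : ℝ) (a : Idx r) (η : (Idx r → ℝ) → ℂ) :
    derivQ a η = fun q => (‖level k s‖ : ℂ) * I / 2 * ladder k s false a η q +
      (‖level k s‖ : ℂ) * I / 2 * ladder k s true a η q := by
  funext q
  have hT : (‖level k s‖ : ℂ) ≠ 0 := by exact_mod_cast (norm_level_pos hk s).ne'
  rw [ladder_true, ladder_false]
  field_simp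
  linear_combination (2 * derivQ a η q) * I_sq

theorem mulQ_linear (a : Idx r) (c d : ℂ) (f g : (Idx r → ℝ) → ℂ) :
    mulQ a (fun q => c * f q + d * g q) = fun q => c * mulQ a f q + d * mulQ a g q := by
  funext q; simp only [mulQ]; ring

theorem derivQ_linear (a : Idx r) (c d : ℂ) {f g : (Idx r → ℝ) → ℂ} (hf : Differentiable ℝ f)
    (hg : Differentiable ℝ g) :
    derivQ a (fun q => c * f q + d * g q) = fun q => c * derivQ a f q + d * derivQ a g q := by
  funext q
  simp only [derivQ]
  rw [fderiv_fun_add ((hf q).const_mul c) ((hg q).const_mul d), fderiv_const_mul (hf q),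
    fderiv_const_mul (hg q)]
  simp

/-- First-order regularity: the function and its images under the ladder operators are
square-integrable. -/
structure LadderRegular (k : ℕ) (s : ℝ) {r : ℕ} (η : (Idx r → ℝ) → ℂ) : Prop where
  contDiff : ContDiff ℝ ∞ η
  memLp : MemLp η 2 volume
  memLp_mulQ : ∀ a, MemLp (mulQ a η) 2 volume
  memLp_derivQ : ∀ a, MemLp (derivQ a η) 2 volume

theorem LadderRegular.of_ladder (hk : 0 < k) {η : (Idx r → ℝ) → ℂ} (h : ContDiff ℝ ∞ η)
    (h2 : MemLp η 2 volume) (hl : ∀ ε a, MemLp (ladder k s ε a η) 2 volume) :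
    LadderRegular k s η where
  contDiff := h
  memLp := h2
  memLp_mulQ a := by
    rw [mulQ_eq_ladder (k := k) (s := s)]
    exact ((hl false a).const_mul _).sub ((hl true a).const_mul _)
  memLp_derivQ a := by
    rw [derivQ_eq_ladder hk s]
    exact ((hl false a).const_mul _).add ((hl true a).const_mul _)

theorem LadderRegular.combination {f g : (Idx r → ℝ) → ℂ} (hf : LadderRegular k s f)
    (hg : LadderRegular k s g) (c d : ℂ) : LadderRegular k s fun q => c * f q + d * g q where
  contDiff := (contDiff_const.mul hf.contDiff).add (contDiff_const.mul hg.contDiff)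
  memLp := (hf.memLp.const_mul c).add (hg.memLp.const_mul d)
  memLp_mulQ a := by
    rw [mulQ_linear]
    exact ((hf.memLp_mulQ a).const_mul c).add ((hg.memLp_mulQ a).const_mul d)
  memLp_derivQ a := by
    rw [derivQ_linear a c d (hf.contDiff.differentiable (by simp))
      (hg.contDiff.differentiable (by simp))]
    exact ((hf.memLp_derivQ a).const_mul c).add ((hg.memLp_derivQ a).const_mul d)

/-- Functions in the domain of the two-fold compositions of ladder operators are second-order
regular. -/
theorem ladderRegular_of_twofold (hk : 0 < k) {η : (Idx r → ℝ) → ℂ} (h : ContDiff ℝ ∞ η)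
    (hη : InTwofoldLadderDomain k s η) :
    LadderRegular k s η ∧ (∀ a, LadderRegular k s (mulQ a η)) ∧
      ∀ a, LadderRegular k s (derivQ a η) := by
  obtain ⟨h0, h1, h2⟩ := hη
  have hl : ∀ ε a, LadderRegular k s (ladder k s ε a η) := fun ε a =>
    .of_ladder hk (contDiff_ladder h ε a) (h1 ε a) fun ε' a' => h2 ε' a' ε a
  refine ⟨.of_ladder hk h h0 h1, fun a => ?_, fun a => ?_⟩
  · rw [mulQ_eq_ladder (k := k) (s := s)]
    simpa only [neg_mul, ← sub_eq_add_neg] using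
      (hl false a).combination (hl true a) (I / 2) (-(I / 2))
  · rw [derivQ_eq_ladder hk s]
    exact (hl false a).combination (hl true a) _ _

variable {η : (Idx r → ℝ) → ℂ}

/-- The formula for the z-derivative of a transform, solved for the transform of q_a η. Thus q_a
acts as (i/T)(∂_a - (T/2) z_a). -/
theorem LadderRegular.segal_mulQ (hk : 0 < k) (h : LadderRegular k s η) (a : Idx r)
    (z : Idx r → ℂ) : segal ‖level k s‖ (mulQ a η) z =
      I / (‖level k s‖ : ℂ) * pd (segal ‖level k s‖ η) a z - I / 2 * z a * segal ‖level k s‖ η z := by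
  have hT : (‖level k s‖ : ℂ) ≠ 0 := by exact_mod_cast (norm_level_pos hk s).ne'
  have e := fderiv_segal_single (norm_level_pos hk s) h.memLp z a
  rw [pd, e]
  field_simp
  have e2 : segal ‖level k s‖ (mulQ a η) z = segal ‖level k s‖ (fun q => (q a : ℂ) * η q) z := rfl
  rw [e2]
  linear_combination (-2 * segal ‖level k s‖ (fun q => (q a : ℂ) * η q) z) * (-I_sq)

/-- Integration by parts expresses this through the transform of q_a η, already known. Thus ∂/∂q_a
acts as i(∂_a + (T/2) z_a). -/
theorem LadderRegular.segal_derivQ (hk : 0 < k) (h : LadderRegular k s η) (a : Idx r)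
    (z : Idx r → ℂ) : segal ‖level k s‖ (derivQ a η) z =
      I * pd (segal ‖level k s‖ η) a z + (‖level k s‖ : ℂ) * I / 2 * z a *
        segal ‖level k s‖ η z := by
  have hT : (‖level k s‖ : ℂ) ≠ 0 := by exact_mod_cast (norm_level_pos hk s).ne'
  have e := segal_fderiv (norm_level_pos hk s) (h.contDiff.differentiable (by simp)) h.memLp a
    (h.memLp_derivQ a) z
  have e2 : segal ‖level k s‖ (derivQ a η) z =
    segal ‖level k s‖ (fun q => fderiv ℝ η q (Pi.single a 1)) z := rfl
  have e3 : segal ‖level k s‖ (mulQ a η) z = segal ‖level k s‖ (fun q => (q a : ℂ) * η q) z := rfl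
  rw [e2, e, ← e3, h.segal_mulQ hk]
  field_simp
  ring

theorem segal_linear {T : ℝ} (hT : 0 < T) {f g : (Idx r → ℝ) → ℂ} (hf : MemLp f 2)
    (hg : MemLp g 2) (c d : ℂ) (z : Idx r → ℂ) :
    segal T (fun q => c * f q + d * g q) z = c * segal T f z + d * segal T g z := by
  simp only [segal]
  rw [← integral_const_mul, ← integral_const_mul, ← integral_add]
  · congr 1; funext q; ring
  · exact (integrable_mul_segalKernel hT hf z).const_mul c
  · exact (integrable_mul_segalKernel hT hg z).const_mul d

/-- The derivative of a transform is a transform. -/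
theorem LadderRegular.pd_segal (hk : 0 < k) (h : LadderRegular k s η) (a : Idx r) :
    pd (segal ‖level k s‖ η) a = segal ‖level k s‖ (fun q =>
      (-(I * (‖level k s‖ : ℂ)) / 2) * mulQ a η q + (-I / 2) * derivQ a η q) := by
  have hT : (‖level k s‖ : ℂ) ≠ 0 := by exact_mod_cast (norm_level_pos hk s).ne'
  funext z
  rw [segal_linear (norm_level_pos hk s) (h.memLp_mulQ a) (h.memLp_derivQ a), h.segal_mulQ hk,
    h.segal_derivQ hk]
  field_simp
  linear_combination (4 * pd (segal ‖level k s‖ η) a z) * I_sq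

/-- The product of a transform with a coordinate is a transform. -/
theorem LadderRegular.coord_mul_segal (hk : 0 < k) (h : LadderRegular k s η) (a : Idx r) :
    (fun z => z a * segal ‖level k s‖ η z) = segal ‖level k s‖ (fun q =>
      I * mulQ a η q + (-I / (‖level k s‖ : ℂ)) * derivQ a η q) := by
  have hT : (‖level k s‖ : ℂ) ≠ 0 := by exact_mod_cast (norm_level_pos hk s).ne'
  funext z
  rw [segal_linear (norm_level_pos hk s) (h.memLp_mulQ a) (h.memLp_derivQ a), h.segal_mulQ hk,
    h.segal_derivQ hk]
  field_simp
  linear_combination (2 * ‖level k s‖ * z a * segal ‖level k s‖ η z) * I_sq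

end Ladder

/-! ### Second-order square-integrability of transforms -/

section SquareIntegrable

open Complex
open scoped ComplexConjugate

variable {r : ℕ} {k : ℕ} {s : ℝ} {τ : ℂ}

/-- Square-integrability with respect to the weight `σ`. -/
def SigmaL2 (T : ℝ) (F : (Idx r → ℂ) → ℂ) : Prop :=
  MemLp (fun z => F z * sigmaZ T z) 2 volume

theorem continuous_sigmaZ (T : ℝ) : Continuous (sigmaZ T : (Idx r → ℂ) → ℂ) := by
  unfold sigmaZ; fun_prop

theorem SigmaL2.const_mul {T : ℝ} {F : (Idx r → ℂ) → ℂ} (hF : SigmaL2 T F) (c : ℂ) :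
    SigmaL2 T fun z => c * F z :=
  (MemLp.const_mul hF c).ae_eq (.of_forall fun z => by simp [mul_assoc])

theorem SigmaL2.sub {T : ℝ} {F G : (Idx r → ℂ) → ℂ} (hF : SigmaL2 T F) (hG : SigmaL2 T G) :
    SigmaL2 T fun z => F z - G z :=
  (MemLp.sub hF hG).ae_eq (.of_forall fun z => by simp [sub_mul])

theorem SigmaL2.sum {ι : Type*} {T : ℝ} {F : ι → (Idx r → ℂ) → ℂ} (t : Finset ι)
    (hF : ∀ i ∈ t, SigmaL2 T (F i)) : SigmaL2 T fun z => ∑ i ∈ t, F i z :=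
  (memLp_finsetSum t hF).ae_eq (.of_forall fun z => by simp [Finset.sum_mul])

/-- Its purpose is to replace a coordinate z_a by z̄_a, which has the same modulus; the covariant
derivatives contain conjugates, while the ladder operators only yield bounds for z_a. -/
theorem SigmaL2.of_norm_eq {T : ℝ} {F G : (Idx r → ℂ) → ℂ} (hF : SigmaL2 T F) (hG : Continuous G)
    (h : ∀ z, ‖G z‖ = ‖F z‖) : SigmaL2 T G :=
  MemLp.of_le hF (hG.mul (continuous_sigmaZ T)).aestronglyMeasurable
    (.of_forall fun z => by simp [h z])

theorem sigmaL2_segal {T : ℝ} (hT : 0 < T) {η : (Idx r → ℝ) → ℂ} (hη : MemLp η 2) :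
    SigmaL2 T (segal T η) :=
  ((memLp_segal hT hη).const_mul (((T / (2 * Real.pi)) ^ (2 * r) : ℝ) : ℂ)).ae_eq
    (.of_forall fun z => by simp only [sigmaZ]; push_cast; ring)

/-- Square-integrable sections in the frame `σ` are square-integrable in all linear coordinates. -/
theorem SigmaL2.memLp (hk : 0 < k) (hτ : 0 < τ.im) {F : (Idx r → ℂ) → ℂ}
    (hF : SigmaL2 ‖level k s‖ F) :
    MemLp (fun A => F (coordZ k s τ A) * frameSigma k s τ A) 2 volume :=
  TorusCS.MemLp.comp_continuousLinearEquiv (zEquiv hk s hτ) hF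

/-- A holomorphic function with enough integrability for the second covariant derivatives. -/
structure SecondOrderRegular (T : ℝ) (F : (Idx r → ℂ) → ℂ) : Prop where
  diff : Differentiable ℂ F
  diff_pd : ∀ a, Differentiable ℂ (pd F a)
  sigmaL2 : SigmaL2 T F
  sigmaL2_coord : ∀ a, SigmaL2 T fun z => z a * F z
  sigmaL2_pd : ∀ a, SigmaL2 T (pd F a)
  sigmaL2_coord_coord : ∀ a b, SigmaL2 T fun z => z a * (z b * F z)
  sigmaL2_coord_pd : ∀ a b, SigmaL2 T fun z => z a * pd F b z
  sigmaL2_pd_pd : ∀ a b, SigmaL2 T (pd (pd F a) b)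

/-- Both z_a and ∂_a take a transform to the transform of a combination of q_a η and ∂η/∂q_a. On the
two-fold domain these combinations are again first-order regular, so the step can be repeated once
and all second-order expressions are transforms of L² functions. -/
theorem secondOrderRegular_segal (hk : 0 < k) {η : (Idx r → ℝ) → ℂ} (h : ContDiff ℝ ∞ η)
    (hη : InTwofoldLadderDomain k s η) :
    SecondOrderRegular ‖level k s‖ (segal ‖level k s‖ η) := by
  obtain ⟨h0, h1, h2⟩ := ladderRegular_of_twofold hk h hη
  have hT := norm_level_pos hk s
  have hc : ∀ (a : Idx r) (c d : ℂ), LadderRegular k s fun q => c * mulQ a η q + d * derivQ a η q :=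
    fun a c d => (h1 a).combination (h2 a) c d
  have first : ∀ {f : (Idx r → ℝ) → ℂ}, LadderRegular k s f →
      (∀ a, SigmaL2 ‖level k s‖ fun z => z a * segal ‖level k s‖ f z) ∧
      (∀ a, SigmaL2 ‖level k s‖ (pd (segal ‖level k s‖ f) a)) := fun hf =>
    ⟨fun a => by
      rw [hf.coord_mul_segal hk]
      exact sigmaL2_segal hT (((hf.memLp_mulQ a).const_mul _).add ((hf.memLp_derivQ a).const_mul _)),
    fun a => by
      rw [hf.pd_segal hk]
      exact sigmaL2_segal hT (((hf.memLp_mulQ a).const_mul _).add ((hf.memLp_derivQ a).const_mul _))⟩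
  refine ⟨differentiable_segal hT h0.memLp, fun a => ?_, sigmaL2_segal hT h0.memLp, (first h0).1,
    (first h0).2, fun a b => ?_, fun a b => ?_, fun a b => ?_⟩
  · rw [h0.pd_segal hk]
    exact differentiable_segal hT (hc _ _ _).memLp
  · simp only [congrFun (h0.coord_mul_segal hk b)]
    exact (first (hc _ _ _)).1 a
  · rw [h0.pd_segal hk]
    exact (first (hc _ _ _)).1 a
  · rw [h0.pd_segal hk]
    exact (first (hc _ _ _)).2 b

variable {T : ℝ} {F : (Idx r → ℂ) → ℂ}

theorem SecondOrderRegular.const_mul (h : SecondOrderRegular T F) (c : ℂ) :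
    SecondOrderRegular T fun z => c * F z := by
  have e : ∀ {G : (Idx r → ℂ) → ℂ}, Differentiable ℂ G → ∀ a,
      pd (fun z => c * G z) a = fun z => c * pd G a z := fun hG a => by
    funext z; simp [pd, fderiv_const_mul (hG z)]
  have e1 := e h.diff
  refine ⟨h.diff.const_mul c, fun a => ?_, h.sigmaL2.const_mul c, fun a => ?_, fun a => ?_,
    fun a b => ?_, fun a b => ?_, fun a b => ?_⟩
  · rw [e1]; exact (h.diff_pd a).const_mul c
  · simpa only [mul_left_comm] using (h.sigmaL2_coord a).const_mul c
  · rw [e1]; exact (h.sigmaL2_pd a).const_mul c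
  · simpa only [mul_left_comm] using (h.sigmaL2_coord_coord a b).const_mul c
  · simp only [e1]; simpa only [mul_left_comm] using (h.sigmaL2_coord_pd a b).const_mul c
  · rw [e1, e (h.diff_pd a)]; exact (h.sigmaL2_pd_pd a b).const_mul c

theorem SecondOrderRegular.sigmaL2_conj_mul (h : SecondOrderRegular T F) (a : Idx r) :
    SigmaL2 T fun z => conj (z a) * F z :=
  (h.sigmaL2_coord a).of_norm_eq
    ((continuous_conj.comp (continuous_apply a)).mul h.diff.continuous) fun z => by simp

theorem SecondOrderRegular.sigmaL2_conj_mul_pd (h : SecondOrderRegular T F) (a b : Idx r) :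
    SigmaL2 T fun z => conj (z a) * pd F b z :=
  (h.sigmaL2_coord_pd a b).of_norm_eq
    ((continuous_conj.comp (continuous_apply a)).mul (h.diff_pd b).continuous) fun z => by simp

theorem SecondOrderRegular.sigmaL2_nabla (h : SecondOrderRegular T F) (a : Idx r) :
    SigmaL2 T (nabla T F a) := by
  convert (h.sigmaL2_pd a).sub ((h.sigmaL2_conj_mul a).const_mul (T / 2)) using 2 with z
  simp only [nabla]; ring

theorem SecondOrderRegular.sigmaL2_nabla2 (h : SecondOrderRegular T F) (c a : Idx r) :
    SigmaL2 T (nabla2 T F c a) := by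
  have h1 : SigmaL2 T fun z => conj (z c) * (conj (z a) * F z) :=
    (h.sigmaL2_coord_coord c a).of_norm_eq ((continuous_conj.comp (continuous_apply c)).mul
      ((continuous_conj.comp (continuous_apply a)).mul h.diff.continuous)) fun z => by simp
  have h2 := ((h.sigmaL2_pd_pd a c).sub ((h.sigmaL2_conj_mul_pd a c).const_mul (T / 2))).sub
    (((h.sigmaL2_conj_mul_pd c a).const_mul (T / 2)).sub (h1.const_mul (T / 2 * (T / 2))))
  convert h2 using 2 with z
  simp only [nabla2, nabla]; ring

/-- Holomorphic functions give holomorphic sections. -/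
theorem isHolomorphicSection_mul_frameSigma (hk : 0 < k) (hτ : 0 < τ.im)
    (hF : Differentiable ℂ F) :
    IsHolomorphicSection k s τ fun A => F (coordZ k s τ A) * frameSigma k s τ A := by
  have hz : Differentiable ℝ fun A : A0C r => coordZ k s τ A := (zEquiv hk s hτ).differentiable
  refine ⟨?_, fun X A => ?_⟩
  · refine ((hF.restrictScalars ℝ).comp hz).mul ?_
    have : Differentiable ℝ (sigmaZ ‖level k s‖ : (Idx r → ℂ) → ℂ) := fun z =>
      (hasFDerivAt_sigmaZ _ z).choose_spec.1.differentiableAt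
    exact this.comp hz
  · rw [covD_holomorphic hk hτ hF, covD_holomorphic hk hτ hF, coordZ_cxIt hk hτ]
    simp only [Pi.smul_apply, smul_eq_mul, mul_assoc, ← Finset.mul_sum]
    linear_combination ((∑ a, coordZ k s τ X a * nabla ‖level k s‖ F a (coordZ k s τ A)) *
      frameSigma k s τ A) * I_sq

/-- The normalising constant of the Bargmann transform. -/
def bargmannConst (k : ℕ) (s : ℝ) (r : ℕ) : ℂ :=
  ((1 / (Real.pi * (1 / ‖level k s‖)) ^ ((2 * r : ℝ) / 4) : ℝ) : ℂ)

theorem bargmann_eq (η : A0C r → ℂ) (A : A0C r) : bargmann k s τ η A =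
    bargmannConst k s r * segal ‖level k s‖ (restrictQ k s τ η) (coordZ k s τ A) := rfl

end SquareIntegrable

/-! ### Polarised functions as functions of q, and the derivative δ_V -/

section Delta

open Complex
open scoped ComplexConjugate

variable {r : ℕ} {k : ℕ} {s : ℝ} {τ : ℂ}

theorem eventually_im_pos (hτ : 0 < τ.im) : ∀ᶠ x : ℂ in nhds τ, 0 < x.im :=
  continuous_im.continuousAt.eventually (eventually_gt_nhds hτ)

theorem differentiableAt_ofReal_re : DifferentiableAt ℝ (fun x : ℂ => (x.re : ℂ)) τ :=
  (hasWirt_re τ).differentiableAt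

theorem differentiableAt_ofReal_im : DifferentiableAt ℝ (fun x : ℂ => (x.im : ℂ)) τ :=
  (hasWirt_im τ).differentiableAt

theorem differentiableAt_frameX (hτ : 0 < τ.im) (a : Idx r) :
    DifferentiableAt ℝ (fun x => frameX (r := r) x a) τ := by
  rw [differentiableAt_pi]
  intro b
  have h := (hasWirt_sqrt_inv hτ).differentiableAt
  have h1 : DifferentiableAt ℝ (fun x : ℂ => if b.1 = 0 then 1 else x) τ := by
    split_ifs <;> fun_prop
  simp only [frameX, div_eq_mul_inv]
  by_cases h2 : b.2 = a.2
  · simp only [h2, if_true]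
    exact ((differentiableAt_const _).mul h1).mul h
  · simp only [h2, if_false]
    exact differentiableAt_const _

theorem differentiableAt_frameY (hτ : 0 < τ.im) (a : Idx r) :
    DifferentiableAt ℝ (fun x => frameY k s (r := r) x a) τ := by
  have h := differentiableAt_pi.1 (differentiableAt_frameX hτ a)
  have hc : ∀ b, DifferentiableAt ℝ (fun x => conj (frameX (r := r) x a b)) τ := fun b =>
    conjCLE.differentiableAt.comp τ (h b)
  have hr := differentiableAt_ofReal_re (τ := τ)
  have hi := differentiableAt_ofReal_im (τ := τ)
  have hv := (hasWirt_im_inv hτ).differentiableAt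
  rw [differentiableAt_pi]
  rintro ⟨i, j⟩
  simp only [frameY]
  fin_cases i
  · simp only [Fin.zero_eta, cxIt_zero, div_eq_mul_inv]
    have h0 := hc (0, j)
    have h1 := hc (1, j)
    exact ((differentiableAt_const _).mul ((hr.mul h0).sub h1)).mul hv
  · simp only [Fin.mk_one, cxIt_one, normSq_tau_eq, div_eq_mul_inv]
    have h0 := hc (0, j)
    have h1 := hc (1, j)
    exact ((differentiableAt_const _).mul ((((hr.pow 2).add (hi.pow 2)).mul h0).sub (hr.mul h1))).mul hv

theorem differentiableAt_coordQ (hk : 0 < k) (hτ : 0 < τ.im) (A : A0C r) (a : Idx r) :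
    DifferentiableAt ℝ (fun x => coordQ k s x A a) τ := by
  obtain ⟨i, j⟩ := a
  have h := (hasWirt_coordQm (s := s) hk hτ A j).differentiableAt
  fin_cases i
  · have e : (fun x => coordQ k s x A (0, j)) =ᶠ[nhds τ] fun x => (coordQm k s x A j).re :=
      (eventually_im_pos hτ).mono fun x hx => coordQ_zero hk hx A j
    exact (reCLM.differentiableAt.comp τ h).congr_of_eventuallyEq e
  · have e : (fun x => coordQ k s x A (1, j)) =ᶠ[nhds τ] fun x => -(coordQm k s x A j).im :=
      (eventually_im_pos hτ).mono fun x hx => coordQ_one hk hx A j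
    exact (imCLM.differentiableAt.comp τ h).neg.congr_of_eventuallyEq e

theorem coordQm_eq_coordQ (hk : 0 < k) (hτ : 0 < τ.im) (A : A0C r) (j : Fin r) :
    coordQm k s τ A j = coordQ k s τ A (0, j) - I * coordQ k s τ A (1, j) := by
  rw [coordQ_zero hk hτ, coordQ_one hk hτ]
  push_cast
  linear_combination -re_add_im (coordQm k s τ A j)

theorem sub_pointQ_mem_polP (hk : 0 < k) (hτ : 0 < τ.im) {A : A0C r} {q : Idx r → ℝ}
    (h : coordQ k s τ A = q) : A - pointQ k s τ q ∈ polP τ := by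
  refine sub_mem_polP_of_coordQm_eq hk (s := s) hτ (funext fun j => ?_)
  rw [coordQm_eq_coordQ hk hτ, coordQm_eq_coordQ hk hτ, coordQ_pointQ hk hτ, h]

theorem IsPolarised.eq_pointQ (hk : 0 < k) (hτ : 0 < τ.im) {η : A0C r → ℂ}
    (hd : Differentiable ℝ η) (h : IsPolarised τ η) (A : A0C r) :
    η A = restrictQ k s τ η (coordQ k s τ A) :=
  h.eq_of_sub_mem hd (sub_pointQ_mem_polP hk hτ rfl)

/-- A polarised function has the same derivative at points that differ by the polarisation. -/
theorem IsPolarised.fderiv_eq {η : A0C r → ℂ} (hd : Differentiable ℝ η)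
    (h : IsPolarised τ η) {A B : A0C r} (hAB : A - B ∈ polP τ) : fderiv ℝ η A = fderiv ℝ η B := by
  have e : (fun C => η (C + (A - B))) = η := funext fun C =>
    h.eq_of_sub_mem hd (by simpa using hAB)
  rw [← congrArg (fun f => fderiv ℝ f B) e]
  simp only [fderiv_comp_add_right]
  rw [add_sub_cancel]

theorem differentiable_slice {U : Set ℂ} {ψ : ℂ → A0C r → ℂ} (hU : IsOpen U)
    (h : ContDiffOn ℝ ∞ (fun x : ℂ × A0C r => ψ x.1 x.2) (U ×ˢ Set.univ)) (hτU : τ ∈ U) :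
    ContDiff ℝ ∞ (ψ τ) := by
  rw [contDiff_iff_contDiffAt]
  intro A
  have h1 := (h (τ, A) ⟨hτU, trivial⟩).contDiffAt
    ((hU.prod isOpen_univ).mem_nhds ⟨hτU, trivial⟩)
  exact h1.comp A (contDiffAt_const.prodMk contDiffAt_id)

/-- On polarised families, `δ_V` differentiates at fixed coordinates `q`. -/
theorem deltaDeriv_eq (hk : 0 < k) {U : Set ℂ} {ψ : ℂ → A0C r → ℂ} (hU : IsOpen U)
    (hUp : ∀ τ ∈ U, 0 < τ.im)
    (h : ContDiffOn ℝ ∞ (fun x : ℂ × A0C r => ψ x.1 x.2) (U ×ˢ Set.univ))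
    (hpol : ∀ τ ∈ U, IsPolarised τ (ψ τ)) (hτU : τ ∈ U) (V : ℂ × ℂ) (A : A0C r) :
    deltaDeriv k s V ψ τ A =
      tderiv V (fun x => ψ x (pointQ k s x (coordQ k s τ A))) τ := by
  have hτ := hUp τ hτU
  set q := coordQ k s τ A with hq
  have hψd : ∀ x ∈ U, Differentiable ℝ (ψ x) := fun x hx =>
    (differentiable_slice hU h hx).differentiable (by simp)
  have hΨ : DifferentiableAt ℝ (fun x : ℂ × A0C r => ψ x.1 x.2) (τ, pointQ k s τ q) :=
    ((h _ ⟨hτU, trivial⟩).contDiffAt ((hU.prod isOpen_univ).mem_nhds ⟨hτU, trivial⟩)).differentiableAt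
      (by simp)
  set L := fderiv ℝ (fun x : ℂ × A0C r => ψ x.1 x.2) (τ, pointQ k s τ q) with hL
  have hc : ∀ a, HasFDerivAt (fun x => coordQ k s x A a) _ τ := fun a =>
    (differentiableAt_coordQ hk hτ A a).hasFDerivAt
  have hY : ∀ a, HasFDerivAt (fun x => frameY k s (r := r) x a) _ τ := fun a =>
    (differentiableAt_frameY hτ a).hasFDerivAt
  have hP := HasFDerivAt.fun_sum (u := Finset.univ) fun a _ => (hc a).smul (hY a)
  have hP0 := HasFDerivAt.fun_sum (u := Finset.univ) fun a _ => (hY a).const_smul (q a)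
  -- By polarisation ψ_x(A) may be evaluated at the point of Q_x with the same coordinates q as A.
  -- This point moves with x through both its coordinates and the frame Y.
  have e0 : (fun x => ψ x A) =ᶠ[nhds τ]
      fun x => ψ x (∑ a, coordQ k s x A a • frameY k s x a) := by
    filter_upwards [hU.mem_nhds hτU] with x hx
    exact (hpol x hx).eq_pointQ hk (s := s) (hUp x hx) (hψd x hx) A
  have hg0 : HasFDerivAt (fun x => ψ x (∑ a, coordQ k s x A a • frameY k s x a)) _ τ :=
    HasFDerivAt.comp τ (g := fun x : ℂ × A0C r => ψ x.1 x.2) hΨ.hasFDerivAt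
      ((hasFDerivAt_id τ).prodMk hP)
  have hg := hg0.congr_of_eventuallyEq e0
  have hh : HasFDerivAt (fun x => ψ x (pointQ k s x q)) _ τ :=
    HasFDerivAt.comp τ (g := fun x : ℂ × A0C r => ψ x.1 x.2) hΨ.hasFDerivAt
      ((hasFDerivAt_id τ).prodMk hP0)
  have hLψ : ∀ X, L (0, X) = fderiv ℝ (ψ τ) A X := by
    intro X
    rw [(hpol τ hτU).fderiv_eq (hψd τ hτU) (sub_pointQ_mem_polP (s := s) hk hτ hq.symm)]
    have h1 : HasFDerivAt (fun B => ψ τ B) _ (pointQ k s τ q) :=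
      HasFDerivAt.comp (pointQ k s τ q) (g := fun x : ℂ × A0C r => ψ x.1 x.2) hΨ.hasFDerivAt
        ((hasFDerivAt_const τ _).prodMk (hasFDerivAt_id _))
    rw [h1.fderiv]
    simp [hL]
  -- The product rule for ∑ q_a(x) Y_a(x) splits the derivative at fixed A into the derivative at
  -- fixed q and the motion of the coordinates q, which is exactly what δ_V subtracts.
  have hdiff : ∀ v, fderiv ℝ (fun x => ψ x A) τ v = fderiv ℝ (fun x => ψ x (pointQ k s x q)) τ v +
      ∑ a, fderiv ℝ (fun x => (coordQ k s x A a : ℂ)) τ v * fderiv ℝ (ψ τ) A (frameY k s τ a) := by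
    intro v
    have e1 : ∀ a, fderiv ℝ (fun x => (coordQ k s x A a : ℂ)) τ v =
        (fderiv ℝ (fun x => coordQ k s x A a) τ v : ℂ) := fun a => by
      have := (ofRealCLM.hasFDerivAt (x := coordQ k s τ A a)).comp τ (hc a)
      have h2 : HasFDerivAt (fun x => (coordQ k s x A a : ℂ)) _ τ := this
      rw [h2.fderiv]; simp
    rw [hg.fderiv, hh.fderiv]
    simp only [e1, ← hLψ]
    have e2 : ∀ a, (fderiv ℝ (fun x => coordQ k s x A a) τ v : ℂ) * L (0, frameY k s τ a) =
        L (0, fderiv ℝ (fun x => coordQ k s x A a) τ v • frameY k s τ a) := fun a => by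
      have : ((0 : ℂ), fderiv ℝ (fun x => coordQ k s x A a) τ v • frameY k s τ a) =
        fderiv ℝ (fun x => coordQ k s x A a) τ v • ((0 : ℂ), frameY k s τ a) := by simp
      rw [this, map_smul, real_smul]
    have e3 : ∀ f : Idx r → A0C r, ∑ a, L (0, f a) = L (0, ∑ a, f a) := fun f =>
      (map_sum (L.comp (ContinuousLinearMap.inr ℝ ℂ (A0C r))) f Finset.univ).symm
    simp only [e2, e3, ContinuousLinearMap.comp_apply, ← hL]
    rw [← map_add, Prod.mk_add_mk, add_zero]
    congr 1
    simp [Finset.sum_add_distrib, hq]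
  -- The terms of δ_V with V[p_a] differentiate along the polarisation and vanish.
  have hX : ∀ a, fderiv ℝ (ψ τ) A (frameX τ a) = 0 := fun a =>
    hpol τ hτU A _ (frameX_mem_polP hτ a)
  simp only [deltaDeriv, hX, mul_zero, zero_add]
  simp only [TorusCS.tderiv, hdiff]
  set y := fun a => fderiv ℝ (ψ τ) A (frameY k s τ a)
  have e : ∀ (c d : Idx r → ℂ), ∑ a, (V.1 * ((c a - I * d a) / 2) + V.2 * ((c a + I * d a) / 2)) *
      y a = V.1 * ((∑ a, c a * y a - I * ∑ a, d a * y a) / 2) +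
        V.2 * ((∑ a, c a * y a + I * ∑ a, d a * y a) / 2) := by
    intro c d
    rw [Finset.mul_sum, ← Finset.sum_sub_distrib, ← Finset.sum_add_distrib, Finset.sum_div,
      Finset.sum_div, Finset.mul_sum, Finset.mul_sum, ← Finset.sum_add_distrib]
    exact Finset.sum_congr rfl fun a _ => by ring
  rw [e]
  ring

end Delta

/-! ### The prequantum connection over the real space in the frame ρ -/

section RealSpace

open Complex
open scoped ComplexConjugate

variable {r : ℕ} {k : ℕ} {s : ℝ} {τ : ℂ}

/-- The inclusion of `A0` as a continuous linear map. -/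
def inclL (r : ℕ) : A0 r →L[ℝ] A0C r :=
  ContinuousLinearMap.pi fun a => ofRealCLM.comp (ContinuousLinearMap.proj a)

/-- The coordinates `q` as a continuous linear map on `A0`. -/
def qIncl (hk : 0 < k) (s : ℝ) (hτ : 0 < τ.im) : A0 r →L[ℝ] (Idx r → ℝ) :=
  (ContinuousLinearMap.pi fun a => imCLM.comp (ContinuousLinearMap.proj a)).comp
    ((zEquiv hk s hτ).toContinuousLinearMap.comp (inclL r))

theorem qIncl_apply (hk : 0 < k) (hτ : 0 < τ.im) (u : A0 r) :
    qIncl hk s hτ u = coordQ k s τ (incl u) := by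
  funext a
  rw [coordQ_eq_im]
  rfl

/-- The frame `ρ` on `A0` as a function of `q`. -/
def rhoQ (s : ℝ) (q : Idx r → ℝ) : ℂ := Complex.exp (-(I * s / 2) * ∑ a, (q a : ℂ) ^ 2)

theorem frameRho_incl_eq (hk : 0 < k) (hτ : 0 < τ.im) (u : A0 r) :
    frameRho k s τ (incl u) = rhoQ s (coordQ k s τ (incl u)) := by
  rw [frameRho_incl hk hτ, rhoQ, Fintype.sum_prod_type_right]
  congr 2
  refine Finset.sum_congr rfl fun j _ => ?_
  rw [coordQm_eq_coordQ hk hτ, Fin.sum_univ_two]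
  simp only [map_sub, map_mul, conj_I, conj_ofReal]
  linear_combination (-(coordQ k s τ (incl u) (1, j) : ℂ) ^ 2) * I_sq

theorem hasFDerivAt_rhoQ (s : ℝ) (q : Idx r → ℝ) :
    ∃ L : (Idx r → ℝ) →L[ℝ] ℂ, HasFDerivAt (rhoQ s) L q ∧
      ∀ v, L v = -(I * s) * (∑ a, (q a : ℂ) * v a) * rhoQ s q := by
  have hp : ∀ a, HasFDerivAt (fun q : Idx r → ℝ => (q a : ℂ)) _ q :=
    fun a => (ofRealCLM.comp (ContinuousLinearMap.proj (R := ℝ) (φ := fun _ : Idx r => ℝ) a)).hasFDerivAt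
  have h := ((HasFDerivAt.fun_sum (u := Finset.univ) fun a _ => (hp a).pow 2).const_mul
    (-(I * s / 2))).cexp
  refine ⟨_, h, fun v => ?_⟩
  simp only [_root_.smul_apply, _root_.sum_apply, smul_eq_mul, ContinuousLinearMap.comp_apply,
    ContinuousLinearMap.proj_apply, ofRealCLM_apply, rhoQ]
  have : ∑ a, (2 : ℕ) • (q a : ℂ) ^ (2 - 1) * (v a : ℂ) = 2 * ∑ a, (q a : ℂ) * v a := by
    rw [Finset.mul_sum]
    exact Finset.sum_congr rfl fun a _ => by simp; ring
  simp only [nsmul_eq_mul] at this ⊢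
  rw [this]
  ring

/-- For real forms u, b the imaginary part of Q_j(u) times the conjugate of Q_j(b) is -1/2 of the
j-th term of ω(u, b); the phase of t drops out of this product. -/
theorem omega_eq (hk : 0 < k) (hτ : 0 < τ.im) (u b : A0 r) :
    omega u b = -2 * ∑ j, (coordQ k s τ (incl u) (0, j) * coordQ k s τ (incl b) (1, j) -
      coordQ k s τ (incl u) (1, j) * coordQ k s τ (incl b) (0, j)) := by
  rw [omega, Finset.mul_sum]
  refine Finset.sum_congr rfl fun j _ => ?_
  have h1 : coordQm k s τ (incl u) j * conj (coordQm k s τ (incl b) j) =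
      ((u (1, j) : ℂ) - τ * u (0, j)) * ((b (1, j) : ℂ) - conj τ * b (0, j)) *
        ((√(2 * τ.im) : ℂ)⁻¹ * (√(2 * τ.im) : ℂ)⁻¹) := by
    simp only [coordQm, incl, map_mul, map_sub, map_inv₀, conj_ofReal]
    linear_combination (((u (1, j) : ℂ) - τ * u (0, j)) * ((b (1, j) : ℂ) - conj τ * b (0, j)) *
      ((√(2 * τ.im) : ℂ)⁻¹ * (√(2 * τ.im) : ℂ)⁻¹)) * phase_mul_conj hk s
  have hν : (√(2 * τ.im) : ℂ)⁻¹ * (√(2 * τ.im) : ℂ)⁻¹ = ((2 * τ.im)⁻¹ : ℝ) := by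
    rw [← ofReal_inv, ← ofReal_mul, ← mul_inv, Real.mul_self_sqrt (by positivity)]
  rw [hν] at h1
  have h2 := congrArg im h1
  rw [coordQm_eq_coordQ hk hτ, coordQm_eq_coordQ hk hτ] at h2
  simp [mul_re, mul_im] at h2
  have h0 := hτ.ne'
  field_simp at h2
  linarith

/-- The connection coefficients over `A0` in the frame `ρ`. -/
def muQ (k : ℕ) (s : ℝ) (a : Idx r) (q : Idx r → ℝ) : ℂ :=
  if a.1 = 0 then -(I * (s * q (0, a.2) + k * q (1, a.2)))
  else -(I * (s * q (1, a.2) - k * q (0, a.2)))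

/-- The covariant derivatives over `A0` in the frame `ρ`. -/
def nablaQ (k : ℕ) (s : ℝ) (a : Idx r) (h : (Idx r → ℝ) → ℂ) (q : Idx r → ℝ) : ℂ :=
  derivQ a h q + muQ k s a q * h q

/-- In the coefficients `muQ` the terms with s come from the derivative of ρ, those with k from the
symplectic potential. -/
theorem covD_A0 (hk : 0 < k) (hτ : 0 < τ.im) {h : (Idx r → ℝ) → ℂ} (hh : Differentiable ℝ h)
    (b u : A0 r) :
    covD (fun A B => (k : ℝ) * omega A B) b
      (fun u => h (coordQ k s τ (incl u)) * rhoQ s (coordQ k s τ (incl u))) u =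
    (∑ a, (coordQ k s τ (incl b) a : ℂ) * nablaQ k s a h (coordQ k s τ (incl u))) *
      rhoQ s (coordQ k s τ (incl u)) := by
  obtain ⟨L, hL, hLv⟩ := hasFDerivAt_rhoQ s (coordQ k s τ (incl u))
  have hq : HasFDerivAt (fun u : A0 r => coordQ k s τ (incl u)) (qIncl hk s hτ) u := by
    simpa only [← qIncl_apply hk hτ] using (qIncl hk s hτ).hasFDerivAt
  have h1 := HasFDerivAt.comp u (((hh (coordQ k s τ (incl u))).hasFDerivAt).mul hL) hq
  have e : (fun u => h (coordQ k s τ (incl u)) * rhoQ s (coordQ k s τ (incl u))) =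
    (h * rhoQ s) ∘ fun u : A0 r => coordQ k s τ (incl u) := rfl
  have hD : ∀ v : Idx r → ℝ, fderiv ℝ h (coordQ k s τ (incl u)) v =
      ∑ a, (v a : ℂ) * derivQ a h (coordQ k s τ (incl u)) := by
    intro v
    conv_lhs => rw [← Finset.univ_sum_single v]
    rw [map_sum]
    refine Finset.sum_congr rfl fun a _ => ?_
    have : (Pi.single a (v a) : Idx r → ℝ) = v a • Pi.single a (1 : ℝ) := by
      rw [← Pi.single_smul]; simp
    rw [this, map_smul, real_smul, derivQ]
  rw [covD, e, h1.fderiv]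
  simp only [ContinuousLinearMap.comp_apply, _root_.add_apply, _root_.smul_apply, hLv, hD,
    qIncl_apply hk hτ, smul_eq_mul, nablaQ, mul_add,
    Finset.sum_add_distrib]
  have hω : ((k : ℝ) * omega u b : ℝ) = (-2 * k : ℂ) *
      ∑ j, ((coordQ k s τ (incl u) (0, j) : ℂ) * coordQ k s τ (incl b) (1, j) -
      coordQ k s τ (incl u) (1, j) * coordQ k s τ (incl b) (0, j)) := by
    rw [omega_eq (s := s) hk hτ]; push_cast; ring
  have hμ : ∑ a, (coordQ k s τ (incl b) a : ℂ) * (muQ k s a (coordQ k s τ (incl u)) *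
      h (coordQ k s τ (incl u))) = (-(I * s) * (∑ a, (coordQ k s τ (incl u) a : ℂ) *
        coordQ k s τ (incl b) a) + I * k * ∑ j, ((coordQ k s τ (incl u) (0, j) : ℂ) *
        coordQ k s τ (incl b) (1, j) - coordQ k s τ (incl u) (1, j) *
        coordQ k s τ (incl b) (0, j))) * h (coordQ k s τ (incl u)) := by
    rw [Fintype.sum_prod_type_right, Fintype.sum_prod_type_right, Finset.mul_sum, Finset.mul_sum,
      ← Finset.sum_add_distrib, Finset.sum_mul]
    refine Finset.sum_congr rfl fun j _ => ?_
    simp only [Fin.sum_univ_two, muQ, one_ne_zero, if_true, if_false]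
    ring
  rw [hω, hμ]
  ring

theorem contDiff_muQ (a : Idx r) : ContDiff ℝ ∞ (muQ k s a) := by
  have := contDiff_coord (r := r)
  unfold muQ
  split_ifs <;> fun_prop

theorem contDiff_nablaQ {h : (Idx r → ℝ) → ℂ} (hh : ContDiff ℝ ∞ h) (a : Idx r) :
    ContDiff ℝ ∞ (nablaQ k s a h) :=
  (contDiff_derivQ hh a).add ((contDiff_muQ a).mul hh)

theorem laplacian_A0 (hk : 0 < k) (hτ : 0 < τ.im) {h : (Idx r → ℝ) → ℂ} (hh : ContDiff ℝ ∞ h)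
    (G : Matrix (Idx r) (Idx r) ℂ) (u : A0 r) :
    laplacian (basisA0 r) (fun A B => (k : ℝ) * omega A B) G
      (fun u => h (coordQ k s τ (incl u)) * rhoQ s (coordQ k s τ (incl u))) u =
    (∑ d, ∑ c, (∑ x, ∑ y, G x y * coordQ k s τ (incl (basisA0 r x)) c *
      coordQ k s τ (incl (basisA0 r y)) d) * nablaQ k s c (nablaQ k s d h)
        (coordQ k s τ (incl u))) * rhoQ s (coordQ k s τ (incl u)) := by
  have e : ∀ y, covD (fun A B => (k : ℝ) * omega A B) (basisA0 r y)
      (fun u => h (coordQ k s τ (incl u)) * rhoQ s (coordQ k s τ (incl u))) =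
      fun u => (fun q => ∑ d, (coordQ k s τ (incl (basisA0 r y)) d : ℂ) * nablaQ k s d h q)
        (coordQ k s τ (incl u)) * rhoQ s (coordQ k s τ (incl u)) := fun y => funext fun u =>
    covD_A0 hk hτ (hh.differentiable (by simp)) _ u
  have hn : ∀ d, Differentiable ℝ (nablaQ k s d h) := fun d =>
    (contDiff_nablaQ hh d).differentiable (by simp)
  have e2 : ∀ (c : Idx r) (w : Idx r → ℂ), nablaQ k s c (fun q => ∑ d, w d * nablaQ k s d h q) =
      fun q => ∑ d, w d * nablaQ k s c (nablaQ k s d h) q := by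
    intro c w
    funext q
    have h3 : HasFDerivAt (fun q => ∑ d, w d * nablaQ k s d h q) _ q :=
      HasFDerivAt.fun_sum (u := Finset.univ) fun d _ => ((hn d) q).hasFDerivAt.const_mul (w d)
    rw [nablaQ, derivQ, h3.fderiv]
    simp only [_root_.sum_apply, _root_.smul_apply, smul_eq_mul]
    rw [Finset.mul_sum, ← Finset.sum_add_distrib]
    refine Finset.sum_congr rfl fun d _ => ?_
    conv_rhs => rw [nablaQ]
    rw [derivQ]; ring
  have e3 : ∀ (w : Idx r → ℂ), Differentiable ℝ (fun q => ∑ d, w d * nablaQ k s d h q) := by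
    intro w
    fun_prop
  simp only [laplacian, e, covD_A0 hk hτ (e3 _), e2]
  simp only [Finset.mul_sum, Finset.sum_mul]
  rw [sum_comm_four]
  rw [Finset.sum_comm]
  refine Finset.sum_congr rfl fun a _ => Finset.sum_congr rfl fun c _ =>
    Finset.sum_congr rfl fun x _ => Finset.sum_congr rfl fun y _ => ?_
  ring

end RealSpace

/-! ### The Hitchin-Witten Laplacians in the coordinates q -/

section RealContraction

open Complex
open scoped ComplexConjugate

variable {r : ℕ} {k : ℕ} {s : ℝ} {τ : ℂ}

/-- On the complexified real space Q_j = q_(0,j) - i q_(1,j) annihilates dx + τ dy, and its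
conjugate annihilates dx + τ̄ dy. This forces the directions (1, -i) and (1, i). -/
theorem coordQ_combination (hk : 0 < k) (hτ : 0 < τ.im) (c : Idx r) (j : Fin r) :
    (∑ l, formBar τ l * coordQ k s τ (incl (basisA0 r (l, j))) c = if c.2 = j then wPlus c.1 *
      (-I * τ.im * phase k s * (√(2 * τ.im) : ℂ)⁻¹) else 0) ∧
    (∑ l, formHol τ l * coordQ k s τ (incl (basisA0 r (l, j))) c = if c.2 = j then wMinus c.1 *
      (I * τ.im * conj (phase k s) * (√(2 * τ.im) : ℂ)⁻¹) else 0) := by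
  obtain ⟨i, j'⟩ := c
  set ν := (√(2 * τ.im) : ℂ)⁻¹ with hν
  have hνc : conj ν = ν := by rw [hν, map_inv₀, conj_ofReal]
  have h0 : ∀ B : A0C r, (coordQ k s τ B (0, j') : ℂ) =
      (coordQm k s τ B j' + conj (coordQm k s τ B j')) / 2 := fun B => by
    rw [coordQm_eq_coordQ hk hτ, map_sub, map_mul, conj_I, conj_ofReal, conj_ofReal]; ring
  have h1 : ∀ B : A0C r, (coordQ k s τ B (1, j') : ℂ) =
      I * (coordQm k s τ B j' - conj (coordQm k s τ B j')) / 2 := fun B => by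
    rw [coordQm_eq_coordQ hk hτ, map_sub, map_mul, conj_I, conj_ofReal, conj_ofReal]
    linear_combination (coordQ k s τ B (1, j') : ℂ) * I_sq
  have hQ : ∀ l, coordQm k s τ (incl (basisA0 r (l, j))) j' = if j' = j then
      phase k s * (if l = 0 then -τ else 1) * ν else 0 := by
    intro l
    rw [coordQm, basisA0_apply, hν]
    by_cases hj : j' = j
    · fin_cases l <;> simp [hj, incl]
    · simp [hj, incl]
  have hd := tau_sub_conj τ
  by_cases hj : j' = j
  · subst hj
    simp only [if_true] at hQ ⊢
    have hb : conj τ = τ - 2 * τ.im * I := by linear_combination -hd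
    clear_value ν
    constructor <;> rw [Fin.sum_univ_two] <;> fin_cases i <;>
      simp only [Fin.zero_eta, Fin.mk_one, h0, h1, hQ] <;>
      simp [hνc, formBar, formHol, wPlus, wMinus, hb] <;> ring_nf
  · simp only [hj, if_false] at hQ ⊢
    constructor <;> fin_cases i <;> simp [h0, h1, hQ]

theorem sum_prod_eq_of_block {M : Type*} [AddCommMonoid M] (f : Idx r → M)
    (j : Fin r) (h : ∀ l i, i ≠ j → f (l, i) = 0) : ∑ x, f x = ∑ l, f (l, j) := by
  rw [Fintype.sum_prod_type_right, Finset.sum_eq_single j]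
  · intro i _ hi
    exact Finset.sum_eq_zero fun l _ => h l i hi
  · simp

/-- Contraction of a block-diagonal bivector of rank one. -/
theorem sum_rankOne (α : ℂ) (f : Fin 2 → ℂ) (w : Fin 2 → ℂ) (v : ℂ) (φ : Idx r → Idx r → ℂ)
    (h : ∀ c j, ∑ l, f l * φ (l, j) c = if c.2 = j then w c.1 * v else 0)
    (G : Matrix (Idx r) (Idx r) ℂ) (hG : ∀ a b : Idx r,
      G a b = if a.2 = b.2 then α * f a.1 * f b.1 else 0) (c d : Idx r) :
    ∑ x, ∑ y, G x y * φ x c * φ y d =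
      if c.2 = d.2 then α * v ^ 2 * (w c.1 * w d.1) else 0 := by
  have h1 : ∀ x : Idx r, ∑ y, G x y * φ x c * φ y d =
      if d.2 = x.2 then α * (f x.1 * φ x c) * (w d.1 * v) else 0 := by
    rintro ⟨l, j⟩
    rw [sum_prod_eq_of_block _ j]
    · have : ∀ l', G (l, j) (l', j) * φ (l, j) c * φ (l', j) d =
          α * (f l * φ (l, j) c) * (f l' * φ (l', j) d) := fun l' => by
        rw [hG, if_pos rfl]; ring
      simp only [this, ← Finset.mul_sum, h]
      split_ifs <;> simp
    · intro l' i hi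
      simp [hG, Ne.symm hi]
  simp only [h1]
  rw [sum_prod_eq_of_block _ d.2]
  · simp only [if_true, ← Finset.mul_sum, ← Finset.sum_mul, h]
    split_ifs
    · ring
    · ring
  · intro l i hi
    simp [Ne.symm hi]

theorem derivQ_muQ (a b : Idx r) (q : Idx r → ℝ) :
    derivQ b (muQ k s a) q = muQ k s a (Pi.single b 1) := by
  let M : (Idx r → ℝ) →ₗ[ℝ] ℂ :=
    { toFun := muQ k s a
      map_add' := fun x y => by
        simp only [muQ, Pi.add_apply]; push_cast; split_ifs <;> ring
      map_smul' := fun c x => by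
        simp only [muQ, Pi.smul_apply, smul_eq_mul, real_smul, RingHom.id_apply]
        push_cast; split_ifs <;> ring }
  have h : HasFDerivAt (muQ k s a) (LinearMap.toContinuousLinearMap M) q :=
    (LinearMap.toContinuousLinearMap M).hasFDerivAt
  rw [derivQ, h.fderiv]
  rfl

theorem nablaQ_nablaQ {f : (Idx r → ℝ) → ℂ} (hf : ContDiff ℝ ∞ f) (a b : Idx r)
    (q : Idx r → ℝ) : nablaQ k s b (nablaQ k s a f) q =
      derivQ b (derivQ a f) q + muQ k s a (Pi.single b 1) * f q + muQ k s a q * derivQ b f q +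
        muQ k s b q * (derivQ a f q + muQ k s a q * f q) := by
  have h1 := ((contDiff_derivQ hf a).differentiable (by simp) q).hasFDerivAt
  have h2 := ((contDiff_muQ (k := k) (s := s) a).differentiable (by simp) q).hasFDerivAt
  have h3 := (hf.differentiable (by simp) q).hasFDerivAt
  have h4 : HasFDerivAt (nablaQ k s a f) _ q := h1.add (h2.mul h3)
  rw [nablaQ, derivQ, h4.fderiv, ← derivQ_muQ a b q]
  simp only [_root_.add_apply, _root_.smul_apply, smul_eq_mul, derivQ, nablaQ]
  ring

/-- Put D = ∂_(0,j) + i∂_(1,j) and w = q_(0,j) + i q_(1,j). The coefficients combine to -t w, and D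
w = 1 + i² = 0, so (D - t w)² expands without a commutator term. -/
theorem sum_nablaQ_wPlus {f : (Idx r → ℝ) → ℂ} (hf : ContDiff ℝ ∞ f) (j : Fin r)
    (q : Idx r → ℝ) :
    ∑ i, ∑ i', wPlus i' * wPlus i * nablaQ k s (i', j) (nablaQ k s (i, j) f) q =
      ∑ i, ∑ i', wPlus i' * wPlus i * derivQ (i', j) (derivQ (i, j) f) q
        - 2 * level k s * (q (0, j) + I * q (1, j)) *
          (derivQ (0, j) f q + I * derivQ (1, j) f q)
        + (level k s) ^ 2 * (q (0, j) + I * q (1, j)) ^ 2 * f q := by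
  simp only [nablaQ_nablaQ hf, Fin.sum_univ_two, wPlus, muQ, level, one_ne_zero, if_true, if_false]
  simp
  ring_nf
  simp only [I_sq, I_pow_three, I_pow_four]
  ring

/-- The conjugate direction: now the connection coefficient is t̄ (q_(0,j) - i q_(1,j)), again
annihilated by ∂_(0,j) - i∂_(1,j). -/
theorem sum_nablaQ_wMinus {f : (Idx r → ℝ) → ℂ} (hf : ContDiff ℝ ∞ f) (j : Fin r)
    (q : Idx r → ℝ) :
    ∑ i, ∑ i', wMinus i' * wMinus i * nablaQ k s (i', j) (nablaQ k s (i, j) f) q =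
      ∑ i, ∑ i', wMinus i' * wMinus i * derivQ (i', j) (derivQ (i, j) f) q
        + 2 * conj (level k s) * (q (0, j) - I * q (1, j)) *
          (derivQ (0, j) f q - I * derivQ (1, j) f q)
        + conj (level k s) ^ 2 * (q (0, j) - I * q (1, j)) ^ 2 * f q := by
  simp only [nablaQ_nablaQ hf, Fin.sum_univ_two, wMinus, muQ, level, one_ne_zero, if_true, if_false]
  simp
  ring_nf
  simp only [I_sq, I_pow_three, I_pow_four]
  ring

theorem laplacian_bivector10_A0 (hk : 0 < k) (hτ : 0 < τ.im) {f : (Idx r → ℝ) → ℂ}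
    (hf : ContDiff ℝ ∞ f) (V : ℂ × ℂ) (u : A0 r) (q : Idx r → ℝ)
    (hq : coordQ k s τ (incl u) = q) :
    laplacian (basisA0 r) (fun A B => (k : ℝ) * omega A B)
      (bivector10 (basisA0 r) omega 1 hodge V τ)
      (fun u => f (coordQ k s τ (incl u)) * rhoQ s (coordQ k s τ (incl u))) u =
    I * V.1 * phase k s ^ 2 / (4 * τ.im) * (∑ j, (∑ i, ∑ i', wPlus i' * wPlus i *
      derivQ (i', j) (derivQ (i, j) f) q
        - 2 * level k s * (q (0, j) + I * q (1, j)) *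
          (derivQ (0, j) f q + I * derivQ (1, j) f q)
        + (level k s) ^ 2 * (q (0, j) + I * q (1, j)) ^ 2 * f q)) * rhoQ s q := by
  have hi : (τ.im : ℂ) ≠ 0 := by exact_mod_cast hτ.ne'
  have hν : ((√(2 * τ.im) : ℂ)⁻¹) ^ 2 = (2 * τ.im : ℂ)⁻¹ := by
    rw [inv_pow, ← ofReal_pow, Real.sq_sqrt (by positivity)]; push_cast; ring
  rw [laplacian_A0 hk hτ hf, hq]
  congr 1
  simp only [sum_rankOne (V.1 / (2 * I * τ.im ^ 2)) (formBar τ) wPlus _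
    (fun x c => (coordQ k s τ (incl (basisA0 r x)) c : ℂ))
    (fun c j => (coordQ_combination (s := s) hk hτ c j).1) _ (fun a b => bivector10_A0 hτ V a b)]
  rw [Fintype.sum_prod_type_right, Finset.mul_sum]
  refine Finset.sum_congr rfl fun j _ => ?_
  rw [← sum_nablaQ_wPlus hf, Finset.mul_sum]
  refine Finset.sum_congr rfl fun i _ => ?_
  rw [sum_prod_eq_of_block _ j, Finset.mul_sum]
  · refine Finset.sum_congr rfl fun i' _ => ?_
    simp only [if_true]
    rw [mul_pow, hν]
    have e : V.1 / (2 * I * (τ.im : ℂ) ^ 2) * ((-I * τ.im * phase k s) ^ 2 * (2 * (τ.im : ℂ))⁻¹) =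
        I * V.1 * phase k s ^ 2 / (4 * τ.im) := by
      field_simp
      ring
    rw [e]; ring
  · intro l j' h
    simp [h]

theorem laplacian_bivector01_A0 (hk : 0 < k) (hτ : 0 < τ.im) {f : (Idx r → ℝ) → ℂ}
    (hf : ContDiff ℝ ∞ f) (V : ℂ × ℂ) (u : A0 r) (q : Idx r → ℝ)
    (hq : coordQ k s τ (incl u) = q) :
    laplacian (basisA0 r) (fun A B => (k : ℝ) * omega A B)
      (bivector01 (basisA0 r) omega 1 hodge V τ)
      (fun u => f (coordQ k s τ (incl u)) * rhoQ s (coordQ k s τ (incl u))) u =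
    -I * V.2 * conj (phase k s) ^ 2 / (4 * τ.im) * (∑ j, (∑ i, ∑ i', wMinus i' * wMinus i *
      derivQ (i', j) (derivQ (i, j) f) q
        + 2 * conj (level k s) * (q (0, j) - I * q (1, j)) *
          (derivQ (0, j) f q - I * derivQ (1, j) f q)
        + conj (level k s) ^ 2 * (q (0, j) - I * q (1, j)) ^ 2 * f q)) * rhoQ s q := by
  have hi : (τ.im : ℂ) ≠ 0 := by exact_mod_cast hτ.ne'
  have hν : ((√(2 * τ.im) : ℂ)⁻¹) ^ 2 = (2 * τ.im : ℂ)⁻¹ := by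
    rw [inv_pow, ← ofReal_pow, Real.sq_sqrt (by positivity)]; push_cast; ring
  rw [laplacian_A0 hk hτ hf, hq]
  congr 1
  simp only [sum_rankOne (-V.2 / (2 * I * τ.im ^ 2)) (formHol τ) wMinus _
    (fun x c => (coordQ k s τ (incl (basisA0 r x)) c : ℂ))
    (fun c j => (coordQ_combination (s := s) hk hτ c j).2) _ (fun a b =>
      (bivector01_A0 hτ V a b).trans (by simp only [neg_div, neg_mul]))]
  rw [Fintype.sum_prod_type_right, Finset.mul_sum]
  refine Finset.sum_congr rfl fun j _ => ?_
  rw [← sum_nablaQ_wMinus hf, Finset.mul_sum]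
  refine Finset.sum_congr rfl fun i _ => ?_
  rw [sum_prod_eq_of_block _ j, Finset.mul_sum]
  · refine Finset.sum_congr rfl fun i' _ => ?_
    simp only [if_true]
    rw [mul_pow, hν]
    have e : -V.2 / (2 * I * (τ.im : ℂ) ^ 2) * ((I * τ.im * conj (phase k s)) ^ 2 *
        (2 * (τ.im : ℂ))⁻¹) = -I * V.2 * conj (phase k s) ^ 2 / (4 * τ.im) := by
      field_simp
      ring
    rw [e]; ring
  · intro l j' h
    simp [h]

end RealContraction

/-! ### The Hitchin-Witten derivative as an operator in q -/

section HitchinWitten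

open Complex
open scoped ComplexConjugate

variable {r : ℕ} {k : ℕ} {s : ℝ} {τ : ℂ}

theorem HasWirt.congr_of_eventuallyEq {F G : ℂ → ℂ} {a b : ℂ} (h : HasWirt F a b τ)
    (e : G =ᶠ[nhds τ] F) : HasWirt G a b τ :=
  HasFDerivAt.congr_of_eventuallyEq h e

theorem hasWirt_coordQ (hk : 0 < k) (hτ : 0 < τ.im) (A : A0C r) (j : Fin r) {a b : ℂ}
    (h : HasWirt (fun x => coordQm k s x A j) a b τ) :
    HasWirt (fun x => (coordQ k s x A (0, j) : ℂ)) ((a + conj b) / 2) ((b + conj a) / 2) τ ∧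
    HasWirt (fun x => (coordQ k s x A (1, j) : ℂ)) (I * (a - conj b) / 2)
      (I * (b - conj a) / 2) τ := by
  constructor
  · refine (((h.add h.conj).const_mul (1 / 2)).congr (by ring) (by ring)).congr_of_eventuallyEq ?_
    filter_upwards [eventually_im_pos hτ] with x hx
    rw [coordQm_eq_coordQ hk hx, map_sub, map_mul, conj_I, conj_ofReal, conj_ofReal]; ring
  · refine (((h.sub h.conj).const_mul (I / 2)).congr (by ring) (by ring)).congr_of_eventuallyEq ?_
    filter_upwards [eventually_im_pos hτ] with x hx
    rw [coordQm_eq_coordQ hk hx, map_sub, map_mul, conj_I, conj_ofReal, conj_ofReal]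
    linear_combination (coordQ k s x A (1, j) : ℂ) * I_sq

theorem coordPp_eq_coordP (hk : 0 < k) (hτ : 0 < τ.im) (A : A0C r) (j : Fin r) :
    coordPp τ A j = coordP k s τ A (0, j) + I * coordP k s τ A (1, j) := by
  rw [coordP_zero hk hτ, coordP_one hk hτ]
  linear_combination -re_add_im (coordPp τ A j)

theorem hasWirt_coordP (hk : 0 < k) (hτ : 0 < τ.im) (A : A0C r) (j : Fin r) {a b : ℂ}
    (h : HasWirt (fun x => coordPp x A j) a b τ) :
    HasWirt (fun x => (coordP k s x A (0, j) : ℂ)) ((a + conj b) / 2) ((b + conj a) / 2) τ ∧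
    HasWirt (fun x => (coordP k s x A (1, j) : ℂ)) (-I * (a - conj b) / 2)
      (-I * (b - conj a) / 2) τ := by
  constructor
  · refine (((h.add h.conj).const_mul (1 / 2)).congr (by ring) (by ring)).congr_of_eventuallyEq ?_
    filter_upwards [eventually_im_pos hτ] with x hx
    rw [coordPp_eq_coordP (s := s) hk hx, map_add, map_mul, conj_I, conj_ofReal, conj_ofReal]; ring
  · refine (((h.sub h.conj).const_mul (-I / 2)).congr (by ring) (by ring)).congr_of_eventuallyEq ?_
    filter_upwards [eventually_im_pos hτ] with x hx
    rw [coordPp_eq_coordP (s := s) hk hx, map_add, map_mul, conj_I, conj_ofReal, conj_ofReal]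
    linear_combination (coordP k s x A (1, j) : ℂ) * I_sq

theorem level_im_eq (hk : 0 < k) (s : ℝ) :
    (s : ℂ) = -I / 2 * (‖level k s‖ * (phase k s - conj (phase k s))) := by
  have h1 := level_eq hk s
  have h2 := congrArg conj h1
  rw [map_mul, conj_ofReal] at h2
  rw [mul_sub, ← h1, ← h2, level]
  simp only [map_add, map_mul, conj_I, conj_ofReal, map_natCast]
  linear_combination (s : ℂ) * I_sq

theorem coordQ_projA0 (hk : 0 < k) (hτ : 0 < τ.im) (A : A0C r) :
    coordQ k s τ (incl (projA0 τ A)) = coordQ k s τ A := by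
  have h := coordQm_projA0 (k := k) (s := s) hτ A
  funext ⟨i, j⟩
  fin_cases i
  · simp [coordQ_zero hk hτ, h]
  · simp [coordQ_one hk hτ, h]

theorem contDiff_restrictQ {η : A0C r → ℂ} (h : ContDiff ℝ ∞ η) :
    ContDiff ℝ ∞ (restrictQ k s τ η) := by
  refine h.comp ?_
  unfold pointQ
  refine ContDiff.sum fun a _ => ?_
  exact (contDiff_apply ℝ ℝ a).smul contDiff_const

theorem derivQ_restrictQ {η : A0C r → ℂ} (h : Differentiable ℝ η) (a : Idx r) (q : Idx r → ℝ) :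
    derivQ a (restrictQ k s τ η) q = fderiv ℝ η (pointQ k s τ q) (frameY k s τ a) := by
  have hp : HasFDerivAt (fun q => pointQ k s τ q) (∑ a : Idx r,
      (ContinuousLinearMap.proj (R := ℝ) (φ := fun _ : Idx r => ℝ) a).smulRight
        (frameY k s τ a)) q := by
    unfold pointQ
    exact HasFDerivAt.fun_sum fun a _ => HasFDerivAt.smul_const
      ((ContinuousLinearMap.proj (R := ℝ) (φ := fun _ : Idx r => ℝ) a).hasFDerivAt) _
  have h1 : HasFDerivAt (restrictQ k s τ η) _ q := (h (pointQ k s τ q)).hasFDerivAt.comp q hp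
  rw [derivQ, h1.fderiv, ContinuousLinearMap.comp_apply]
  congr 1
  rw [_root_.sum_apply, Finset.sum_eq_single a]
  · simp
  · intro b _ hb; simp [hb]
  · simp

/-- The Hitchin-Witten derivative of a polarised family, as a second-order differential operator
in the coordinates `q`. -/
theorem restrictQ_hitchinWittenPol (hk : 0 < k) {U : Set ℂ} {ψ : ℂ → A0C r → ℂ} (hU : IsOpen U)
    (hUp : ∀ τ ∈ U, 0 < τ.im)
    (h : ContDiffOn ℝ ∞ (fun x : ℂ × A0C r => ψ x.1 x.2) (U ×ˢ Set.univ))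
    (hpol : ∀ τ ∈ U, IsPolarised τ (ψ τ)) (hτU : τ ∈ U) (V : ℂ × ℂ) (q : Idx r → ℝ) :
    restrictQ k s τ (hitchinWittenPol k s V ψ τ) q =
      restrictQ k s τ (deltaDeriv k s V ψ τ) q +
      (V.1 + V.2) / (4 * τ.im) * ∑ j, (mulQ (0, j) (derivQ (1, j) (restrictQ k s τ (ψ τ))) q -
        mulQ (1, j) (derivQ (0, j) (restrictQ k s τ (ψ τ))) q) +
      I / (8 * ‖level k s‖ * τ.im) * ∑ j, ∑ i, ∑ i', (V.1 * phase k s * wPlus i' * wPlus i +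
        V.2 * conj (phase k s) * wMinus i' * wMinus i) *
        (derivQ (i', j) (derivQ (i, j) (restrictQ k s τ (ψ τ))) q +
          ‖level k s‖ ^ 2 * mulQ (i', j) (mulQ (i, j) (restrictQ k s τ (ψ τ))) q) := by
  have hτ := hUp τ hτU
  have hi : (τ.im : ℂ) ≠ 0 := by exact_mod_cast hτ.ne'
  have hT : (‖level k s‖ : ℂ) ≠ 0 := by exact_mod_cast (norm_level_pos hk s).ne'
  have hψ := differentiable_slice hU h hτU
  have hψd := hψ.differentiable (by simp)
  set f := restrictQ k s τ (ψ τ) with hf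
  have hfc : ContDiff ℝ ∞ f := contDiff_restrictQ hψ
  -- The polarised extension at a point of Q_τ is computed at the point of `A0` in the same leaf,
  -- which has the same coordinates q.
  set u := projA0 τ (pointQ k s τ q) with hu
  have hq : coordQ k s τ (incl u) = q := by
    rw [hu, coordQ_projA0 hk hτ, coordQ_pointQ hk hτ]
  have hρ : rhoQ s q ≠ 0 := Complex.exp_ne_zero _
  have hχ : (fun u => ψ τ (incl u) * frameRho k s τ (incl u)) =
      fun u => f (coordQ k s τ (incl u)) * rhoQ s (coordQ k s τ (incl u)) := funext fun u => by
    rw [frameRho_incl_eq hk hτ, (hpol τ hτU).eq_pointQ hk (s := s) hτ hψd]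
  -- the derivative of the family at fixed `u`
  have hwψ : HasWirt (fun x => ψ x (incl u)) _ _ τ := hasWirt_tderiv (by
    have h1 := ((h (τ, incl u) ⟨hτU, trivial⟩).contDiffAt
      ((hU.prod isOpen_univ).mem_nhds ⟨hτU, trivial⟩)).differentiableAt (by simp)
    exact h1.comp (f := fun x => (x, incl u)) τ (by fun_prop))
  have hwm := fun j => hasWirt_coordQm (s := s) hk hτ (incl u) j
  have hwρ : HasWirt (fun x => frameRho k s x (incl u)) _ _ τ :=
    (((HasWirt.sum (u := Finset.univ) fun j _ => (hwm j).mul (hwm j).conj).const_mul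
      (-(I * s / 2))).cexp).congr_of_eventuallyEq (by
        filter_upwards [eventually_im_pos hτ] with x hx
        exact frameRho_incl hk hx u)
  -- At a fixed real form the coordinates q vary with τ. Their motion is added to δ_V; there is no
  -- p-contribution since ψ is polarised.
  have hδ : tderiv V (fun x => ψ x (incl u)) τ = restrictQ k s τ (deltaDeriv k s V ψ τ) q +
      ∑ a, tderiv V (fun x => (coordQ k s x (incl u) a : ℂ)) τ * derivQ a f q := by
    have e1 : restrictQ k s τ (deltaDeriv k s V ψ τ) q = deltaDeriv k s V ψ τ (incl u) := by
      rw [restrictQ, deltaDeriv_eq hk hU hUp h hpol hτU, deltaDeriv_eq hk hU hUp h hpol hτU, hq,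
        coordQ_pointQ hk hτ]
    have e2 : ∀ a, derivQ a f q = fderiv ℝ (ψ τ) (incl u) (frameY k s τ a) := fun a => by
      rw [hf, derivQ_restrictQ hψd,
        ← (hpol τ hτU).fderiv_eq hψd (sub_pointQ_mem_polP (s := s) hk hτ hq)]
    have hX : ∀ a, fderiv ℝ (ψ τ) (incl u) (frameX τ a) = 0 := fun a =>
      hpol τ hτU _ _ (frameX_mem_polP hτ a)
    rw [e1, deltaDeriv]
    simp only [e2, hX, mul_zero, zero_add]
    ring
  -- The frame ρ equals 1 on Q_τ, so the extension amounts to division by ρ at u.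
  have hstep : restrictQ k s τ (hitchinWittenPol k s V ψ τ) q =
      hitchinWitten k s V (fun τ' u => ψ τ' (incl u) * frameRho k s τ' (incl u)) τ u /
        rhoQ s q := by
    rw [restrictQ, hitchinWittenPol, polExt, frameRho_pointQ hk hτ, mul_one, ← hu,
      frameRho_incl_eq hk hτ, hq]
  rw [hstep, div_eq_iff hρ, hitchinWitten, hχ, laplacian_bivector10_A0 hk hτ hfc V u q hq,
    laplacian_bivector01_A0 hk hτ hfc V u q hq, (hwψ.mul hwρ).tderiv]
  have hψq : ψ τ (incl u) = f q := by
    rw [(hpol τ hτU).eq_pointQ hk (s := s) hτ hψd, hq]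
  have hδ' := hδ
  rw [hwψ.tderiv] at hδ'
  rw [hψq, frameRho_incl_eq hk hτ, hq]
  have hm : ∀ j, coordQm k s τ (incl u) j = q (0, j) - I * q (1, j) := fun j => by
    rw [coordQm_eq_coordQ hk hτ, hq]
  have hP : ∀ j, coordPp τ (incl u) j = -I * phase k s * (q (0, j) + I * q (1, j)) := fun j => by
    rw [coordPp_incl hk, hm, map_sub, map_mul, conj_I, conj_ofReal, conj_ofReal]; ring
  have hexp : Complex.exp (-(I * s / 2) * ∑ j, coordQm k s τ (incl u) j *
      conj (coordQm k s τ (incl u) j)) = rhoQ s q := by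
    rw [← frameRho_incl hk hτ, frameRho_incl_eq hk hτ, hq]
  rw [hexp]
  set X1 := ∑ j, ((-(I / (4 * τ.im)) * coordQm k s τ (incl u) j -
    phase k s / (2 * τ.im) * coordPp τ (incl u) j) * conj (coordQm k s τ (incl u) j) +
    coordQm k s τ (incl u) j * conj (-(I / (4 * τ.im)) * coordQm k s τ (incl u) j)) with hX1
  set X2 := ∑ j, (-(I / (4 * τ.im)) * coordQm k s τ (incl u) j * conj (coordQm k s τ (incl u) j) +
    coordQm k s τ (incl u) j * conj (-(I / (4 * τ.im)) * coordQm k s τ (incl u) j -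
    phase k s / (2 * τ.im) * coordPp τ (incl u) j)) with hX2
  set S10 := ∑ j, (∑ i, ∑ i', wPlus i' * wPlus i *
      derivQ (i', j) (derivQ (i, j) f) q
        - 2 * level k s * (q (0, j) + I * q (1, j)) *
          (derivQ (0, j) f q + I * derivQ (1, j) f q)
        + (level k s) ^ 2 * (q (0, j) + I * q (1, j)) ^ 2 * f q) with hS10
  set S01 := ∑ j, (∑ i, ∑ i', wMinus i' * wMinus i *
      derivQ (i', j) (derivQ (i, j) f) q
        + 2 * conj (level k s) * (q (0, j) - I * q (1, j)) *
          (derivQ (0, j) f q - I * derivQ (1, j) f q)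
        + conj (level k s) ^ 2 * (q (0, j) - I * q (1, j)) ^ 2 * f q) with hS01
  -- All contributions other than δ_V: motion of q, derivative of ρ, and the two Laplacians. On `A0`
  -- the coordinate P is expressed through Q̄, so both sides become a rational identity in q, the
  -- derivatives of f, T and e, one pair j at a time.
  have key : ∑ a, tderiv V (fun x => (coordQ k s x (incl u) a : ℂ)) τ * derivQ a f q +
      (V.1 * (-(I * s / 2) * X1) + V.2 * (-(I * s / 2) * X2)) * f q -
      1 / 2 * (1 / conj (level k s) * (-I * V.2 * conj (phase k s) ^ 2 / (4 * τ.im) * S01) -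
        1 / level k s * (I * V.1 * phase k s ^ 2 / (4 * τ.im) * S10)) =
      (V.1 + V.2) / (4 * τ.im) * ∑ j, (mulQ (0, j) (derivQ (1, j) f) q -
        mulQ (1, j) (derivQ (0, j) f) q) +
      I / (8 * ‖level k s‖ * τ.im) * ∑ j, ∑ i, ∑ i', (V.1 * phase k s * wPlus i' * wPlus i +
        V.2 * conj (phase k s) * wMinus i' * wMinus i) *
        (derivQ (i', j) (derivQ (i, j) f) q +
          ‖level k s‖ ^ 2 * mulQ (i', j) (mulQ (i, j) f) q) := by
    rw [Fintype.sum_prod_type_right]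
    simp only [hX1, hX2, hS10, hS01, Finset.mul_sum (s := (Finset.univ : Finset (Fin r))),
      Finset.sum_mul (s := (Finset.univ : Finset (Fin r))), ← Finset.sum_add_distrib,
      ← Finset.sum_sub_distrib]
    refine Finset.sum_congr rfl fun j _ => ?_
    obtain ⟨hw0, hw1⟩ := hasWirt_coordQ (s := s) hk hτ (incl u) j (hwm j)
    rw [Fin.sum_univ_two, hw0.tderiv, hw1.tderiv, hm, hP]
    have he := phase_mul_conj hk s
    have hs := level_im_eq hk s
    have hl := level_eq hk s
    have hl' := congrArg conj hl
    rw [map_mul, conj_ofReal] at hl'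
    simp only [Fin.sum_univ_two, wPlus, wMinus, one_ne_zero, if_true, if_false, mulQ, map_sub,
      map_add, map_mul, map_neg, map_div₀, conj_I, conj_ofReal, Complex.conj_ofNat]
    generalize (‖level k s‖ : ℂ) = T at *
    rw [hl', hl, hs]
    have he0 : phase k s ≠ 0 := left_ne_zero_of_mul_eq_one he
    have he' : conj (phase k s) = (phase k s)⁻¹ := (inv_eq_of_mul_eq_one_right he).symm
    rw [he']
    generalize phase k s = e at *
    generalize derivQ (0, j) f q = d0
    generalize derivQ (1, j) f q = d1
    generalize (q (0, j) : ℂ) = q0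
    generalize (q (1, j) : ℂ) = q1
    generalize f q = y
    clear * - hi hT he0
    field_simp
    ring_nf
    simp only [I_sq, I_pow_three, I_pow_four, show I ^ 5 = I by rw [pow_succ, I_pow_four, one_mul]]
    ring
  linear_combination rhoQ s q * hδ' + rhoQ s q * key

end HitchinWitten

/-! ### The Bargmann transform of the Hitchin-Witten operator -/

section HitchinWittenTransform

open Complex
open scoped ComplexConjugate

variable {r : ℕ} {k : ℕ} {s : ℝ} {τ : ℂ}

/-- The differential operator in `q` of the Hitchin-Witten connection. -/
def hwOperator (k : ℕ) (s : ℝ) (V : ℂ × ℂ) (τ : ℂ) (f : (Idx r → ℝ) → ℂ) (q : Idx r → ℝ) : ℂ :=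
  (V.1 + V.2) / (4 * τ.im) * ∑ j, (mulQ (0, j) (derivQ (1, j) f) q -
    mulQ (1, j) (derivQ (0, j) f) q) +
  I / (8 * ‖level k s‖ * τ.im) * ∑ j, ∑ i, ∑ i', (V.1 * phase k s * wPlus i' * wPlus i +
    V.2 * conj (phase k s) * wMinus i' * wMinus i) *
    (derivQ (i', j) (derivQ (i, j) f) q + ‖level k s‖ ^ 2 * mulQ (i', j) (mulQ (i, j) f) q)

/-- The corresponding operator on Bargmann transforms. -/
def hwOperatorZ (k : ℕ) (s : ℝ) (V : ℂ × ℂ) (τ : ℂ) (F : (Idx r → ℂ) → ℂ) (z : Idx r → ℂ) : ℂ :=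
  (V.1 + V.2) / (4 * τ.im) * ∑ j, (z (0, j) * pd F (1, j) z - z (1, j) * pd F (0, j) z) -
  I / (4 * ‖level k s‖ * τ.im) * ∑ j, ∑ i, ∑ i', (V.1 * phase k s * wPlus i' * wPlus i +
    V.2 * conj (phase k s) * wMinus i' * wMinus i) *
    (pd (pd F (i, j)) (i', j) z + ‖level k s‖ ^ 2 / 4 * z (i', j) * z (i, j) * F z)

theorem segal_sum {ι : Type*} {T : ℝ} (hT : 0 < T) (t : Finset ι) {f : ι → (Idx r → ℝ) → ℂ}
    (hf : ∀ i ∈ t, MemLp (f i) 2) (c : ι → ℂ) (z : Idx r → ℂ) :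
    segal T (fun q => ∑ i ∈ t, c i * f i q) z = ∑ i ∈ t, c i * segal T (f i) z := by
  simp only [segal, Finset.sum_mul, ← integral_const_mul]
  rw [integral_finsetSum]
  · simp only [mul_assoc]
  · intro i hi
    simpa only [mul_assoc] using (integrable_mul_segalKernel hT (hf i hi) z).const_mul (c i)

theorem memLp_finset_sum_mul {ι : Type*} (t : Finset ι) {f : ι → (Idx r → ℝ) → ℂ}
    (hf : ∀ i ∈ t, MemLp (f i) 2) (c : ι → ℂ) : MemLp (fun q => ∑ i ∈ t, c i * f i q) 2 :=
  memLp_finsetSum t fun i hi => (hf i hi).const_mul (c i)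

theorem pd_coord_mul {F : (Idx r → ℂ) → ℂ} (hF : Differentiable ℂ F) (a b : Idx r) (z : Idx r → ℂ) :
    pd (fun z => z a * F z) b z = (if a = b then 1 else 0) * F z + z a * pd F b z := by
  have hp : HasFDerivAt (fun z : Idx r → ℂ => z a)
      (ContinuousLinearMap.proj (R := ℂ) (φ := fun _ : Idx r => ℂ) a) z :=
    (ContinuousLinearMap.proj (R := ℂ) (φ := fun _ : Idx r => ℂ) a).hasFDerivAt
  have h := hp.mul (hF z).hasFDerivAt
  have e : (fun z : Idx r → ℂ => z a * F z) = (fun z : Idx r → ℂ => z a) * F := rfl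
  rw [pd, e, h.fderiv]
  simp only [_root_.add_apply, _root_.smul_apply, smul_eq_mul, ContinuousLinearMap.proj_apply,
    Pi.single_apply, pd]
  ring

theorem pd_linear {F G : (Idx r → ℂ) → ℂ} (hF : Differentiable ℂ F) (hG : Differentiable ℂ G)
    (c d : ℂ) (b : Idx r) (z : Idx r → ℂ) :
    pd (fun z => c * F z + d * G z) b z = c * pd F b z + d * pd G b z := by
  have h := ((hF z).hasFDerivAt.const_mul c).add ((hG z).hasFDerivAt.const_mul d)
  have h' : HasFDerivAt (fun z => c * F z + d * G z) _ z := h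
  rw [pd, h'.fderiv]
  simp [pd]

variable {f : (Idx r → ℝ) → ℂ}

theorem mulQ_derivQ_comm (hf : Differentiable ℝ f) {a b : Idx r} (hab : a ≠ b) :
    derivQ b (mulQ a f) = mulQ a (derivQ b f) := by
  funext q
  have hp : HasFDerivAt (fun q : Idx r → ℝ => (q a : ℂ)) _ q :=
    (ofRealCLM.comp (ContinuousLinearMap.proj (R := ℝ) (φ := fun _ : Idx r => ℝ) a)).hasFDerivAt
  have h : HasFDerivAt (mulQ a f) _ q := hp.mul (hf q).hasFDerivAt
  rw [derivQ, h.fderiv]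
  simp [mulQ, derivQ, hab]

/-- The Bargmann transform of the Hitchin-Witten operator. -/
theorem segal_hwOperator (hk : 0 < k) (hf : ContDiff ℝ ∞ f) (h : InTwofoldLadderDomain k s f)
    (V : ℂ × ℂ) (τ : ℂ) : MemLp (hwOperator k s V τ f) 2 ∧
    segal ‖level k s‖ (hwOperator k s V τ f) =
      hwOperatorZ k s V τ (segal ‖level k s‖ f) := by
  obtain ⟨h0, h1, h2⟩ := ladderRegular_of_twofold hk hf h
  have hT := norm_level_pos hk s
  have hT' : (‖level k s‖ : ℂ) ≠ 0 := by exact_mod_cast hT.ne'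
  set F := segal ‖level k s‖ f with hF
  have hFd : Differentiable ℂ F := differentiable_segal hT h0.memLp
  have hF' : ∀ a, Differentiable ℂ (pd F a) := fun a => by
    rw [hF, h0.pd_segal hk]
    exact differentiable_segal hT ((h1 a).combination (h2 a) _ _).memLp
  have hzF : ∀ a, Differentiable ℂ fun z => z a * F z := fun a => by fun_prop
  have sm : ∀ a, segal ‖level k s‖ (mulQ a f) = fun z => I / (‖level k s‖ : ℂ) * pd F a z +
      (-I / 2) * (z a * F z) := fun a => funext fun z => by
    rw [h0.segal_mulQ hk]; ring
  have sd : ∀ a, segal ‖level k s‖ (derivQ a f) = fun z => I * pd F a z +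
      ((‖level k s‖ : ℂ) * I / 2) * (z a * F z) := fun a => funext fun z => by
    rw [h0.segal_derivQ hk]; ring
  -- transforms of products of two operators
  have e1 : ∀ a b z, segal ‖level k s‖ (fun q => derivQ a (derivQ b f) q +
      ‖level k s‖ ^ 2 * mulQ a (mulQ b f) q) z =
      -2 * (pd (pd F b) a z + ‖level k s‖ ^ 2 / 4 * z a * z b * F z) := by
    intro a b z
    have := segal_linear hT ((h2 b).memLp_derivQ a) ((h1 b).memLp_mulQ a) 1 (‖level k s‖ ^ 2) z
    simp only [one_mul] at this
    -- Here i(∂ + (T/2)z) occurs twice and T·(i/T)(∂ - (T/2)z) occurs twice; in the sum the mixed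
    -- terms in z and ∂ cancel.
    rw [this, (h2 b).segal_derivQ hk, (h1 b).segal_mulQ hk, sm, sd, pd_linear (hF' b) (hzF b),
      pd_linear (hF' b) (hzF b), pd_coord_mul hFd]
    field_simp
    ring_nf
    simp only [I_sq]
    ring
  have e2 : ∀ a b : Idx r, a ≠ b → ∀ z, segal ‖level k s‖ (mulQ a (derivQ b f)) z =
      -1 / ‖level k s‖ * pd (pd F b) a z + (z a * pd F b z - z b * pd F a z) / 2 +
        ‖level k s‖ / 4 * z a * z b * F z := by
    intro a b hab z
    rw [(h2 b).segal_mulQ hk, sd, pd_linear (hF' b) (hzF b), pd_coord_mul hFd, if_neg hab.symm]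
    field_simp
    ring_nf
    simp only [I_sq]
    ring
  -- The same transform computed with the commuting operators in the other order, which produces the
  -- other mixed derivative. Using one form for each half of the rotation makes its second-order
  -- terms cancel without appeal to symmetry of second derivatives.
  have e3 : ∀ a b : Idx r, a ≠ b → ∀ z, segal ‖level k s‖ (mulQ a (derivQ b f)) z =
      -1 / ‖level k s‖ * pd (pd F a) b z + (z a * pd F b z - z b * pd F a z) / 2 +
        ‖level k s‖ / 4 * z a * z b * F z := by
    intro a b hab z
    rw [← mulQ_derivQ_comm (hf.differentiable (by simp)) hab, (h1 a).segal_derivQ hk, sm,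
      pd_linear (hF' a) (hzF a), pd_coord_mul hFd, if_neg hab]
    field_simp
    ring_nf
    simp only [I_sq]
    ring
  have mrot : ∀ j : Fin r, MemLp (fun q => mulQ (0, j) (derivQ (1, j) f) q -
      mulQ (1, j) (derivQ (0, j) f) q) 2 := fun j =>
    ((h2 _).memLp_mulQ _).sub ((h2 _).memLp_mulQ _)
  have msec : ∀ a b, MemLp (fun q => derivQ a (derivQ b f) q +
      ‖level k s‖ ^ 2 * mulQ a (mulQ b f) q) 2 := fun a b =>
    ((h2 _).memLp_derivQ _).add (((h1 _).memLp_mulQ _).const_mul _)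
  have srot : ∀ (j : Fin r) z, segal ‖level k s‖ (fun q => mulQ (0, j) (derivQ (1, j) f) q -
      mulQ (1, j) (derivQ (0, j) f) q) z = z (0, j) * pd F (1, j) z - z (1, j) * pd F (0, j) z := by
    intro j z
    have := segal_linear hT ((h2 (1, j)).memLp_mulQ (0, j)) ((h2 (0, j)).memLp_mulQ (1, j)) 1 (-1) z
    simp only [one_mul, neg_one_mul, ← sub_eq_add_neg] at this
    rw [this, e2 _ _ (by simp), e3 _ _ (by simp)]
    ring
  let c : Fin r → Fin 2 → Fin 2 → ℂ := fun _ i i' => V.1 * phase k s * wPlus i' * wPlus i +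
    V.2 * conj (phase k s) * wMinus i' * wMinus i
  have mR := memLp_finset_sum_mul Finset.univ (fun j _ => mrot j) (fun _ => (1 : ℂ))
  have mS := memLp_finset_sum_mul (Finset.univ : Finset (Fin r × Fin 2 × Fin 2))
    (fun x _ => msec (x.2.2, x.1) (x.2.1, x.1)) (fun x => c x.1 x.2.1 x.2.2)
  have e : hwOperator k s V τ f = fun q => (V.1 + V.2) / (4 * τ.im) *
      (∑ j, 1 * (mulQ (0, j) (derivQ (1, j) f) q - mulQ (1, j) (derivQ (0, j) f) q)) +
      I / (8 * ‖level k s‖ * τ.im) * ∑ x : Fin r × Fin 2 × Fin 2, c x.1 x.2.1 x.2.2 *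
      (derivQ (x.2.2, x.1) (derivQ (x.2.1, x.1) f) q +
        ‖level k s‖ ^ 2 * mulQ (x.2.2, x.1) (mulQ (x.2.1, x.1) f) q) := by
    funext q
    simp only [Fintype.sum_prod_type, one_mul]
    rfl
  refine ⟨?_, funext fun z => ?_⟩
  · rw [e]
    exact (mR.const_mul _).add (mS.const_mul _)
  · rw [e, segal_linear hT mR mS, segal_sum hT _ fun j _ => mrot j,
      segal_sum hT _ fun (x : Fin r × Fin 2 × Fin 2) _ => msec (x.2.2, x.1) (x.2.1, x.1)]
    simp only [srot, e1, Fintype.sum_prod_type, one_mul, hwOperatorZ]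
    have aux : ∀ a b c : ℂ, b = -c → a + b = a - c := fun a b c h => by rw [h, sub_eq_add_neg]
    refine aux _ _ _ ?_
    rw [← neg_mul, Finset.mul_sum, Finset.mul_sum]
    refine Finset.sum_congr rfl fun j _ => ?_
    rw [Finset.mul_sum, Finset.mul_sum]
    refine Finset.sum_congr rfl fun i _ => ?_
    rw [Finset.mul_sum, Finset.mul_sum]
    refine Finset.sum_congr rfl fun i' _ => ?_
    simp only [c]
    ring

end HitchinWittenTransform

/-! ### Motion of the holomorphic frame and the intertwining identity -/

section Intertwining

open Complex
open scoped ComplexConjugate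

variable {r : ℕ} {k : ℕ} {s : ℝ} {τ : ℂ}

/-- The Bargmann transform as a function of the holomorphic coordinates. -/
def bargmannZ (k : ℕ) (s : ℝ) (τ : ℂ) (η : A0C r → ℂ) (z : Idx r → ℂ) : ℂ :=
  bargmannConst k s r * segal ‖level k s‖ (restrictQ k s τ η) z

theorem bargmannSection_eq (ψ : ℂ → A0C r → ℂ) : bargmannSection k s ψ τ =
    fun A => bargmannZ k s τ (ψ τ) (coordZ k s τ A) * frameSigma k s τ A := rfl

theorem deltaDeriv_linear (V : ℂ × ℂ) (F : ℂ → A0C r → ℂ) (A : A0C r) :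
    deltaDeriv k s V F τ A =
      V.1 * deltaDeriv k s ddTau F τ A + V.2 * deltaDeriv k s ddTauBar F τ A := by
  simp only [deltaDeriv]
  rw [tderiv_eq V]
  simp only [tderiv_eq V (fun τ' => (coordP k s τ' A _ : ℂ)),
    tderiv_eq V (fun τ' => (coordQ k s τ' A _ : ℂ))]
  simp only [mul_sub, Finset.mul_sum]
  rw [sub_add_sub_comm, ← Finset.sum_add_distrib]
  congr 1
  refine Finset.sum_congr rfl fun a _ => ?_
  ring

theorem fderiv_comp_coordZ (hk : 0 < k) (hτ : 0 < τ.im) {F : (Idx r → ℂ) → ℂ}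
    (hF : Differentiable ℂ F) (A X : A0C r) :
    fderiv ℝ (fun A => F (coordZ k s τ A)) A X = ∑ a, coordZ k s τ X a * pd F a (coordZ k s τ A) := by
  have hz : HasFDerivAt (fun A => coordZ k s τ A) (zEquiv hk s hτ).toContinuousLinearMap A :=
    (zEquiv hk s hτ).hasFDerivAt
  have h := ((hF (coordZ k s τ A)).hasFDerivAt.restrictScalars ℝ).comp A hz
  have h' : HasFDerivAt (fun A => F (coordZ k s τ A)) _ A := h
  rw [h'.fderiv, ← fderiv_eq_sum_pd]
  rfl

/-- The derivative of the frame `σ`. -/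
theorem hasWirt_frameSigma (A : A0C r) {p p' q q' : Idx r → ℂ}
    (hp : ∀ a, HasWirt (fun x => (coordP k s x A a : ℂ)) (p a) (p' a) τ)
    (hq : ∀ a, HasWirt (fun x => (coordQ k s x A a : ℂ)) (q a) (q' a) τ) :
    HasWirt (fun x => frameSigma k s x A)
      (-(‖level k s‖ / 2) * (∑ a, (coordP k s τ A a * p a + coordQ k s τ A a * q a)) *
        frameSigma k s τ A)
      (-(‖level k s‖ / 2) * (∑ a, (coordP k s τ A a * p' a + coordQ k s τ A a * q' a)) *
        frameSigma k s τ A) τ := by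
  have e : (fun x => frameSigma k s x A) = fun x => ((‖level k s‖ : ℂ) / (2 * Real.pi)) ^ (2 * r) *
      Complex.exp (-((‖level k s‖ : ℂ) / 4) * ∑ a, ((coordP k s x A a : ℂ) * coordP k s x A a +
        (coordQ k s x A a : ℂ) * coordQ k s x A a)) := by
    funext x
    have hn : ∀ a, ‖coordZ k s x A a‖ ^ 2 = coordP k s x A a * coordP k s x A a +
        coordQ k s x A a * coordQ k s x A a := fun a => by
      rw [← normSq_eq_norm_sq, normSq_apply, coordP_eq_re, coordQ_eq_im]
    simp only [frameSigma, hn]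
    push_cast
    rfl
  have h := ((((HasWirt.sum (u := Finset.univ) fun a _ => ((hp a).mul (hp a)).add
    ((hq a).mul (hq a))).const_mul (-((‖level k s‖ : ℂ) / 4))).cexp).const_mul
      (((‖level k s‖ : ℂ) / (2 * Real.pi)) ^ (2 * r)))
  have e' : frameSigma k s τ A = _ := congrFun e τ
  rw [e', e]
  have h2 : ∀ p q : Idx r → ℂ, ∑ a, (p a * (coordP k s τ A a : ℂ) + coordP k s τ A a * p a +
      (q a * (coordQ k s τ A a : ℂ) + coordQ k s τ A a * q a)) =
      2 * ∑ a, (coordP k s τ A a * p a + coordQ k s τ A a * q a) := fun p q => by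
    rw [Finset.mul_sum]
    exact Finset.sum_congr rfl fun a _ => by ring
  exact h.congr (by rw [h2]; ring) (by rw [h2]; ring)

theorem pd_const_mul {F : (Idx r → ℂ) → ℂ} (hF : Differentiable ℂ F) (c : ℂ) (a : Idx r) :
    pd (fun z => c * F z) a = fun z => c * pd F a z := by
  funext z; simp [pd, fderiv_const_mul (hF z)]

theorem hwOperatorZ_const_mul {F : (Idx r → ℂ) → ℂ} (hF : Differentiable ℂ F)
    (hF' : ∀ a, Differentiable ℂ (pd F a)) (c : ℂ) (V : ℂ × ℂ) (z : Idx r → ℂ) :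
    hwOperatorZ k s V τ (fun z => c * F z) z = c * hwOperatorZ k s V τ F z := by
  simp only [hwOperatorZ, pd_const_mul hF, pd_const_mul (hF' _)]
  rw [mul_sub, mul_left_comm c, mul_left_comm c]
  simp only [Finset.mul_sum (s := (Finset.univ : Finset (Fin r))) (a := c),
    Finset.mul_sum (s := (Finset.univ : Finset (Fin 2)))]
  congr 2
  · exact Finset.sum_congr rfl fun j _ => by ring
  · exact Finset.sum_congr rfl fun j _ => Finset.sum_congr rfl fun i _ =>
      Finset.sum_congr rfl fun i' _ => by ring

/-- The second-order operator of the complexified Hitchin connection in the frame `σ`. -/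
def hitchinOperator (k : ℕ) (s : ℝ) (V : ℂ × ℂ) (τ : ℂ) (F : (Idx r → ℂ) → ℂ) (z : Idx r → ℂ) : ℂ :=
  -I / τ.im * ∑ j, ∑ i, ∑ i', (V.1 * phase k s * wPlus i' * wPlus i +
      V.2 * conj (phase k s) * wMinus i' * wMinus i) * nabla2 ‖level k s‖ F (i', j) (i, j) z

/-- The transport of the holomorphic coordinates and of the frame `σ` accounts for the difference
of the two second-order operators. -/
theorem transport_identity (hk : 0 < k) (hτ : 0 < τ.im) (F : (Idx r → ℂ) → ℂ)
    (V : ℂ × ℂ) (A : A0C r) :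
    ∑ a, (tderiv V (fun x => (coordP k s x A a : ℂ)) τ * pd F a (coordZ k s τ A) +
        tderiv V (fun x => (coordQ k s x A a : ℂ)) τ * (I * pd F a (coordZ k s τ A))) -
      ‖level k s‖ / 2 * (∑ a, (coordP k s τ A a * tderiv V (fun x => (coordP k s x A a : ℂ)) τ +
        coordQ k s τ A a * tderiv V (fun x => (coordQ k s x A a : ℂ)) τ)) * F (coordZ k s τ A) =
    hwOperatorZ k s V τ F (coordZ k s τ A) -
      1 / (4 * ‖level k s‖) * hitchinOperator k s V τ F (coordZ k s τ A) := by
  have hi : (τ.im : ℂ) ≠ 0 := by exact_mod_cast hτ.ne'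
  have hT : (‖level k s‖ : ℂ) ≠ 0 := by exact_mod_cast (norm_level_pos hk s).ne'
  rw [hwOperatorZ, hitchinOperator, Fintype.sum_prod_type_right, Fintype.sum_prod_type_right]
  simp only [Finset.mul_sum (s := (Finset.univ : Finset (Fin r))),
      Finset.sum_mul (s := (Finset.univ : Finset (Fin r))), ← Finset.sum_sub_distrib]
  refine Finset.sum_congr rfl fun j _ => ?_
  -- The identity is checked in each pair j separately. The values and derivatives of F enter as
  -- independent quantities: on the right the second derivatives cancel, and the terms in z̄ from ∇∇
  -- match the motion of z and of σ.
  obtain ⟨hp0, hp1⟩ := hasWirt_coordP (s := s) hk hτ A j (hasWirt_coordPp (s := s) hk hτ A j)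
  obtain ⟨hq0, hq1⟩ := hasWirt_coordQ (s := s) hk hτ A j (hasWirt_coordQm (s := s) hk hτ A j)
  have he0 : phase k s ≠ 0 := left_ne_zero_of_mul_eq_one (phase_mul_conj hk s)
  have he' : conj (phase k s) = (phase k s)⁻¹ :=
    (inv_eq_of_mul_eq_one_right (phase_mul_conj hk s)).symm
  simp only [Fin.sum_univ_two, hp0.tderiv, hp1.tderiv, hq0.tderiv, hq1.tderiv,
    coordPp_eq_coordP (s := s) hk hτ, coordQm_eq_coordQ hk hτ, wPlus, wMinus, one_ne_zero, if_true,
    if_false, map_sub, map_add, map_mul, map_neg, map_div₀, conj_I, conj_ofReal, conj_conj,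
    Complex.conj_ofNat, nabla2, nabla, coordZ]
  simp only [he']
  generalize (‖level k s‖ : ℂ) = T at *
  generalize phase k s = e at *
  set z : Idx r → ℂ := fun a => (coordP k s τ A a : ℂ) + I * coordQ k s τ A a
  generalize pd F (0, j) z = d0
  generalize pd F (1, j) z = d1
  generalize pd (pd F (0, j)) (0, j) z = d00
  generalize pd (pd F (0, j)) (1, j) z = d01
  generalize pd (pd F (1, j)) (0, j) z = d10
  generalize pd (pd F (1, j)) (1, j) z = d11
  generalize (coordQ k s τ A (0, j) : ℂ) = q0
  generalize (coordQ k s τ A (1, j) : ℂ) = q1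
  generalize (coordP k s τ A (0, j) : ℂ) = p0
  generalize (coordP k s τ A (1, j) : ℂ) = p1
  generalize F z = y
  generalize (τ.im : ℂ) = t2 at *
  generalize V.1 = v1
  generalize V.2 = v2
  clear * - hi hT he0
  field_simp
  ring_nf
  simp only [I_sq, I_pow_three, I_pow_four]
  ring

theorem differentiable_bargmannZ (hk : 0 < k) {η : A0C r → ℂ}
    (hη : MemLp (restrictQ k s τ η) 2) : Differentiable ℂ (bargmannZ k s τ η) :=
  (differentiable_segal (norm_level_pos hk s) hη).const_mul _

/-- The derivative of the transformed family. -/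
theorem tderiv_bargmannSection (hk : 0 < k) {U : Set ℂ} {ψ : ℂ → A0C r → ℂ} (hU : IsOpen U)
    (hUp : ∀ τ ∈ U, 0 < τ.im)
    (h : ContDiffOn ℝ ∞ (fun x : ℂ × A0C r => ψ x.1 x.2) (U ×ˢ Set.univ))
    (hpol : ∀ τ ∈ U, IsPolarised τ (ψ τ)) (hτU : τ ∈ U)
    (hladder : InTwofoldLadderDomain k s (restrictQ k s τ (ψ τ)))
    (hL2 : ∀ V ∈ ({ddTau, ddTauBar} : Set (ℂ × ℂ)),
      MemLp (restrictQ k s τ (deltaDeriv k s V ψ τ)) 2 volume)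
    (hdiff : ∀ A : A0C r, DifferentiableAt ℝ (fun τ' => bargmann k s τ' (ψ τ') A) τ)
    (hcomm : ∀ V ∈ ({ddTau, ddTauBar} : Set (ℂ × ℂ)), ∀ A : A0C r,
      bargmann k s τ (deltaDeriv k s V ψ τ) A =
        deltaDeriv k s V (fun τ' => bargmann k s τ' (ψ τ')) τ A) (V : ℂ × ℂ) :
    MemLp (restrictQ k s τ (hitchinWittenPol k s V ψ τ)) 2 volume ∧
    ∀ A, tderiv V (fun τ' => bargmannSection k s ψ τ' A) τ =
      bargmann k s τ (hitchinWittenPol k s V ψ τ) A * frameSigma k s τ A -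
      1 / (4 * ‖level k s‖) * (hitchinOperator k s V τ (bargmannZ k s τ (ψ τ)) (coordZ k s τ A) *
        frameSigma k s τ A) := by
  have hτ := hUp τ hτU
  have hT := norm_level_pos hk s
  have hf : ContDiff ℝ ∞ (restrictQ k s τ (ψ τ)) :=
    contDiff_restrictQ (differentiable_slice hU h hτU)
  obtain ⟨hm, hseg⟩ := segal_hwOperator hk hf hladder V τ
  have hreg := secondOrderRegular_segal hk hf hladder
  have hm1 := hL2 ddTau (by simp)
  have hm2 := hL2 ddTauBar (by simp)
  have eδ : restrictQ k s τ (deltaDeriv k s V ψ τ) = fun q =>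
      V.1 * restrictQ k s τ (deltaDeriv k s ddTau ψ τ) q +
        V.2 * restrictQ k s τ (deltaDeriv k s ddTauBar ψ τ) q := funext fun q =>
    deltaDeriv_linear V ψ _
  have hδm : MemLp (restrictQ k s τ (deltaDeriv k s V ψ τ)) 2 volume := by
    rw [eδ]; exact (hm1.const_mul _).add (hm2.const_mul _)
  have ehw : restrictQ k s τ (hitchinWittenPol k s V ψ τ) = fun q =>
      1 * restrictQ k s τ (deltaDeriv k s V ψ τ) q +
        1 * hwOperator k s V τ (restrictQ k s τ (ψ τ)) q := funext fun q => by
    rw [restrictQ_hitchinWittenPol hk hU hUp h hpol hτU, hwOperator]; ring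
  refine ⟨?_, fun A => ?_⟩
  · rw [ehw]
    exact (hδm.const_mul _).add (hm.const_mul _)
  set F := bargmannZ k s τ (ψ τ) with hF
  have hFd : Differentiable ℂ F := differentiable_bargmannZ hk hladder.1
  -- The commutation hypothesis for ∂/∂τ and ∂/∂τ̄ extends to V by linearity of δ_V and of the
  -- transform on L².
  have hδ : bargmann k s τ (deltaDeriv k s V ψ τ) A =
      deltaDeriv k s V (fun τ' => bargmann k s τ' (ψ τ')) τ A := by
    rw [deltaDeriv_linear V, ← hcomm ddTau (by simp), ← hcomm ddTauBar (by simp)]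
    simp only [bargmann_eq]
    rw [eδ, segal_linear hT hm1 hm2]
    ring
  have hhw : bargmann k s τ (hitchinWittenPol k s V ψ τ) A =
      bargmann k s τ (deltaDeriv k s V ψ τ) A + hwOperatorZ k s V τ F (coordZ k s τ A) := by
    have e1 : F = fun z => bargmannConst k s r * segal ‖level k s‖ (restrictQ k s τ (ψ τ)) z := rfl
    rw [e1, hwOperatorZ_const_mul hreg.diff hreg.diff_pd, bargmann_eq, bargmann_eq, ehw,
      segal_linear hT hδm hm, hseg]
    ring
  have hB : fderiv ℝ (bargmann k s τ (ψ τ)) A = fderiv ℝ (fun A => F (coordZ k s τ A)) A := rfl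
  have hX : ∀ a, fderiv ℝ (bargmann k s τ (ψ τ)) A (frameX τ a) = pd F a (coordZ k s τ A) := by
    intro a
    rw [hB, fderiv_comp_coordZ hk hτ hFd, coordZ_frameX hk hτ]
    simp [Pi.single_apply]
  have hY : ∀ a, fderiv ℝ (bargmann k s τ (ψ τ)) A (frameY k s τ a) =
      I * pd F a (coordZ k s τ A) := by
    intro a
    rw [hB, fderiv_comp_coordZ hk hτ hFd, coordZ_frameY hk hτ]
    simp [Pi.single_apply]
  have hq : ∀ a, HasWirt (fun x => (coordQ k s x A a : ℂ)) _ _ τ := fun a =>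
    hasWirt_tderiv (ofRealCLM.differentiableAt.comp τ (differentiableAt_coordQ hk hτ A a))
  have hp : ∀ a, HasWirt (fun x => (coordP k s x A a : ℂ)) _ _ τ := fun a => hasWirt_tderiv (by
    obtain ⟨i, j⟩ := a
    obtain ⟨h0, h1⟩ := hasWirt_coordP (s := s) hk hτ A j (hasWirt_coordPp (s := s) hk hτ A j)
    fin_cases i
    · exact h0.differentiableAt
    · exact h1.differentiableAt)
  have hσ := hasWirt_frameSigma A hp hq
  have hwB := hasWirt_tderiv (hdiff A)
  have hmul : tderiv V (fun τ' => bargmannSection k s ψ τ' A) τ = _ := (hwB.mul hσ).tderiv V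
  have hid := transport_identity (s := s) hk hτ F V A
  -- On a holomorphic function of z the vectors X_a and Y_a act as ∂_a and i∂_a, so δ_V removes
  -- precisely the motion of the holomorphic coordinates.
  have hdef : deltaDeriv k s V (fun τ' => bargmann k s τ' (ψ τ')) τ A =
    tderiv V (fun τ' => bargmann k s τ' (ψ τ') A) τ - ∑ a,
      (tderiv V (fun x => (coordP k s x A a : ℂ)) τ * pd F a (coordZ k s τ A) +
        tderiv V (fun x => (coordQ k s x A a : ℂ)) τ * (I * pd F a (coordZ k s τ A))) := by
    simp only [deltaDeriv, hX, hY]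
  have hsum : ∑ a, (coordP k s τ A a * tderiv V (fun x => (coordP k s x A a : ℂ)) τ +
        coordQ k s τ A a * tderiv V (fun x => (coordQ k s x A a : ℂ)) τ) =
      V.1 * ∑ a, (coordP k s τ A a * tderiv ddTau (fun x => (coordP k s x A a : ℂ)) τ +
        coordQ k s τ A a * tderiv ddTau (fun x => (coordQ k s x A a : ℂ)) τ) +
      V.2 * ∑ a, (coordP k s τ A a * tderiv ddTauBar (fun x => (coordP k s x A a : ℂ)) τ +
        coordQ k s τ A a * tderiv ddTauBar (fun x => (coordQ k s x A a : ℂ)) τ) := by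
    rw [Finset.mul_sum, Finset.mul_sum, ← Finset.sum_add_distrib]
    refine Finset.sum_congr rfl fun a _ => ?_
    rw [tderiv_eq V (fun x => (coordP k s x A a : ℂ)), tderiv_eq V (fun x => (coordQ k s x A a : ℂ))]
    ring
  have hFB : bargmann k s τ (ψ τ) A = F (coordZ k s τ A) := rfl
  rw [tderiv_eq V (fun τ' => bargmann k s τ' (ψ τ') A)] at hdef
  rw [hsum] at hid
  rw [hmul, hhw, hδ, hdef, hFB]
  linear_combination frameSigma k s τ A * hid

/-- The complexified Hitchin connection on the transformed family. -/
theorem complexHitchin_bargmannSection (hk : 0 < k) {U : Set ℂ} {ψ : ℂ → A0C r → ℂ} (hU : IsOpen U)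
    (hUp : ∀ τ ∈ U, 0 < τ.im)
    (h : ContDiffOn ℝ ∞ (fun x : ℂ × A0C r => ψ x.1 x.2) (U ×ˢ Set.univ)) (hτU : τ ∈ U)
    (hladder : InTwofoldLadderDomain k s (restrictQ k s τ (ψ τ))) (V : ℂ × ℂ) (A : A0C r) :
    complexHitchin k s V (bargmannSection k s ψ) τ A =
      tderiv V (fun τ' => bargmannSection k s ψ τ' A) τ +
      1 / (4 * ‖level k s‖) * (hitchinOperator k s V τ (bargmannZ k s τ (ψ τ)) (coordZ k s τ A) *
        frameSigma k s τ A) := by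
  have hreg := (secondOrderRegular_segal hk
    (contDiff_restrictQ (differentiable_slice hU h hτU)) hladder).const_mul (bargmannConst k s r)
  rw [complexHitchin, bargmannSection_eq]
  have : laplacian (basisA0C r) (omegaT k s)
      (bivector10 (basisA0C r) (omegaT k s) ‖level k s‖ (cxIt k s) V τ)
      (fun A => bargmannZ k s τ (ψ τ) (coordZ k s τ A) * frameSigma k s τ A) A =
      hitchinOperator k s V τ (bargmannZ k s τ (ψ τ)) (coordZ k s τ A) * frameSigma k s τ A :=
    laplacian_bivector10 hk (hUp τ hτU) (s := s) hreg.diff hreg.diff_pd V A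
  rw [this]
  ring

end Intertwining

/-! ### Integrals of divergences -/

section Divergence

open Complex Filter Topology
open scoped ComplexConjugate

/-- The directional derivatives of a holomorphic function of several variables are continuous. -/
theorem continuous_fderiv_apply_of_differentiable {E : Type*} [NormedAddCommGroup E]
    [NormedSpace ℂ E] {G : E → ℂ} (hG : Differentiable ℂ G) (v : E) :
    Continuous fun z => fderiv ℂ G z v := by
  have hd : ∀ z, Differentiable ℂ fun w : ℂ => G (z + w • v) := fun z =>
    hG.comp ((differentiable_const z).add (differentiable_id.smul_const v))
  -- Cauchy's formula on the unit circle in the complex line through z in the direction v writes the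
  -- derivative as an integral depending continuously on z.
  have key : ∀ z, fderiv ℂ G z v =
      (2 * Real.pi * I : ℂ)⁻¹ • ∮ w in C(0, 1), ((w - 0) ^ 2)⁻¹ • G (z + w • v) := fun z => by
    rw [two_pi_I_inv_smul_circleIntegral_sub_sq_inv_smul_of_differentiable isOpen_univ
      (Set.subset_univ _) (hd z).differentiableOn (Metric.mem_ball_self one_pos)]
    have h1 : HasDerivAt (fun w : ℂ => z + w • v) v 0 := by
      simpa using ((hasDerivAt_id (0 : ℂ)).smul_const v).const_add z
    have h2 : HasFDerivAt G (fderiv ℂ G z) (z + (0 : ℂ) • v) := by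
      simpa using (hG z).hasFDerivAt
    exact (h2.comp_hasDerivAt 0 h1).deriv.symm
  simp only [key, circleIntegral]
  refine Continuous.const_smul ?_ (2 * Real.pi * I : ℂ)⁻¹
  refine intervalIntegral.continuous_parametric_intervalIntegral_of_continuous' ?_ _ _
  have h0 : ∀ x : E × ℝ, (circleMap 0 1 x.2 - 0) ^ 2 ≠ 0 := fun x => by simp
  have h1 : Continuous fun x : E × ℝ => ((circleMap 0 1 x.2 - 0) ^ 2)⁻¹ :=
    Continuous.inv₀ (by fun_prop) h0
  have h2 : Continuous fun x : E × ℝ => G (x.1 + circleMap 0 1 x.2 • v) :=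
    hG.continuous.comp (by fun_prop)
  have h3 : Continuous fun x : E × ℝ => deriv (circleMap 0 1) x.2 := by
    simp only [deriv_circleMap]; fun_prop
  exact h3.smul (h1.smul h2)

/-- The divergence of an integrable vector field `u v`, `v` a constant complex vector field, has
integral zero if it is integrable. -/
theorem integral_fderiv_combination_eq_zero {E : Type*} [NormedAddCommGroup E] [NormedSpace ℝ E]
    [FiniteDimensional ℝ E] [MeasurableSpace E] [BorelSpace E] {μ : Measure E}
    [μ.IsAddHaarMeasure] {u : E → ℂ} (v w : E) (c d : ℂ) (hd : Differentiable ℝ u)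
    (hv : Continuous fun x => fderiv ℝ u x v) (hw : Continuous fun x => fderiv ℝ u x w)
    (hu : Integrable u μ)
    (hi : Integrable (fun x => c * fderiv ℝ u x v + d * fderiv ℝ u x w) μ) :
    ∫ x, (c * fderiv ℝ u x v + d * fderiv ℝ u x w) ∂μ = 0 := by
  let χ : ContDiffBump (0 : E) := ⟨1, 2, one_pos, one_lt_two⟩
  have hχd : ContDiff ℝ ∞ χ := χ.contDiff
  have hχc : HasCompactSupport χ := χ.hasCompactSupport
  have hχ' : Continuous (fderiv ℝ χ) := hχd.continuous_fderiv (by simp)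
  obtain ⟨C, hC⟩ := (hχc.fderiv ℝ).exists_bound_of_continuous hχ'
  -- The cutoffs χ(ε_n x) equal 1 on balls exhausting the space, and their derivatives are of size
  -- ε_n.
  let ε : ℕ → ℝ := fun n => 1 / ((n : ℝ) + 1)
  have hε : Tendsto ε atTop (𝓝 0) := tendsto_one_div_add_atTop_nhds_zero_nat
  have hε0 : ∀ n, 0 < ε n := fun n => by positivity
  let f : ℕ → E → ℂ := fun n x => (χ (ε n • x) : ℂ)
  have hf : ∀ n x, HasFDerivAt (f n) (ofRealCLM ∘L ((fderiv ℝ χ (ε n • x)) ∘L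
      (ε n • ContinuousLinearMap.id ℝ E))) x := fun n x =>
    ofRealCLM.hasFDerivAt.comp x ((hχd.differentiable (by simp) _).hasFDerivAt.comp x
      ((ε n • ContinuousLinearMap.id ℝ E).hasFDerivAt))
  have hfd : ∀ n, Differentiable ℝ (f n) := fun n x => (hf n x).differentiableAt
  have hfv : ∀ n x e, fderiv ℝ (f n) x e = ((ε n * fderiv ℝ χ (ε n • x) e : ℝ) : ℂ) := fun n x e => by
    rw [(hf n x).fderiv]
    simp
  have hfcont : ∀ n e, Continuous fun x => fderiv ℝ (f n) x e := fun n e => by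
    simp only [hfv]
    exact continuous_ofReal.comp (continuous_const.mul
      ((hχ'.comp (continuous_const_smul (ε n))).clm_apply continuous_const))
  have hfc : ∀ n, HasCompactSupport (f n) := fun n => by
    have : HasCompactSupport fun x => χ (ε n • x) :=
      hχc.comp_homeomorph (Homeomorph.smulOfNeZero (ε n) (hε0 n).ne')
    exact this.comp_left (g := ofReal) ofReal_zero
  have hfc' : ∀ n e, HasCompactSupport fun x => fderiv ℝ (f n) x e := fun n e =>
    (hfc n).fderiv_apply ℝ e
  -- Only the combination of the two derivatives is integrable by hypothesis. The compactly
  -- supported cutoff makes each derivative integrable separately, so that integration by parts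
  -- applies.
  have hpart : ∀ n e, (Continuous fun x => fderiv ℝ u x e) →
      Integrable (fun x => f n x * fderiv ℝ u x e) μ ∧
      Integrable (fun x => fderiv ℝ (f n) x e * u x) μ ∧
      ∫ x, f n x * fderiv ℝ u x e ∂μ = -∫ x, fderiv ℝ (f n) x e * u x ∂μ := fun n e he => by
    have i1 : Integrable (fun x => f n x * fderiv ℝ u x e) μ :=
      ((hfd n).continuous.mul he).integrable_of_hasCompactSupport (hfc n).mul_right
    have i2 : Integrable (fun x => fderiv ℝ (f n) x e * u x) μ :=
      ((hfcont n e).mul hd.continuous).integrable_of_hasCompactSupport (hfc' n e).mul_right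
    have i3 : Integrable (fun x => f n x * u x) μ :=
      ((hfd n).continuous.mul hd.continuous).integrable_of_hasCompactSupport (hfc n).mul_right
    exact ⟨i1, i2, integral_mul_fderiv_eq_neg_fderiv_mul_of_integrable i2 i1 i3
      (fun x _ => hfd n x) fun x _ => hd x⟩
  set D : E → ℂ := fun x => c * fderiv ℝ u x v + d * fderiv ℝ u x w with hD
  have hstep : ∀ n, ∫ x, f n x * D x ∂μ =
      -∫ x, (c * fderiv ℝ (f n) x v + d * fderiv ℝ (f n) x w) * u x ∂μ := fun n => by
    obtain ⟨a1, a2, a3⟩ := hpart n v hv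
    obtain ⟨b1, b2, b3⟩ := hpart n w hw
    have e1 : ∀ x, f n x * D x = c * (f n x * fderiv ℝ u x v) + d * (f n x * fderiv ℝ u x w) :=
      fun x => by simp only [hD]; ring
    have e2 : ∀ x, (c * fderiv ℝ (f n) x v + d * fderiv ℝ (f n) x w) * u x =
        c * (fderiv ℝ (f n) x v * u x) + d * (fderiv ℝ (f n) x w * u x) := fun x => by ring
    simp only [e1, e2]
    rw [integral_add (a1.const_mul c) (b1.const_mul d), integral_add (a2.const_mul c)
      (b2.const_mul d)]
    simp only [integral_const_mul, a3, b3]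
    ring
  have hl : Tendsto (fun n => ∫ x, f n x * D x ∂μ) atTop (𝓝 (∫ x, D x ∂μ)) := by
    refine tendsto_integral_of_dominated_convergence (fun x => ‖D x‖)
      (fun n => (hfd n).continuous.aestronglyMeasurable.mul hi.aestronglyMeasurable) hi.norm
      (fun n => .of_forall fun x => ?_) (.of_forall fun x => ?_)
    · rw [norm_mul]
      refine mul_le_of_le_one_left (norm_nonneg _) ?_
      simp only [f, norm_real, Real.norm_eq_abs, abs_of_nonneg χ.nonneg]
      exact χ.le_one
    · have h1 : Tendsto (fun n => χ (ε n • x)) atTop (𝓝 (χ ((0 : ℝ) • x))) :=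
        (hχd.continuous.tendsto _).comp (hε.smul_const x)
      have h2 : χ ((0 : ℝ) • x) = 1 := χ.one_of_mem_closedBall (by simp [χ])
      rw [h2] at h1
      simpa using ((continuous_ofReal.tendsto _).comp h1).mul_const (D x)
  -- After integration by parts only derivatives of the cutoff remain; they are O(ε_n) against the
  -- integrable u.
  have hr : Tendsto (fun n => -∫ x, (c * fderiv ℝ (f n) x v + d * fderiv ℝ (f n) x w) * u x ∂μ)
      atTop (𝓝 0) := by
    set K := ‖c‖ * (C * ‖v‖) + ‖d‖ * (C * ‖w‖) with hK
    refine squeeze_zero_norm (a := fun n => ε n * (K * ∫ x, ‖u x‖ ∂μ)) (fun n => ?_) ?_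
    · rw [norm_neg, ← integral_const_mul, ← integral_const_mul]
      refine norm_integral_le_of_norm_le ((hu.norm.const_mul _).const_mul _) (.of_forall fun x => ?_)
      rw [norm_mul, ← mul_assoc]
      refine mul_le_mul_of_nonneg_right ((norm_add_le _ _).trans ?_) (norm_nonneg _)
      have hb : ∀ e, ‖fderiv ℝ (f n) x e‖ ≤ ε n * (C * ‖e‖) := fun e => by
        rw [hfv, norm_real, norm_mul, Real.norm_of_nonneg (hε0 n).le]
        refine mul_le_mul_of_nonneg_left ?_ (hε0 n).le
        exact (ContinuousLinearMap.le_opNorm _ _).trans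
          (mul_le_mul_of_nonneg_right (hC _) (norm_nonneg _))
      rw [norm_mul, norm_mul]
      have h1 := mul_le_mul_of_nonneg_left (hb v) (norm_nonneg c)
      have h2 := mul_le_mul_of_nonneg_left (hb w) (norm_nonneg d)
      rw [hK]
      linarith
    · simpa using hε.mul_const (K * ∫ x, ‖u x‖ ∂μ)
  simp only [hstep] at hl
  exact tendsto_nhds_unique hl hr

end Divergence

/-! ### Orthogonality of the Laplacian term to holomorphic sections -/

section Orthogonality

open Complex
open scoped ComplexConjugate

variable {r : ℕ} {k : ℕ} {s : ℝ} {τ : ℂ}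

/-- Holomorphic sections are holomorphic functions times the frame `σ`. -/
theorem IsHolomorphicSection.exists_eq_mul (hk : 0 < k) (hτ : 0 < τ.im) {φ : A0C r → ℂ}
    (hφ : IsHolomorphicSection k s τ φ) : ∃ G : (Idx r → ℂ) → ℂ, Differentiable ℂ G ∧
      φ = fun A => G (coordZ k s τ A) * frameSigma k s τ A := by
  have hσ : Differentiable ℝ (sigmaZ ‖level k s‖ : (Idx r → ℂ) → ℂ) := fun z =>
    (hasFDerivAt_sigmaZ _ z).choose_spec.1.differentiableAt
  have hσ0 := fun z => sigmaZ_ne_zero hk s (r := r) z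
  set G : (Idx r → ℂ) → ℂ := fun z => φ ((zEquiv hk s hτ).symm z) * (sigmaZ ‖level k s‖ z)⁻¹ with hG
  have hd : Differentiable ℝ G :=
    (hφ.1.comp (zEquiv hk s hτ).symm.differentiable).mul (hσ.inv hσ0)
  have e : φ = fun A => G (coordZ k s τ A) * frameSigma k s τ A := by
    funext A
    have h1 : (zEquiv hk s hτ).symm (coordZ k s τ A) = A := (zEquiv hk s hτ).symm_apply_apply A
    simp only [hG, h1, frameSigma_eq]
    rw [mul_assoc, inv_mul_cancel₀ (hσ0 _), mul_one]
  refine ⟨G, fun z => ?_, e⟩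
  refine (differentiableAt_iff_restrictScalars ℝ (hd z)).2 ?_
  -- Since σ is a holomorphic frame, the zeroth-order terms cancel in ∇^{0,1}(Gσ) = 0, and what
  -- remains are the Cauchy-Riemann equations for G.
  have hI : ∀ v, fderiv ℝ G z (I • v) = I * fderiv ℝ G z v := fun v => by
    set A := (zEquiv hk s hτ).symm z with hA
    set X := (zEquiv hk s hτ).symm v with hX
    have hzA : coordZ k s τ A = z := (zEquiv hk s hτ).apply_symm_apply z
    have hzX : coordZ k s τ X = v := (zEquiv hk s hτ).apply_symm_apply v
    have hσA : frameSigma k s τ A ≠ 0 := hσ0 _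
    have h := hφ.2 X A
    rw [e, covD_mul_frameSigma hk hτ (hd _).hasFDerivAt, covD_mul_frameSigma hk hτ
      (hd _).hasFDerivAt, coordZ_cxIt hk hτ, hzA, hzX] at h
    have h2 : ∑ a, conj (z a) * (I • v) a = I * ∑ a, conj (z a) * v a := by
      rw [Finset.mul_sum]
      exact Finset.sum_congr rfl fun a _ => by simp only [Pi.smul_apply, smul_eq_mul]; ring
    rw [h2] at h
    have h3 : (fderiv ℝ G z v + I * fderiv ℝ G z (I • v)) * frameSigma k s τ A = 0 := by
      linear_combination h + (‖level k s‖ : ℂ) / 2 * (∑ a, conj (z a) * v a) * G z *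
        frameSigma k s τ A * I_sq
    have h4 := (mul_eq_zero.1 h3).resolve_right hσA
    linear_combination -I * h4 + fderiv ℝ G z (I • v) * I_sq
  refine ⟨{ toFun := fderiv ℝ G z, map_add' := map_add _, map_smul' := fun c v => ?_,
            cont := (fderiv ℝ G z).continuous }, rfl⟩
  have hc : c • v = c.re • v + c.im • (I • v) := by
    conv_lhs => rw [← re_add_im c, add_smul, mul_smul]
    simp
  rw [hc, map_add, map_smul, map_smul, hI, RingHom.id_apply, real_smul, real_smul, smul_eq_mul]
  conv_rhs => rw [← re_add_im c]
  ring

theorem continuous_pd {F : (Idx r → ℂ) → ℂ} (hF : Differentiable ℂ F) (a : Idx r) :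
    Continuous (pd F a) :=
  continuous_fderiv_apply_of_differentiable hF _

/-- Covariant derivatives along `(1,0)`-vectors are orthogonal to holomorphic sections. -/
theorem integral_nabla2_mul_conj_eq_zero (hk : 0 < k) (hτ : 0 < τ.im) {F : (Idx r → ℂ) → ℂ}
    (hF : SecondOrderRegular ‖level k s‖ F) (c a : Idx r) {φ : A0C r → ℂ}
    (hφ : IsHolomorphicSection k s τ φ) (hm : MemLp φ 2) :
    ∫ A, nabla2 ‖level k s‖ F c a (coordZ k s τ A) * frameSigma k s τ A * conj (φ A) = 0 := by
  obtain ⟨G, hG, rfl⟩ := hφ.exists_eq_mul hk hτ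
  set T := ‖level k s‖ with hT
  let Z : A0C r →L[ℝ] (Idx r → ℂ) := (zEquiv hk s hτ).toContinuousLinearMap
  have hZ : ∀ A, Z A = coordZ k s τ A := fun A => rfl
  -- The Hermitian product of the first covariant derivative ∇_a F σ with the holomorphic section
  -- Gσ; the integrand of the claim is its derivative in z_c.
  let W : (Idx r → ℂ) → ℂ := fun z => nabla T F a z * (sigmaZ T z * sigmaZ T z) * conj (G z)
  let D : (Idx r → ℂ) → (Idx r → ℂ) → ℂ := fun z v =>
    ((∑ b, v b * (pd (pd F a) b z - T / 2 * conj (z a) * pd F b z) - T / 2 * conj (v a) * F z) -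
      (T / 2 * ∑ b, (conj (z b) * v b + z b * conj (v b))) * nabla T F a z) *
      (sigmaZ T z * sigmaZ T z) * conj (G z) +
    nabla T F a z * (sigmaZ T z * sigmaZ T z) * conj (∑ b, v b * pd G b z)
  have hW : ∀ z, ∃ L : (Idx r → ℂ) →L[ℝ] ℂ, HasFDerivAt W L z ∧ ∀ v, L v = D z v := fun z => by
    obtain ⟨L1, h1, e1⟩ := hasFDerivAt_nabla T hF.diff hF.diff_pd a z
    obtain ⟨L2, h2, e2⟩ := hasFDerivAt_sigmaZ T z
    have h3 : HasFDerivAt (fun z => conj (G z)) _ z :=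
      (conjCLE.hasFDerivAt (x := G z)).comp z ((hG z).hasFDerivAt.restrictScalars ℝ)
    refine ⟨_, (h1.mul (h2.mul h2)).mul h3, fun v => ?_⟩
    simp only [_root_.add_apply, _root_.smul_apply, ContinuousLinearMap.comp_apply,
      ContinuousLinearMap.coe_restrictScalars', fderiv_eq_sum_pd, e1, e2, smul_eq_mul,
      ContinuousLinearEquiv.coe_coe, conjCLE_apply, Pi.mul_apply, D]
    ring
  have hu : ∀ A, HasFDerivAt (fun A => W (Z A)) _ A := fun A =>
    (hW (Z A)).choose_spec.1.comp A Z.hasFDerivAt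
  have huD : ∀ A X, fderiv ℝ (fun A => W (Z A)) A X = D (Z A) (Z X) := fun A X => by
    rw [(hu A).fderiv]
    exact (hW (Z A)).choose_spec.2 _
  have hDc : ∀ v, Continuous fun z => D z v := fun v => by
    have c1 := fun b => continuous_pd (hF.diff_pd a) b
    have c2 := fun b => continuous_pd hF.diff b
    have c3 := fun b => continuous_pd hG b
    have c4 := hF.diff.continuous
    have c5 := hG.continuous
    have c6 := continuous_sigmaZ (r := r) T
    have c7 : Continuous (nabla T F a) := by unfold nabla; fun_prop
    simp only [D]
    fun_prop
  obtain ⟨X, hX⟩ : ∃ X, Z X = Pi.single c 1 := (zEquiv hk s hτ).surjective _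
  obtain ⟨Y, hY⟩ : ∃ Y, Z Y = Pi.single c I := (zEquiv hk s hτ).surjective _
  -- The vectors X, Y have coordinates e_c and i e_c, so (∂_X - i∂_Y)/2 = ∂/∂z_c. It annihilates the
  -- conjugate of G, and on σ² it gives -(T/2) z̄_c σ², which completes the covariant derivative.
  have hcomb : ∀ A, 1 / 2 * fderiv ℝ (fun A => W (Z A)) A X +
      -I / 2 * fderiv ℝ (fun A => W (Z A)) A Y =
      nabla2 T F c a (coordZ k s τ A) * frameSigma k s τ A *
        conj (G (coordZ k s τ A) * frameSigma k s τ A) := fun A => by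
    have hσ : conj (frameSigma k s τ A) = frameSigma k s τ A := by
      simp only [frameSigma, conj_ofReal]
    have hσ' : sigmaZ T (coordZ k s τ A) = frameSigma k s τ A := rfl
    have hca : (Pi.single c I : Idx r → ℂ) a = I * (Pi.single c 1 : Idx r → ℂ) a := by
      by_cases h : a = c <;> simp [h]
    have hca' : conj ((Pi.single c 1 : Idx r → ℂ) a) = (Pi.single c 1 : Idx r → ℂ) a := by
      by_cases h : a = c <;> simp [h]
    rw [huD, huD, hX, hY, hZ]
    simp only [D, hca, map_mul, hca', map_sum, conj_I, hσ, hσ']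
    generalize (Pi.single c 1 : Idx r → ℂ) a = δ
    simp only [Pi.single_apply, ite_mul, mul_ite, apply_ite conj, conj_I, map_one, map_zero,
      one_mul, mul_one, zero_mul, mul_zero, Finset.sum_ite_eq', Finset.sum_add_distrib,
      Finset.mem_univ, if_true]
    simp only [nabla2]
    ring_nf
    simp only [I_sq]
    ring
  have hGm : MemLp (fun A => conj (G (coordZ k s τ A) * frameSigma k s τ A)) 2 := hm.star
  have hn := (hF.sigmaL2_nabla a).memLp hk hτ
  have hn2 := (hF.sigmaL2_nabla2 c a).memLp hk hτ
  have key := integral_fderiv_combination_eq_zero (μ := (volume : Measure (A0C r)))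
    (u := fun A => W (Z A)) X Y (1 / 2) (-I / 2) (fun A => (hu A).differentiableAt)
    (by simp only [huD]; exact (hDc _).comp Z.continuous)
    (by simp only [huD]; exact (hDc _).comp Z.continuous)
    ((hn.integrable_mul hGm).congr (.of_forall fun A => ?_))
    ((hn2.integrable_mul hGm).congr (.of_forall fun A => (hcomb A).symm))
  · simpa only [hcomb] using key
  · have hσ : conj (frameSigma k s τ A) = frameSigma k s τ A := by
      simp only [frameSigma, conj_ofReal]
    have hσ' : sigmaZ T (coordZ k s τ A) = frameSigma k s τ A := rfl
    simp only [W, hZ, map_mul, hσ, hσ', Pi.mul_apply]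
    ring

/-- The second-order operator of the complexified Hitchin connection takes values orthogonal to
holomorphic sections. -/
theorem integral_hitchinOperator_mul_conj_eq_zero (hk : 0 < k) (hτ : 0 < τ.im)
    {F : (Idx r → ℂ) → ℂ} (hF : SecondOrderRegular ‖level k s‖ F) (V : ℂ × ℂ) {φ : A0C r → ℂ}
    (hφ : IsHolomorphicSection k s τ φ) (hm : MemLp φ 2) :
    ∫ A, hitchinOperator k s V τ F (coordZ k s τ A) * frameSigma k s τ A * conj (φ A) = 0 := by
  have hi : ∀ c a, Integrable fun A => nabla2 ‖level k s‖ F c a (coordZ k s τ A) *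
      frameSigma k s τ A * conj (φ A) := fun c a =>
    ((hF.sigmaL2_nabla2 c a).memLp hk hτ).integrable_mul hm.star
  simp only [hitchinOperator, mul_assoc, Finset.sum_mul, integral_const_mul]
  have e : ∀ j i i', Integrable fun A => (V.1 * (phase k s * (wPlus i' * wPlus i)) +
      V.2 * (conj (phase k s) * (wMinus i' * wMinus i))) *
      (nabla2 ‖level k s‖ F (i', j) (i, j) (coordZ k s τ A) *
        (frameSigma k s τ A * conj (φ A))) := fun j i i' => by
    simpa only [mul_assoc] using (hi (i', j) (i, j)).const_mul
      (V.1 * (phase k s * (wPlus i' * wPlus i)) + V.2 * (conj (phase k s) * (wMinus i' * wMinus i)))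
  rw [integral_finsetSum _ fun j _ => integrable_finsetSum _ fun i _ => integrable_finsetSum _
    fun i' _ => e j i i']
  have h0 : ∀ c a, ∫ A, nabla2 ‖level k s‖ F c a (coordZ k s τ A) *
      (frameSigma k s τ A * conj (φ A)) = 0 := fun c a => by
    simpa only [mul_assoc] using integral_nabla2_mul_conj_eq_zero hk hτ hF c a hφ hm
  have : ∀ j, ∫ A, ∑ i, ∑ i', (V.1 * (phase k s * (wPlus i' * wPlus i)) +
      V.2 * (conj (phase k s) * (wMinus i' * wMinus i))) *
      (nabla2 ‖level k s‖ F (i', j) (i, j) (coordZ k s τ A) *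
        (frameSigma k s τ A * conj (φ A))) = 0 := fun j => by
    rw [integral_finsetSum _ fun i _ => integrable_finsetSum _ fun i' _ => e j i i']
    refine Finset.sum_eq_zero fun i _ => ?_
    rw [integral_finsetSum _ fun i' _ => e j i i']
    refine Finset.sum_eq_zero fun i' _ => ?_
    rw [integral_const_mul, h0, mul_zero]
  simp only [this, Finset.sum_const_zero, mul_zero]

theorem sigmaL2_hitchinOperator {T : ℝ} (hT : T = ‖level k s‖) {F : (Idx r → ℂ) → ℂ}
    (hF : SecondOrderRegular T F) (V : ℂ × ℂ) : SigmaL2 T (hitchinOperator k s V τ F) := by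
  subst hT
  exact (SigmaL2.sum _ fun j _ => SigmaL2.sum _ fun i _ => SigmaL2.sum _ fun i' _ =>
    (hF.sigmaL2_nabla2 (i', j) (i, j)).const_mul _).const_mul _

/-- A holomorphic section is the projection of its sum with a section orthogonal to the
holomorphic ones. -/
theorem l2Connection_eq {V : ℂ × ℂ} {φ : ℂ → A0C r → ℂ} {h n : A0C r → ℂ}
    (hh : IsHolomorphicSection k s τ h) (hh2 : MemLp h 2) (hn : MemLp n 2)
    (hφ : ∀ A, tderiv V (fun τ' => φ τ' A) τ = h A + n A)
    (horth : ∀ χ, IsHolomorphicSection k s τ χ → MemLp χ 2 → ∫ A, n A * conj (χ A) = 0) :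
    h =ᵐ[volume] l2Connection k s V φ τ := by
  have hm : MemLp (fun A => tderiv V (fun τ' => φ τ' A) τ) 2 volume := by
    simp only [hφ]; exact hh2.add hn
  have e : hm.toLp _ = hh2.toLp h + hn.toLp n := by
    rw [← MemLp.toLp_add]
    exact MemLp.toLp_congr _ _ (.of_forall hφ)
  rw [l2Connection, dif_pos hm, holoProj]
  have hmem : hh2.toLp h ∈ (holoSpace k s r τ).topologicalClosure :=
    Submodule.le_topologicalClosure _ ⟨h, hh, hh2.coeFn_toLp⟩
  -- Orthogonality to the closure is orthogonality to the holomorphic sections themselves, where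
  -- honest representatives are available.
  have ho : hn.toLp n ∈ (holoSpace k s r τ).topologicalClosureᗮ := by
    rw [Submodule.orthogonal_closure]
    rw [Submodule.mem_orthogonal]
    rintro χ ⟨χ₀, hχ, he⟩
    rw [L2.inner_def]
    have hχ2 : MemLp χ₀ 2 := (memLp_congr_ae he).1 (Lp.memLp χ)
    rw [← horth χ₀ hχ hχ2]
    refine integral_congr_ae ?_
    filter_upwards [he, hn.coeFn_toLp] with A h1 h2
    rw [h1, h2]
    simp [RCLike.inner_apply]
  rw [e, Submodule.eq_starProjection_of_mem_orthogonal' hmem ho rfl]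
  exact hh2.coeFn_toLp.symm

end Orthogonality

/-! ### The modular action on τ, on forms and on the coordinates P, Q -/

section MappingClassGroup

open Complex
open scoped ComplexConjugate

variable {r : ℕ} {k : ℕ} {s : ℝ} {τ : ℂ} {γ : Matrix.SpecialLinearGroup (Fin 2) ℤ}

/-- The automorphy factor `c τ + d`. -/
def autFactor (γ : Matrix.SpecialLinearGroup (Fin 2) ℤ) (τ : ℂ) : ℂ :=
  (γ.1 1 0 : ℂ) * τ + (γ.1 1 1 : ℂ)

theorem sl_det (R : Type*) [CommRing R] (γ : Matrix.SpecialLinearGroup (Fin 2) ℤ) :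
    (γ.1 0 0 : R) * γ.1 1 1 - γ.1 0 1 * γ.1 1 0 = 1 := by
  have h := γ.2
  rw [Matrix.det_fin_two] at h
  exact_mod_cast congrArg (Int.cast : ℤ → R) h

theorem autFactor_ne_zero (γ : Matrix.SpecialLinearGroup (Fin 2) ℤ) (hτ : 0 < τ.im) :
    autFactor γ τ ≠ 0 := by
  intro h
  have h1 := congrArg im h
  have h2 := congrArg re h
  simp only [autFactor, add_im, mul_im, intCast_re, intCast_im, zero_mul, add_zero, zero_im,
    add_re, mul_re, sub_zero, zero_re] at h1 h2
  have h3 : (γ.1 1 0 : ℝ) = 0 := (mul_eq_zero.1 h1).resolve_right hτ.ne'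
  rw [h3] at h2
  have h4 := sl_det ℝ γ
  rw [h3] at h4
  have h5 : (γ.1 1 1 : ℝ) = 0 := by linarith
  rw [h5] at h4
  norm_num at h4

theorem mobius_eq (γ : Matrix.SpecialLinearGroup (Fin 2) ℤ) (τ : ℂ) :
    mobius γ τ = ((γ.1 0 0 : ℂ) * τ + (γ.1 0 1 : ℂ)) / autFactor γ τ := rfl

theorem normSq_autFactor (γ : Matrix.SpecialLinearGroup (Fin 2) ℤ) (τ : ℂ) :
    (normSq (autFactor γ τ) : ℂ) = autFactor γ τ * (γ.1 1 0 * conj τ + γ.1 1 1) := by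
  rw [normSq_eq_conj_mul_self]
  simp only [autFactor, map_add, map_mul, map_intCast]
  ring

theorem mobius_im (γ : Matrix.SpecialLinearGroup (Fin 2) ℤ) (hτ : 0 < τ.im) :
    (mobius γ τ).im = τ.im / normSq (autFactor γ τ) := by
  have hm := autFactor_ne_zero γ hτ
  have hd := sl_det ℂ γ
  have hn : (normSq (autFactor γ τ) : ℂ) ≠ 0 := by exact_mod_cast normSq_pos.2 hm |>.ne'
  have hc : (γ.1 1 0 * conj τ + γ.1 1 1 : ℂ) ≠ 0 := by
    intro h; rw [normSq_autFactor, h, mul_zero] at hn; exact hn rfl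
  have e : mobius γ τ - conj (mobius γ τ) = (τ - conj τ) / normSq (autFactor γ τ) := by
    rw [normSq_autFactor, mobius_eq]
    simp only [autFactor, map_div₀, map_add, map_mul, map_intCast] at hm hc ⊢
    rw [div_sub_div _ _ hm hc]
    congr 1
    linear_combination (τ - conj τ) * hd
  rw [tau_sub_conj, tau_sub_conj] at e
  have e2 : ((mobius γ τ).im : ℂ) = τ.im / normSq (autFactor γ τ) := by
    have h2I : (2 * I : ℂ) ≠ 0 := by simp
    apply mul_left_cancel₀ h2I
    linear_combination e
  exact_mod_cast e2

theorem mobius_im_pos (γ : Matrix.SpecialLinearGroup (Fin 2) ℤ) (hτ : 0 < τ.im) :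
    0 < (mobius γ τ).im := by
  rw [mobius_im γ hτ]
  exact div_pos hτ (normSq_pos.2 (autFactor_ne_zero γ hτ))

theorem sl_inv_entries (γ : Matrix.SpecialLinearGroup (Fin 2) ℤ) :
    γ⁻¹.1 0 0 = γ.1 1 1 ∧ γ⁻¹.1 0 1 = -γ.1 0 1 ∧ γ⁻¹.1 1 0 = -γ.1 1 0 ∧ γ⁻¹.1 1 1 = γ.1 0 0 := by
  rw [Matrix.SpecialLinearGroup.SL2_inv_expl]
  exact ⟨rfl, rfl, rfl, rfl⟩

theorem mobius_inv_mobius (γ : Matrix.SpecialLinearGroup (Fin 2) ℤ) (hτ : 0 < τ.im) :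
    mobius γ⁻¹ (mobius γ τ) = τ := by
  obtain ⟨h1, h2, h3, h4⟩ := sl_inv_entries γ
  have hm := autFactor_ne_zero γ hτ
  have hd := sl_det ℂ γ
  have hm' := autFactor_ne_zero γ⁻¹ (mobius_im_pos γ hτ)
  rw [mobius_eq γ⁻¹, div_eq_iff hm']
  simp only [autFactor, mobius, h1, h2, h3, h4] at hm ⊢
  push_cast
  linear_combination div_mul_cancel₀ ((γ.1 0 0 : ℂ) * τ + (γ.1 0 1 : ℂ)) hm

theorem mobius_mobius_inv (γ : Matrix.SpecialLinearGroup (Fin 2) ℤ) (hτ : 0 < τ.im) :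
    mobius γ (mobius γ⁻¹ τ) = τ := by
  simpa using mobius_inv_mobius γ⁻¹ hτ

theorem hasDerivAt_mobius (γ : Matrix.SpecialLinearGroup (Fin 2) ℤ) (hτ : 0 < τ.im) :
    HasDerivAt (mobius γ) (1 / autFactor γ τ ^ 2) τ := by
  have hm := autFactor_ne_zero γ hτ
  have h1 : ∀ a b : ℂ, HasDerivAt (fun x => a * x + b) a τ := fun a b => by
    simpa using ((hasDerivAt_id τ).const_mul a).add_const b
  have h := (h1 (γ.1 0 0) (γ.1 0 1)).div (h1 (γ.1 1 0) (γ.1 1 1)) hm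
  refine h.congr_deriv ?_
  have hd := sl_det ℂ γ
  simp only [autFactor]
  congr 1
  linear_combination hd

/-- The chain rule for the action on Teichmueller space. -/
theorem tderiv_mobius (γ : Matrix.SpecialLinearGroup (Fin 2) ℤ) (hτ : 0 < τ.im) (V : ℂ × ℂ)
    (F : ℂ → ℂ) : tderiv (mobiusPush γ τ V) F (mobius γ τ) =
      tderiv V (fun x => F (mobius γ x)) τ := by
  have hm := autFactor_ne_zero γ hτ
  have h1 := (hasDerivAt_mobius γ hτ).hasFDerivAt.restrictScalars ℝ
  by_cases hF : DifferentiableAt ℝ F (mobius γ τ)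
  · have hc : HasFDerivAt (fun x => F (mobius γ x)) _ τ := hF.hasFDerivAt.comp τ h1
    set D := fderiv ℝ F (mobius γ τ) with hD
    have hlin : ∀ w : ℂ, D w = w.re * D 1 + w.im * D I := fun w => by
      conv_lhs => rw [show w = w.re • (1 : ℂ) + w.im • I by simp]
      rw [map_add, map_smul, map_smul, real_smul, real_smul]
    have hv : ∀ v : ℂ, fderiv ℝ (fun x => F (mobius γ x)) τ v = D (v * (1 / autFactor γ τ ^ 2)) :=
      fun v => by rw [hc.fderiv]; simp
    rw [tderiv, tderiv, hv, hv, mobiusPush]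
    set w := 1 / autFactor γ τ ^ 2 with hw
    have e1 : V.1 / ((γ.1 1 0 : ℂ) * τ + (γ.1 1 1 : ℂ)) ^ 2 = V.1 * w := by
      rw [hw, autFactor]; ring
    have e2 : V.2 / conj (((γ.1 1 0 : ℂ) * τ + (γ.1 1 1 : ℂ)) ^ 2) = V.2 * conj w := by
      rw [hw, autFactor, map_div₀, map_one]; ring
    have e4 : conj w = w.re - w.im * I := by apply Complex.ext <;> simp
    rw [e1, e2, hlin (1 * w), hlin (I * w), e4]
    have e3 : w = w.re + w.im * I := (re_add_im w).symm
    simp only [one_mul, mul_re, mul_im, I_re, I_im, zero_mul, zero_sub, zero_add]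
    push_cast
    linear_combination (V.1 * (D 1 - I * D I) / 2) * e3 + (w.im * D I * (-V.2 - V.1) / 2) * I_sq
  -- If F is not differentiable, neither is its composition with the locally invertible Möbius map;
  -- both derivatives then have the default value 0.
  · have hF' : ¬DifferentiableAt ℝ (fun x => F (mobius γ x)) τ := fun h => hF (by
      have h2 := ((hasDerivAt_mobius γ⁻¹ (mobius_im_pos γ hτ)).hasFDerivAt.restrictScalars
        ℝ).differentiableAt
      have h3 : DifferentiableAt ℝ (fun y => F (mobius γ (mobius γ⁻¹ y))) (mobius γ τ) :=
        DifferentiableAt.comp (mobius γ τ) (g := fun x => F (mobius γ x))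
          (by rw [mobius_inv_mobius γ hτ]; exact h) h2
      refine h3.congr_of_eventuallyEq ?_
      filter_upwards [eventually_im_pos (mobius_im_pos γ hτ)] with y hy
      rw [mobius_mobius_inv γ hy])
    rw [tderiv, tderiv, fderiv_zero_of_not_differentiableAt hF,
      fderiv_zero_of_not_differentiableAt hF']
    simp

theorem tderiv_congr {F G : ℂ → ℂ} (h : F =ᶠ[nhds τ] G) (V : ℂ × ℂ) :
    tderiv V F τ = tderiv V G τ := by
  rw [tderiv, tderiv, h.fderiv_eq]

/-- The action on one-forms. -/
def mcgEquiv (r : ℕ) (γ : Matrix.SpecialLinearGroup (Fin 2) ℤ) : A0C r ≃L[ℝ] A0C r :=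
  LinearEquiv.toContinuousLinearEquiv
    { toFun := mcgForm γ
      invFun := mcgForm γ⁻¹
      map_add' := fun A B => by
        funext a; simp only [mcgForm, Pi.add_apply]; split_ifs <;> ring
      map_smul' := fun c A => by
        funext a
        simp only [mcgForm, Pi.smul_apply, real_smul, RingHom.id_apply]; split_ifs <;> ring
      left_inv := fun A => by
        obtain ⟨h1, h2, h3, h4⟩ := sl_inv_entries γ
        have hd := sl_det ℂ γ
        funext ⟨i, j⟩
        fin_cases i <;> simp [mcgForm, h1, h2, h3, h4]
        · linear_combination A (0, j) * hd
        · linear_combination A (1, j) * hd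
      right_inv := fun A => by
        obtain ⟨h1, h2, h3, h4⟩ := sl_inv_entries γ
        have hd := sl_det ℂ γ
        funext ⟨i, j⟩
        fin_cases i <;> simp [mcgForm, h1, h2, h3, h4]
        · linear_combination A (0, j) * hd
        · linear_combination A (1, j) * hd }

theorem mcgEquiv_apply (A : A0C r) : mcgEquiv r γ A = mcgForm γ A := rfl

theorem mcgForm_inv_mcgForm (A : A0C r) : mcgForm γ⁻¹ (mcgForm γ A) = A :=
  (mcgEquiv r γ).symm_apply_apply A

theorem mcgForm_mcgForm_inv (A : A0C r) : mcgForm γ (mcgForm γ⁻¹ A) = A :=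
  (mcgEquiv r γ).apply_symm_apply A

/-- The action on real one-forms. -/
def mcgReal (r : ℕ) (γ : Matrix.SpecialLinearGroup (Fin 2) ℤ) : A0 r ≃L[ℝ] A0 r :=
  LinearEquiv.toContinuousLinearEquiv
    { toFun := fun u a => if a.1 = 0 then (γ.1 1 1 : ℝ) * u (0, a.2) + (γ.1 1 0 : ℝ) * u (1, a.2)
        else (γ.1 0 1 : ℝ) * u (0, a.2) + (γ.1 0 0 : ℝ) * u (1, a.2)
      invFun := fun u a => if a.1 = 0 then (γ.1 0 0 : ℝ) * u (0, a.2) - (γ.1 1 0 : ℝ) * u (1, a.2)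
        else -(γ.1 0 1 : ℝ) * u (0, a.2) + (γ.1 1 1 : ℝ) * u (1, a.2)
      map_add' := fun A B => by
        funext a; simp only [Pi.add_apply]; split_ifs <;> ring
      map_smul' := fun c A => by
        funext a
        simp only [Pi.smul_apply, smul_eq_mul, RingHom.id_apply]; split_ifs <;> ring
      left_inv := fun A => by
        have hd := sl_det ℝ γ
        funext ⟨i, j⟩
        fin_cases i <;> simp
        · linear_combination A (0, j) * hd
        · linear_combination A (1, j) * hd
      right_inv := fun A => by
        have hd := sl_det ℝ γ
        funext ⟨i, j⟩
        fin_cases i <;> simp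
        · linear_combination A (0, j) * hd
        · linear_combination A (1, j) * hd }

theorem incl_mcgReal (u : A0 r) : incl (mcgReal r γ u) = mcgForm γ (incl u) := by
  funext ⟨i, j⟩
  fin_cases i <;> simp [incl, mcgForm, mcgReal]

theorem omega_mcgReal (u v : A0 r) : omega (mcgReal r γ u) (mcgReal r γ v) = omega u v := by
  have hd := sl_det ℝ γ
  refine Finset.sum_congr rfl fun j _ => ?_
  simp only [mcgReal, LinearEquiv.coe_toContinuousLinearEquiv', LinearEquiv.coe_mk,
    LinearMap.coe_mk, AddHom.coe_mk, if_true, one_ne_zero, if_false]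
  linear_combination (u (0, j) * v (1, j) - u (1, j) * v (0, j)) * hd

theorem omegaT_mcgForm (A B : A0C r) :
    omegaT k s (mcgForm γ A) (mcgForm γ B) = omegaT k s A B := by
  have hd := sl_det ℂ γ
  have : omegaC (mcgForm γ A) (mcgForm γ B) = omegaC A B := by
    refine Finset.sum_congr rfl fun j _ => ?_
    simp only [mcgForm, if_true, one_ne_zero, if_false]
    linear_combination (A (0, j) * B (1, j) - A (1, j) * B (0, j)) * hd
  rw [omegaT, omegaT, this]

/-- The unitary part of the automorphy factor. -/
def autUnit (γ : Matrix.SpecialLinearGroup (Fin 2) ℤ) (τ : ℂ) : ℂ :=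
  autFactor γ τ / ‖autFactor γ τ‖

theorem sqrt_mobius_im (γ : Matrix.SpecialLinearGroup (Fin 2) ℤ) (hτ : 0 < τ.im) :
    (√(2 * (mobius γ τ).im) : ℂ)⁻¹ = ‖autFactor γ τ‖ * (√(2 * τ.im) : ℂ)⁻¹ := by
  have : √(2 * (mobius γ τ).im) = √(2 * τ.im) / ‖autFactor γ τ‖ := by
    rw [mobius_im γ hτ, ← mul_div_assoc, Real.sqrt_div' _ (normSq_nonneg _)]
    rfl
  rw [this]
  push_cast
  rw [inv_div]; ring

theorem autUnit_mul_conj (γ : Matrix.SpecialLinearGroup (Fin 2) ℤ) (hτ : 0 < τ.im) :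
    autUnit γ τ * conj (autUnit γ τ) = 1 := by
  have hm := autFactor_ne_zero γ hτ
  have hn : (‖autFactor γ τ‖ : ℂ) ≠ 0 := by simpa using hm
  rw [autUnit, map_div₀, conj_ofReal, div_mul_div_comm, mul_conj, ← ofReal_mul, normSq_eq_norm_sq,
    ← sq, div_self]
  exact_mod_cast (pow_ne_zero 2 hn)

theorem conj_autUnit (γ : Matrix.SpecialLinearGroup (Fin 2) ℤ) (hτ : 0 < τ.im) :
    conj (autUnit γ τ) = ‖autFactor γ τ‖ / autFactor γ τ := by
  rw [eq_div_iff (autFactor_ne_zero γ hτ)]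
  have hm := autFactor_ne_zero γ hτ
  have hn : (‖autFactor γ τ‖ : ℂ) ≠ 0 := by simpa using hm
  have h := autUnit_mul_conj γ hτ
  have e : autFactor γ τ = autUnit γ τ * ‖autFactor γ τ‖ := by rw [autUnit]; field_simp
  linear_combination conj (autUnit γ τ) * e + ‖autFactor γ τ‖ * h

/-- The functional A(1,j) - τ A(0,j) is divided by cτ + d, while the factor (2τ₂)^(-1/2) is
multiplied by |cτ + d|; only a unitary factor survives. -/
theorem coordQm_mcgForm (γ : Matrix.SpecialLinearGroup (Fin 2) ℤ) (hτ : 0 < τ.im) (A : A0C r)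
    (j : Fin r) : coordQm k s (mobius γ τ) (mcgForm γ A) j =
      conj (autUnit γ τ) * coordQm k s τ A j := by
  have hm := autFactor_ne_zero γ hτ
  have hd := sl_det ℂ γ
  rw [coordQm, coordQm, sqrt_mobius_im γ hτ, conj_autUnit γ hτ]
  have : mcgForm γ A (1, j) - mobius γ τ * mcgForm γ A (0, j) =
      (A (1, j) - τ * A (0, j)) / autFactor γ τ := by
    rw [eq_div_iff hm, sub_mul, mobius_eq, mul_right_comm, div_mul_cancel₀ _ hm]
    simp only [mcgForm, if_true, one_ne_zero, if_false, autFactor]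
    linear_combination (A (1, j) - τ * A (0, j)) * hd
  rw [this]; ring

theorem coordPp_mcgForm (γ : Matrix.SpecialLinearGroup (Fin 2) ℤ) (hτ : 0 < τ.im) (A : A0C r)
    (j : Fin r) : coordPp (mobius γ τ) (mcgForm γ A) j = autUnit γ τ * coordPp τ A j := by
  have hm := autFactor_ne_zero γ hτ
  have hm' : conj (autFactor γ τ) ≠ 0 := by simpa using hm
  have hd := sl_det ℂ γ
  have hu : autUnit γ τ = ‖autFactor γ τ‖ / conj (autFactor γ τ) := by
    rw [← conj_conj (autUnit γ τ), conj_autUnit γ hτ, map_div₀, conj_ofReal]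
  rw [coordPp, coordPp, sqrt_mobius_im γ hτ, hu]
  have : mcgForm γ A (1, j) - conj (mobius γ τ) * mcgForm γ A (0, j) =
      (A (1, j) - conj τ * A (0, j)) / conj (autFactor γ τ) := by
    rw [eq_div_iff hm', sub_mul, mobius_eq, map_div₀, mul_right_comm, div_mul_cancel₀ _ hm']
    simp only [mcgForm, if_true, one_ne_zero, if_false, autFactor, map_add, map_mul, map_intCast]
    linear_combination (A (1, j) - conj τ * A (0, j)) * hd
  rw [this]; ring

end MappingClassGroup

/-! ### The action as a rotation of the coordinates; invariance of the frames and of the transform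
-/

section Rotation

open Complex
open scoped ComplexConjugate

variable {r : ℕ} {k : ℕ} {s : ℝ} {τ : ℂ} {γ : Matrix.SpecialLinearGroup (Fin 2) ℤ}

/-- The simultaneous rotation of the coordinate pairs `(0, j)`, `(1, j)`. -/
def rot {M : Type*} [AddCommGroup M] [Module ℝ M] (u : ℂ) : (Idx r → M) →ₗ[ℝ] (Idx r → M) where
  toFun z a := if a.1 = 0 then u.re • z (0, a.2) - u.im • z (1, a.2)
    else u.im • z (0, a.2) + u.re • z (1, a.2)
  map_add' z w := by funext a; simp only [Pi.add_apply, smul_add]; split_ifs <;> abel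
  map_smul' c z := by
    funext a
    simp only [Pi.smul_apply, RingHom.id_apply]
    split_ifs <;> module

theorem rot_zero {M : Type*} [AddCommGroup M] [Module ℝ M] (u : ℂ) (z : Idx r → M) (j : Fin r) :
    rot u z (0, j) = u.re • z (0, j) - u.im • z (1, j) := rfl

theorem rot_one {M : Type*} [AddCommGroup M] [Module ℝ M] (u : ℂ) (z : Idx r → M) (j : Fin r) :
    rot u z (1, j) = u.im • z (0, j) + u.re • z (1, j) := rfl

theorem sum_rot_mul_rot {A : Type*} [CommRing A] [Algebra ℝ A] {u : ℂ} (hu : normSq u = 1)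
    (z w : Idx r → A) : ∑ a, rot u z a * rot u w a = ∑ a, z a * w a := by
  rw [Fintype.sum_prod_type_right, Fintype.sum_prod_type_right]
  refine Finset.sum_congr rfl fun j _ => ?_
  rw [normSq_apply] at hu
  have hu' : algebraMap ℝ A u.re * algebraMap ℝ A u.re + algebraMap ℝ A u.im * algebraMap ℝ A u.im
      = 1 := by rw [← map_mul, ← map_mul, ← map_add, hu, map_one]
  simp only [Fin.sum_univ_two, rot_zero, rot_one, Algebra.smul_def]
  linear_combination (z (0, j) * w (0, j) + z (1, j) * w (1, j)) * hu'

theorem rot_rot {M : Type*} [AddCommGroup M] [Module ℝ M] (u v : ℂ) (z : Idx r → M) :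
    rot u (rot v z) = rot (u * v) z := by
  funext ⟨i, j⟩
  fin_cases i
  · simp only [Fin.zero_eta, rot_zero, rot_one, mul_re, mul_im]; module
  · simp only [Fin.mk_one, rot_zero, rot_one, mul_re, mul_im]; module

theorem rot_by_one {M : Type*} [AddCommGroup M] [Module ℝ M] (z : Idx r → M) : rot 1 z = z := by
  funext ⟨i, j⟩
  fin_cases i
  · simp [rot_zero]
  · simp [rot_one]

/-- The inverse rotation, by ū, is conjugate to the rotation by u through the reflection of the
second coordinates, so it has the same determinant. Hence the determinant has square 1. -/
theorem measurePreserving_rot {u : ℂ} (hu : normSq u = 1) :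
    MeasurePreserving (rot u : (Idx r → ℝ) →ₗ[ℝ] (Idx r → ℝ)) volume volume := by
  let f : (Idx r → ℝ) →ₗ[ℝ] (Idx r → ℝ) := rot u
  let g : (Idx r → ℝ) →ₗ[ℝ] (Idx r → ℝ) := rot (conj u)
  let S : (Idx r → ℝ) →ₗ[ℝ] (Idx r → ℝ) :=
    { toFun := fun z a => if a.1 = 0 then z a else -z a
      map_add' := fun z w => by funext a; simp only [Pi.add_apply]; split_ifs <;> ring
      map_smul' := fun c z => by funext a; simp }
  have hS : S ∘ₗ S = LinearMap.id := by
    ext z a; by_cases h : a.1 = 0 <;> simp [S, h]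
  have hg : g = S ∘ₗ f ∘ₗ S := by
    refine LinearMap.ext fun z => funext fun ⟨i, j⟩ => ?_
    fin_cases i
    · simp [f, g, S, rot_zero]
    · simp [f, g, S, rot_one, add_comm]
  have hgf : g ∘ₗ f = LinearMap.id := by
    refine LinearMap.ext fun z => ?_
    have : conj u * u = 1 := by rw [← normSq_eq_conj_mul_self, hu, ofReal_one]
    simp [f, g, rot_rot, this, rot_by_one]
  have d1 : LinearMap.det S * LinearMap.det S = 1 := by
    rw [← LinearMap.det_comp, hS, LinearMap.det_id]
  have d2 : LinearMap.det g = LinearMap.det f := by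
    rw [hg, LinearMap.det_comp, LinearMap.det_comp]; linear_combination LinearMap.det f * d1
  have d3 : LinearMap.det f * LinearMap.det f = 1 := by
    conv_lhs => rw [← d2]
    rw [d2]
    conv_lhs => enter [1]; rw [← d2]
    rw [← LinearMap.det_comp, hgf, LinearMap.det_id]
  have d4 : |(LinearMap.det f)⁻¹| = 1 := by
    rcases mul_self_eq_one_iff.1 d3 with h | h <;> simp [h]
  have d5 : LinearMap.det f ≠ 0 := left_ne_zero_of_mul_eq_one d3
  refine ⟨(LinearMap.continuous_of_finiteDimensional f).measurable, ?_⟩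
  have := Measure.map_linearMap_addHaar_eq_smul_addHaar (volume : Measure (Idx r → ℝ)) d5
  rwa [d4, ENNReal.ofReal_one, one_smul] at this

theorem normSq_autUnit (γ : Matrix.SpecialLinearGroup (Fin 2) ℤ) (hτ : 0 < τ.im) :
    normSq (autUnit γ τ) = 1 := by
  have h := autUnit_mul_conj γ hτ
  rw [mul_conj] at h
  exact_mod_cast h

/-- P is multiplied by the unit u and Q by ū, so z_(0,j) ± i z_(1,j) are multiplied by u and ū
respectively: a real rotation of the pair. -/
theorem coordZ_mcgForm (hk : 0 < k) (s : ℝ) (γ : Matrix.SpecialLinearGroup (Fin 2) ℤ)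
    (hτ : 0 < τ.im) (A : A0C r) :
    coordZ k s (mobius γ τ) (mcgForm γ A) = rot (autUnit γ τ) (coordZ k s τ A) := by
  have hτ' := mobius_im_pos γ hτ
  set u := autUnit γ τ with hu
  have eu : u = u.re + u.im * I := (re_add_im u).symm
  have eu' : conj u = u.re - u.im * I := by apply Complex.ext <;> simp
  refine coordZ_ext (fun j => ?_) fun j => ?_
  · rw [coordZp_eq hk hτ', coordPp_mcgForm γ hτ, coordQm_mcgForm γ hτ, map_mul, conj_conj, rot_zero,
      rot_one]
    have h := coordZp_eq (s := s) hk hτ A j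
    simp only [real_smul]
    linear_combination -u * h + (coordZ k s τ A (0, j) + I * coordZ k s τ A (1, j)) * eu +
      u.im * coordZ k s τ A (1, j) * I_sq
  · rw [coordZm_eq hk hτ', coordPp_mcgForm γ hτ, coordQm_mcgForm γ hτ, map_mul, rot_zero,
      rot_one]
    have h := coordZm_eq (s := s) hk hτ A j
    simp only [real_smul]
    linear_combination -conj u * h + (coordZ k s τ A (0, j) - I * coordZ k s τ A (1, j)) * eu' +
      u.im * coordZ k s τ A (1, j) * I_sq

theorem coordQ_mcgForm (hk : 0 < k) (s : ℝ) (γ : Matrix.SpecialLinearGroup (Fin 2) ℤ)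
    (hτ : 0 < τ.im) (A : A0C r) :
    coordQ k s (mobius γ τ) (mcgForm γ A) = rot (autUnit γ τ) (coordQ k s τ A) := by
  have h := coordZ_mcgForm hk s γ hτ A
  funext ⟨i, j⟩
  rw [coordQ_eq_im, h]
  fin_cases i
  · simp [rot_zero, coordQ_eq_im]
  · simp [rot_one, coordQ_eq_im]

theorem coordP_mcgForm (hk : 0 < k) (s : ℝ) (γ : Matrix.SpecialLinearGroup (Fin 2) ℤ)
    (hτ : 0 < τ.im) (A : A0C r) :
    coordP k s (mobius γ τ) (mcgForm γ A) = rot (autUnit γ τ) (coordP k s τ A) := by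
  have h := coordZ_mcgForm hk s γ hτ A
  funext ⟨i, j⟩
  rw [coordP_eq_re, h]
  fin_cases i
  · simp [rot_zero, coordP_eq_re]
  · simp [rot_one, coordP_eq_re]

theorem frameRho_mcgForm (hk : 0 < k) (s : ℝ) (γ : Matrix.SpecialLinearGroup (Fin 2) ℤ)
    (hτ : 0 < τ.im) (A : A0C r) :
    frameRho k s (mobius γ τ) (mcgForm γ A) = frameRho k s τ A := by
  have h := sum_rot_mul_rot (normSq_autUnit γ hτ) (coordP k s τ A) (coordQ k s τ A)
  rw [frameRho, frameRho, coordP_mcgForm hk s γ hτ, coordQ_mcgForm hk s γ hτ]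
  congr 2
  exact_mod_cast h

theorem frameSigma_mcgForm (hk : 0 < k) (s : ℝ) (γ : Matrix.SpecialLinearGroup (Fin 2) ℤ)
    (hτ : 0 < τ.im) (A : A0C r) :
    frameSigma k s (mobius γ τ) (mcgForm γ A) = frameSigma k s τ A := by
  have e : ∀ (x : ℂ) (B : A0C r), ∑ a, ‖coordZ k s x B a‖ ^ 2 =
      ∑ a, coordP k s x B a * coordP k s x B a + ∑ a, coordQ k s x B a * coordQ k s x B a :=
    fun x B => by
      rw [← Finset.sum_add_distrib]
      refine Finset.sum_congr rfl fun a _ => ?_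
      rw [← normSq_eq_norm_sq, normSq_apply, coordP_eq_re, coordQ_eq_im]
  rw [frameSigma, frameSigma, e, e, coordP_mcgForm hk s γ hτ, coordQ_mcgForm hk s γ hτ,
    sum_rot_mul_rot (normSq_autUnit γ hτ), sum_rot_mul_rot (normSq_autUnit γ hτ)]

theorem pointQ_rot (hk : 0 < k) (s : ℝ) (γ : Matrix.SpecialLinearGroup (Fin 2) ℤ)
    (hτ : 0 < τ.im) (q : Idx r → ℝ) :
    pointQ k s (mobius γ τ) (rot (autUnit γ τ) q) = mcgForm γ (pointQ k s τ q) := by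
  have hτ' := mobius_im_pos γ hτ
  refine (zEquiv hk s hτ').injective ?_
  simp only [zEquiv_apply]
  rw [coordZ_mcgForm hk s γ hτ]
  funext ⟨i, j⟩
  rw [coordZ_pointQ hk hτ']
  fin_cases i
  · simp only [Fin.zero_eta, rot_zero, coordZ_pointQ hk hτ, smul_eq_mul, real_smul]
    push_cast; ring
  · simp only [Fin.mk_one, rot_one, coordZ_pointQ hk hτ, smul_eq_mul, real_smul]
    push_cast; ring

/-- The Bargmann transform is equivariant. -/
theorem bargmann_mcgForm (hk : 0 < k) (s : ℝ) (γ : Matrix.SpecialLinearGroup (Fin 2) ℤ)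
    (hτ : 0 < τ.im) {η η' : A0C r → ℂ} (h : ∀ A, η' (mcgForm γ A) = η A) (A : A0C r) :
    bargmann k s (mobius γ τ) η' (mcgForm γ A) = bargmann k s τ η A := by
  have hu := normSq_autUnit γ hτ
  have hinj : Function.Injective (rot (autUnit γ τ) : (Idx r → ℝ) →ₗ[ℝ] (Idx r → ℝ)) := fun q q' e => by
    have h1 := congrArg (rot (conj (autUnit γ τ))) e
    rwa [rot_rot, rot_rot, ← normSq_eq_conj_mul_self, hu, ofReal_one, rot_by_one, rot_by_one] at h1
  have hemb : MeasurableEmbedding (rot (autUnit γ τ) : (Idx r → ℝ) →ₗ[ℝ] (Idx r → ℝ)) :=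
    (LinearMap.isClosedEmbedding_of_injective (LinearMap.ker_eq_bot.2 hinj)).measurableEmbedding
  -- Changing variables by the rotation in q leaves the kernel unchanged: it involves only q·z, q·q
  -- and z·z, invariant under a simultaneous real orthogonal map.
  rw [bargmann, bargmann, ← (measurePreserving_rot hu).integral_comp hemb]
  congr 2
  funext q
  have e1 := sum_rot_mul_rot hu (fun a => (q a : ℂ)) (coordZ k s τ A)
  have e2 := sum_rot_mul_rot hu q q
  have e3 := sum_rot_mul_rot hu (coordZ k s τ A) (coordZ k s τ A)
  have e4 : (rot (autUnit γ τ) fun a => (q a : ℂ)) = fun a => ((rot (autUnit γ τ) q a : ℝ) : ℂ) := by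
    funext ⟨i, j⟩
    fin_cases i
    · simp [rot_zero]
    · simp [rot_one]
  rw [e4] at e1
  have e5 : ∑ a, ((rot (autUnit γ τ) q a : ℝ) : ℂ) ^ 2 = ∑ a, (q a : ℂ) ^ 2 := by
    simp only [sq]; exact_mod_cast e2
  rw [coordZ_mcgForm hk s γ hτ, restrictQ, restrictQ, pointQ_rot hk s γ hτ, h, e1, e5]
  simp only [sq]
  rw [e3]

/-- In the coordinates z the complex structure is multiplication by i, which commutes with real
rotations. -/
theorem cxIt_mcgForm (hk : 0 < k) (s : ℝ) (γ : Matrix.SpecialLinearGroup (Fin 2) ℤ)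
    (hτ : 0 < τ.im) (A : A0C r) :
    cxIt k s (mobius γ τ) (mcgForm γ A) = mcgForm γ (cxIt k s τ A) := by
  have hτ' := mobius_im_pos γ hτ
  refine (zEquiv hk s hτ').injective ?_
  simp only [zEquiv_apply]
  rw [coordZ_cxIt hk hτ', coordZ_mcgForm hk s γ hτ, coordZ_mcgForm hk s γ hτ, coordZ_cxIt hk hτ]
  funext ⟨i, j⟩
  fin_cases i
  · simp only [Fin.zero_eta, rot_zero, Pi.smul_apply, smul_eq_mul, real_smul]; ring
  · simp only [Fin.mk_one, rot_one, Pi.smul_apply, smul_eq_mul, real_smul]; ring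

theorem incl_injective : Function.Injective (incl : A0 r → A0C r) := fun u v h =>
  funext fun a => by simpa [incl] using congrFun h a

/-- On `A0` the Hodge operator is the restriction of I_{τ,t} at t = 1, so the statement follows from
that for I_{τ,t}. -/
theorem hodge_mcgReal (γ : Matrix.SpecialLinearGroup (Fin 2) ℤ) (hτ : 0 < τ.im) (u : A0 r) :
    hodge (mobius γ τ) (mcgReal r γ u) = mcgReal r γ (hodge τ u) := by
  have e : ∀ x (v : A0 r), cxIt 1 0 x (incl v) = incl (hodge x v) := fun x v => by
    funext a
    simp [cxIt, cxI, level, incl, hodge]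
  apply incl_injective
  rw [incl_mcgReal, ← e, ← e, incl_mcgReal, cxIt_mcgForm one_pos 0 γ hτ]

/-- A real form is determined by its coordinates Q, and projection along the polarisation preserves
Q. The level 1 is an arbitrary choice, as the claim does not involve t. -/
theorem projA0_mcgForm (γ : Matrix.SpecialLinearGroup (Fin 2) ℤ) (hτ : 0 < τ.im) (A : A0C r) :
    projA0 (mobius γ τ) (mcgForm γ A) = mcgReal r γ (projA0 τ A) := by
  have hτ' := mobius_im_pos γ hτ
  set v := projA0 (mobius γ τ) (mcgForm γ A) with hv
  set w := mcgReal r γ (projA0 τ A) with hw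
  have h : ∀ j, coordQm 1 0 (mobius γ τ) (incl v) j = coordQm 1 0 (mobius γ τ) (incl w) j := fun j => by
    rw [hv, hw, coordQm_projA0 hτ', incl_mcgReal, coordQm_mcgForm γ hτ, coordQm_mcgForm γ hτ,
      coordQm_projA0 hτ]
  have hν : (√(2 * (mobius γ τ).im) : ℂ)⁻¹ ≠ 0 := by
    have : 0 < √(2 * (mobius γ τ).im) := by positivity
    exact inv_ne_zero (by exact_mod_cast this.ne')
  have hp : phase 1 0 ≠ 0 := left_ne_zero_of_mul_eq_one (phase_mul_conj one_pos 0)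
  have h2 : ∀ j, v (0, j) = w (0, j) ∧ v (1, j) = w (1, j) := fun j => by
    have h3 := mul_left_cancel₀ hp (mul_right_cancel₀ hν (h j))
    simp only [incl] at h3
    have h4 := congrArg im h3
    have h5 := congrArg re h3
    simp only [sub_im, ofReal_im, mul_im, ofReal_re, mul_zero, zero_add, zero_sub, sub_re, mul_re,
      sub_zero, neg_inj] at h4 h5
    have h6 := mul_left_cancel₀ hτ'.ne' h4
    rw [h6] at h5
    exact ⟨h6, by linarith⟩
  funext ⟨i, j⟩
  fin_cases i
  · exact (h2 j).1
  · exact (h2 j).2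

end Rotation

/-! ### Naturality of bivectors and Laplacians under linear symplectic maps -/

section Naturality

open Complex

variable {E ι : Type*} [NormedAddCommGroup E] [NormedSpace ℝ E] [Fintype ι] [DecidableEq ι]
  {b : Module.Basis ι ℝ E} {Ω : E → E → ℝ} {g : E ≃L[ℝ] E}

/-- Invariance of the prequantum connection under linear symplectic maps. -/
theorem covD_comp_equiv (hΩ : ∀ A B, Ω (g A) (g B) = Ω A B) {χ χ' : E → ℂ}
    (h : ∀ A, χ' (g A) = χ A) (X A : E) : covD Ω (g X) χ' (g A) = covD Ω X χ A := by
  have e : χ = χ' ∘ g := funext fun A => (h A).symm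
  rw [covD, covD, hΩ, h, e, g.comp_right_fderiv]
  rfl

/-- Second covariant derivatives of the transported section along X, Y are those of the original
along g⁻¹X, g⁻¹Y, and M G Mᵀ is the matrix of the pushed-forward bivector. The bilinear form β
records the linearity of Ω, needed to change the basis inside ∇∇. -/
theorem laplacian_natural (β : LinearMap.BilinForm ℝ E) (hβ : ∀ A B, Ω A B = β A B)
    (hΩ : ∀ A B, Ω (g A) (g B) = Ω A B) (G : Matrix ι ι ℂ) {χ χ' : E → ℂ}
    (h : ∀ A, χ' (g A) = χ A) (hd : ∀ X, Differentiable ℝ (covD Ω X χ)) (A : E) :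
    laplacian b Ω (endMatrix b (g : E →ₗ[ℝ] E) * G * (endMatrix b (g : E →ₗ[ℝ] E)).transpose)
      χ' (g A) = laplacian b Ω G χ A := by
  have add : ∀ X Y (f : E → ℂ) B, covD Ω (X + Y) f B = covD Ω X f B + covD Ω Y f B :=
    fun X Y f B => by simp only [covD, hβ, map_add]; push_cast; ring
  have smul : ∀ (c : ℝ) X (f : E → ℂ) B, covD Ω (c • X) f B = c • covD Ω X f B :=
    fun c X f B => by simp only [covD, hβ, map_smul, smul_eq_mul, real_smul]; push_cast; ring
  -- Linearity in the inner direction requires differentiating a sum of first covariant derivatives;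
  -- this is the use of the differentiability hypothesis.
  let H : E →ₗ[ℝ] E →ₗ[ℝ] ℂ := LinearMap.mk₂ ℝ (fun X Y => covD Ω X (covD Ω Y χ) A)
    (fun X X' Y => add X X' _ A) (fun c X Y => smul c X _ A)
    (fun X Y Y' => by
      have : covD Ω (Y + Y') χ = covD Ω Y χ + covD Ω Y' χ := funext fun B => add Y Y' χ B
      rw [this]
      simp only [covD, fderiv_add (hd Y A) (hd Y' A), Pi.add_apply, _root_.add_apply]
      ring)
    (fun c X Y => by
      have : covD Ω (c • Y) χ = c • covD Ω Y χ := funext fun B => smul c Y χ B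
      rw [this]
      simp only [covD, fderiv_const_smul (hd Y A), Pi.smul_apply, _root_.smul_apply, real_smul]
      ring)
  have hH : ∀ X Y, covD Ω X (covD Ω Y χ') (g A) = H (g.symm X) (g.symm Y) := fun X Y => by
    conv_lhs => rw [← g.apply_symm_apply X, ← g.apply_symm_apply Y]
    rw [covD_comp_equiv hΩ fun B => covD_comp_equiv hΩ h _ B]
    rfl
  set M := LinearMap.toMatrix b b (g : E →ₗ[ℝ] E) with hM
  -- The relation g b_l = ∑ M_il b_i with g⁻¹ applied: it expands the basis b in the basis g⁻¹ b_i.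
  have hb : ∀ l, b l = ∑ i, M i l • g.symm (b i) := fun l => by
    apply g.injective
    simp only [map_sum, map_smul, g.apply_symm_apply]
    simp only [hM, LinearMap.toMatrix_apply]
    exact (b.sum_repr _).symm
  have hkl : ∀ m l, H (b m) (b l) =
      ∑ i, ∑ j, (M i m : ℂ) * ((M j l : ℂ) * H (g.symm (b i)) (g.symm (b j))) := fun m l => by
    conv_lhs => rw [hb m, hb l]
    simp only [map_sum, map_smul, LinearMap.sum_apply, LinearMap.smul_apply, real_smul,
      Finset.mul_sum]
    rw [Finset.sum_comm]
    exact Finset.sum_congr rfl fun _ _ => Finset.sum_congr rfl fun _ _ => by ring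
  have hR : laplacian b Ω G χ A = ∑ m, ∑ l, G m l * H (b m) (b l) := rfl
  rw [hR, laplacian]
  simp only [hH, hkl, Matrix.mul_apply, Matrix.transpose_apply, Finset.sum_mul, Finset.mul_sum]
  rw [sum_comm_four, Finset.sum_comm]
  refine Finset.sum_congr rfl fun m _ => Finset.sum_congr rfl fun l _ =>
    Finset.sum_congr rfl fun i _ => Finset.sum_congr rfl fun j _ => ?_
  simp only [endMatrix, Matrix.of_apply, ← hM]
  ring

theorem endMatrix_mul_symm : endMatrix b (g : E →ₗ[ℝ] E) * endMatrix b (g.symm : E →ₗ[ℝ] E) = 1 := by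
  have h : LinearMap.toMatrix b b (g : E →ₗ[ℝ] E) * LinearMap.toMatrix b b (g.symm : E →ₗ[ℝ] E) = 1 := by
    rw [← LinearMap.toMatrix_comp]
    convert LinearMap.toMatrix_id b
    ext x; simp
  ext i j
  have := congrArg (ofReal) (congrFun (congrFun h i) j)
  simpa [endMatrix, Matrix.mul_apply, Matrix.one_apply, apply_ite ofReal] using this

theorem endMatrix_symm_mul : endMatrix b (g.symm : E →ₗ[ℝ] E) * endMatrix b (g : E →ₗ[ℝ] E) = 1 :=
  mul_eq_one_comm.1 endMatrix_mul_symm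

theorem endMatrix_conj {S S' : E →ₗ[ℝ] E} (h : ∀ X, S' (g X) = g (S X)) :
    endMatrix b S' = endMatrix b (g : E →ₗ[ℝ] E) * endMatrix b S *
      endMatrix b (g.symm : E →ₗ[ℝ] E) := by
  have e : S' = (g : E →ₗ[ℝ] E) ∘ₗ S ∘ₗ (g.symm : E →ₗ[ℝ] E) := by
    ext X; simp [← h]
  ext i j
  simp only [endMatrix, e, LinearMap.toMatrix_comp b b b, Matrix.mul_apply, Matrix.of_apply,
    Finset.mul_sum, Finset.sum_mul, ofReal_sum, ofReal_mul]
  rw [Finset.sum_comm]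
  exact Finset.sum_congr rfl fun _ _ => Finset.sum_congr rfl fun _ _ => by ring

/-- Invert the relation Mᵀ Ω M = Ω. This turns conjugation of endomorphisms into the transformation
law of bivectors. -/
theorem formMatrix_inv_mul_transpose (β : LinearMap.BilinForm ℝ E) (hβ : ∀ A B, Ω A B = β A B)
    (hΩ : ∀ A B, Ω (g A) (g B) = Ω A B) :
    endMatrix b (g.symm : E →ₗ[ℝ] E) * (formMatrix b Ω)⁻¹ =
      (formMatrix b Ω)⁻¹ * (endMatrix b (g : E →ₗ[ℝ] E)).transpose := by
  set M := endMatrix b (g : E →ₗ[ℝ] E) with hM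
  have h1 : M.transpose * formMatrix b Ω * M = formMatrix b Ω := by
    ext i j
    have hb : ∀ l, g (b l) = ∑ i, LinearMap.toMatrix b b (g : E →ₗ[ℝ] E) i l • b i := fun l => by
      simp only [LinearMap.toMatrix_apply]
      exact (b.sum_repr _).symm
    have : Ω (b i) (b j) = _ := (hΩ (b i) (b j)).symm
    rw [hβ, hβ, hb, hb] at this
    simp only [map_sum, map_smul, LinearMap.sum_apply, LinearMap.smul_apply, smul_eq_mul] at this
    simp only [formMatrix, hβ, this, hM, endMatrix, Matrix.mul_apply, Matrix.transpose_apply,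
      Matrix.of_apply, ofReal_sum, ofReal_mul, Finset.sum_mul, Finset.mul_sum]
    exact Finset.sum_congr rfl fun _ _ => Finset.sum_congr rfl fun _ _ => by ring
  have hMi : M⁻¹ = endMatrix b (g.symm : E →ₗ[ℝ] E) := Matrix.inv_eq_right_inv endMatrix_mul_symm
  have hu : IsUnit M.transpose.det := by
    rw [Matrix.det_transpose]
    exact (Matrix.isUnit_iff_isUnit_det _).1 (IsUnit.of_mul_eq_one _ endMatrix_mul_symm)
  conv_rhs => rw [← h1]
  rw [Matrix.mul_inv_rev, Matrix.mul_inv_rev, mul_assoc, mul_assoc, Matrix.nonsing_inv_mul _ hu,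
    mul_one, hMi]

variable {S : ℂ → (E →ₗ[ℝ] E)} {γ : Matrix.SpecialLinearGroup (Fin 2) ℤ} {τ : ℂ}

/-- Along the orbit the family is conjugated by the constant matrix of g, which passes through the
derivative; the chain rule for the Möbius map accounts for the pushed-forward vector. -/
theorem varMatrix_natural (hτ : 0 < τ.im)
    (hS : ∀ x : ℂ, 0 < x.im → ∀ X, S (mobius γ x) (g X) = g (S x X))
    (hd : ∀ i j, DifferentiableAt ℝ (fun x => endMatrix b (S x) i j) τ) (V : ℂ × ℂ) :
    varMatrix b S (mobiusPush γ τ V) (mobius γ τ) =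
      endMatrix b (g : E →ₗ[ℝ] E) * varMatrix b S V τ * endMatrix b (g.symm : E →ₗ[ℝ] E) := by
  ext i j
  rw [varMatrix, Matrix.of_apply, tderiv_mobius γ hτ, tderiv_congr (G := fun x =>
    (endMatrix b (g : E →ₗ[ℝ] E) * endMatrix b (S x) * endMatrix b (g.symm : E →ₗ[ℝ] E)) i j) ?_]
  · set M := endMatrix b (g : E →ₗ[ℝ] E)
    set N := endMatrix b (g.symm : E →ₗ[ℝ] E)
    have e : (fun x => (M * endMatrix b (S x) * N) i j) =
        fun x => ∑ l, ∑ m, M i m * N l j * endMatrix b (S x) m l := by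
      funext x
      simp only [Matrix.mul_apply, Finset.sum_mul]
      exact Finset.sum_congr rfl fun _ _ => Finset.sum_congr rfl fun _ _ => by ring
    have hw : HasWirt (fun x => ∑ l, ∑ m, M i m * N l j * endMatrix b (S x) m l) _ _ τ :=
      HasWirt.sum fun l _ => HasWirt.sum fun m _ => (hasWirt_tderiv (hd m l)).const_mul (M i m * N l j)
    rw [e, hw.tderiv]
    simp only [Matrix.mul_apply, Finset.sum_mul, Finset.mul_sum, varMatrix, Matrix.of_apply]
    rw [← Finset.sum_add_distrib]
    refine Finset.sum_congr rfl fun l _ => ?_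
    rw [← Finset.sum_add_distrib]
    refine Finset.sum_congr rfl fun m _ => ?_
    rw [tderiv_eq V]
    ring
  · filter_upwards [eventually_im_pos hτ] with x hx
    rw [endMatrix_conj (hS x hx)]

theorem bivector_natural (β : LinearMap.BilinForm ℝ E) (hβ : ∀ A B, Ω A B = β A B)
    (hΩ : ∀ A B, Ω (g A) (g B) = Ω A B) (hτ : 0 < τ.im)
    (hS : ∀ x : ℂ, 0 < x.im → ∀ X, S (mobius γ x) (g X) = g (S x X))
    (hd : ∀ i j, DifferentiableAt ℝ (fun x => endMatrix b (S x) i j) τ) (c : ℝ) (V : ℂ × ℂ) :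
    bivector b Ω c S (mobiusPush γ τ V) (mobius γ τ) =
      endMatrix b (g : E →ₗ[ℝ] E) * bivector b Ω c S V τ *
        (endMatrix b (g : E →ₗ[ℝ] E)).transpose := by
  rw [bivector, varMatrix_natural hτ hS hd, mul_assoc, formMatrix_inv_mul_transpose β hβ hΩ, bivector]
  simp only [Matrix.mul_smul, Matrix.smul_mul, mul_assoc]

theorem bivector10_natural (β : LinearMap.BilinForm ℝ E) (hβ : ∀ A B, Ω A B = β A B)
    (hΩ : ∀ A B, Ω (g A) (g B) = Ω A B) (hτ : 0 < τ.im)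
    (hS : ∀ x : ℂ, 0 < x.im → ∀ X, S (mobius γ x) (g X) = g (S x X))
    (hd : ∀ i j, DifferentiableAt ℝ (fun x => endMatrix b (S x) i j) τ) (c : ℝ) (V : ℂ × ℂ) :
    bivector10 b Ω c S (mobiusPush γ τ V) (mobius γ τ) =
      endMatrix b (g : E →ₗ[ℝ] E) * bivector10 b Ω c S V τ *
        (endMatrix b (g : E →ₗ[ℝ] E)).transpose := by
  rw [bivector10, bivector_natural β hβ hΩ hτ hS hd, endMatrix_conj (hS τ hτ), bivector10]
  set M := endMatrix b (g : E →ₗ[ℝ] E)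
  have h : endMatrix b (g.symm : E →ₗ[ℝ] E) * M = 1 := endMatrix_symm_mul
  have h2 : ∀ X, endMatrix b (g.symm : E →ₗ[ℝ] E) * (M * X) = X := fun X => by
    rw [← mul_assoc, h, one_mul]
  simp only [smul_sub, sub_mul, mul_sub, Matrix.smul_mul, Matrix.mul_smul, one_mul, mul_assoc, h2]

theorem bivector01_natural (β : LinearMap.BilinForm ℝ E) (hβ : ∀ A B, Ω A B = β A B)
    (hΩ : ∀ A B, Ω (g A) (g B) = Ω A B) (hτ : 0 < τ.im)
    (hS : ∀ x : ℂ, 0 < x.im → ∀ X, S (mobius γ x) (g X) = g (S x X))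
    (hd : ∀ i j, DifferentiableAt ℝ (fun x => endMatrix b (S x) i j) τ) (c : ℝ) (V : ℂ × ℂ) :
    bivector01 b Ω c S (mobiusPush γ τ V) (mobius γ τ) =
      endMatrix b (g : E →ₗ[ℝ] E) * bivector01 b Ω c S V τ *
        (endMatrix b (g : E →ₗ[ℝ] E)).transpose := by
  rw [bivector01, bivector_natural β hβ hΩ hτ hS hd, endMatrix_conj (hS τ hτ), bivector01]
  set M := endMatrix b (g : E →ₗ[ℝ] E)
  have h : endMatrix b (g.symm : E →ₗ[ℝ] E) * M = 1 := endMatrix_symm_mul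
  have h2 : ∀ X, endMatrix b (g.symm : E →ₗ[ℝ] E) * (M * X) = X := fun X => by
    rw [← mul_assoc, h, one_mul]
  simp only [smul_add, add_mul, mul_add, Matrix.smul_mul, Matrix.mul_smul, one_mul, mul_assoc, h2]

end Naturality

/-! ### Equivariance of the two differential connections -/

section Equivariance

open Complex
open scoped ComplexConjugate

variable {r : ℕ} {k : ℕ} {s : ℝ} {τ : ℂ} {γ : Matrix.SpecialLinearGroup (Fin 2) ℤ}

/-- The symplectic form `k ω` as a bilinear form. -/
def omegaBilin (k : ℕ) (r : ℕ) : LinearMap.BilinForm ℝ (A0 r) :=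
  LinearMap.mk₂ ℝ (fun A B => (k : ℝ) * omega A B)
    (fun A A' B => by
      simp only [omega, Pi.add_apply, ← mul_add, ← Finset.sum_add_distrib]
      congr 1; exact Finset.sum_congr rfl fun j _ => by ring)
    (fun c A B => by
      simp only [omega, Pi.smul_apply, smul_eq_mul, Finset.mul_sum]
      exact Finset.sum_congr rfl fun j _ => by ring)
    (fun A B B' => by
      simp only [omega, Pi.add_apply, ← mul_add, ← Finset.sum_add_distrib]
      congr 1; exact Finset.sum_congr rfl fun j _ => by ring)
    (fun c A B => by
      simp only [omega, Pi.smul_apply, smul_eq_mul, Finset.mul_sum]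
      exact Finset.sum_congr rfl fun j _ => by ring)

/-- The symplectic form `ω_t` as a bilinear form. -/
def omegaTBilin (k : ℕ) (s : ℝ) (r : ℕ) : LinearMap.BilinForm ℝ (A0C r) :=
  LinearMap.mk₂ ℝ (omegaT k s)
    (fun A A' B => by
      rw [omegaT, omegaT, omegaT, ← add_re, ← mul_add]
      simp only [omegaC, Pi.add_apply, ← Finset.sum_add_distrib]
      congr 2; exact Finset.sum_congr rfl fun j _ => by ring)
    (fun c A B => by
      rw [omegaT, omegaT, smul_eq_mul, ← re_ofReal_mul]
      simp only [omegaC, Pi.smul_apply, real_smul, Finset.mul_sum]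
      congr 1; exact Finset.sum_congr rfl fun j _ => by ring)
    (fun A B B' => by
      rw [omegaT, omegaT, omegaT, ← add_re, ← mul_add]
      simp only [omegaC, Pi.add_apply, ← Finset.sum_add_distrib]
      congr 2; exact Finset.sum_congr rfl fun j _ => by ring)
    (fun c A B => by
      rw [omegaT, omegaT, smul_eq_mul, ← re_ofReal_mul]
      simp only [omegaC, Pi.smul_apply, real_smul, Finset.mul_sum]
      congr 1; exact Finset.sum_congr rfl fun j _ => by ring)

theorem differentiableAt_hodgeMatrix (hτ : 0 < τ.im) (i j : Fin 2) :
    DifferentiableAt ℝ (fun x => (hodgeMatrix x i j : ℂ)) τ := by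
  have h1 : DifferentiableAt ℝ (fun x : ℂ => x.im) τ := imCLM.differentiableAt
  have h2 : DifferentiableAt ℝ (fun x : ℂ => x.re) τ := reCLM.differentiableAt
  have h3 : DifferentiableAt ℝ (fun x : ℂ => x.im⁻¹) τ := h1.inv hτ.ne'
  refine ofRealCLM.differentiableAt.comp τ (?_ : DifferentiableAt ℝ (fun x => hodgeMatrix x i j) τ)
  simp only [hodgeMatrix, Matrix.smul_apply, one_div, smul_eq_mul, normSq_apply]
  fin_cases i <;> fin_cases j <;> simp <;> fun_prop

theorem differentiableAt_endMatrix_hodge (hτ : 0 < τ.im) (a b : Idx r) :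
    DifferentiableAt ℝ (fun x => endMatrix (basisA0 r) (hodge x) a b) τ := by
  simp only [endMatrix_hodge]
  split_ifs
  · exact differentiableAt_hodgeMatrix hτ _ _
  · exact differentiableAt_const _

theorem differentiableAt_endMatrix_cxIt (hτ : 0 < τ.im) (x y : Σ _ : Idx r, Fin 2) :
    DifferentiableAt ℝ (fun τ' => endMatrix (basisA0C r) (cxIt k s τ') x y) τ := by
  simp only [endMatrix_cxIt]
  split_ifs
  · exact (differentiableAt_hodgeMatrix hτ _ _).mul_const _
  · exact differentiableAt_const _

theorem tderiv_family {E : Type*} {g : E → E} {φ φ' : ℂ → E → ℂ} (hτ : 0 < τ.im)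
    (h : ∀ᶠ x in nhds τ, ∀ A, φ' (mobius γ x) (g A) = φ x A) (V : ℂ × ℂ) (A : E) :
    tderiv (mobiusPush γ τ V) (fun x => φ' x (g A)) (mobius γ τ) =
      tderiv V (fun x => φ x A) τ := by
  rw [tderiv_mobius γ hτ]
  exact tderiv_congr (h.mono fun x hx => hx A) V

/-- The complexified Hitchin connection is equivariant. -/
theorem complexHitchin_mcgForm (hk : 0 < k) {φ φ' : ℂ → A0C r → ℂ} (hτ : 0 < τ.im)
    (h : ∀ᶠ x in nhds τ, ∀ A, φ' (mobius γ x) (mcgForm γ A) = φ x A)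
    (hd : ∀ X, Differentiable ℝ (covD (omegaT k s) X (φ τ))) (V : ℂ × ℂ) (A : A0C r) :
    complexHitchin k s (mobiusPush γ τ V) φ' (mobius γ τ) (mcgForm γ A) =
      complexHitchin k s V φ τ A := by
  have hG := bivector10_natural (b := basisA0C r) (Ω := omegaT k s) (g := mcgEquiv r γ) (omegaTBilin k s r)
    (fun _ _ => rfl) (fun A B => omegaT_mcgForm A B) hτ
    (fun x hx X => cxIt_mcgForm hk s γ hx X) (differentiableAt_endMatrix_cxIt hτ)
    ‖level k s‖ V
  have hL := laplacian_natural (b := basisA0C r) (Ω := omegaT k s) (g := mcgEquiv r γ) (omegaTBilin k s r)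
    (fun _ _ => rfl) (fun A B => omegaT_mcgForm A B)
    (bivector10 (basisA0C r) (omegaT k s) ‖level k s‖ (cxIt k s) V τ) h.self_of_nhds hd A
  rw [complexHitchin, complexHitchin, tderiv_family hτ h, hG, ← hL]
  rfl

/-- The Hitchin-Witten connection is equivariant. -/
theorem hitchinWitten_mcgReal {χ χ' : ℂ → A0 r → ℂ} (hτ : 0 < τ.im)
    (h : ∀ᶠ x in nhds τ, ∀ u, χ' (mobius γ x) (mcgReal r γ u) = χ x u)
    (hd : ∀ X, Differentiable ℝ (covD (fun A B => (k : ℝ) * omega A B) X (χ τ))) (V : ℂ × ℂ)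
    (u : A0 r) :
    hitchinWitten k s (mobiusPush γ τ V) χ' (mobius γ τ) (mcgReal r γ u) =
      hitchinWitten k s V χ τ u := by
  -- The bivectors are formed with ω and the Laplacians with kω, so invariance is needed for both
  -- forms.
  have hω : ∀ A B : A0 r, omega A B = omegaBilin 1 r A B := fun A B => by simp [omegaBilin]
  have hG := bivector10_natural (b := basisA0 r) (g := mcgReal r γ) (omegaBilin 1 r)
    hω omega_mcgReal hτ (fun x hx X => hodge_mcgReal γ hx X) (differentiableAt_endMatrix_hodge hτ)
    1 V
  have hG' := bivector01_natural (b := basisA0 r) (g := mcgReal r γ) (omegaBilin 1 r)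
    hω omega_mcgReal hτ (fun x hx X => hodge_mcgReal γ hx X) (differentiableAt_endMatrix_hodge hτ)
    1 V
  have hL := fun G => laplacian_natural (b := basisA0 r)
    (Ω := fun A B => (k : ℝ) * omega A B) (g := mcgReal r γ) (omegaBilin k r)
    (fun _ _ => rfl) (fun A B => congrArg ((k : ℝ) * ·) (omega_mcgReal A B)) G h.self_of_nhds hd u
  rw [hitchinWitten, hitchinWitten, tderiv_family hτ h, hG, hG', hL, hL]

theorem differentiable_covD {E : Type*} [NormedAddCommGroup E] [NormedSpace ℝ E]
    [FiniteDimensional ℝ E] (β : LinearMap.BilinForm ℝ E) {χ : E → ℂ} (h : ContDiff ℝ ∞ χ) (X : E) :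
    Differentiable ℝ (covD (fun A B => β A B) X χ) := by
  have h1 : Differentiable ℝ fun A => fderiv ℝ χ A X :=
    ((h.fderiv_right (m := ∞) (by simp)).differentiable (by simp)).clm_apply
      (differentiable_const X)
  have h2 : Differentiable ℝ fun A => ((β A X : ℝ) : ℂ) :=
    ofRealCLM.differentiable.comp (LinearMap.toContinuousLinearMap (β.flip X)).differentiable
  unfold covD
  exact h1.sub ((h2.const_mul _).mul (h.differentiable (by simp)))

theorem mcgFamily_mobius (γ : Matrix.SpecialLinearGroup (Fin 2) ℤ) (ψ : ℂ → A0C r → ℂ)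
    (hτ : 0 < τ.im) (A : A0C r) : mcgFamily γ ψ (mobius γ τ) (mcgForm γ A) = ψ τ A := by
  rw [mcgFamily, mobius_inv_mobius γ hτ, mcgForm_inv_mcgForm]

/-- The Hitchin-Witten connection on polarised families is equivariant. -/
theorem hitchinWittenPol_mcgForm (hk : 0 < k) (s : ℝ) (γ : Matrix.SpecialLinearGroup (Fin 2) ℤ)
    {ψ : ℂ → A0C r → ℂ} (hτ : 0 < τ.im) (hψ : ContDiff ℝ ∞ (ψ τ)) (V : ℂ × ℂ) (A : A0C r) :
    hitchinWittenPol k s (mobiusPush γ τ V) (mcgFamily γ ψ) (mobius γ τ) (mcgForm γ A) =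
      hitchinWittenPol k s V ψ τ A := by
  have hρ : ContDiff ℝ ∞ fun u : A0 r => frameRho k s τ (incl u) := by
    have e : (fun u : A0 r => frameRho k s τ (incl u)) = rhoQ s ∘ qIncl hk s hτ := funext fun u => by
      rw [frameRho_incl_eq hk hτ, Function.comp_apply, qIncl_apply]
    have h1 : ContDiff ℝ ∞ (rhoQ s : (Idx r → ℝ) → ℂ) := by
      have : ∀ a, ContDiff ℝ ∞ fun q : Idx r → ℝ => (q a : ℂ) := fun a =>
        ofRealCLM.contDiff.comp (contDiff_apply ℝ ℝ a)
      exact (contDiff_const.mul (ContDiff.sum fun a _ => (this a).pow 2)).cexp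
    rw [e]
    exact h1.comp (qIncl hk s hτ).contDiff
  have hχ : ContDiff ℝ ∞ fun u : A0 r => ψ τ (incl u) * frameRho k s τ (incl u) :=
    (hψ.comp (inclL r).contDiff).mul hρ
  have h := hitchinWitten_mcgReal (k := k) (s := s) (γ := γ)
    (χ := fun x u => ψ x (incl u) * frameRho k s x (incl u))
    (χ' := fun x u => mcgFamily γ ψ x (incl u) * frameRho k s x (incl u)) hτ
    (by
      filter_upwards [eventually_im_pos hτ] with x hx u
      rw [incl_mcgReal, mcgFamily_mobius γ ψ hx, frameRho_mcgForm hk s γ hx])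
    (fun X => differentiable_covD (omegaBilin k r) hχ X) V
  rw [hitchinWittenPol, hitchinWittenPol, polExt, polExt, projA0_mcgForm γ hτ, h, incl_mcgReal,
    frameRho_mcgForm hk s γ hτ, frameRho_mcgForm hk s γ hτ]

theorem bargmannSection_mcgForm (hk : 0 < k) (s : ℝ) (γ : Matrix.SpecialLinearGroup (Fin 2) ℤ)
    (ψ : ℂ → A0C r → ℂ) (hτ : 0 < τ.im) (A : A0C r) :
    bargmannSection k s (mcgFamily γ ψ) (mobius γ τ) (mcgForm γ A) = bargmannSection k s ψ τ A := by
  rw [bargmannSection, bargmannSection, frameSigma_mcgForm hk s γ hτ,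
    bargmann_mcgForm hk s γ hτ (mcgFamily_mobius γ ψ hτ)]

theorem IsHolomorphicSection.comp_mcgForm_inv (hk : 0 < k) (hτ : 0 < τ.im) {φ φ' : A0C r → ℂ}
    (h : ∀ A, φ' (mcgForm γ A) = φ A) (hφ : IsHolomorphicSection k s τ φ) :
    IsHolomorphicSection k s (mobius γ τ) φ' := by
  have e : φ' = φ ∘ (mcgEquiv r γ).symm := funext fun A => by
    rw [Function.comp_apply, ← h]
    exact congrArg φ' ((mcgEquiv r γ).apply_symm_apply A).symm
  refine ⟨e ▸ hφ.1.comp (mcgEquiv r γ).symm.differentiable, fun X A => ?_⟩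
  have hc := fun X A => covD_comp_equiv (g := mcgEquiv r γ) (Ω := omegaT k s)
    (fun A B => omegaT_mcgForm A B) h X A
  have h2 := hφ.2 (mcgForm γ⁻¹ X) (mcgForm γ⁻¹ A)
  rw [← hc, ← hc, mcgEquiv_apply, mcgEquiv_apply, mcgEquiv_apply, ← cxIt_mcgForm hk s γ hτ,
    mcgForm_mcgForm_inv, mcgForm_mcgForm_inv] at h2
  exact h2

theorem IsHolomorphicSection.comp_mcgForm (hk : 0 < k) (hτ : 0 < τ.im) {φ : A0C r → ℂ}
    (hφ : IsHolomorphicSection k s (mobius γ τ) φ) :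
    IsHolomorphicSection k s τ fun A => φ (mcgForm γ A) := by
  have h := hφ.comp_mcgForm_inv (γ := γ⁻¹) (φ' := fun A => φ (mcgForm γ A)) hk (mobius_im_pos γ hτ)
    fun A => by rw [mcgForm_mcgForm_inv]
  rwa [mobius_inv_mobius γ hτ] at h

/-- Integrals that vanish keep vanishing after a linear change of variables. -/
theorem integral_comp_mcgForm_eq_zero {f : A0C r → ℂ} (h : ∫ A, f (mcgForm γ A) = 0) :
    ∫ A, f A = 0 := by
  have hdet : LinearMap.det (mcgEquiv r γ : A0C r →ₗ[ℝ] A0C r) ≠ 0 :=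
    (LinearEquiv.isUnit_det' (mcgEquiv r γ).toLinearEquiv).ne_zero
  have hmap := Measure.map_linearMap_addHaar_eq_smul_addHaar (volume : Measure (A0C r)) hdet
  have e := (mcgEquiv r γ).toHomeomorph.measurableEmbedding.integral_map (μ := volume) f
  have e' : ∫ A, f A ∂(Measure.map (mcgEquiv r γ) volume) = 0 := e.trans h
  have hmap' : Measure.map (mcgEquiv r γ) volume = _ := hmap
  rw [hmap', integral_smul_measure, smul_eq_zero] at e'
  refine e'.resolve_left ?_
  rw [ENNReal.toReal_ofReal (abs_nonneg _)]
  exact abs_ne_zero.2 (inv_ne_zero hdet)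

end Equivariance

/-! ### Equivariance of the L²-connection and the ingredients of the conclusion -/

section Main

open Complex
open scoped ComplexConjugate

variable {r : ℕ} {k : ℕ} {s : ℝ} {τ : ℂ} {γ : Matrix.SpecialLinearGroup (Fin 2) ℤ}

/-- The regularity that `laplacian_natural` demands of the transformed family: its covariant
derivatives are combinations of the differentiable functions ∇_a F, times σ. -/
theorem differentiable_covD_mul_frameSigma (hk : 0 < k) (hτ : 0 < τ.im) {F : (Idx r → ℂ) → ℂ}
    (hF : SecondOrderRegular ‖level k s‖ F) (X : A0C r) :
    Differentiable ℝ (covD (omegaT k s) X fun A => F (coordZ k s τ A) * frameSigma k s τ A) := by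
  have hz : Differentiable ℝ fun A : A0C r => coordZ k s τ A := (zEquiv hk s hτ).differentiable
  have hσ : Differentiable ℝ (sigmaZ ‖level k s‖ : (Idx r → ℂ) → ℂ) := fun z =>
    (hasFDerivAt_sigmaZ _ z).choose_spec.1.differentiableAt
  have hn : ∀ a, Differentiable ℝ (nabla ‖level k s‖ F a) := fun a z =>
    (hasFDerivAt_nabla _ hF.diff hF.diff_pd a z).choose_spec.1.differentiableAt
  have e : (covD (omegaT k s) X fun A => F (coordZ k s τ A) * frameSigma k s τ A) = fun A =>
      (∑ a, coordZ k s τ X a * nabla ‖level k s‖ F a (coordZ k s τ A)) * frameSigma k s τ A :=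
    funext fun A => covD_holomorphic hk hτ hF.diff X A
  rw [e]
  exact (Differentiable.fun_sum fun a _ => ((hn a).comp hz).const_mul _).mul (hσ.comp hz)

/-- The `L²`-connection is equivariant on families whose derivative is the sum of a holomorphic
section and of one orthogonal to the holomorphic ones. -/
theorem l2Connection_mcgForm (hk : 0 < k) (hτ : 0 < τ.im) {V : ℂ × ℂ} {φ φ' : ℂ → A0C r → ℂ}
    (hφ' : ∀ᶠ x in nhds τ, ∀ A, φ' (mobius γ x) (mcgForm γ A) = φ x A) {h n : A0C r → ℂ}
    (hh : IsHolomorphicSection k s τ h) (hh2 : MemLp h 2) (hn : MemLp n 2)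
    (hφ : ∀ A, tderiv V (fun τ' => φ τ' A) τ = h A + n A)
    (horth : ∀ χ, IsHolomorphicSection k s τ χ → MemLp χ 2 → ∫ A, n A * conj (χ A) = 0) :
    (fun A => l2Connection k s (mobiusPush γ τ V) φ' (mobius γ τ) (mcgForm γ A))
      =ᵐ[volume] l2Connection k s V φ τ := by
  have hqm : Measure.QuasiMeasurePreserving (mcgForm γ : A0C r → A0C r) volume volume := by
    have hdet : LinearMap.det (mcgEquiv r γ : A0C r →ₗ[ℝ] A0C r) ≠ 0 :=
      (LinearEquiv.isUnit_det' (mcgEquiv r γ).toLinearEquiv).ne_zero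
    refine ⟨(mcgEquiv r γ).continuous.measurable, ?_⟩
    have hmap : Measure.map (mcgForm γ) volume = _ :=
      Measure.map_linearMap_addHaar_eq_smul_addHaar (volume : Measure (A0C r)) hdet
    rw [hmap]
    exact Measure.smul_absolutelyContinuous
  -- The decomposition into a holomorphic part and an orthogonal part is transported by γ. The
  -- transported pieces have the same properties at γτ, so the projection there is the transported
  -- holomorphic part.
  have key := l2Connection_eq (k := k) (s := s) (τ := mobius γ τ) (V := mobiusPush γ τ V) (φ := φ')
    (h := fun A => h (mcgForm γ⁻¹ A)) (n := fun A => n (mcgForm γ⁻¹ A))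
    (hh.comp_mcgForm_inv hk hτ fun A => by rw [mcgForm_inv_mcgForm])
    (TorusCS.MemLp.comp_continuousLinearEquiv (mcgEquiv r γ⁻¹) hh2)
    (TorusCS.MemLp.comp_continuousLinearEquiv (mcgEquiv r γ⁻¹) hn)
    (fun A => by
      have h1 := tderiv_family (g := mcgForm γ) hτ hφ' V (mcgForm γ⁻¹ A)
      rwa [mcgForm_mcgForm_inv, hφ] at h1)
    (fun χ hχ hχ2 => integral_comp_mcgForm_eq_zero (γ := γ) (by
      simp only [mcgForm_inv_mcgForm]
      exact horth _ (hχ.comp_mcgForm hk hτ)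
        (TorusCS.MemLp.comp_continuousLinearEquiv (mcgEquiv r γ) hχ2)))
  have h2 := hqm.ae_eq_comp key
  refine (h2.symm.trans ?_).trans (l2Connection_eq hh hh2 hn hφ horth)
  exact .of_forall fun A => by simp only [Function.comp_apply, mcgForm_inv_mcgForm]

theorem isHolomorphicSection_bargmann (hk : 0 < k) (hτ : 0 < τ.im) {η : A0C r → ℂ}
    (hη : MemLp (restrictQ k s τ η) 2) :
    IsHolomorphicSection k s τ (fun A => bargmann k s τ η A * frameSigma k s τ A) ∧
      MemLp (fun A => bargmann k s τ η A * frameSigma k s τ A) 2 :=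
  ⟨isHolomorphicSection_mul_frameSigma hk hτ (differentiable_bargmannZ hk hη),
    SigmaL2.memLp hk hτ (F := bargmannZ k s τ η)
      ((sigmaL2_segal (norm_level_pos hk s) hη).const_mul _)⟩

end Main

end TorusCS

end

theorem theorem2 (r k : ℕ) (hk : 0 < k) (s : ℝ)
    (U : Set ℂ) (hU : IsOpen U) (hUpper : ∀ τ ∈ U, 0 < τ.im)
    (ψ : ℂ → TorusCS.A0C r → ℂ)
    -- a smooth family of polarised functions
    (hsmooth : ContDiffOn ℝ ∞ (fun x : ℂ × TorusCS.A0C r => ψ x.1 x.2) (U ×ˢ Set.univ))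
    (hpol : ∀ τ ∈ U, TorusCS.IsPolarised τ (ψ τ))
    -- in the domain of all two-fold compositions of ladder operators
    (hladder : ∀ τ ∈ U, TorusCS.InTwofoldLadderDomain k s (TorusCS.restrictQ k s τ (ψ τ)))
    -- the derivatives along `δ/δτ` and `δ/δτ̄` are square-integrable on `Q_τ`
    (hL2 : ∀ V ∈ ({TorusCS.ddTau, TorusCS.ddTauBar} : Set (ℂ × ℂ)), ∀ τ ∈ U,
      MemLp (TorusCS.restrictQ k s τ (TorusCS.deltaDeriv k s V ψ τ)) 2 volume)
    -- the Bargmann transforms are differentiable in `τ`, and the transform commutes with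
    -- `δ/δτ` and `δ/δτ̄`
    (hdiff : ∀ τ ∈ U, ∀ A : TorusCS.A0C r,
      DifferentiableAt ℝ (fun τ' => TorusCS.bargmann k s τ' (ψ τ') A) τ)
    (hcomm : ∀ V ∈ ({TorusCS.ddTau, TorusCS.ddTauBar} : Set (ℂ × ℂ)), ∀ τ ∈ U,
      ∀ A : TorusCS.A0C r,
        TorusCS.bargmann k s τ (TorusCS.deltaDeriv k s V ψ τ) A =
          TorusCS.deltaDeriv k s V (fun τ' => TorusCS.bargmann k s τ' (ψ τ')) τ A) :
    -- the transformed family is a family of holomorphic square-integrable sections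
    (∀ τ ∈ U, TorusCS.IsHolomorphicSection k s τ (TorusCS.bargmannSection k s ψ τ) ∧
      MemLp (TorusCS.bargmannSection k s ψ τ) 2 volume) ∧
    -- the Bargmann transform intertwines the connections, for `∂/∂τ`, for `∂/∂τ̄`, and hence for
    -- all their combinations `V`
    (∀ τ ∈ U, ∀ V : ℂ × ℂ,
      MemLp (TorusCS.restrictQ k s τ (TorusCS.hitchinWittenPol k s V ψ τ)) 2 volume ∧
      MemLp (fun A => TorusCS.tderiv V (fun τ' => TorusCS.bargmannSection k s ψ τ' A) τ) 2 volume ∧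
      (fun A => TorusCS.bargmann k s τ (TorusCS.hitchinWittenPol k s V ψ τ) A *
          TorusCS.frameSigma k s τ A)
        =ᵐ[volume] TorusCS.l2Connection k s V (TorusCS.bargmannSection k s ψ) τ ∧
      ∀ A : TorusCS.A0C r,
        TorusCS.bargmann k s τ (TorusCS.hitchinWittenPol k s V ψ τ) A *
            TorusCS.frameSigma k s τ A =
          TorusCS.complexHitchin k s V (TorusCS.bargmannSection k s ψ) τ A) ∧
    -- equivariance of the Bargmann transform and of the connections under the mapping class group
    (∀ γ : Matrix.SpecialLinearGroup (Fin 2) ℤ, ∀ τ ∈ U,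
      (∀ A : TorusCS.A0C r,
        TorusCS.bargmannSection k s (TorusCS.mcgFamily γ ψ) (TorusCS.mobius γ τ)
            (TorusCS.mcgForm γ A) =
          TorusCS.bargmannSection k s ψ τ A) ∧
      ∀ V : ℂ × ℂ,
        (∀ A : TorusCS.A0C r,
          TorusCS.hitchinWittenPol k s (TorusCS.mobiusPush γ τ V) (TorusCS.mcgFamily γ ψ)
              (TorusCS.mobius γ τ) (TorusCS.mcgForm γ A) =
            TorusCS.hitchinWittenPol k s V ψ τ A) ∧
        (∀ A : TorusCS.A0C r,
          TorusCS.complexHitchin k s (TorusCS.mobiusPush γ τ V)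
              (TorusCS.bargmannSection k s (TorusCS.mcgFamily γ ψ))
              (TorusCS.mobius γ τ) (TorusCS.mcgForm γ A) =
            TorusCS.complexHitchin k s V (TorusCS.bargmannSection k s ψ) τ A) ∧
        (fun A => TorusCS.l2Connection k s (TorusCS.mobiusPush γ τ V)
            (TorusCS.bargmannSection k s (TorusCS.mcgFamily γ ψ)) (TorusCS.mobius γ τ)
              (TorusCS.mcgForm γ A))
          =ᵐ[volume] TorusCS.l2Connection k s V (TorusCS.bargmannSection k s ψ) τ) := by
  -- The decomposition V[φ] = B(∇^{HW}_V(ψρ)) σ + n with n = -(1/4T) Δ_{G^ℂ(V)} φ orthogonal to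
  -- holomorphic sections. Both intertwining equalities and the equivariance of the L²-connection
  -- are consequences of it.
  have split : ∀ τ ∈ U, ∀ V : ℂ × ℂ, ∃ n : TorusCS.A0C r → ℂ,
      MemLp (TorusCS.restrictQ k s τ (TorusCS.hitchinWittenPol k s V ψ τ)) 2 volume ∧
      MemLp n 2 volume ∧
      (∀ A, TorusCS.tderiv V (fun τ' => TorusCS.bargmannSection k s ψ τ' A) τ =
        TorusCS.bargmann k s τ (TorusCS.hitchinWittenPol k s V ψ τ) A *
          TorusCS.frameSigma k s τ A + n A) ∧
      (∀ χ, TorusCS.IsHolomorphicSection k s τ χ → MemLp χ 2 volume →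
        ∫ A, n A * (starRingEnd ℂ) (χ A) = 0) ∧
      ∀ A, TorusCS.complexHitchin k s V (TorusCS.bargmannSection k s ψ) τ A =
        TorusCS.tderiv V (fun τ' => TorusCS.bargmannSection k s ψ τ' A) τ - n A := by
    intro τ hτU V
    have hτ := hUpper τ hτU
    have hreg := (TorusCS.secondOrderRegular_segal hk (TorusCS.contDiff_restrictQ
      (TorusCS.differentiable_slice hU hsmooth hτU)) (hladder τ hτU)).const_mul
      (TorusCS.bargmannConst k s r)
    obtain ⟨hm, hd⟩ := TorusCS.tderiv_bargmannSection hk hU hUpper hsmooth hpol hτU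
      (hladder τ hτU) (fun V hV => hL2 V hV τ hτU) (hdiff τ hτU) (fun V hV => hcomm V hV τ hτU) V
    refine ⟨fun A => -(1 / (4 * (‖TorusCS.level k s‖ : ℂ))) * (TorusCS.hitchinOperator k s V τ
      (TorusCS.bargmannZ k s τ (ψ τ)) (TorusCS.coordZ k s τ A) * TorusCS.frameSigma k s τ A), hm,
      ((TorusCS.sigmaL2_hitchinOperator rfl hreg V).memLp hk hτ).const_mul _, fun A => ?_,
      fun χ hχ hχ2 => ?_, fun A => ?_⟩
    · rw [hd]; ring
    · simp only [mul_assoc, MeasureTheory.integral_const_mul]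
      have h := TorusCS.integral_hitchinOperator_mul_conj_eq_zero hk hτ hreg V hχ hχ2
      simp only [mul_assoc] at h
      exact mul_eq_zero_of_right _ h
    · rw [TorusCS.complexHitchin_bargmannSection hk hU hUpper hsmooth hτU (hladder τ hτU)]
      ring
  refine ⟨fun τ hτU => TorusCS.isHolomorphicSection_bargmann hk (hUpper τ hτU) (hladder τ hτU).1,
    fun τ hτU V => ?_, fun γ τ hτU => ?_⟩
  · obtain ⟨n, hm, hn, hd, horth, hC⟩ := split τ hτU V
    obtain ⟨hh, hh2⟩ := TorusCS.isHolomorphicSection_bargmann hk (hUpper τ hτU) hm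
    refine ⟨hm, ?_, TorusCS.l2Connection_eq hh hh2 hn hd horth, fun A => ?_⟩
    · simp only [hd]; exact hh2.add hn
    · rw [hC, hd]; ring
  · have hτ := hUpper τ hτU
    have hψ := TorusCS.differentiable_slice hU hsmooth hτU
    have hfam : ∀ᶠ x in nhds τ, ∀ A, TorusCS.bargmannSection k s (TorusCS.mcgFamily γ ψ)
        (TorusCS.mobius γ x) (TorusCS.mcgForm γ A) = TorusCS.bargmannSection k s ψ x A := by
      filter_upwards [TorusCS.eventually_im_pos hτ] with x hx A
      exact TorusCS.bargmannSection_mcgForm hk s γ ψ hx A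
    refine ⟨TorusCS.bargmannSection_mcgForm hk s γ ψ hτ, fun V =>
      ⟨TorusCS.hitchinWittenPol_mcgForm hk s γ hτ hψ V,
        TorusCS.complexHitchin_mcgForm hk hτ hfam (fun X => ?_) V, ?_⟩⟩
    · exact TorusCS.differentiable_covD_mul_frameSigma hk hτ
        ((TorusCS.secondOrderRegular_segal hk (TorusCS.contDiff_restrictQ hψ)
          (hladder τ hτU)).const_mul (TorusCS.bargmannConst k s r)) X
    · obtain ⟨n, hm, hn, hd, horth, -⟩ := split τ hτU V
      obtain ⟨hh, hh2⟩ := TorusCS.isHolomorphicSection_bargmann hk hτ hm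
      exact TorusCS.l2Connection_mcgForm hk hτ hfam hh hh2 hn hd horth
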